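/- **Setting.** Let $S_j=\sum_{i=1}^n\lambda_{j,i}x_i\partial/\partial x_i$ ($1\le j\le l$, $l\ge 1$) be linearly independent diagonal linear vector fields on $\mathbb C^n$ whose ring of formal first integrals is $\mathbb C[[x^{R_1},\dots,x^{R_p}]]$, $p\ge1$, with algebraically independent monomials $x^{R_k}$. Put $\pi(x)=(x^{R_1},\dots,x^{R_p})$, $\Sigma=\{(x,u): u=\pi(x)\}$, $\Lambda=\max|\lambda_{j,i}|$. Fix $l$ coordinates such that the corresponding $l\times l$ minor $L$ of $(\lambda_{j,i})$ is invertible; $|L^{-1}|$ is the largest modulus of an entry of $L^{-1}$. The weight of $x^Q\partial/\partial x_i$ is $\alpha_{Q,i}=\big((Q,\lambda_j)-\lambda_{j,i}\big)_{j}\in\mathbb C^l$, and $\mathcal W^{s,t}$ is the set of nonzero $\alpha_{Q,i}$ with $s\le|Q|\le t$. $D_d(c,\rho)$ denotes the open polydisc of centre $c$ and radius $\rho$ in $\mathbb C^d$. For a family of vector fields $X(x,u)=\sum_{i}X_i\,\partial/\partial x_i$, $X_i=\sum_Q X_{i,Q}(u)x^Q$, put $|X_i|_{U,r}=\sum_Q\sup_{u\in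 U}|X_{i,Q}(u)|\,r^{|Q|}$, $|X|_{U,r}=\max_i|X_i|_{U,r}$, $|D_uX|_{U,r}=\max_i\sum_k|\partial X_i/\partial u_k|_{U,r}$. The vector field fibered over $\pi$ with respect to $X$ is $\tilde X(x,u)=(X(x,u),D\pi(x)X(x,u))$. $pr_1$ is the projection onto $\mathbb C^n$. Let $\omega=(\omega_k)_{k\ge1}$ satisfy $0<\omega_{k+1}\le\omega_k\le1$, $\sum_k-2^{-k}\ln\omega_k<\infty$, and let $\gamma>0$, $c_1>0$ be constants (in particular $c_1$ may be the constant of the estimate of the solutions of the cohomological equation). For $m=2^k$ put $$t_m=\frac{\gamma\,\omega_{k+1}}{2l\Lambda(2m+1)},\qquad \gamma_k=\Big(\frac{c_1}{\gamma^2\omega_{k+1}^2}\Big)^{-1/m},\qquad\theta_k=\gamma_km^{-2/m},\qquad r_i=\theta_k^i\,r .$$ For $b\in\mathbb C^p$ let $\mathcal{NF}_{m,b}(r)$ be the set of families $X$, linear in $x$, with coefficients holomorphic on $D_p(b,t_{m/2})$, such that $|X|_{D_p(b,t_m),r}<1-\frac1{m^3}$ and $|D_uX|_{D_p(b,t_m),r}<\frac1{2l|L^{-1}|}-\frac1{m^2}$;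 let $\mathcal B_{m+1,b}(r)$ be the set of families $X$ of order $\ge m+1$ in $x$ with coefficients holomorphic on $D_p(b,t_m)$ such that $|X|_{D_p(b,t_m),r}<2^5n/m^4$. **Statement.** There is $k_0$, depending only on the data fixed so far, such that the following holds for all $k\ge k_0$, with $m=2^k$, and all $r$ with $\frac12<r\le1$. Let $\mathcal K\subset\pi(D_n(0,\rho))$ be compact, $0<\rho<\frac12$; let $a^{2^\kappa}=(a_1^{2^\kappa},\dots,a_l^{2^\kappa})$, $\kappa\ge0$, be functions of $u$, put $\mathcal K_0=\mathcal K$, $\mathcal K_{\kappa}=\{c\in\mathcal K_{\kappa-1}:\ |\sum_ja^{2^\kappa}_j(c)\alpha_j|\ge\gamma\omega_{\kappa+1}\ \ \forall\alpha\in\mathcal W^{2^\kappa+1,2^{\kappa+1}}\}$, and let $b\in\mathcal K_k$ be such that $\max_j|b_j|+t_{2m}\le r_3^{|R_i|}$ for $i=1,\dots,p$. Let $NF^m=\sum_ja_j^m(u)S_j\in\mathcal{NF}_{m,b}(r)$, let $R_{m+1}\in\mathcal B_{m+1,b}(r)$, let $r_\Sigma$ be a holomorphic family of vector fields on $D_n(0,r)\times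 D_p(b,t_m)$ that vanishes on $\Sigma$, and let $\tilde X_m$ be the vector field fibered over $\pi$ with respect to $NF^m+R_{m+1}+r_\Sigma$ (so $\tilde X_m$ is normalized up to order $m$ along $\Sigma$). Let $B_\alpha$ be the projection of $R_{m+1}$ onto the $\alpha$-weight space, and let $B_{0|\Sigma}$ be obtained from $B_0$ by writing each monomial $x^Q$ of each component as $(x^{R_1})^{s_1}\cdots(x^{R_p})^{s_p}x^{Q'}$ with $x^{Q'}$ not divisible by any $x^{R_k}$ (one such factorization is fixed for each component and each $Q$) and replacing it by $u^sx^{Q'}$. Put $NF^{2m}=NF^m+B_{0|\Sigma}$ and assume, as for good perturbations, that $NF^{2m}=\sum_ja_j^{2m}(u)S_j$ for $u\in D_p(b,t_m)$. Let $A_\alpha(u)=\sum_ja_j^m(u)\alpha_j$, $D_mV=D_uNF^m(x,u)D\pi(x)V$, and $$U_m=\sum_{\alpha\in\mathcal W^{m+1,2m}}U_{m,\alpha},\qquad U_{m,\alpha}=-\Big(\mathrm{Id}+\frac{D_m}{A_\alpha}\Big)\frac{B_\alpha}{A_\alpha},$$ so that $U_{m,\alpha}$ is the solution in the $\alpha$-weight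 space of $D_xNF^m\,U-D_xU\,NF^m+D_uNF^m\,D\pi\,U=B_\alpha$, and let $$\tilde\Phi_m(x,u)=\big(x+U_m(x,u),\ u+\pi(x+U_m(x,u))-\pi(x)\big).$$ Then $\tilde\Phi_m$ is holomorphic on $D_n(0,r)\times D_p(b,t_m)$ and: 1. $D_n(0,r_4)\times D_p(b,t_{2m})\subset\tilde\Phi_m\big(D_n(0,r)\times D_p(b,t_m)\big)$, and $\tilde\Phi_m$ has a holomorphic inverse $\Psi:D_n(0,r_4)\times D_p(b,t_{2m})\to D_n(0,r)\times D_p(b,t_m)$, $\tilde\Phi_m\circ\Psi=\mathrm{Id}$, $\Psi(0,b)=(0,b)$; 2. on $D_n(0,r_5)\times D_p(b,t_{2m})$, the push-forward by $\tilde\Phi_m$ (computed with the inverse $\Psi$) satisfies $$pr_1\big((\tilde\Phi_m)_*\tilde X_m\big)=NF^{2m}+R'_{2m+1}+r'_\Sigma,\qquad r'_\Sigma=pr_1\big((\tilde\Phi_m)_*\tilde r_\Sigma\big)+B_0-B_{0|\Sigma},$$ where $r'_\Sigma$ is holomorphic and vanishes on $\Sigma$, and $(NF^{2m},R'_{2m+1})\in\mathcal{NF}_{2m,b}(r_5)\times\mathcal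 B_{2m+1,b}(r_5)$. -/

import Mathlib

open Filter Topology
open scoped ENNReal

noncomputable section

namespace LPNewton

/-! ### Spaces of series and norms -/

/-- `{z | |z_i - c_i| < r}`, the polydisc of centre `c` and radius `r`. -/
def polydisc {d : ℕ} (c : Fin d → ℂ) (r : ℝ) : Set (Fin d → ℂ) :=
  {z | ∀ i, ‖z i - c i‖ < r}

/-- Series `∑_Q f_Q(u) x^Q` in `x = (x_1, …, x_n)` whose coefficients are functions of
`u ∈ ℂ^p`. (Holomorphy of the coefficients is imposed in the classes below, on the domain that is
relevant there.) -/
abbrev Ser (n p : ℕ) : Type := MvPowerSeries (Fin n) ((Fin p → ℂ) → ℂ)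

/-- Families of (formal) vector fields `∑_i X_i(x,u) ∂/∂x_i` on `ℂ^n` with parameter `u ∈ ℂ^p`. -/
abbrev VF (n p : ℕ) : Type := Fin n → Ser n p

/-- `|f|_{U,r} = ∑_Q (sup_{u ∈ U} |f_Q(u)|) r^{|Q|}`. -/
def serNorm {n p : ℕ} (U : Set (Fin p → ℂ)) (r : ℝ) (f : Ser n p) : ℝ≥0∞ :=
  ∑' Q : Fin n →₀ ℕ, (⨆ u ∈ U, ‖MvPowerSeries.coeff Q f u‖ₑ) * ENNReal.ofReal r ^ Q.degree

/-- `|X|_{U,r} = max_i |X_i|_{U,r}`. -/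
def vfNorm {n p : ℕ} (U : Set (Fin p → ℂ)) (r : ℝ) (X : VF n p) : ℝ≥0∞ :=
  ⨆ i, serNorm U r (X i)

/-- `∂f/∂u_k`, coefficient by coefficient. -/
def serDu {n p : ℕ} (k : Fin p) (f : Ser n p) : Ser n p :=
  fun Q u => fderiv ℂ (MvPowerSeries.coeff Q f) u (Pi.single k 1)

/-- `|D_u X|_{U,r} = max_i ∑_k |∂X_i/∂u_k|_{U,r}`: the operator norm that belongs to the
sup norms on `ℂ^p` and `ℂ^n`. -/
def vfDuNorm {n p : ℕ} (U : Set (Fin p → ℂ)) (r : ℝ) (X : VF n p) : ℝ≥0∞ :=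
  ⨆ i, ∑ k, serNorm U r (serDu k (X i))

/-- The value of the series `f` at the point `(x, u)`. -/
def serEval {n p : ℕ} (f : Ser n p) (z : (Fin n → ℂ) × (Fin p → ℂ)) : ℂ :=
  ∑' Q : Fin n →₀ ℕ, MvPowerSeries.coeff Q f z.2 * ∏ i, z.1 i ^ Q i

/-- The value of the family of vector fields `X` at the point `(x, u)`. -/
def vfEval {n p : ℕ} (X : VF n p) (z : (Fin n → ℂ) × (Fin p → ℂ)) : Fin n → ℂ :=
  fun i => serEval (X i) z

/-! ### The linear action, its weights and its first integrals

The diagonal linear vector fields are `S_j = ∑_i lam j i • x_i ∂/∂x_i`, `j = 1, …, l`, and the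
resonant monomials are `x^{R_1}, …, x^{R_p}`. -/

/-- Lie derivative of a formal power series along `∑_i c_i x_i ∂/∂x_i`. -/
def lieDeriv {n : ℕ} (c : Fin n → ℂ) (f : MvPowerSeries (Fin n) ℂ) : MvPowerSeries (Fin n) ℂ :=
  ∑ i, c i • (MvPowerSeries.X i * MvPowerSeries.pderiv ℂ i f)

/-- The standing assumptions on the linear action: the `S_j` are linearly independent, the ring
of formal first integrals of `S_1, …, S_l` is `ℂ[[x^{R_1}, …, x^{R_p}]]`, and the monomials
`x^{R_k}` are algebraically independent. -/
structure IsResonantSystem {n p l : ℕ} (lam : Fin l → Fin n → ℂ) (R : Fin p → Fin n →₀ ℕ) :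
    Prop where
  linearIndependent : LinearIndependent ℂ lam
  firstIntegrals : {f : MvPowerSeries (Fin n) ℂ | ∀ j, lieDeriv (lam j) f = 0} =
    Set.range (fun g : MvPowerSeries (Fin p) ℂ =>
      MvPowerSeries.subst
        (fun k => (MvPowerSeries.monomial (R k) (1 : ℂ) : MvPowerSeries (Fin n) ℂ)) g)
  algebraicIndependent : AlgebraicIndependent ℂ
    (fun k => (MvPolynomial.monomial (R k) (1 : ℂ) : MvPolynomial (Fin n) ℂ))

/-- The weight `α_{Q,i} = (Q, λ) - λ_i` of `x^Q ∂/∂x_i`, as the vector of its values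
`α_{Q,i}(g_j)`, `j = 1, …, l`. -/
def weight {n l : ℕ} (lam : Fin l → Fin n → ℂ) (Q : Fin n →₀ ℕ) (i : Fin n) : Fin l → ℂ :=
  fun j => (∑ s, (Q s : ℂ) * lam j s) - lam j i

open Classical in
/-- The nonzero weights `α_{Q,i}` with `lo ≤ |Q| ≤ hi`. -/
def nonzeroWeights {n l : ℕ} (lam : Fin l → Fin n → ℂ) (lo hi : ℕ) : Finset (Fin l → ℂ) :=
  ((Finset.Icc lo hi).biUnion fun d =>
    ((Finset.univ : Finset (Fin n)).finsuppAntidiag d ×ˢ (Finset.univ : Finset (Fin n))).image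
      fun q => weight lam q.1 q.2).erase 0

open Classical in
/-- The projection of `X` onto the `α`-weight space. -/
def weightProj {n p l : ℕ} (lam : Fin l → Fin n → ℂ) (α : Fin l → ℂ) (X : VF n p) : VF n p :=
  fun i Q => if weight lam Q i = α then MvPowerSeries.coeff Q (X i) else 0

/-- The family of linear vector fields `∑_j c_j(u) S_j`. -/
def linField {n p l : ℕ} (lam : Fin l → Fin n → ℂ) (c : Fin l → (Fin p → ℂ) → ℂ) : VF n p :=
  fun i => MvPowerSeries.monomial (Finsupp.single i 1) (fun u => ∑ j, c j u * lam j i)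

/-- `Λ = max_{i,j} |λ_i(g_j)|`. -/
def bigLambda {n l : ℕ} (lam : Fin l → Fin n → ℂ) : ℝ := ⨆ j, ⨆ i, ‖lam j i‖

/-- The square matrix `L` formed by the eigenvalues in the `l` coordinates `e 1, …, e l`. -/
def minorL {n l : ℕ} (lam : Fin l → Fin n → ℂ) (e : Fin l → Fin n) : Matrix (Fin l) (Fin l) ℂ :=
  Matrix.of fun j i => lam j (e i)

/-- `|L⁻¹|`, the largest modulus of an entry of `L⁻¹`. -/
def normLinv {n l : ℕ} (lam : Fin l → Fin n → ℂ) (e : Fin l → Fin n) : ℝ :=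
  ⨆ i, ⨆ j, ‖(minorL lam e)⁻¹ i j‖

/-! ### Fibered vector fields and fibered maps -/

/-- `π(x) = (x^{R_1}, …, x^{R_p})`. -/
def piMap {n p : ℕ} (R : Fin p → Fin n →₀ ℕ) (x : Fin n → ℂ) : Fin p → ℂ :=
  fun k => ∏ i, x i ^ R k i

/-- `Σ = {(x, u) | u = π(x)}`. -/
def graphSigma {n p : ℕ} (R : Fin p → Fin n →₀ ℕ) : Set ((Fin n → ℂ) × (Fin p → ℂ)) :=
  {z | z.2 = piMap R z.1}

/-- The vector field `X̃ = (X, π_* X)` on `ℂ^n × ℂ^p` fibered over `π` with respect to `X`. -/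
def fiberedField {n p : ℕ} (R : Fin p → Fin n →₀ ℕ)
    (X : (Fin n → ℂ) × (Fin p → ℂ) → Fin n → ℂ) (z : (Fin n → ℂ) × (Fin p → ℂ)) :
    (Fin n → ℂ) × (Fin p → ℂ) :=
  (X z, fderiv ℂ (piMap R) z.1 (X z))

/-- The map `Φ̃(x,u) = (Φ(x,u), u + π(Φ(x,u)) - π(x))`, where `Φ(x,u) = x + U(x,u)`. -/
def fiberedMap {n p : ℕ} (R : Fin p → Fin n →₀ ℕ) (U : VF n p)
    (z : (Fin n → ℂ) × (Fin p → ℂ)) : (Fin n → ℂ) × (Fin p → ℂ) :=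
  (z.1 + vfEval U z, z.2 + piMap R (z.1 + vfEval U z) - piMap R z.1)

/-- The push-forward of the vector field `X` by `Φ`, where `Ψ` is the inverse of `Φ`. -/
def pushforward {n p : ℕ}
    (Φ Ψ X : (Fin n → ℂ) × (Fin p → ℂ) → (Fin n → ℂ) × (Fin p → ℂ))
    (z : (Fin n → ℂ) × (Fin p → ℂ)) : (Fin n → ℂ) × (Fin p → ℂ) :=
  fderiv ℂ Φ (Ψ z) (X (Ψ z))

/-! ### Restriction to `Σ` -/

/-- `τ` chooses, for every monomial `x^Q`, a factorization `x^Q = (x^R)^{τ Q} x^{Q'}` in which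
`x^{Q'}` is not divisible by any `x^{R_k}`. -/
def IsReduction {n p : ℕ} (R : Fin p → Fin n →₀ ℕ) (τ : (Fin n →₀ ℕ) → Fin p → ℕ) : Prop :=
  ∀ Q, ∃ Q' : Fin n →₀ ℕ, Q = Q' + ∑ k, τ Q k • R k ∧ ∀ k, ¬ R k ≤ Q'

open Classical in
/-- The restriction `f_{|Σ}`: in each monomial `x^Q = (x^R)^{τ Q} x^{Q'}` the factor
`(x^R)^{τ Q}` is replaced by `u^{τ Q}`. -/
def restrictSigma {n p : ℕ} (R : Fin p → Fin n →₀ ℕ) (τ : (Fin n →₀ ℕ) → Fin p → ℕ)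
    (f : Ser n p) : Ser n p :=
  fun Q' u => ∑' s : Fin p → ℕ,
    if τ (Q' + ∑ k, s k • R k) = s then
      MvPowerSeries.coeff (Q' + ∑ k, s k • R k) f u * ∏ k, u k ^ s k
    else 0

/-! ### The normalizing diffeomorphism -/

/-- `D_m(V) = D_u NF(x,u) Dπ(x) V(x,u) = ∑_j (D_u a_j(u) Dπ(x) V(x,u)) S_j`, for
`NF = ∑_j a_j(u) S_j`. -/
def opD {n p l : ℕ} (lam : Fin l → Fin n → ℂ) (R : Fin p → Fin n →₀ ℕ)
    (a : Fin l → (Fin p → ℂ) → ℂ) (V : VF n p) : VF n p :=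
  fun i => ∑ j, ∑ k, (fun u => fderiv ℂ (a j) u (Pi.single k 1) * lam j i) •
    ((∑ s, MvPowerSeries.pderiv ((Fin p → ℂ) → ℂ) s (MvPowerSeries.monomial (R k) 1) * V s) *
      MvPowerSeries.X i)

/-- `A_α(u) = ∑_j a_j(u) α(g_j)`. -/
def smallDivisor {p l : ℕ} (a : Fin l → (Fin p → ℂ) → ℂ) (α : Fin l → ℂ) : (Fin p → ℂ) → ℂ :=
  fun u => ∑ j, a j u * α j

/-- The solution `U_α = - (Id + D_m / A_α) (B_α / A_α)` in the `α`-weight space of the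
cohomological equation
`D_x NF · U_α - D_x U_α · NF + D_u NF · Dπ · U_α = B_α`,
where `NF = ∑_j a_j(u) S_j`. On the `α`-weight space, `D_x NF · U_α - D_x U_α · NF = - A_α U_α`,
and `D_m ∘ D_m = 0`. -/
def cohomSol {n p l : ℕ} (lam : Fin l → Fin n → ℂ) (R : Fin p → Fin n →₀ ℕ)
    (a : Fin l → (Fin p → ℂ) → ℂ) (B : VF n p) (α : Fin l → ℂ) : VF n p :=
  fun i => -((smallDivisor a α)⁻¹ • weightProj lam α B i +
    ((smallDivisor a α)⁻¹ ^ 2) • opD lam R a (weightProj lam α B) i)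

/-- `U_m = ∑_α U_{m,α}`, the sum over the nonzero weights of degree between `m + 1` and `2m`. -/
def normalizingU {n p l : ℕ} (lam : Fin l → Fin n → ℂ) (R : Fin p → Fin n →₀ ℕ)
    (a : Fin l → (Fin p → ℂ) → ℂ) (m : ℕ) (B : VF n p) : VF n p :=
  ∑ α ∈ nonzeroWeights lam (m + 1) (2 * m), cohomSol lam R a B α

/-! ### Diophantine sequences, the compact sets and the parameters of the scheme -/

/-- Diophantine sequences `(ω_k)_{k ≥ 1}` (the value `ω 0` plays no role). -/
structure IsDiophantineSeq (ω : ℕ → ℝ) : Prop where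
  pos : ∀ k, 1 ≤ k → 0 < ω k
  le_one : ∀ k, 1 ≤ k → ω k ≤ 1
  anti : ∀ k, 1 ≤ k → ω (k + 1) ≤ ω k
  summable : Summable fun k : ℕ => -Real.log (ω (k + 1)) / 2 ^ (k + 1)

/-- The sets `𝒦_k`; here `a κ j` is the coefficient `a_j^{2^κ}` of the normal form
`NF^{2^κ} = ∑_j a_j^{2^κ}(u) S_j`. -/
def compactK {n p l : ℕ} (lam : Fin l → Fin n → ℂ) (ω : ℕ → ℝ) (γ : ℝ)
    (a : ℕ → Fin l → (Fin p → ℂ) → ℂ) (K : Set (Fin p → ℂ)) : ℕ → Set (Fin p → ℂ)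
  | 0 => K
  | k + 1 => {b | b ∈ compactK lam ω γ a K k ∧
      ∀ α ∈ nonzeroWeights lam (2 ^ (k + 1) + 1) (2 ^ (k + 2)),
        γ * ω (k + 2) ≤ ‖smallDivisor (a (k + 1)) α b‖}

/-- `t_m = γ ω_{k+1} / (2 l Λ (2m+1))`, with `m = 2^k`. -/
def tRad {n l : ℕ} (lam : Fin l → Fin n → ℂ) (ω : ℕ → ℝ) (γ : ℝ) (k : ℕ) : ℝ :=
  γ * ω (k + 1) / (2 * l * bigLambda lam * (2 * 2 ^ k + 1))

/-- `γ_k = (c₁ / (γ² ω_{k+1}²))^{-1/m}`, with `m = 2^k`. -/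
def gammaK (ω : ℕ → ℝ) (γ c₁ : ℝ) (k : ℕ) : ℝ :=
  (c₁ / (γ ^ 2 * ω (k + 1) ^ 2)) ^ (-1 / (2 : ℝ) ^ k)

/-- `θ_k = γ_k m^{-2/m}`, with `m = 2^k`. -/
def thetaK (ω : ℕ → ℝ) (γ c₁ : ℝ) (k : ℕ) : ℝ :=
  gammaK ω γ c₁ k * ((2 : ℝ) ^ k) ^ (-2 / (2 : ℝ) ^ k)

/-- The class `𝒩ℱ_{m,b}(r)`, with `m = 2^k`, `k ≥ 1`: linear vector fields with coefficients
holomorphic on `D_p(b, t_{m/2})` and `|X| < 1 - 1/m³`, `|D_u X| < 1/(2l|L⁻¹|) - 1/m²`, in the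
norms `|·|_{D_p(b,t_m),r}`. -/
def classNF {n p l : ℕ} (lam : Fin l → Fin n → ℂ) (e : Fin l → Fin n) (ω : ℕ → ℝ) (γ : ℝ)
    (k : ℕ) (b : Fin p → ℂ) (r : ℝ) : Set (VF n p) :=
  {X | (∀ i Q, DifferentiableOn ℂ (MvPowerSeries.coeff Q (X i))
          (polydisc b (tRad lam ω γ (k - 1)))) ∧
    (∀ i Q, Q.degree ≠ 1 → ∀ u ∈ polydisc b (tRad lam ω γ (k - 1)),
      MvPowerSeries.coeff Q (X i) u = 0) ∧
    vfNorm (polydisc b (tRad lam ω γ k)) r X < ENNReal.ofReal (1 - 1 / ((2 : ℝ) ^ k) ^ 3) ∧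
    vfDuNorm (polydisc b (tRad lam ω γ k)) r X <
      ENNReal.ofReal (1 / (2 * l * normLinv lam e) - 1 / ((2 : ℝ) ^ k) ^ 2)}

/-- The class `ℬ_{m+1,b}(r)`, with `m = 2^k`: vector fields of order at least `m + 1` in `x`,
with coefficients holomorphic on `D_p(b, t_m)` and `|X|_{D_p(b,t_m),r} < 2⁵ n / m⁴`. -/
def classB {n p l : ℕ} (lam : Fin l → Fin n → ℂ) (ω : ℕ → ℝ) (γ : ℝ)
    (k : ℕ) (b : Fin p → ℂ) (r : ℝ) : Set (VF n p) :=
  {X | (∀ i Q, DifferentiableOn ℂ (MvPowerSeries.coeff Q (X i))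
          (polydisc b (tRad lam ω γ k))) ∧
    (∀ i Q, Q.degree < 2 ^ k + 1 → ∀ u ∈ polydisc b (tRad lam ω γ k),
      MvPowerSeries.coeff Q (X i) u = 0) ∧
    vfNorm (polydisc b (tRad lam ω γ k)) r X <
      ENNReal.ofReal (2 ^ 5 * n / ((2 : ℝ) ^ k) ^ 4)}

end LPNewton

end

noncomputable section

namespace LPNewton

/-! The step is a Newton iteration, and its quadratic gain is an algebraic fact about orders in `x`.
Write the field as `NF + Rem`, with `Rem` of order `m+1`. On the `α`-weight space the linearized
operator is `-A_α + D_m` with `D_m ∘ D_m = 0`, so it is inverted explicitly, and `U` removes all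
nonresonant terms of degrees `m+1, …, 2m`. The monomials `x^{R_k}` are first integrals of the `S_j`,
so `Dπ · NF = 0`: the `u`-component of the fibered field is `Dπ · Rem`, again of order `m+1`. Every
term left in the push-forward is then a product of two small factors, or the Taylor error of `π`, or
a part of `Rem` of degree above `2m`. All of these have order at least `2m+1`
(`pushSeries_sub_mem`).

The analysis is done with formal series. Functions holomorphic near `b` in `u` become power series
in `x` and `v = u - b` (`IsRep`), measured by weighted `ℓ¹` norms. These norms are
submultiplicative, they bound a composition by the norm of the outer series at the norms of the
inner ones (`wnorm_subst_le`), and they obey Cauchy estimates (`wnorm_pderiv_le`). The passage from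
sup norms costs a constant that depends only on `p`. The inverse of the fibered map is a formal
fixed point `V = -U ∘ (x + V, v + π(x + V) - π(x))`, which converges coefficient by coefficient and
inherits the bound of `U` (`exists_fib_inverse`). Identities known pointwise in `u` become
identities of series by the identity theorem (`formal_cohomological_eq`).

Smallness comes from orders alone: a series of order `N` in `x` gains `θ^N` when the `x`-radius
shrinks by `θ` (`wnorm_le_of_mem_ordIdeal`). The new remainder is bounded crudely and then gains
`(θ²)^(2m+1)` between the radii `r₃` and `r₅`. Since `θ_k^m = (γ²/c₁) ω_{k+1}²/m²`, this factor
beats the losses, which are at most a constant times `m/ω_{k+1}³` (`remainder_lt`). The small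
divisors are at least `γω_{k+1}` at `b`. The radius `t_m` is such that they lose at most half of
this on `D(b, t_m)`, because the class of normal forms bounds the derivatives of the `a_j` by `1`
(`sum_supNorm_fderiv_le`, `le_norm_smallDivisor`).

For the normal form, replacing `x^R` by `u` does not increase the norm where `|u_k| ≤ ρ^{|R_k|}`
(`serNorm_restrictSigma_le`). The resonant part is of size `θ^(m+1) m^(-4)`, less than the room
between `1 - 1/m³` and `1 - 1/(2m)³`, even after a Cauchy estimate for `D_u`. The Diophantine
condition enters through `exists_threshold`: `θ_k` tends to `1` while `m(1 - θ_k)` tends to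
infinity. -/

/-! ### Weighted `ℓ¹` norms of formal power series -/

/-- A submultiplicative extended seminorm. -/
structure IsSubmul {A : Type*} [Ring A] (ν : A → ℝ≥0∞) : Prop where
  zero : ν 0 = 0
  neg : ∀ a, ν (-a) = ν a
  add_le : ∀ a b, ν (a + b) ≤ ν a + ν b
  mul_le : ∀ a b, ν (a * b) ≤ ν a * ν b

theorem IsSubmul.sum_le {A ι : Type*} [Ring A] {ν : A → ℝ≥0∞} (hν : IsSubmul ν) (s : Finset ι)
    (f : ι → A) : ν (∑ i ∈ s, f i) ≤ ∑ i ∈ s, ν (f i) :=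
  Finset.le_sum_of_subadditive ν hν.zero.le hν.add_le s f

theorem isSubmul_enorm : IsSubmul (fun z : ℂ => ‖z‖ₑ) where
  zero := by simp
  neg := by simp
  add_le := enorm_add_le
  mul_le a b := by rw [enorm_mul]

/-- `sup_{u ∈ U} |g(u)|`. -/
def supNorm {E : Type*} (U : Set E) (g : E → ℂ) : ℝ≥0∞ := ⨆ u ∈ U, ‖g u‖ₑ

theorem le_supNorm {E : Type*} {U : Set E} {u : E} (hu : u ∈ U) (g : E → ℂ) :
    ‖g u‖ₑ ≤ supNorm U g := le_iSup₂ (f := fun u (_ : u ∈ U) => ‖g u‖ₑ) u hu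

theorem supNorm_mono {E : Type*} {U U' : Set E} (h : U ⊆ U') (g : E → ℂ) :
    supNorm U g ≤ supNorm U' g :=
  iSup₂_le fun _ hu => le_supNorm (h hu) g

theorem isSubmul_supNorm {E : Type*} (U : Set E) : IsSubmul (supNorm U) where
  zero := by simp [supNorm]
  neg := by simp [supNorm]
  add_le f g := iSup₂_le fun _ hu =>
    (enorm_add_le _ _).trans (add_le_add (le_supNorm hu f) (le_supNorm hu g))
  mul_le f g := iSup₂_le fun u hu => by
    rw [Pi.mul_apply, enorm_mul]
    exact mul_le_mul' (le_supNorm hu f) (le_supNorm hu g)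

section Weighted

variable {σ τ A : Type*} [Fintype σ] [Fintype τ] [CommRing A]

/-- The weight `w^γ` of the monomial `x^γ`. -/
def wmon {M : Type*} [CommMonoid M] (w : σ → M) (γ : σ →₀ ℕ) : M := ∏ s, w s ^ γ s

theorem wmon_add {M : Type*} [CommMonoid M] (w : σ → M) (γ δ : σ →₀ ℕ) :
    wmon w (γ + δ) = wmon w γ * wmon w δ := by
  simp [wmon, pow_add, Finset.prod_mul_distrib]

@[simp] theorem wmon_zero {M : Type*} [CommMonoid M] (w : σ → M) : wmon w 0 = 1 := by
  simp [wmon]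

@[simp] theorem wmon_single {M : Type*} [CommMonoid M] (w : σ → M) (s : σ) (j : ℕ) :
    wmon w (Finsupp.single s j) = w s ^ j := by
  classical
  rw [wmon, Finset.prod_eq_single s] <;> simp +contextual [eq_comm]

theorem wmon_mono {w w' : σ → ℝ≥0∞} (h : ∀ s, w s ≤ w' s) (γ : σ →₀ ℕ) : wmon w γ ≤ wmon w' γ :=
  Finset.prod_le_prod' fun s _ => pow_le_pow_left' (h s) _

theorem wmon_const {M : Type*} [CommMonoid M] (a : M) (γ : σ →₀ ℕ) :
    wmon (fun _ => a) γ = a ^ γ.degree := by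
  rw [wmon, Finset.prod_pow_eq_pow_sum, Finsupp.degree_eq_sum]

theorem enorm_wmon (z : σ → ℂ) (γ : σ →₀ ℕ) : ‖wmon z γ‖ₑ = wmon (fun s => ‖z s‖ₑ) γ := by
  simp [wmon, enorm_eq_nnnorm, nnnorm_prod, nnnorm_pow]

/-- `∑_γ ν(f_γ) w^γ`. -/
def gnorm (ν : A → ℝ≥0∞) (w : σ → ℝ≥0∞) (f : MvPowerSeries σ A) : ℝ≥0∞ :=
  ∑' γ : σ →₀ ℕ, ν (MvPowerSeries.coeff γ f) * wmon w γ

variable {ν : A → ℝ≥0∞} {w w' : σ → ℝ≥0∞}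

theorem coeff_le_gnorm (γ : σ →₀ ℕ) (f : MvPowerSeries σ A) :
    ν (MvPowerSeries.coeff γ f) * wmon w γ ≤ gnorm ν w f :=
  ENNReal.le_tsum (f := fun γ => ν (MvPowerSeries.coeff γ f) * wmon w γ) γ

theorem gnorm_mono (h : ∀ s, w s ≤ w' s) (f : MvPowerSeries σ A) :
    gnorm ν w f ≤ gnorm ν w' f :=
  ENNReal.tsum_le_tsum fun γ => mul_le_mul_right (wmon_mono h γ) _

theorem gnorm_zero (hν : IsSubmul ν) : gnorm ν w (0 : MvPowerSeries σ A) = 0 := by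
  simp [gnorm, hν.zero]

theorem gnorm_neg (hν : IsSubmul ν) (f : MvPowerSeries σ A) : gnorm ν w (-f) = gnorm ν w f := by
  simp [gnorm, hν.neg]

theorem gnorm_add_le (hν : IsSubmul ν) (f g : MvPowerSeries σ A) :
    gnorm ν w (f + g) ≤ gnorm ν w f + gnorm ν w g := by
  rw [gnorm, gnorm, gnorm, ← ENNReal.tsum_add]
  refine ENNReal.tsum_le_tsum fun γ => ?_
  rw [← add_mul, map_add]
  exact mul_le_mul_left (hν.add_le _ _) _

theorem gnorm_sub_le (hν : IsSubmul ν) (f g : MvPowerSeries σ A) :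
    gnorm ν w (f - g) ≤ gnorm ν w f + gnorm ν w g := by
  rw [sub_eq_add_neg, ← gnorm_neg hν g]
  exact gnorm_add_le hν _ _

theorem gnorm_sum_le (hν : IsSubmul ν) {ι : Type*} (s : Finset ι) (f : ι → MvPowerSeries σ A) :
    gnorm ν w (∑ i ∈ s, f i) ≤ ∑ i ∈ s, gnorm ν w (f i) :=
  Finset.le_sum_of_subadditive _ (gnorm_zero hν).le (gnorm_add_le hν) s f

theorem gnorm_smul_le (hν : IsSubmul ν) (c : A) (f : MvPowerSeries σ A) :
    gnorm ν w (c • f) ≤ ν c * gnorm ν w f := by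
  rw [gnorm, gnorm, ← ENNReal.tsum_mul_left]
  refine ENNReal.tsum_le_tsum fun γ => ?_
  rw [← mul_assoc, MvPowerSeries.coeff_smul]
  exact mul_le_mul_left (hν.mul_le _ _) _

theorem gnorm_monomial (hν : IsSubmul ν) (γ : σ →₀ ℕ) (a : A) :
    gnorm ν w (MvPowerSeries.monomial γ a) = ν a * wmon w γ := by
  classical
  rw [gnorm, tsum_eq_single γ]
  · rw [MvPowerSeries.coeff_monomial_same]
  · intro δ hδ
    rw [MvPowerSeries.coeff_monomial_ne hδ, hν.zero, zero_mul]

theorem tsum_antidiagonal {M : Type*} [AddCommMonoid M] [Finset.HasAntidiagonal M]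
    (g : M × M → ℝ≥0∞) :
    ∑' γ : M, ∑ p ∈ Finset.HasAntidiagonal.antidiagonal γ, g p = ∑' p : M × M, g p := by
  rw [← (Finset.HasAntidiagonal.sigmaAntidiagonalEquivProd (A := M)).tsum_eq, ENNReal.tsum_sigma']
  refine tsum_congr fun γ => ?_
  rw [tsum_fintype]
  exact (Finset.sum_coe_sort (Finset.HasAntidiagonal.antidiagonal γ) g).symm

theorem gnorm_mul_le (hν : IsSubmul ν) (f g : MvPowerSeries σ A) :
    gnorm ν w (f * g) ≤ gnorm ν w f * gnorm ν w g := by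
  classical
  calc gnorm ν w (f * g)
      ≤ ∑' γ, ∑ p ∈ Finset.HasAntidiagonal.antidiagonal γ, (ν (MvPowerSeries.coeff p.1 f) * wmon w p.1) *
          (ν (MvPowerSeries.coeff p.2 g) * wmon w p.2) := by
        refine ENNReal.tsum_le_tsum fun γ => ?_
        rw [MvPowerSeries.coeff_mul]
        refine (mul_le_mul_left (hν.sum_le _ _) _).trans ?_
        rw [Finset.sum_mul]
        refine Finset.sum_le_sum fun p hp => ?_
        rw [← Finset.HasAntidiagonal.mem_antidiagonal.1 hp, wmon_add, mul_mul_mul_comm]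
        exact mul_le_mul_left (hν.mul_le _ _) _
    _ = gnorm ν w f * gnorm ν w g := by
        rw [tsum_antidiagonal (fun p : (σ →₀ ℕ) × (σ →₀ ℕ) =>
          (ν (MvPowerSeries.coeff p.1 f) * wmon w p.1) *
          (ν (MvPowerSeries.coeff p.2 g) * wmon w p.2)), ENNReal.tsum_prod', gnorm, gnorm,
          ← ENNReal.tsum_mul_right]
        exact tsum_congr fun a => by simp only [ENNReal.tsum_mul_left]

/-- The norm `∑_γ |f_γ| w^γ`. -/
abbrev wnorm (w : σ → ℝ≥0∞) (f : MvPowerSeries σ ℂ) : ℝ≥0∞ := gnorm (fun z : ℂ => ‖z‖ₑ) w f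

theorem wnorm_X (s : σ) : wnorm w (MvPowerSeries.X s) = w s := by
  rw [MvPowerSeries.X, wnorm, gnorm_monomial isSubmul_enorm]; simp

theorem wnorm_one : wnorm w 1 = 1 := by
  have := gnorm_monomial (w := w) isSubmul_enorm 0 (1 : ℂ)
  simpa using this

theorem wnorm_pow_le (f : MvPowerSeries σ ℂ) (j : ℕ) : wnorm w (f ^ j) ≤ wnorm w f ^ j := by
  induction j with
  | zero => simp [wnorm_one]
  | succ j ih =>
    rw [pow_succ, pow_succ]
    exact (gnorm_mul_le isSubmul_enorm _ _).trans (mul_le_mul_left ih _)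

theorem wnorm_prod_le {ι : Type*} (t : Finset ι) (f : ι → MvPowerSeries σ ℂ) :
    wnorm w (∏ i ∈ t, f i) ≤ ∏ i ∈ t, wnorm w (f i) := by
  classical
  induction t using Finset.induction_on with
  | empty => simp [wnorm_one]
  | insert a t ha ih =>
    rw [Finset.prod_insert ha, Finset.prod_insert ha]
    exact (gnorm_mul_le isSubmul_enorm _ _).trans (mul_le_mul_right ih _)

theorem finsuppProd_eq_wmon {M : Type*} [CommMonoid M] (a : σ → M) (γ : σ →₀ ℕ) :
    (γ.prod fun s e => a s ^ e) = wmon a γ :=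
  Finsupp.prod_fintype _ _ fun _ => pow_zero _

theorem wnorm_wmon_le (a : σ → MvPowerSeries τ ℂ) (w : τ → ℝ≥0∞) (γ : σ →₀ ℕ) :
    wnorm w (wmon a γ) ≤ wmon (fun s => wnorm w (a s)) γ :=
  (wnorm_prod_le _ _).trans (Finset.prod_le_prod' fun _ _ => wnorm_pow_le _ _)

/-- Majorant principle. All terms are nonnegative, so the double sum over inner and outer exponents
can be reordered, and submultiplicativity bounds the norm of each monomial in the substituted
series. This single inequality controls every composition below. -/
theorem wnorm_subst_le {a : σ → MvPowerSeries τ ℂ} (ha : MvPowerSeries.HasSubst a) (w : τ → ℝ≥0∞)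
    (f : MvPowerSeries σ ℂ) :
    wnorm w (MvPowerSeries.subst a f) ≤ wnorm (fun s => wnorm w (a s)) f := by
  calc wnorm w (MvPowerSeries.subst a f)
      ≤ ∑' e, ∑' γ, ‖MvPowerSeries.coeff γ f‖ₑ * (‖MvPowerSeries.coeff e (wmon a γ)‖ₑ * wmon w e) := by
        refine ENNReal.tsum_le_tsum fun e => ?_
        simp only [← mul_assoc]
        rw [ENNReal.tsum_mul_right, MvPowerSeries.coeff_subst ha]
        refine mul_le_mul_left ?_ _
        simp only [finsuppProd_eq_wmon]
        rw [finsum_eq_sum _ (by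
          simpa only [finsuppProd_eq_wmon] using MvPowerSeries.coeff_subst_finite ha f e)]
        refine (isSubmul_enorm.sum_le _ _).trans ?_
        simp only [smul_eq_mul, enorm_mul]
        exact ENNReal.sum_le_tsum _
    _ = ∑' γ, ‖MvPowerSeries.coeff γ f‖ₑ * wnorm w (wmon a γ) := by
        rw [ENNReal.tsum_comm]
        exact tsum_congr fun γ => ENNReal.tsum_mul_left
    _ ≤ _ := ENNReal.tsum_le_tsum fun γ => mul_le_mul_right (wnorm_wmon_le a w γ) _

/-- Cauchy's estimate in the `ℓ¹` norm. It holds monomial by monomial, because `δ (j+1) w^j ≤ (w +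
δ)^(j+1)`. -/
theorem wnorm_pderiv_le {δ : ℝ≥0∞} {s : σ} (h : ∀ i, w i ≤ w' i) (hs : w s + δ ≤ w' s)
    (f : MvPowerSeries σ ℂ) : δ * wnorm w (MvPowerSeries.pderiv ℂ s f) ≤ wnorm w' f := by
  classical
  have hpow : ∀ j : ℕ, δ * ((j + 1 : ℕ) : ℝ≥0∞) * w s ^ j ≤ w' s ^ (j + 1) := fun j => by
    refine le_trans ?_ (pow_le_pow_left' hs (j + 1))
    induction j with
    | zero => simp
    | succ j ih =>
      calc δ * ((j + 1 + 1 : ℕ) : ℝ≥0∞) * w s ^ (j + 1)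
          = δ * ((j + 1 : ℕ) : ℝ≥0∞) * w s ^ j * w s + w s ^ (j + 1) * δ := by
            push_cast; ring
        _ ≤ (w s + δ) ^ (j + 1) * w s + (w s + δ) ^ (j + 1) * δ := by
            gcongr
            exact le_self_add
        _ = (w s + δ) ^ (j + 1 + 1) := by ring
  calc δ * wnorm w (MvPowerSeries.pderiv ℂ s f)
      ≤ ∑' γ : σ →₀ ℕ, ‖MvPowerSeries.coeff (γ + Finsupp.single s 1) f‖ₑ *
          wmon w' (γ + Finsupp.single s 1) := by
        rw [wnorm, gnorm, ← ENNReal.tsum_mul_left]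
        refine ENNReal.tsum_le_tsum fun γ => ?_
        rw [MvPowerSeries.coeff_pderiv, enorm_mul]
        have h1 : ‖((γ s : ℂ) + 1)‖ₑ = ((γ s + 1 : ℕ) : ℝ≥0∞) := by
          rw [← Nat.cast_add_one, enorm_eq_nnnorm, RCLike.nnnorm_natCast]; simp
        have h2 : δ * ((γ s + 1 : ℕ) : ℝ≥0∞) * wmon w γ ≤ wmon w' (γ + Finsupp.single s 1) := by
          rw [wmon, wmon, ← Finset.mul_prod_erase _ _ (Finset.mem_univ s),
            ← Finset.mul_prod_erase Finset.univ _ (Finset.mem_univ s), ← mul_assoc]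
          refine mul_le_mul' (by simpa using hpow (γ s)) (Finset.prod_le_prod' fun i hi => ?_)
          have : i ≠ s := Finset.ne_of_mem_erase hi
          simp only [Finsupp.add_apply, Finsupp.single_apply, this.symm, if_false, add_zero]
          exact pow_le_pow_left' (h i) _
        rw [h1]
        calc _ = ‖MvPowerSeries.coeff (γ + Finsupp.single s 1) f‖ₑ *
              (δ * ((γ s + 1 : ℕ) : ℝ≥0∞) * wmon w γ) := by ring
          _ ≤ _ := mul_le_mul_right h2 _
    _ ≤ wnorm w' f :=
        ENNReal.tsum_comp_le_tsum_of_injective (add_left_injective (Finsupp.single s 1))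
          (fun γ => ‖MvPowerSeries.coeff γ f‖ₑ * wmon w' γ)

end Weighted

/-! ### Sums of holomorphic functions -/

section Holomorphic

variable {E : Type*} [NormedAddCommGroup E] [NormedSpace ℂ E]

/-- One-variable Cauchy estimate on the complex line through `u` in the direction `v`. The disc has
radius `δ / (2‖v‖)`, so that its closure stays in the open ball; hence the factor `2`. -/
theorem norm_fderiv_le_of_bound {g : E → ℂ} {u : E} {δ M : ℝ} (hδ : 0 < δ)
    (hg : DifferentiableOn ℂ g (Metric.ball u δ)) (hM : ∀ x ∈ Metric.ball u δ, ‖g x‖ ≤ M) :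
    ‖fderiv ℂ g u‖ ≤ 2 * M / δ := by
  have hM0 : 0 ≤ M := (norm_nonneg _).trans (hM u (Metric.mem_ball_self hδ))
  refine ContinuousLinearMap.opNorm_le_bound _ (by positivity) fun v => ?_
  rcases eq_or_ne v 0 with rfl | hv
  · simp
  have hv' : 0 < ‖v‖ := norm_pos_iff.2 hv
  set R := δ / (2 * ‖v‖) with hR
  have hR0 : 0 < R := by positivity
  have hmem : ∀ ζ ∈ Metric.closedBall (0 : ℂ) R, u + ζ • v ∈ Metric.ball u δ := fun ζ hζ => by
    rw [mem_ball_iff_norm, add_sub_cancel_left, norm_smul]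
    have h1 : ‖ζ‖ ≤ R := by simpa using hζ
    calc ‖ζ‖ * ‖v‖ ≤ R * ‖v‖ := by gcongr
      _ = δ / 2 := by rw [hR]; field_simp
      _ < δ := by linarith
  have hlin : Differentiable ℂ fun ζ : ℂ => u + ζ • v := by fun_prop
  have hd : DifferentiableOn ℂ (fun ζ : ℂ => g (u + ζ • v)) (Metric.closedBall 0 R) :=
    hg.comp hlin.differentiableOn hmem
  have hderiv : deriv (fun ζ : ℂ => g (u + ζ • v)) 0 = fderiv ℂ g u v := by
    have h1 : HasFDerivAt g (fderiv ℂ g u) (u + (0 : ℂ) • v) := by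
      simpa using (hg.differentiableAt (Metric.ball_mem_nhds u hδ)).hasFDerivAt
    have h2 : HasDerivAt (fun ζ : ℂ => u + ζ • v) v 0 := by
      simpa using ((hasDerivAt_id (0 : ℂ)).smul_const v).const_add u
    exact (h1.comp_hasDerivAt 0 h2).deriv
  have := Complex.norm_deriv_le_of_forall_mem_sphere_norm_le hR0
    (hd.diffContOnCl_ball subset_rfl) (C := M)
    fun z hz => hM _ (hmem z (Metric.sphere_subset_closedBall hz))
  rw [hderiv] at this
  refine this.trans (le_of_eq ?_)
  rw [hR]; field_simp

theorem norm_le_toReal_supNorm {X : Type*} {U : Set X} {g : X → ℂ} (h : supNorm U g ≠ ⊤) {u : X}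
    (hu : u ∈ U) : ‖g u‖ ≤ (supNorm U g).toReal := by
  rw [← toReal_enorm]
  exact ENNReal.toReal_mono h (le_supNorm hu g)

variable {ι : Type*} {U : Set E} {g : ι → E → ℂ}

/-- Cauchy's estimate turns the summable sup norms on `U` into summable bounds of the derivatives on
a ball around `u` of half the available radius, which justifies termwise differentiation. -/
theorem hasFDerivAt_tsum_of_supNorm (hU : IsOpen U) (hg : ∀ i, DifferentiableOn ℂ (g i) U)
    (hs : ∑' i, supNorm U (g i) ≠ ⊤) {u : E} (hu : u ∈ U) :
    Summable (fun i => fderiv ℂ (g i) u) ∧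
      HasFDerivAt (fun x => ∑' i, g i x) (∑' i, fderiv ℂ (g i) u) u := by
  obtain ⟨δ, hδ, hball⟩ := Metric.isOpen_iff.1 hU u hu
  have hM := ENNReal.summable_toReal hs
  have hM' : Summable fun i => 2 * (supNorm U (g i)).toReal / (δ / 2) :=
    (hM.mul_left 2).div_const _
  have hsub : ∀ x ∈ Metric.ball u (δ / 2), Metric.ball x (δ / 2) ⊆ U := fun x hx =>
    (Metric.ball_subset_ball' (by rw [Metric.mem_ball] at hx; linarith)).trans hball
  have hbound : ∀ i, ∀ x ∈ Metric.ball u (δ / 2),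
      ‖fderiv ℂ (g i) x‖ ≤ 2 * (supNorm U (g i)).toReal / (δ / 2) := fun i x hx =>
    norm_fderiv_le_of_bound (by linarith) ((hg i).mono (hsub x hx)) fun y hy =>
      norm_le_toReal_supNorm (ENNReal.ne_top_of_tsum_ne_top hs i) (hsub x hx hy)
  have hu' : u ∈ Metric.ball u (δ / 2) := Metric.mem_ball_self (by linarith)
  refine ⟨Summable.of_norm_bounded hM' fun i => hbound i u hu', ?_⟩
  refine hasFDerivAt_tsum_of_isPreconnected hM' Metric.isOpen_ball
    (convex_ball u (δ / 2)).isPreconnected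
    (fun i x hx => ((hg i).differentiableAt (hU.mem_nhds
      (hsub x hx (Metric.mem_ball_self (by linarith))))).hasFDerivAt) hbound hu'
    (Summable.of_norm_bounded hM fun i =>
      norm_le_toReal_supNorm (ENNReal.ne_top_of_tsum_ne_top hs i) hu) hu'

theorem differentiableOn_tsum_of_supNorm (hU : IsOpen U) (hg : ∀ i, DifferentiableOn ℂ (g i) U)
    (hs : ∑' i, supNorm U (g i) ≠ ⊤) : DifferentiableOn ℂ (fun x => ∑' i, g i x) U :=
  fun _ hu => (hasFDerivAt_tsum_of_supNorm hU hg hs hu).2.differentiableAt.differentiableWithinAt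

end Holomorphic

/-! ### Evaluation of power series -/

section Eval

variable {σ τ : Type*} [Fintype σ] [Fintype τ]

/-- The value `∑_γ f_γ z^γ` of a power series. -/
def ev (f : MvPowerSeries σ ℂ) (z : σ → ℂ) : ℂ :=
  ∑' γ : σ →₀ ℕ, MvPowerSeries.coeff γ f * wmon z γ

variable {f g : MvPowerSeries σ ℂ} {z : σ → ℂ} {w w' : σ → ℝ≥0∞}

theorem summable_of_tsum_enorm_ne_top {ι : Type*} {h : ι → ℂ} (hh : ∑' i, ‖h i‖ₑ ≠ ⊤) :
    Summable h := by
  simp only [enorm_eq_nnnorm] at hh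
  exact Summable.of_nnnorm (ENNReal.tsum_coe_ne_top_iff_summable.1 hh)

theorem wnorm_enorm_eq : wnorm (fun s => ‖z s‖ₑ) f =
    ∑' γ : σ →₀ ℕ, ‖MvPowerSeries.coeff γ f * wmon z γ‖ₑ := by
  simp only [wnorm, gnorm, enorm_mul, enorm_wmon]

theorem hasSum_ev (h : wnorm (fun s => ‖z s‖ₑ) f ≠ ⊤) :
    HasSum (fun γ : σ →₀ ℕ => MvPowerSeries.coeff γ f * wmon z γ) (ev f z) :=
  (summable_of_tsum_enorm_ne_top (by rwa [← wnorm_enorm_eq])).hasSum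

theorem wnorm_ne_top_mono (h : ∀ s, w s ≤ w' s) (hf : wnorm w' f ≠ ⊤) : wnorm w f ≠ ⊤ :=
  ne_top_of_le_ne_top hf (gnorm_mono h f)

theorem enorm_tsum_le {ι : Type*} (h : ι → ℂ) : ‖∑' i, h i‖ₑ ≤ ∑' i, ‖h i‖ₑ := by
  by_cases hh : ∑' i, ‖h i‖ₑ = ⊤
  · rw [hh]; exact le_top
  · exact enorm_tsum_le_tsum_enorm

theorem enorm_ev_le : ‖ev f z‖ₑ ≤ wnorm (fun s => ‖z s‖ₑ) f := by
  rw [wnorm_enorm_eq]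
  exact enorm_tsum_le _

theorem ev_zero : ev (0 : MvPowerSeries σ ℂ) z = 0 := by simp [ev]

theorem ev_one : ev (1 : MvPowerSeries σ ℂ) z = 1 := by
  classical
  rw [ev, tsum_eq_single 0] <;> simp +contextual [MvPowerSeries.coeff_one]

theorem ev_monomial (γ : σ →₀ ℕ) (c : ℂ) :
    ev (MvPowerSeries.monomial γ c : MvPowerSeries σ ℂ) z = c * wmon z γ := by
  classical
  rw [ev, tsum_eq_single γ] <;> simp +contextual [MvPowerSeries.coeff_monomial]

theorem ev_X (s : σ) : ev (MvPowerSeries.X s) z = z s := by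
  rw [MvPowerSeries.X, ev_monomial]; simp

theorem ev_at_zero : ev f 0 = MvPowerSeries.constantCoeff f := by
  classical
  rw [ev, tsum_eq_single 0]
  · simp
  · intro γ hγ
    obtain ⟨s, hs⟩ : ∃ s, γ s ≠ 0 := by
      by_contra! h
      exact hγ (Finsupp.ext h)
    rw [wmon, Finset.prod_eq_zero (Finset.mem_univ s) (by simp [hs]), mul_zero]

theorem ev_neg : ev (-f) z = -ev f z := by
  simp only [ev, map_neg, neg_mul, tsum_neg]

theorem ev_smul (c : ℂ) : ev (c • f) z = c * ev f z := by
  simp only [ev, MvPowerSeries.coeff_smul, mul_assoc, tsum_mul_left]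

theorem ev_add (hf : wnorm (fun s => ‖z s‖ₑ) f ≠ ⊤) (hg : wnorm (fun s => ‖z s‖ₑ) g ≠ ⊤) :
    ev (f + g) z = ev f z + ev g z := by
  simp only [ev, map_add, add_mul]
  exact (hasSum_ev hf).summable.tsum_add (hasSum_ev hg).summable

theorem ev_sub (hf : wnorm (fun s => ‖z s‖ₑ) f ≠ ⊤) (hg : wnorm (fun s => ‖z s‖ₑ) g ≠ ⊤) :
    ev (f - g) z = ev f z - ev g z := by
  rw [sub_eq_add_neg, ev_add hf, ev_neg, sub_eq_add_neg]
  rwa [wnorm, gnorm_neg isSubmul_enorm]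

theorem wnorm_add_ne_top (hf : wnorm w f ≠ ⊤) (hg : wnorm w g ≠ ⊤) : wnorm w (f + g) ≠ ⊤ :=
  ne_top_of_le_ne_top (ENNReal.add_ne_top.2 ⟨hf, hg⟩) (gnorm_add_le isSubmul_enorm _ _)

theorem wnorm_sub_ne_top (hf : wnorm w f ≠ ⊤) (hg : wnorm w g ≠ ⊤) : wnorm w (f - g) ≠ ⊤ :=
  ne_top_of_le_ne_top (ENNReal.add_ne_top.2 ⟨hf, hg⟩) (gnorm_sub_le isSubmul_enorm _ _)

theorem wnorm_mul_ne_top (hf : wnorm w f ≠ ⊤) (hg : wnorm w g ≠ ⊤) : wnorm w (f * g) ≠ ⊤ :=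
  ne_top_of_le_ne_top (ENNReal.mul_ne_top hf hg) (gnorm_mul_le isSubmul_enorm _ _)

theorem wnorm_sum_ne_top {ι : Type*} {t : Finset ι} {F : ι → MvPowerSeries σ ℂ}
    (h : ∀ i ∈ t, wnorm w (F i) ≠ ⊤) : wnorm w (∑ i ∈ t, F i) ≠ ⊤ :=
  ne_top_of_le_ne_top (ENNReal.sum_ne_top.2 h) (gnorm_sum_le isSubmul_enorm _ _)

theorem wnorm_pow_ne_top (hf : wnorm w f ≠ ⊤) (j : ℕ) : wnorm w (f ^ j) ≠ ⊤ :=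
  ne_top_of_le_ne_top (ENNReal.pow_ne_top hf) (wnorm_pow_le _ _)

theorem wnorm_prod_ne_top {ι : Type*} {t : Finset ι} {F : ι → MvPowerSeries σ ℂ}
    (h : ∀ i ∈ t, wnorm w (F i) ≠ ⊤) : wnorm w (∏ i ∈ t, F i) ≠ ⊤ :=
  ne_top_of_le_ne_top (ENNReal.prod_ne_top h) (wnorm_prod_le _ _)

theorem ev_sum {ι : Type*} {t : Finset ι} {F : ι → MvPowerSeries σ ℂ}
    (h : ∀ i ∈ t, wnorm (fun s => ‖z s‖ₑ) (F i) ≠ ⊤) :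
    ev (∑ i ∈ t, F i) z = ∑ i ∈ t, ev (F i) z := by
  classical
  induction t using Finset.induction_on with
  | empty => simp [ev_zero]
  | insert a t ha ih =>
    rw [Finset.sum_insert ha, Finset.sum_insert ha, ev_add (h a (by simp))
      (wnorm_sum_ne_top fun i hi => h i (by simp [hi])), ih fun i hi => h i (by simp [hi])]

theorem ev_mul (hf : wnorm (fun s => ‖z s‖ₑ) f ≠ ⊤) (hg : wnorm (fun s => ‖z s‖ₑ) g ≠ ⊤) :
    ev (f * g) z = ev f z * ev g z := by
  classical
  have key : Summable fun p : (σ →₀ ℕ) × (σ →₀ ℕ) =>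
      (MvPowerSeries.coeff p.1 f * wmon z p.1) * (MvPowerSeries.coeff p.2 g * wmon z p.2) := by
    apply summable_of_tsum_enorm_ne_top
    rw [ENNReal.tsum_prod']
    simp only [enorm_mul _ (_ * _), ENNReal.tsum_mul_left, ENNReal.tsum_mul_right,
      ← wnorm_enorm_eq]
    exact ENNReal.mul_ne_top hf hg
  have h2 := (hasSum_ev hf).summable.tsum_mul_tsum_eq_tsum_sum_antidiagonal
    (hasSum_ev hg).summable key
  rw [ev, ev, ev, h2]
  refine tsum_congr fun γ => ?_
  rw [MvPowerSeries.coeff_mul, Finset.sum_mul]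
  refine Finset.sum_congr rfl fun p hp => ?_
  rw [← Finset.HasAntidiagonal.mem_antidiagonal.1 hp, wmon_add]
  ring

theorem ev_pow (hf : wnorm (fun s => ‖z s‖ₑ) f ≠ ⊤) (j : ℕ) : ev (f ^ j) z = ev f z ^ j := by
  induction j with
  | zero => simp [ev_one]
  | succ j ih => rw [pow_succ, pow_succ, ev_mul (wnorm_pow_ne_top hf j) hf, ih]

theorem ev_prod {ι : Type*} {t : Finset ι} {F : ι → MvPowerSeries σ ℂ}
    (h : ∀ i ∈ t, wnorm (fun s => ‖z s‖ₑ) (F i) ≠ ⊤) :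
    ev (∏ i ∈ t, F i) z = ∏ i ∈ t, ev (F i) z := by
  classical
  induction t using Finset.induction_on with
  | empty => simp [ev_one]
  | insert a t ha ih =>
    rw [Finset.prod_insert ha, Finset.prod_insert ha, ev_mul (h a (by simp))
      (wnorm_prod_ne_top fun i hi => h i (by simp [hi])), ih fun i hi => h i (by simp [hi])]

/-- The reordering of `wnorm_subst_le`, now for the complex terms: the hypotheses say exactly that
the double series converges absolutely. -/
theorem ev_subst {a : σ → MvPowerSeries τ ℂ} (ha : MvPowerSeries.HasSubst a) {z : τ → ℂ}
    (hW : ∀ s, wnorm (fun i => ‖z i‖ₑ) (a s) ≠ ⊤)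
    (hf : wnorm (fun s => wnorm (fun i => ‖z i‖ₑ) (a s)) f ≠ ⊤) :
    ev (MvPowerSeries.subst a f) z = ev f fun s => ev (a s) z := by
  set F : (τ →₀ ℕ) → (σ →₀ ℕ) → ℂ := fun e γ =>
    MvPowerSeries.coeff γ f * (MvPowerSeries.coeff e (wmon a γ) * wmon z e) with hF
  have hWγ : ∀ γ : σ →₀ ℕ, wnorm (fun i => ‖z i‖ₑ) (wmon a γ) ≠ ⊤ := fun γ =>
    wnorm_prod_ne_top fun s _ => wnorm_pow_ne_top (hW s) _
  have hsum : Summable (Function.uncurry F) := by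
    apply summable_of_tsum_enorm_ne_top
    rw [ENNReal.tsum_prod', ENNReal.tsum_comm]
    refine ne_top_of_le_ne_top hf (ENNReal.tsum_le_tsum fun γ => ?_)
    simp only [Function.uncurry, hF, enorm_mul _ (_ * _)]
    rw [ENNReal.tsum_mul_left, ← wnorm_enorm_eq]
    exact mul_le_mul_right (wnorm_wmon_le a _ γ) _
  have h1 : ev (MvPowerSeries.subst a f) z = ∑' e, ∑' γ, F e γ := by
    refine tsum_congr fun e => ?_
    have hfin := MvPowerSeries.coeff_subst_finite ha f e
    rw [MvPowerSeries.coeff_subst ha, ← tsum_eq_finsum (L := .unconditional _) hfin, ← tsum_mul_right]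
    simp only [finsuppProd_eq_wmon, smul_eq_mul, hF, mul_assoc]
  rw [h1, ← hsum.tsum_comm]
  refine tsum_congr fun γ => ?_
  simp only [hF]
  rw [tsum_mul_left]
  congr 1
  change ev (wmon a γ) z = _
  rw [wmon, ev_prod fun s _ => wnorm_pow_ne_top (hW s) _]
  exact Finset.prod_congr rfl fun s _ => ev_pow (hW s) _

/-- The open polydisc with polyradius `w`. -/
def openPoly (w : σ → ℝ≥0∞) : Set (σ → ℂ) := {z | ∀ s, ‖z s‖ₑ < w s}

theorem isOpen_openPoly (w : σ → ℝ≥0∞) : IsOpen (openPoly w) := by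
  have : openPoly w = ⋂ s, {z : σ → ℂ | ‖z s‖ₑ < w s} := by ext; simp [openPoly]
  rw [this]
  exact isOpen_iInter_of_finite fun s =>
    isOpen_lt (continuous_enorm.comp (continuous_apply s)) continuous_const

theorem wnorm_ne_top_of_mem (hf : wnorm w f ≠ ⊤) (hz : z ∈ openPoly w) :
    wnorm (fun s => ‖z s‖ₑ) f ≠ ⊤ := wnorm_ne_top_mono (fun s => (hz s).le) hf

theorem hasFDerivAt_wmon (γ : σ →₀ ℕ) (z : σ → ℂ) (s : σ) [DecidableEq σ] :
    fderiv ℂ (fun z : σ → ℂ => wmon z γ) z (Pi.single s 1) =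
      γ s * wmon z (γ - Finsupp.single s 1) := by
  have h1 : ∀ i ∈ (Finset.univ : Finset σ), HasFDerivAt (fun z : σ → ℂ => z i ^ γ i)
      ((γ i * z i ^ (γ i - 1)) • ContinuousLinearMap.proj (R := ℂ) (φ := fun _ : σ => ℂ) i) z :=
    fun i _ => (hasDerivAt_pow (γ i) (z i)).comp_hasFDerivAt z
      (ContinuousLinearMap.proj (R := ℂ) (φ := fun _ : σ => ℂ) i).hasFDerivAt
  have h2 := HasFDerivAt.finsetProd h1
  have h3 : (fun z : σ → ℂ => wmon z γ) = fun z => ∏ i, z i ^ γ i := rfl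
  rw [h3, h2.fderiv]
  simp only [sum_apply, smul_apply,
    ContinuousLinearMap.proj_apply, smul_eq_mul]
  rw [Finset.sum_eq_single s]
  · rw [wmon, ← Finset.mul_prod_erase _ _ (Finset.mem_univ s)]
    simp only [Pi.single_eq_same, mul_one, Finsupp.tsub_apply, Finsupp.single_eq_same]
    have : ∏ x ∈ Finset.univ.erase s, z x ^ (γ x - (Finsupp.single s 1) x) =
        ∏ x ∈ Finset.univ.erase s, z x ^ γ x :=
      Finset.prod_congr rfl fun i hi => by
        simp [(Finset.ne_of_mem_erase hi).symm]
    rw [this]; ring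
  · intro i _ hi; simp [hi]
  · simp

theorem hasFDerivAt_ev [DecidableEq σ] (hf : wnorm w f ≠ ⊤) (hz : z ∈ openPoly w) :
    ∃ L : (σ → ℂ) →L[ℂ] ℂ, HasFDerivAt (ev f) L z ∧
      ∀ v, L v = ∑ s, v s * ev (MvPowerSeries.pderiv ℂ s f) z := by
  have hdiff : ∀ γ : σ →₀ ℕ, Differentiable ℂ fun z : σ → ℂ => wmon z γ := fun γ => by
    unfold wmon; fun_prop
  obtain ⟨hs, hd⟩ := hasFDerivAt_tsum_of_supNorm (isOpen_openPoly w)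
    (g := fun (γ : σ →₀ ℕ) z => MvPowerSeries.coeff γ f * wmon z γ)
    (fun γ => ((hdiff γ).const_mul _).differentiableOn)
    (ne_top_of_le_ne_top hf (ENNReal.tsum_le_tsum fun γ => iSup₂_le fun u hu => by
      rw [enorm_mul, enorm_wmon]
      exact mul_le_mul_right (wmon_mono (fun s => (hu s).le) γ) _)) hz
  refine ⟨_, hd, fun v => ?_⟩
  have hv : v = ∑ s, v s • (Pi.single s 1 : σ → ℂ) := by
    ext i; simp [Finset.sum_apply, Pi.single_apply]
  conv_lhs => rw [hv]
  rw [map_sum]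
  refine Finset.sum_congr rfl fun s _ => ?_
  rw [map_smul, smul_eq_mul]
  congr 1
  rw [← ContinuousLinearMap.apply_apply (𝕜 := ℂ) (Pi.single s 1 : σ → ℂ),
    ContinuousLinearMap.map_tsum _ hs, ev]
  simp only [ContinuousLinearMap.apply_apply]
  have hterm : ∀ γ : σ →₀ ℕ, fderiv ℂ (fun z => MvPowerSeries.coeff γ f * wmon z γ) z
      (Pi.single s 1) =
      MvPowerSeries.coeff γ f * (γ s * wmon z (γ - Finsupp.single s 1)) := fun γ => by
    rw [fderiv_const_mul (hdiff γ z), smul_apply, hasFDerivAt_wmon,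
      smul_eq_mul]
  simp only [hterm]
  -- Shift the exponent by one in the variable `s`. The exponents outside the range of the shift
  -- have `γ s = 0` and contribute nothing to the derivative.
  rw [← (add_left_injective (Finsupp.single s 1)).tsum_eq]
  · refine tsum_congr fun γ => ?_
    rw [MvPowerSeries.coeff_pderiv, add_tsub_cancel_right]
    simp [mul_assoc]
  · intro γ hγ
    have : γ s ≠ 0 := by
      intro h0; simp [h0] at hγ
    refine ⟨γ - Finsupp.single s 1, ?_⟩
    exact tsub_add_cancel_of_le (Finsupp.single_le_iff.2 (Nat.one_le_iff_ne_zero.2 this))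

theorem differentiableOn_ev (hf : wnorm w f ≠ ⊤) : DifferentiableOn ℂ (ev f) (openPoly w) := by
  classical
  intro z hz
  obtain ⟨L, hL, -⟩ := hasFDerivAt_ev hf hz
  exact hL.differentiableAt.differentiableWithinAt

theorem wnorm_pderiv_ne_top {s : σ} (h : ∀ i, w i ≤ w' i) (hs : w s < w' s)
    (hf : wnorm w' f ≠ ⊤) : wnorm w (MvPowerSeries.pderiv ℂ s f) ≠ ⊤ := by
  have h1 := wnorm_pderiv_le h (add_tsub_cancel_of_le hs.le).le f
  intro htop
  rw [htop, ENNReal.mul_top (tsub_pos_of_lt hs).ne'] at h1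
  exact hf (top_le_iff.1 h1)

theorem eq_zero_of_ev_eq_zero (hw0 : ∀ s, w s ≠ 0) (hwt : ∀ s, w s ≠ ⊤) (hf : wnorm w f ≠ ⊤)
    (h : ∀ z ∈ openPoly w, ev f z = 0) : f = 0 := by
  classical
  -- The induction is on the degree of the coefficient. It passes from `f` to a partial derivative
  -- on the polydisc of half the radii, where finiteness of the norm survives, so both `f` and `w`
  -- must vary.
  suffices H : ∀ (N : ℕ) (w : σ → ℝ≥0∞) (f : MvPowerSeries σ ℂ), (∀ s, w s ≠ 0) →
      (∀ s, w s ≠ ⊤) → wnorm w f ≠ ⊤ → (∀ z ∈ openPoly w, ev f z = 0) →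
      ∀ γ : σ →₀ ℕ, γ.degree = N → MvPowerSeries.coeff γ f = 0 by
    ext γ
    simpa using H γ.degree w f hw0 hwt hf h γ rfl
  intro N
  induction N with
  | zero =>
    intro w f hw0 _ _ h γ hγ
    rw [(Finsupp.degree_eq_zero_iff γ).1 hγ, MvPowerSeries.coeff_zero_eq_constantCoeff, ← ev_at_zero]
    exact h 0 fun s => by simpa using pos_iff_ne_zero.2 (hw0 s)
  | succ N ih =>
    intro w f hw0 hwt hf h γ hγ
    obtain ⟨s, hs⟩ : ∃ s, γ s ≠ 0 := by
      by_contra! h'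
      rw [Finsupp.ext (g := 0) h'] at hγ
      simp at hγ
    obtain ⟨δ, rfl⟩ : ∃ δ, γ = δ + Finsupp.single s 1 :=
      ⟨γ - Finsupp.single s 1, (tsub_add_cancel_of_le
        (Finsupp.single_le_iff.2 (Nat.one_le_iff_ne_zero.2 hs))).symm⟩
    have hlt : ∀ i, w i / 2 < w i := fun i => ENNReal.half_lt_self (hw0 i) (hwt i)
    have := ih (fun i => w i / 2) (MvPowerSeries.pderiv ℂ s f)
      (fun i => (ENNReal.half_pos (hw0 i)).ne') (fun i => ((hlt i).trans_le le_top).ne)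
      (wnorm_pderiv_ne_top (fun i => (hlt i).le) (hlt s) hf) (fun z hz => by
        have hz' : z ∈ openPoly w := fun i => (hz i).trans (hlt i)
        obtain ⟨L, hL, hLv⟩ := hasFDerivAt_ev hf hz'
        have hL0 : L = 0 := by
          refine hL.unique ((hasFDerivAt_const (0 : ℂ) z).congr_of_eventuallyEq ?_)
          filter_upwards [(isOpen_openPoly w).mem_nhds hz'] with y hy using h y hy
        have := hLv (Pi.single s 1)
        rw [hL0] at this
        simpa [Pi.single_apply] using this.symm) δ (by simpa using hγ)
    rw [MvPowerSeries.coeff_pderiv] at this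
    exact (mul_eq_zero.1 this).resolve_right (Nat.cast_add_one_ne_zero _)

end Eval

/-! ### Order ideals -/

section Order

variable {σ τ : Type*} [Fintype σ] [Fintype τ]

/-- The weighted degree `∑_s e_s γ_s`. -/
def wdeg (e : σ → ℕ) (γ : σ →₀ ℕ) : ℕ := ∑ s, e s * γ s

theorem wdeg_add (e : σ → ℕ) (γ δ : σ →₀ ℕ) : wdeg e (γ + δ) = wdeg e γ + wdeg e δ := by
  simp [wdeg, mul_add, Finset.sum_add_distrib]

@[simp] theorem wdeg_single (e : σ → ℕ) (s : σ) (j : ℕ) :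
    wdeg e (Finsupp.single s j) = e s * j := by
  classical
  rw [wdeg, Finset.sum_eq_single s] <;> simp +contextual [eq_comm]

/-- The ideal of the power series all of whose monomials have weighted degree at least `d`. -/
def ordIdeal (e : σ → ℕ) (d : ℕ) : Ideal (MvPowerSeries σ ℂ) where
  carrier := {f | ∀ γ, wdeg e γ < d → MvPowerSeries.coeff γ f = 0}
  add_mem' hf hg γ hγ := by rw [map_add, hf γ hγ, hg γ hγ, add_zero]
  zero_mem' γ _ := map_zero _
  smul_mem' c f hf γ hγ := by
    classical
    rw [smul_eq_mul, MvPowerSeries.coeff_mul]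
    refine Finset.sum_eq_zero fun p hp => ?_
    rw [← Finset.HasAntidiagonal.mem_antidiagonal.1 hp, wdeg_add] at hγ
    rw [hf p.2 (by omega), mul_zero]

variable {e : σ → ℕ} {d d' : ℕ} {f g : MvPowerSeries σ ℂ}

theorem mem_ordIdeal : f ∈ ordIdeal e d ↔ ∀ γ, wdeg e γ < d → MvPowerSeries.coeff γ f = 0 :=
  Iff.rfl

theorem ordIdeal_anti (h : d ≤ d') : ordIdeal e d' ≤ ordIdeal e d :=
  fun _ hf γ hγ => hf γ (hγ.trans_le h)

theorem mem_ordIdeal_zero : f ∈ ordIdeal e 0 := fun _ h => absurd h (Nat.not_lt_zero _)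

theorem smul_mem_ordIdeal (c : ℂ) (hf : f ∈ ordIdeal e d) : c • f ∈ ordIdeal e d := fun γ hγ => by
  rw [MvPowerSeries.coeff_smul, hf γ hγ, mul_zero]

theorem mul_mem_ordIdeal (hf : f ∈ ordIdeal e d) (hg : g ∈ ordIdeal e d') :
    f * g ∈ ordIdeal e (d + d') := by
  classical
  intro γ hγ
  rw [MvPowerSeries.coeff_mul]
  refine Finset.sum_eq_zero fun p hp => ?_
  rw [← Finset.HasAntidiagonal.mem_antidiagonal.1 hp, wdeg_add] at hγ
  rcases Nat.lt_or_ge (wdeg e p.1) d with h | h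
  · rw [hf _ h, zero_mul]
  · rw [hg _ (by omega), mul_zero]

theorem pow_mem_ordIdeal (hf : f ∈ ordIdeal e d) (j : ℕ) : f ^ j ∈ ordIdeal e (d * j) := by
  induction j with
  | zero => exact mem_ordIdeal_zero
  | succ j ih => rw [pow_succ, mul_add, mul_one]; exact mul_mem_ordIdeal ih hf

theorem prod_mem_ordIdeal {ι : Type*} (t : Finset ι) {F : ι → MvPowerSeries σ ℂ} {c : ι → ℕ}
    (h : ∀ i ∈ t, F i ∈ ordIdeal e (c i)) : ∏ i ∈ t, F i ∈ ordIdeal e (∑ i ∈ t, c i) := by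
  classical
  induction t using Finset.induction_on with
  | empty => exact mem_ordIdeal_zero
  | insert a t ha ih =>
    rw [Finset.prod_insert ha, Finset.sum_insert ha]
    exact mul_mem_ordIdeal (h a (by simp)) (ih fun i hi => h i (by simp [hi]))

theorem pderiv_mem_ordIdeal {s : σ} (hd : d' + e s ≤ d) (hf : f ∈ ordIdeal e d) :
    MvPowerSeries.pderiv ℂ s f ∈ ordIdeal e d' := fun γ hγ => by
  rw [MvPowerSeries.coeff_pderiv, hf _ (by rw [wdeg_add, wdeg_single, mul_one]; omega), zero_mul]

theorem X_mem_ordIdeal (s : σ) : MvPowerSeries.X s ∈ ordIdeal e (e s) := by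
  classical
  intro γ hγ
  rw [MvPowerSeries.coeff_X, if_neg]
  rintro rfl
  simp at hγ

theorem constantCoeff_eq_zero_of_mem (hd : 0 < d) (hf : f ∈ ordIdeal e d) :
    MvPowerSeries.constantCoeff f = 0 := by
  rw [← MvPowerSeries.coeff_zero_eq_constantCoeff_apply]
  exact hf 0 (by simpa [wdeg] using hd)

theorem wmon_mem_ordIdeal {a : τ → MvPowerSeries σ ℂ} {c : τ → ℕ}
    (h : ∀ s, a s ∈ ordIdeal e (c s)) (γ : τ →₀ ℕ) : wmon a γ ∈ ordIdeal e (wdeg c γ) :=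
  prod_mem_ordIdeal _ fun s _ => pow_mem_ordIdeal (h s) _

theorem mem_total_one_iff : f ∈ ordIdeal (fun _ => 1) 1 ↔ MvPowerSeries.constantCoeff f = 0 := by
  refine ⟨constantCoeff_eq_zero_of_mem one_pos, fun h γ hγ => ?_⟩
  have : γ = 0 := by
    rw [← Finsupp.degree_eq_zero_iff, Finsupp.degree_eq_sum]
    simpa [wdeg] using hγ
  rw [this, MvPowerSeries.coeff_zero_eq_constantCoeff_apply, h]

theorem subst_mem_ordIdeal {a : τ → MvPowerSeries σ ℂ} (ha : MvPowerSeries.HasSubst a) {c : τ → ℕ}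
    (h : ∀ s, a s ∈ ordIdeal e (c s)) {f : MvPowerSeries τ ℂ} (hf : f ∈ ordIdeal c d) :
    MvPowerSeries.subst a f ∈ ordIdeal e d := by
  intro γ hγ
  rw [MvPowerSeries.coeff_subst ha]
  refine finsum_eq_zero_of_forall_eq_zero fun δ => ?_
  rw [finsuppProd_eq_wmon]
  rcases Nat.lt_or_ge (wdeg c δ) d with h1 | h1
  · rw [hf δ h1, zero_smul]
  · rw [wmon_mem_ordIdeal h δ γ (by omega), smul_zero]

/-- A linear operator that lowers the order by at most one is determined by its values on
monomials. -/
theorem map_mem_ordIdeal_of_monomial (L : MvPowerSeries τ ℂ →ₗ[ℂ] MvPowerSeries σ ℂ)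
    (hL : ∀ K, ∀ f ∈ ordIdeal (fun _ : τ => 1) (K + 1), L f ∈ ordIdeal (fun _ => 1) K)
    {f : MvPowerSeries τ ℂ}
    (h : ∀ γ, MvPowerSeries.coeff γ f ≠ 0 → L (MvPowerSeries.monomial γ 1) ∈ ordIdeal e d) :
    L f ∈ ordIdeal e d := by
  classical
  intro γ hγ
  -- `f` is truncated beyond the degree of `γ`, with a margin of one for the order that `L` may
  -- lose. The tail then does not reach the coefficient of `γ`, and the truncation is a finite
  -- combination of monomials.
  set K := wdeg (fun _ : σ => 1) γ + 1 with hK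
  have hfin := Finsupp.finite_of_degree_lt (σ := τ) (K + 1)
  set T : MvPowerSeries τ ℂ :=
    ∑ δ ∈ hfin.toFinset, MvPowerSeries.coeff δ f • MvPowerSeries.monomial δ 1 with hT
  have hcoeff : ∀ δ, δ.degree < K + 1 → MvPowerSeries.coeff δ T = MvPowerSeries.coeff δ f := by
    intro δ hδ
    rw [hT, map_sum, Finset.sum_eq_single δ]
    · simp
    · intro δ' _ hne
      rw [MvPowerSeries.coeff_smul, MvPowerSeries.coeff_monomial_ne hne.symm, mul_zero]
    · intro hn; exact absurd (by simpa using hδ) hn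
  have h1 : L (f - T) ∈ ordIdeal (fun _ => 1) K := hL K _ fun δ hδ => by
    rw [map_sub, hcoeff δ (by rw [Finsupp.degree_eq_sum]; simpa [wdeg] using hδ), sub_self]
  have h2 : L T ∈ ordIdeal e d := by
    rw [hT, map_sum]
    refine Ideal.sum_mem _ fun δ _ => ?_
    rw [map_smul]
    by_cases h0 : MvPowerSeries.coeff δ f = 0
    · rw [h0, zero_smul]; exact Ideal.zero_mem _
    · exact smul_mem_ordIdeal _ (h δ h0)
  have h3 := h1 γ (by omega)
  rw [map_sub, map_sub, h2 γ hγ, sub_zero] at h3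
  exact h3

theorem substLin_mem_total {a : τ → MvPowerSeries σ ℂ} (ha : MvPowerSeries.HasSubst a)
    (h0 : ∀ s, MvPowerSeries.constantCoeff (a s) = 0) {f : MvPowerSeries τ ℂ} {K : ℕ}
    (hf : f ∈ ordIdeal (fun _ : τ => 1) K) :
    MvPowerSeries.subst a f ∈ ordIdeal (fun _ => 1) K :=
  subst_mem_ordIdeal ha (fun s => mem_total_one_iff.2 (h0 s)) hf

/-- The first order Taylor formula modulo the square of an order ideal. -/
theorem subst_taylor_mem [DecidableEq σ] {h : σ → MvPowerSeries σ ℂ}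
    (h0 : ∀ s, MvPowerSeries.constantCoeff (h s) = 0)
    (hh : ∀ s, h s ∈ ordIdeal e d) (f : MvPowerSeries σ ℂ) :
    MvPowerSeries.subst (fun s => MvPowerSeries.X s + h s) f - f -
      ∑ s, h s * MvPowerSeries.pderiv ℂ s f ∈ ordIdeal e (d + d) := by
  have hc : ∀ s, MvPowerSeries.constantCoeff (MvPowerSeries.X s + h s) = 0 := fun s => by
    simp [h0 s]
  have ha : MvPowerSeries.HasSubst fun s => MvPowerSeries.X s + h s :=
    MvPowerSeries.hasSubst_of_constantCoeff_zero hc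
  let L : MvPowerSeries σ ℂ →ₗ[ℂ] MvPowerSeries σ ℂ :=
    (MvPowerSeries.substAlgHom (R := ℂ) ha).toLinearMap - LinearMap.id -
      ∑ s, (LinearMap.mulLeft ℂ (h s)).comp (MvPowerSeries.pderiv ℂ s).toLinearMap
  have hLdef : ∀ f, L f = MvPowerSeries.subst (fun s => MvPowerSeries.X s + h s) f - f -
      ∑ s, h s * MvPowerSeries.pderiv ℂ s f := fun f => by
    simp [L]
  -- Let `L` be the Taylor defect, `σ` the substitution, and `A`, `B` the first order terms of `f`,
  -- `g`. Then `L(fg) = L f · σ g + (f + A) · L g + A B`, with `A B` in the ideal of order `2d`. So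
  -- the series with small defect are closed under products, and it suffices to treat `1` and the
  -- variables.
  have hmul : ∀ f g, L f ∈ ordIdeal e (d + d) → L g ∈ ordIdeal e (d + d) →
      L (f * g) ∈ ordIdeal e (d + d) := by
    intro f g hf hg
    set A := ∑ s, h s * MvPowerSeries.pderiv ℂ s f with hA
    set B := ∑ s, h s * MvPowerSeries.pderiv ℂ s g with hB
    have hAm : A ∈ ordIdeal e d := Ideal.sum_mem _ fun s _ => Ideal.mul_mem_right _ _ (hh s)
    have hBm : B ∈ ordIdeal e d := Ideal.sum_mem _ fun s _ => Ideal.mul_mem_right _ _ (hh s)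
    have hAB : ∑ s, h s * MvPowerSeries.pderiv ℂ s (f * g) = f * B + g * A := by
      rw [hA, hB, Finset.mul_sum, Finset.mul_sum, ← Finset.sum_add_distrib]
      refine Finset.sum_congr rfl fun s _ => ?_
      rw [Derivation.leibniz, smul_eq_mul, smul_eq_mul]
      ring
    have : L (f * g) = L f * MvPowerSeries.subst (fun s => MvPowerSeries.X s + h s) g +
        (f + A) * L g + A * B := by
      rw [hLdef, hLdef, hLdef, hAB, MvPowerSeries.subst_mul ha, ← hA, ← hB]
      ring
    rw [this]
    exact Ideal.add_mem _ (Ideal.add_mem _ (Ideal.mul_mem_right _ _ hf) (Ideal.mul_mem_left _ _ hg))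
      (mul_mem_ordIdeal hAm hBm)
  have hone : L 1 ∈ ordIdeal e (d + d) := by
    have h1 : MvPowerSeries.subst (fun s => MvPowerSeries.X s + h s) (1 : MvPowerSeries σ ℂ) = 1 := by
      rw [← MvPowerSeries.substAlgHom_apply ha, map_one]
    rw [hLdef, h1]
    simp
  have hX : ∀ s, L (MvPowerSeries.X s) ∈ ordIdeal e (d + d) := fun s => by
    rw [hLdef, MvPowerSeries.subst_X ha, Finset.sum_eq_single s]
    · simp
    · intro i _ hi; simp [MvPowerSeries.pderiv_X_of_ne hi.symm]
    · simp
  have hpow : ∀ s j, L (MvPowerSeries.X s ^ j) ∈ ordIdeal e (d + d) := fun s j => by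
    induction j with
    | zero => simpa using hone
    | succ j ih => rw [pow_succ]; exact hmul _ _ ih (hX s)
  have hprod : ∀ (γ : σ →₀ ℕ) (t : Finset σ), L (∏ s ∈ t, MvPowerSeries.X s ^ γ s) ∈
      ordIdeal e (d + d) := fun γ t => by
    induction t using Finset.induction_on with
    | empty => simpa using hone
    | insert a t ha ih => rw [Finset.prod_insert ha]; exact hmul _ _ (hpow _ _) ih
  rw [← hLdef]
  refine map_mem_ordIdeal_of_monomial L (fun K f hf => ?_) fun γ _ => ?_
  · rw [hLdef]
    refine Ideal.sub_mem _ (Ideal.sub_mem _ ?_ (ordIdeal_anti (Nat.le_succ K) hf))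
      (Ideal.sum_mem _ fun s _ => Ideal.mul_mem_left _ _ (pderiv_mem_ordIdeal le_rfl hf))
    exact ordIdeal_anti (Nat.le_succ K) (substLin_mem_total ha hc hf)
  · rw [MvPowerSeries.monomial_one_eq, Finsupp.prod_fintype _ _ fun _ => pow_zero _]
    exact hprod γ _

/-- Telescoping with `A B - A' B' = A (B - B') + (A - A') B'`. Every unchanged factor contributes
its full order, and the one difference contributes the extra `d`. -/
theorem prod_pow_sub_mem {ι : Type*} (t : Finset ι) {a a' : ι → MvPowerSeries σ ℂ} {c : ι → ℕ}
    (γ : ι → ℕ) (h : ∀ s, a s ∈ ordIdeal e (c s)) (h' : ∀ s, a' s ∈ ordIdeal e (c s))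
    (hd : ∀ s, a s - a' s ∈ ordIdeal e (d + c s)) :
    ∏ s ∈ t, a s ^ γ s - ∏ s ∈ t, a' s ^ γ s ∈ ordIdeal e (d + ∑ s ∈ t, c s * γ s) := by
  classical
  have step : ∀ {A A' B B' : MvPowerSeries σ ℂ} {i j : ℕ}, A ∈ ordIdeal e i →
      B' ∈ ordIdeal e j → A - A' ∈ ordIdeal e (d + i) → B - B' ∈ ordIdeal e (d + j) →
      A * B - A' * B' ∈ ordIdeal e (d + (i + j)) := by
    intro A A' B B' i j hA hB' hAA hBB
    have : A * B - A' * B' = A * (B - B') + (A - A') * B' := by ring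
    rw [this]
    refine Ideal.add_mem _ ?_ ?_
    · have := mul_mem_ordIdeal hA hBB
      rwa [show i + (d + j) = d + (i + j) by ring] at this
    · have := mul_mem_ordIdeal hAA hB'
      rwa [add_assoc] at this
  have hpow : ∀ s j, a s ^ j - a' s ^ j ∈ ordIdeal e (d + c s * j) := fun s j => by
    induction j with
    | zero => simp
    | succ j ih =>
      rw [pow_succ, pow_succ, mul_add, mul_one]
      exact step (pow_mem_ordIdeal (h s) j) (h' s) ih (hd s)
  induction t using Finset.induction_on with
  | empty => simp
  | insert s t hs ih =>
    rw [Finset.prod_insert hs, Finset.prod_insert hs, Finset.sum_insert hs]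
    exact step (pow_mem_ordIdeal (h s) _)
      (prod_mem_ordIdeal _ fun i _ => pow_mem_ordIdeal (h' i) _) (hpow s _) ih

/-- It is enough to treat monomials, by `map_mem_ordIdeal_of_monomial`, and there the difference
telescopes. The agreement of `a s` and `a' s` is measured relative to the order `c s` that both
have, so the gain `d` adds to the order of `f`. -/
theorem subst_sub_mem {a a' : τ → MvPowerSeries σ ℂ}
    (h0 : ∀ s, MvPowerSeries.constantCoeff (a s) = 0)
    (h0' : ∀ s, MvPowerSeries.constantCoeff (a' s) = 0) {c : τ → ℕ}
    (h : ∀ s, a s ∈ ordIdeal e (c s)) (h' : ∀ s, a' s ∈ ordIdeal e (c s))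
    (hd : ∀ s, a s - a' s ∈ ordIdeal e (d + c s)) {f : MvPowerSeries τ ℂ} {N : ℕ}
    (hf : f ∈ ordIdeal c N) :
    MvPowerSeries.subst a f - MvPowerSeries.subst a' f ∈ ordIdeal e (d + N) := by
  have ha := MvPowerSeries.hasSubst_of_constantCoeff_zero h0
  have ha' := MvPowerSeries.hasSubst_of_constantCoeff_zero h0'
  let L : MvPowerSeries τ ℂ →ₗ[ℂ] MvPowerSeries σ ℂ :=
    (MvPowerSeries.substAlgHom (R := ℂ) ha).toLinearMap -
      (MvPowerSeries.substAlgHom (R := ℂ) ha').toLinearMap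
  have hLdef : ∀ f, L f = MvPowerSeries.subst a f - MvPowerSeries.subst a' f := fun f => by
    simp [L]
  rw [← hLdef]
  refine map_mem_ordIdeal_of_monomial L (fun K f hf => ?_) fun γ hγ => ?_
  · rw [hLdef]
    exact ordIdeal_anti (Nat.le_succ K)
      (Ideal.sub_mem _ (substLin_mem_total ha h0 hf) (substLin_mem_total ha' h0' hf))
  · rw [hLdef, MvPowerSeries.subst_monomial ha, MvPowerSeries.subst_monomial ha',
      finsuppProd_eq_wmon, finsuppProd_eq_wmon, map_one, one_mul, one_mul]
    have hN : N ≤ wdeg c γ := by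
      by_contra hlt
      exact hγ (hf γ (not_le.1 hlt))
    exact ordIdeal_anti (Nat.add_le_add_left hN d) (prod_pow_sub_mem _ γ h h' hd)

end Order

/-! ### Formal fibered maps -/

section Fibered

variable {n p : ℕ}

/-- Formal power series in `x` and `v = u - b`. -/
abbrev FS (n p : ℕ) : Type := MvPowerSeries (Fin n ⊕ Fin p) ℂ

/-- The weights that define the order in `x`. -/
def xw : Fin n ⊕ Fin p → ℕ := Sum.elim (fun _ => 1) fun _ => 0

/-- The monomial `y^{R_k}`. -/
def resMon (R : Fin p → Fin n →₀ ℕ) (k : Fin p) (y : Fin n → FS n p) : FS n p :=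
  ∏ i, y i ^ R k i

/-- The variables `x_1, …, x_n`. -/
def xvar : Fin n → FS n p := fun i => MvPowerSeries.X (Sum.inl i)

/-- The series of the components of `(x + V, v + π(x + V) - π(x))`. -/
def fib (R : Fin p → Fin n →₀ ℕ) (V : Fin n → FS n p) : Fin n ⊕ Fin p → FS n p :=
  Sum.elim (fun i => xvar i + V i)
    fun k => MvPowerSeries.X (Sum.inr k) + (resMon R k (xvar + V) - resMon R k xvar)

variable {R : Fin p → Fin n →₀ ℕ} {V V' U : Fin n → FS n p} {d m : ℕ}

theorem fib_inr (k : Fin p) : fib R V (Sum.inr k) =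
    MvPowerSeries.X (Sum.inr k) + (resMon R k (xvar + V) - resMon R k xvar) := rfl

theorem xvar_mem (i : Fin n) : (xvar i : FS n p) ∈ ordIdeal xw 1 :=
  X_mem_ordIdeal (e := xw) (Sum.inl i)

theorem resMon_sub_mem {y y' : Fin n → FS n p} (h : ∀ i, y i - y' i ∈ ordIdeal xw d) (k : Fin p) :
    resMon R k y - resMon R k y' ∈ ordIdeal xw d := by
  have := prod_pow_sub_mem (e := xw) (d := d) Finset.univ (c := fun _ => 0) (R k)
    (fun _ => mem_ordIdeal_zero) (fun _ => mem_ordIdeal_zero) h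
  simpa [resMon] using this

theorem fib_mem (hV : ∀ i, V i ∈ ordIdeal xw 1) (s : Fin n ⊕ Fin p) :
    fib R V s ∈ ordIdeal xw (xw s) := by
  cases s with
  | inl i => exact Ideal.add_mem _ (xvar_mem i) (hV i)
  | inr k => exact mem_ordIdeal_zero

theorem resMon_shift_mem (hV : ∀ i, V i ∈ ordIdeal xw d) (k : Fin p) :
    resMon R k (xvar + V) - resMon R k xvar ∈ ordIdeal xw d :=
  resMon_sub_mem (fun i => by simpa using hV i) k

theorem constantCoeff_fib (hV : ∀ i, V i ∈ ordIdeal xw 1) (s : Fin n ⊕ Fin p) :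
    MvPowerSeries.constantCoeff (fib R V s) = 0 := by
  cases s with
  | inl i => exact constantCoeff_eq_zero_of_mem one_pos (fib_mem hV (Sum.inl i))
  | inr k =>
    rw [fib, Sum.elim_inr, map_add, constantCoeff_eq_zero_of_mem one_pos (resMon_shift_mem hV k)]
    simp

theorem hasSubst_fib (hV : ∀ i, V i ∈ ordIdeal xw 1) : MvPowerSeries.HasSubst (fib R V) :=
  MvPowerSeries.hasSubst_of_constantCoeff_zero (constantCoeff_fib hV)

theorem fib_sub_mem (h : ∀ i, V i - V' i ∈ ordIdeal xw d) (s : Fin n ⊕ Fin p) :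
    fib R V s - fib R V' s ∈ ordIdeal xw d := by
  cases s with
  | inl i => simpa [fib] using h i
  | inr k =>
    have := resMon_sub_mem (R := R) (y := xvar + V) (y' := xvar + V') (d := d)
      (fun i => by simpa using h i) k
    simpa [fib] using this

/-- The contraction behind `exists_fib_inverse`. The `x`-components of the substitution already have
order one, so agreement of `V` and `V'` up to order `d + 1` is a relative gain of `d` only. For `f`
of order `N = 2` the result agrees up to order `d + 2`, which is one better than before. -/
theorem subst_fib_sub_mem (hV : ∀ i, V i ∈ ordIdeal xw 1) (hV' : ∀ i, V' i ∈ ordIdeal xw 1)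
    (h : ∀ i, V i - V' i ∈ ordIdeal xw (d + 1)) {f : FS n p} {N : ℕ} (hf : f ∈ ordIdeal xw N) :
    MvPowerSeries.subst (fib R V) f - MvPowerSeries.subst (fib R V') f ∈ ordIdeal xw (d + N) :=
  subst_sub_mem (constantCoeff_fib hV) (constantCoeff_fib hV') (fib_mem hV) (fib_mem hV')
    (fun s => ordIdeal_anti (by cases s <;> simp [xw]) (fib_sub_mem h s)) hf

/-- In the unit ball of the norm, a monomial is Lipschitz with constant its degree, by telescoping
over its factors. This bounds the displacement of `u` by the displacement of `x`. -/
theorem wnorm_resMon_sub_le {w : Fin n ⊕ Fin p → ℝ≥0∞} {y y' : Fin n → FS n p} {ε : ℝ≥0∞}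
    (h : ∀ i, wnorm w (y i) ≤ 1) (h' : ∀ i, wnorm w (y' i) ≤ 1)
    (hd : ∀ i, wnorm w (y i - y' i) ≤ ε) (k : Fin p) :
    wnorm w (resMon R k y - resMon R k y') ≤ (R k).degree * ε := by
  have step : ∀ {A A' B B' : FS n p} {i j : ℕ}, wnorm w A ≤ 1 → wnorm w B' ≤ 1 →
      wnorm w (A - A') ≤ i * ε → wnorm w (B - B') ≤ j * ε →
      wnorm w (A * B - A' * B') ≤ ((i + j : ℕ) : ℝ≥0∞) * ε := by
    intro A A' B B' i j hA hB' hAA hBB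
    have : A * B - A' * B' = A * (B - B') + (A - A') * B' := by ring
    rw [this]
    refine (gnorm_add_le isSubmul_enorm _ _).trans ?_
    calc _ ≤ wnorm w A * wnorm w (B - B') + wnorm w (A - A') * wnorm w B' :=
          add_le_add (gnorm_mul_le isSubmul_enorm _ _) (gnorm_mul_le isSubmul_enorm _ _)
      _ ≤ 1 * (j * ε) + i * ε * 1 := by gcongr
      _ = _ := by push_cast; ring
  have hpow : ∀ (i : Fin n) (j : ℕ), wnorm w (y i ^ j - y' i ^ j) ≤ (j : ℝ≥0∞) * ε := fun i j => by
    induction j with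
    | zero => simp [wnorm, gnorm_zero isSubmul_enorm]
    | succ j ih =>
      rw [pow_succ, pow_succ]
      exact step ((wnorm_pow_le _ _).trans (pow_le_one₀ zero_le (h i))) (h' i) ih
        (by simpa using hd i)
  have hprod : ∀ t : Finset (Fin n), wnorm w (∏ i ∈ t, y i ^ R k i - ∏ i ∈ t, y' i ^ R k i) ≤
      ((∑ i ∈ t, R k i : ℕ) : ℝ≥0∞) * ε := fun t => by
    induction t using Finset.induction_on with
    | empty => simp [wnorm, gnorm_zero isSubmul_enorm]
    | insert s t hs ih =>
      rw [Finset.prod_insert hs, Finset.prod_insert hs, Finset.sum_insert hs]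
      exact step ((wnorm_pow_le _ _).trans (pow_le_one₀ zero_le (h s)))
        ((wnorm_prod_le _ _).trans (Finset.prod_le_one' fun i _ =>
          (wnorm_pow_le _ _).trans (pow_le_one₀ zero_le (h' i)))) (hpow s _) ih
  rw [Finsupp.degree_eq_sum]
  exact hprod Finset.univ

theorem wnorm_fib_le {w W : Fin n ⊕ Fin p → ℝ≥0∞} {ε : ℝ≥0∞} (hV : ∀ i, wnorm w (V i) ≤ ε)
    (hx : ∀ i, w (Sum.inl i) + ε ≤ W (Sum.inl i)) (hW : ∀ i, W (Sum.inl i) ≤ 1)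
    (hu : ∀ k, w (Sum.inr k) + (R k).degree * ε ≤ W (Sum.inr k)) (s : Fin n ⊕ Fin p) :
    wnorm w (fib R V s) ≤ W s := by
  have hxV : ∀ i, wnorm w (xvar i + V i) ≤ W (Sum.inl i) := fun i => by
    refine (gnorm_add_le isSubmul_enorm _ _).trans (le_trans (add_le_add ?_ (hV i)) (hx i))
    exact (wnorm_X (Sum.inl i)).le
  cases s with
  | inl i => exact hxV i
  | inr k =>
    refine (gnorm_add_le isSubmul_enorm _ _).trans (le_trans (add_le_add ?_ ?_) (hu k))
    · exact (wnorm_X (Sum.inr k)).le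
    · refine wnorm_resMon_sub_le (fun i => (hxV i).trans (hW i)) (fun i => ?_)
        (fun i => by simpa using hV i) k
      exact (wnorm_X (Sum.inl i)).le.trans (le_self_add.trans ((hx i).trans (hW i)))

/-- The fixed point `V = -U ∘ (x + V, v + π(x + V) - π(x))`, and an estimate of its norm. -/
theorem exists_fib_inverse {w W : Fin n ⊕ Fin p → ℝ≥0∞} {ε : ℝ≥0∞}
    (hU : ∀ i, U i ∈ ordIdeal xw 2) (hUε : ∀ i, wnorm W (U i) ≤ ε)
    (hx : ∀ i, w (Sum.inl i) + ε ≤ W (Sum.inl i)) (hW : ∀ i, W (Sum.inl i) ≤ 1)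
    (hu : ∀ k, w (Sum.inr k) + (R k).degree * ε ≤ W (Sum.inr k)) :
    ∃ V : Fin n → FS n p, (∀ i, V i ∈ ordIdeal xw 1) ∧ (∀ i, wnorm w (V i) ≤ ε) ∧
      ∀ i, V i = -MvPowerSeries.subst (fib R V) (U i) := by
  -- Picard iteration from `0`. The iterates converge in the `x`-adic sense by the contraction on
  -- orders, while the norm bound `ε` is merely preserved; no contraction in norm is needed.
  let T : (Fin n → FS n p) → Fin n → FS n p := fun V i => -MvPowerSeries.subst (fib R V) (U i)
  let S : ℕ → Fin n → FS n p := fun j => T^[j] 0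
  have hS : ∀ j, S (j + 1) = T (S j) := fun j => Function.iterate_succ_apply' T j 0
  have hT1 : ∀ V : Fin n → FS n p, (∀ i, V i ∈ ordIdeal xw 1) → ∀ i, T V i ∈ ordIdeal xw 1 :=
    fun V hV i => Ideal.neg_mem_iff _ |>.2 (ordIdeal_anti one_le_two
      (subst_mem_ordIdeal (hasSubst_fib hV) (fib_mem hV) (hU i)))
  have hS1 : ∀ j i, S j i ∈ ordIdeal xw 1 := fun j => by
    induction j with
    | zero => exact fun i => Ideal.zero_mem _
    | succ j ih => rw [hS]; exact hT1 _ ih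
  have hTd : ∀ {V V' : Fin n → FS n p} {d : ℕ}, (∀ i, V i ∈ ordIdeal xw 1) →
      (∀ i, V' i ∈ ordIdeal xw 1) → (∀ i, V i - V' i ∈ ordIdeal xw (d + 1)) →
      ∀ i, T V i - T V' i ∈ ordIdeal xw (d + 2) := by
    intro V V' d hV hV' h i
    have := subst_fib_sub_mem (R := R) hV hV' h (hU i)
    rw [show T V i - T V' i = -(MvPowerSeries.subst (fib R V) (U i) -
      MvPowerSeries.subst (fib R V') (U i)) by simp only [T]; ring]
    exact (Ideal.neg_mem_iff _).2 this
  have hSd : ∀ j i, S (j + 1) i - S j i ∈ ordIdeal xw (j + 1) := fun j => by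
    induction j with
    | zero => intro i; simpa [S] using hS1 1 i
    | succ j ih =>
      intro i
      have := hTd (hS1 (j + 1)) (hS1 j) ih i
      rwa [← hS, ← hS] at this
  have hSdd : ∀ j j' i, j ≤ j' → S j' i - S j i ∈ ordIdeal xw (j + 1) := by
    intro j j' i hj
    induction j', hj using Nat.le_induction with
    | base => simp
    | succ j' hj ih =>
      rw [← sub_add_sub_cancel _ (S j' i)]
      exact Ideal.add_mem _ (ordIdeal_anti (by omega) (hSd j' i)) ih
  have hSε : ∀ j i, wnorm w (S j i) ≤ ε := fun j => by
    induction j with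
    | zero => intro i; simp [S, wnorm, gnorm_zero isSubmul_enorm]
    | succ j ih =>
      intro i
      rw [hS]
      simp only [T]
      rw [wnorm, gnorm_neg isSubmul_enorm]
      refine (wnorm_subst_le (hasSubst_fib (hS1 j)) _ _).trans ((gnorm_mono ?_ _).trans (hUε i))
      exact wnorm_fib_le ih hx hW hu
  -- The coefficient of `γ` no longer changes from the iterate whose index is the `x`-degree of `γ`
  -- onwards.
  let V : Fin n → FS n p := fun i γ => MvPowerSeries.coeff γ (S (wdeg xw γ) i)
  have hVcoeff : ∀ i γ, MvPowerSeries.coeff γ (V i) = MvPowerSeries.coeff γ (S (wdeg xw γ) i) :=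
    fun _ _ => rfl
  have hVS : ∀ j i, V i - S j i ∈ ordIdeal xw (j + 1) := by
    intro j i γ hγ
    have := hSdd (wdeg xw γ) j i (by omega) γ (by omega)
    rw [map_sub, sub_eq_zero] at this
    rw [map_sub, hVcoeff, this, sub_self]
  have hV1 : ∀ i, V i ∈ ordIdeal xw 1 := fun i => by
    have := Ideal.add_mem _ (hVS 0 i) (hS1 0 i)
    simpa using this
  refine ⟨V, hV1, fun i => ?_, fun i => ?_⟩
  -- A finite partial sum of the norm of `V` involves finitely many coefficients, all of which are
  -- those of a single iterate; hence the bound `ε` passes to the limit.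
  · rw [wnorm, gnorm, ENNReal.tsum_eq_iSup_sum]
    refine iSup_le fun F => ?_
    set j := F.sup (wdeg xw) with hj
    calc _ = ∑ γ ∈ F, ‖MvPowerSeries.coeff γ (S j i)‖ₑ * wmon w γ := by
          refine Finset.sum_congr rfl fun γ hγ => ?_
          have := hVS j i γ (Nat.lt_succ_of_le (Finset.le_sup hγ))
          rw [map_sub, sub_eq_zero] at this
          rw [this]
      _ ≤ wnorm w (S j i) := ENNReal.sum_le_tsum _
      _ ≤ ε := hSε j i
  · change V i = T V i
    ext γ
    have h1 := hVS (wdeg xw γ + 1) i γ (by omega)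
    have h2 := hTd hV1 (hS1 _) (hVS (wdeg xw γ)) i γ (by omega)
    rw [← hS] at h2
    rw [map_sub, sub_eq_zero] at h1 h2
    rw [h1, h2]

theorem subst_fib_xvar (hV : ∀ i, V i ∈ ordIdeal xw 1) (i : Fin n) :
    MvPowerSeries.subst (fib R V) (xvar i : FS n p) = xvar i + V i :=
  MvPowerSeries.subst_X (hasSubst_fib hV) (Sum.inl i)

theorem subst_fib_resMon (hV : ∀ i, V i ∈ ordIdeal xw 1) (k : Fin p) (y : Fin n → FS n p) :
    MvPowerSeries.subst (fib R V) (resMon R k y) =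
      resMon R k fun i => MvPowerSeries.subst (fib R V) (y i) := by
  simp only [resMon, ← MvPowerSeries.substAlgHom_apply (hasSubst_fib hV), map_prod, map_pow]

/-- In the `x`-components the fixed point equation gives `x + V + U ∘ Ψ = x`. In the `u`-components
the increments `π(x + V) - π(x)` and `(π(x + U) - π(x)) ∘ Ψ = π(x) - π(x + V)` cancel. -/
theorem subst_fib_fib (hU : ∀ i, U i ∈ ordIdeal xw 1) (hV : ∀ i, V i ∈ ordIdeal xw 1)
    (hVU : ∀ i, V i = -MvPowerSeries.subst (fib R V) (U i)) (f : FS n p) :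
    MvPowerSeries.subst (fib R V) (MvPowerSeries.subst (fib R U) f) = f := by
  have hs := hasSubst_fib (R := R) hV
  rw [MvPowerSeries.subst_comp_subst_apply (hasSubst_fib hU) hs]
  have hxU : ∀ i, MvPowerSeries.subst (fib R V) (xvar i + U i) = xvar i := fun i => by
    rw [MvPowerSeries.subst_add hs, subst_fib_xvar hV]
    nth_rewrite 1 [hVU i]
    ring
  have : (fun s => MvPowerSeries.subst (fib R V) (fib R U s)) = MvPowerSeries.X := by
    funext s
    cases s with
    | inl i => exact hxU i
    | inr k =>
      rw [fib_inr, MvPowerSeries.subst_add hs, MvPowerSeries.subst_sub hs,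
        subst_fib_resMon hV, subst_fib_resMon hV, MvPowerSeries.subst_X hs]
      have h1 : (fun i => MvPowerSeries.subst (fib R V) ((xvar + U : Fin n → FS n p) i)) = xvar :=
        funext hxU
      have h2 : (fun i => MvPowerSeries.subst (fib R V) (xvar i)) = xvar + V :=
        funext fun i => subst_fib_xvar hV i
      rw [h1, h2, fib_inr]
      ring
  rw [this, MvPowerSeries.subst_self]
  rfl

/-! ### The push-forward of a fibered field as a formal series -/

/-- The series of `Dπ(x) Y`. -/
def dpi (R : Fin p → Fin n →₀ ℕ) (Y : Fin n → FS n p) (k : Fin p) : FS n p :=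
  ∑ s, MvPowerSeries.pderiv ℂ (Sum.inl s) (resMon R k xvar) * Y s

/-- The series of the first component of `DΦ̃ · (X, Dπ X)`, where `Φ̃` is the fibered map of
`x + U`. -/
def pushSeries (R : Fin p → Fin n →₀ ℕ) (U X : Fin n → FS n p) (i : Fin n) : FS n p :=
  X i + ∑ s, MvPowerSeries.pderiv ℂ (Sum.inl s) (U i) * X s +
    ∑ k, MvPowerSeries.pderiv ℂ (Sum.inr k) (U i) * dpi R X k

theorem pderiv_inr_resMon (k k' : Fin p) :
    MvPowerSeries.pderiv ℂ (Sum.inr k') (resMon R k xvar : FS n p) = 0 := by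
  have : ∀ t : Finset (Fin n), MvPowerSeries.pderiv ℂ (Sum.inr k')
      (∏ i ∈ t, (xvar i : FS n p) ^ R k i) = 0 := fun t => by
    induction t using Finset.induction_on with
    | empty => simp
    | insert s t hs ih =>
      rw [Finset.prod_insert hs, Derivation.leibniz, ih, MvPowerSeries.pderiv_pow, xvar,
        MvPowerSeries.pderiv_X_of_ne (by simp), mul_zero, smul_zero, smul_zero, add_zero]
  exact this Finset.univ

theorem fib_eq (U : Fin n → FS n p) : fib R U = fun s => MvPowerSeries.X s +
    Sum.elim U (fun k => resMon R k (xvar + U) - resMon R k xvar) s := by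
  funext s
  cases s <;> rfl

theorem dpi_mem {Y : Fin n → FS n p} (hY : ∀ i, Y i ∈ ordIdeal xw d) (k : Fin p) :
    dpi R Y k ∈ ordIdeal xw d :=
  Ideal.sum_mem _ fun s _ => Ideal.mul_mem_left _ _ (hY s)

theorem fib_taylor (hm : 1 ≤ m) (hU : ∀ i, U i ∈ ordIdeal xw m) (f : FS n p) :
    MvPowerSeries.subst (fib R U) f - f - (∑ s, U s * MvPowerSeries.pderiv ℂ (Sum.inl s) f +
      ∑ k, (resMon R k (xvar + U) - resMon R k xvar) * MvPowerSeries.pderiv ℂ (Sum.inr k) f) ∈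
      ordIdeal xw (m + m) := by
  have hh : ∀ s, Sum.elim U (fun k => resMon R k (xvar + U) - resMon R k xvar) s ∈
      ordIdeal (xw (n := n) (p := p)) m := by
    rintro (i | k)
    · exact hU i
    · exact resMon_shift_mem hU k
  have := subst_taylor_mem (fun s => constantCoeff_eq_zero_of_mem hm (hh s)) hh f
  rw [← fib_eq, Fintype.sum_sum_type] at this
  exact this

/-- Comparing `DΦ · X` with `(NF + B₀) ∘ Φ` avoids the inverse map. Expand the second to first
order: the terms linear in `U` combine into the cohomological equation, and the rest is at least
quadratic, apart from `Brest`, which has order `2m + 1` by hypothesis. -/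
theorem pushSeries_sub_mem (hm : 1 ≤ m) {NF Rem B0 Brest : Fin n → FS n p}
    (hU : ∀ i, U i ∈ ordIdeal xw (m + 1))
    (hRem : ∀ i, Rem i ∈ ordIdeal xw (m + 1)) (hB0 : ∀ i, B0 i ∈ ordIdeal xw (m + 1))
    (hBrest : ∀ i, Brest i ∈ ordIdeal xw (2 * m + 1)) (hπ : ∀ k, dpi R NF k = 0)
    (hcoh : ∀ i, ∑ s, U s * MvPowerSeries.pderiv ℂ (Sum.inl s) (NF i) -
      ∑ s, MvPowerSeries.pderiv ℂ (Sum.inl s) (U i) * NF s +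
      ∑ k, dpi R U k * MvPowerSeries.pderiv ℂ (Sum.inr k) (NF i) = Rem i - B0 i - Brest i)
    (i : Fin n) :
    pushSeries R U (NF + Rem) i - MvPowerSeries.subst (fib R U) (NF i + B0 i) ∈
      ordIdeal xw (2 * m + 1) := by
  set δ : Fin p → FS n p := fun k => resMon R k (xvar + U) - resMon R k xvar with hδ
  have hδm : ∀ k, δ k ∈ ordIdeal xw (m + 1) := fun k => resMon_shift_mem hU k
  have hle : 2 * m + 1 ≤ (m + 1) + (m + 1) := by omega
  have hU1 : ∀ i, U i ∈ ordIdeal xw 1 := fun i => ordIdeal_anti (by omega) (hU i)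
  -- The Taylor formula for `π` itself: its actual increment `δ` and the linearized increment `Dπ U`
  -- differ by the square of `U`.
  have hπT : ∀ k, δ k - dpi R U k ∈ ordIdeal xw (2 * m + 1) := fun k => by
    have := ordIdeal_anti hle (fib_taylor (R := R) (by omega) hU (resMon R k xvar))
    rw [subst_fib_resMon hU1] at this
    have h1 : (fun i => MvPowerSeries.subst (fib R U) (xvar i)) = xvar + U :=
      funext fun i => subst_fib_xvar hU1 i
    rw [h1] at this
    simp only [pderiv_inr_resMon, mul_zero, Finset.sum_const_zero, add_zero] at this
    rw [dpi]
    simpa only [mul_comm] using this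
  have hT := ordIdeal_anti hle (fib_taylor (R := R) (by omega) hU (NF i + B0 i))
  simp only [map_add, mul_add, Finset.sum_add_distrib] at hT
  -- Here `Dπ · NF = 0` is essential: only `Rem` moves `u`, so the `u`-component of the field has
  -- order `m + 1`.
  have hdpi : ∀ k, dpi R (NF + Rem) k = dpi R Rem k := fun k => by
    rw [← zero_add (dpi R Rem k), ← hπ k]
    simp only [dpi, Pi.add_apply, mul_add, Finset.sum_add_distrib]
  -- An `x`-derivative costs one order, so this product has order exactly `m + (m + 1)`. In the
  -- terms with `u`-derivatives nothing is lost and there is one order to spare.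
  have e1 : ∑ s, MvPowerSeries.pderiv ℂ (Sum.inl s) (U i) * Rem s ∈ ordIdeal xw (2 * m + 1) :=
    Ideal.sum_mem _ fun s _ => ordIdeal_anti (by omega)
      (mul_mem_ordIdeal (pderiv_mem_ordIdeal (d' := m) le_rfl (hU i)) (hRem s))
  have e2 : ∑ k, MvPowerSeries.pderiv ℂ (Sum.inr k) (U i) * dpi R Rem k ∈
      ordIdeal xw (2 * m + 1) :=
    Ideal.sum_mem _ fun k _ => ordIdeal_anti hle
      (mul_mem_ordIdeal (pderiv_mem_ordIdeal (d' := m + 1) le_rfl (hU i)) (dpi_mem hRem k))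
  have e3 : ∑ s, U s * MvPowerSeries.pderiv ℂ (Sum.inl s) (B0 i) ∈ ordIdeal xw (2 * m + 1) :=
    Ideal.sum_mem _ fun s _ => ordIdeal_anti (by omega)
      (mul_mem_ordIdeal (hU s) (pderiv_mem_ordIdeal (d' := m) le_rfl (hB0 i)))
  have e4 : ∑ k, δ k * MvPowerSeries.pderiv ℂ (Sum.inr k) (B0 i) ∈ ordIdeal xw (2 * m + 1) :=
    Ideal.sum_mem _ fun k _ => ordIdeal_anti hle
      (mul_mem_ordIdeal (hδm k) (pderiv_mem_ordIdeal (d' := m + 1) le_rfl (hB0 i)))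
  have e5 : ∑ k, (δ k - dpi R U k) * MvPowerSeries.pderiv ℂ (Sum.inr k) (NF i) ∈
      ordIdeal xw (2 * m + 1) :=
    Ideal.sum_mem _ fun k _ => Ideal.mul_mem_right _ _ (hπT k)
  simp only [sub_mul, Finset.sum_sub_distrib] at e5
  have htotal := Ideal.sub_mem _ (Ideal.sub_mem _ (Ideal.sub_mem _
    (Ideal.add_mem _ (Ideal.add_mem _ (hBrest i) e1) e2) e3) e4) (Ideal.add_mem _ hT e5)
  have hc := hcoh i
  rw [pushSeries]
  simp only [hdpi, Pi.add_apply, mul_add, Finset.sum_add_distrib]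
  convert htotal using 1
  linear_combination -hc

/-- The remainder after the push-forward has order at least `2m + 1`. -/
theorem subst_pushSeries_sub_mem (hm : 1 ≤ m) {NF Rem B0 Brest : Fin n → FS n p}
    (hU : ∀ i, U i ∈ ordIdeal xw (m + 1))
    (hRem : ∀ i, Rem i ∈ ordIdeal xw (m + 1)) (hB0 : ∀ i, B0 i ∈ ordIdeal xw (m + 1))
    (hBrest : ∀ i, Brest i ∈ ordIdeal xw (2 * m + 1)) (hπ : ∀ k, dpi R NF k = 0)
    (hcoh : ∀ i, ∑ s, U s * MvPowerSeries.pderiv ℂ (Sum.inl s) (NF i) -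
      ∑ s, MvPowerSeries.pderiv ℂ (Sum.inl s) (U i) * NF s +
      ∑ k, dpi R U k * MvPowerSeries.pderiv ℂ (Sum.inr k) (NF i) = Rem i - B0 i - Brest i)
    (hV : ∀ i, V i ∈ ordIdeal xw 1) (hVU : ∀ i, V i = -MvPowerSeries.subst (fib R V) (U i))
    (i : Fin n) :
    MvPowerSeries.subst (fib R V) (pushSeries R U (NF + Rem) i) - (NF i + B0 i) ∈
      ordIdeal xw (2 * m + 1) := by
  have h1 := pushSeries_sub_mem hm hU hRem hB0 hBrest hπ hcoh i
  have h2 := subst_mem_ordIdeal (hasSubst_fib (R := R) hV) (fib_mem hV) h1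
  rwa [MvPowerSeries.subst_sub (hasSubst_fib hV),
    subst_fib_fib (fun i => ordIdeal_anti (by omega) (hU i)) hV hVU] at h2

/-- The Schwarz lemma for the `ℓ¹` norm: each surviving monomial has `x`-degree at least `d`. The
bounds of the displacement and of the new remainder owe their smallness to this gain. -/
theorem wnorm_le_of_mem_ordIdeal {w w' : Fin n ⊕ Fin p → ℝ≥0∞} {θ : ℝ≥0∞}
    (hx : ∀ i, w (Sum.inl i) ≤ θ * w' (Sum.inl i)) (hu : ∀ k, w (Sum.inr k) ≤ w' (Sum.inr k))
    (hθ : θ ≤ 1) {f : FS n p} (hf : f ∈ ordIdeal xw d) : wnorm w f ≤ θ ^ d * wnorm w' f := by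
  rw [wnorm, wnorm, gnorm, gnorm, ← ENNReal.tsum_mul_left]
  refine ENNReal.tsum_le_tsum fun γ => ?_
  rcases Nat.lt_or_ge (wdeg xw γ) d with h | h
  · simp [hf γ h]
  · rw [mul_left_comm]
    refine mul_le_mul_right ?_ _
    calc wmon w γ ≤ θ ^ wdeg xw γ * wmon w' γ := by
          rw [wmon, wmon, wdeg, ← Finset.prod_pow_eq_pow_sum, ← Finset.prod_mul_distrib]
          refine Finset.prod_le_prod' fun s _ => ?_
          rw [pow_mul, ← mul_pow]
          refine pow_le_pow_left' ?_ _
          cases s with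
          | inl i => simpa [xw] using hx i
          | inr k => simpa [xw] using hu k
      _ ≤ θ ^ d * wmon w' γ := mul_le_mul_left (pow_le_pow_of_le_one zero_le hθ h) _

end Fibered

/-! ### Taylor expansions on polydiscs -/

section Taylor

theorem hasSum_geometric_fin : ∀ {p : ℕ} (q : Fin p → ℂ), (∀ i, ‖q i‖ < 1) →
    Summable (fun β : Fin p → ℕ => ‖∏ i, q i ^ β i‖) ∧
      HasSum (fun β : Fin p → ℕ => ∏ i, q i ^ β i) (∏ i, (1 - q i)⁻¹) := by
  intro p
  induction p with
  | zero =>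
    intro q _
    constructor
    · exact (hasSum_unique fun β : Fin 0 → ℕ => ‖∏ i, q i ^ β i‖).summable
    · simpa only [Finset.univ_eq_empty, Finset.prod_empty] using
        hasSum_unique (fun β : Fin 0 → ℕ => ∏ i, q i ^ β i)
  | succ p ih =>
    intro q hq
    obtain ⟨h1, h2⟩ := ih (fun i => q i.succ) fun i => hq _
    have g1 : Summable fun j : ℕ => ‖q 0 ^ j‖ := by
      simpa using summable_geometric_of_lt_one (norm_nonneg _) (hq 0)
    have g2 := hasSum_geometric_of_norm_lt_one (hq 0)
    have e : ∀ x : ℕ × (Fin p → ℕ), (∏ i, q i ^ (Fin.consEquiv (fun _ => ℕ) x) i) =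
        q 0 ^ x.1 * ∏ i : Fin p, q i.succ ^ x.2 i := fun x => by
      simp [Fin.prod_univ_succ, Fin.consEquiv]
    constructor
    · rw [← (Fin.consEquiv fun _ => ℕ).summable_iff]
      simp only [Function.comp_def, e, norm_mul]
      exact g1.mul_of_nonneg h1 (fun _ => norm_nonneg _) fun _ => norm_nonneg _
    · rw [← (Fin.consEquiv fun _ => ℕ).hasSum_iff, Fin.prod_univ_succ]
      simp only [Function.comp_def, e]
      exact HasSum.mul (f := fun j : ℕ => q 0 ^ j)
        (g := fun β : Fin p → ℕ => ∏ i, q i.succ ^ β i) g2 h2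
        (summable_mul_of_summable_norm (f := fun j : ℕ => q 0 ^ j)
          (g := fun β : Fin p → ℕ => ∏ i, q i.succ ^ β i) g1 h1)

theorem hasSum_wmon {p : ℕ} {q : Fin p → ℂ} (hq : ∀ i, ‖q i‖ < 1) :
    Summable (fun β : Fin p →₀ ℕ => ‖wmon q β‖) ∧
      HasSum (fun β : Fin p →₀ ℕ => wmon q β) (∏ i, (1 - q i)⁻¹) := by
  obtain ⟨h1, h2⟩ := hasSum_geometric_fin q hq
  constructor
  · rw [← (Finsupp.equivFunOnFinite (α := Fin p) (M := ℕ)).symm.summable_iff]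
    simpa only [Function.comp_def, wmon, Finsupp.equivFunOnFinite_symm_apply_apply] using h1
  · rw [← (Finsupp.equivFunOnFinite (α := Fin p) (M := ℕ)).symm.hasSum_iff]
    simpa only [Function.comp_def, wmon, Finsupp.equivFunOnFinite_symm_apply_apply] using h2

theorem torusMap_norm {p : ℕ} {s : ℝ} (hs : 0 ≤ s) (θ : Fin p → ℝ) (i : Fin p) :
    ‖torusMap 0 (fun _ => s) θ i‖ = s := by
  simp [torusMap, Complex.norm_exp_ofReal_mul_I, abs_of_nonneg hs]

theorem continuous_torusMap {p : ℕ} (s : ℝ) :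
    Continuous (torusMap (0 : Fin p → ℂ) fun _ => s) := by
  unfold torusMap; fun_prop

theorem isOpen_polydisc {d : ℕ} (c : Fin d → ℂ) (r : ℝ) : IsOpen (polydisc c r) := by
  have : polydisc c r = ⋂ i, {z : Fin d → ℂ | ‖z i - c i‖ < r} := by ext; simp [polydisc]
  rw [this]
  exact isOpen_iInter_of_finite fun i => isOpen_lt (by fun_prop) continuous_const

theorem continuous_comp_torusMap {p : ℕ} {f : (Fin p → ℂ) → ℂ} {s t : ℝ} (hs : 0 ≤ s) (hst : s < t)
    (hf : DifferentiableOn ℂ f (polydisc 0 t)) :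
    Continuous fun θ => f (torusMap 0 (fun _ => s) θ) :=
  hf.continuousOn.comp_continuous (continuous_torusMap s) fun θ i => by
    simpa [torusMap_norm hs] using hst

theorem torusIntegrable_of_continuous {p : ℕ} {f : (Fin p → ℂ) → ℂ} {s : ℝ}
    (hf : Continuous fun θ => f (torusMap 0 (fun _ => s) θ)) :
    TorusIntegrable f 0 fun _ => s :=
  hf.continuousOn.integrableOn_compact isCompact_Icc

theorem torus_sub_ne_zero {p : ℕ} {s : ℝ} (hs : 0 ≤ s) {v : Fin p → ℂ} (hv : ∀ i, ‖v i‖ < s)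
    (θ : Fin p → ℝ) (i : Fin p) : torusMap 0 (fun _ => s) θ i - v i ≠ 0 := by
  intro h
  rw [sub_eq_zero] at h
  have := hv i
  rw [← h, torusMap_norm hs] at this
  exact lt_irrefl _ this

theorem continuous_cauchyKernel {p : ℕ} {f : (Fin p → ℂ) → ℂ} {s t : ℝ} (hs : 0 ≤ s) (hst : s < t)
    (hf : DifferentiableOn ℂ f (polydisc 0 t)) {v : Fin p → ℂ} (hv : ∀ i, ‖v i‖ < s) :
    Continuous fun θ => (∏ i, (torusMap 0 (fun _ => s) θ i - v i)⁻¹) *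
      f (torusMap 0 (fun _ => s) θ) := by
  refine Continuous.mul (continuous_finsetProd _ fun i _ => ?_) (continuous_comp_torusMap hs hst hf)
  exact (((continuous_apply i).comp (continuous_torusMap s)).sub continuous_const).inv₀
    fun θ => torus_sub_ne_zero hs hv θ i

/-- Cauchy's integral formula on a polydisc. -/
theorem torusIntegral_cauchy {s t : ℝ} (hs : 0 < s) (hst : s < t) : ∀ {p : ℕ}
    {f : (Fin p → ℂ) → ℂ}, DifferentiableOn ℂ f (polydisc 0 t) → ∀ {v : Fin p → ℂ},
    (∀ i, ‖v i‖ < s) →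
    torusIntegral (fun ζ => (∏ i, (ζ i - v i)⁻¹) * f ζ) 0 (fun _ => s) =
      (2 * Real.pi * Complex.I) ^ p * f v := by
  intro p
  induction p with
  | zero =>
    intro f _ v _
    rw [torusIntegral_dim0, Subsingleton.elim v 0]
    simp
  | succ p ih =>
    intro f hf v hv
    rw [torusIntegral_succ (torusIntegrable_of_continuous
      (continuous_cauchyKernel hs.le hst hf hv))]
    have hcons : ∀ x : ℂ, ‖x‖ < t → ∀ y ∈ polydisc (0 : Fin p → ℂ) t,
        (Fin.cons x y : Fin (p + 1) → ℂ) ∈ polydisc 0 t := by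
      intro x hx y hy i
      refine Fin.cases ?_ (fun i => ?_) i
      · simpa using hx
      · simpa using hy i
    have hinner : ∀ x ∈ Metric.sphere (0 : ℂ) s,
        torusIntegral (fun y => (∏ i, ((Fin.cons x y : Fin (p + 1) → ℂ) i - v i)⁻¹) *
          f (Fin.cons x y)) ((0 : Fin (p + 1) → ℂ) ∘ Fin.succ) ((fun _ => s) ∘ Fin.succ) =
        (2 * Real.pi * Complex.I) ^ p * ((x - v 0)⁻¹ • f (Fin.cons x fun i => v i.succ)) := by
      intro x hx
      have hxs : ‖x‖ = s := by simpa using hx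
      have hfx : DifferentiableOn ℂ (fun y : Fin p → ℂ => f (Fin.cons x y)) (polydisc 0 t) := by
        refine hf.comp (Differentiable.differentiableOn ?_) (hcons x (by linarith))
        rw [differentiable_pi]
        refine fun i => Fin.cases ?_ (fun i => ?_) i
        · simp
        · simp only [Fin.cons_succ]; fun_prop
      have := ih hfx (v := fun i => v i.succ) fun i => hv _
      have h2 := congrArg (fun c => (x - v 0)⁻¹ * c) this
      simp only [← torusIntegral_const_mul] at h2
      have e : ∀ y : Fin p → ℂ, (∏ i, ((Fin.cons x y : Fin (p + 1) → ℂ) i - v i)⁻¹) *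
          f (Fin.cons x y) =
          (x - v 0)⁻¹ * ((∏ i, (y i - v i.succ)⁻¹) * f (Fin.cons x y)) := fun y => by
        simp only [Fin.prod_univ_succ, Fin.cons_zero, Fin.cons_succ, mul_assoc]
      simp only [e]
      rw [smul_eq_mul, mul_left_comm]
      exact h2
    have hv0 : v 0 ∈ Metric.ball (0 : ℂ) s := by simpa using hv 0
    have hdisc : DifferentiableOn ℂ (fun x : ℂ => f (Fin.cons x fun i => v i.succ))
        (Metric.closedBall 0 s) := by
      refine hf.comp (Differentiable.differentiableOn ?_) fun x hx => hcons x ?_ _ fun i => ?_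
      · rw [differentiable_pi]
        refine fun i => Fin.cases ?_ (fun i => ?_) i
        · simp only [Fin.cons_zero]; fun_prop
        · simp
      · have : ‖x‖ ≤ s := by simpa using hx
        linarith
      · simpa using (hv i.succ).trans hst
    have hc := hdisc.circleIntegral_sub_inv_smul hv0
    rw [Pi.zero_apply, circleIntegral.integral_congr hs.le hinner,
      circleIntegral.integral_const_mul, hc, smul_eq_mul, pow_succ]
    have hcv : f (Fin.cons (v 0) fun i => v i.succ) = f v :=
      congrArg f (Fin.cons_self_tail (α := fun _ => ℂ) v)
    rw [hcv]
    ring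

theorem hasSum_cauchyKernel {p : ℕ} {v ζ : Fin p → ℂ} (h : ∀ i, ‖v i‖ < ‖ζ i‖) :
    HasSum (fun β : Fin p →₀ ℕ => wmon v β * ∏ i, (ζ i)⁻¹ ^ (β i + 1)) (∏ i, (ζ i - v i)⁻¹) := by
  have h0 : ∀ i, ζ i ≠ 0 := fun i => norm_pos_iff.1 ((norm_nonneg _).trans_lt (h i))
  have hq : ∀ i, ‖v i / ζ i‖ < 1 := fun i => by
    rw [norm_div, div_lt_one (norm_pos_iff.2 (h0 i))]; exact h i
  have := (hasSum_wmon hq).2.mul_left (∏ i, (ζ i)⁻¹)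
  have e1 : ∀ β : Fin p →₀ ℕ, wmon v β * ∏ i, (ζ i)⁻¹ ^ (β i + 1) =
      (∏ i, (ζ i)⁻¹) * wmon (fun i => v i / ζ i) β := fun β => by
    rw [wmon, wmon, ← Finset.prod_mul_distrib, ← Finset.prod_mul_distrib]
    refine Finset.prod_congr rfl fun i _ => ?_
    rw [div_pow, pow_succ, inv_pow]
    ring
  have e2 : ∏ i, (ζ i - v i)⁻¹ = (∏ i, (ζ i)⁻¹) * ∏ i, (1 - v i / ζ i)⁻¹ := by
    rw [← Finset.prod_mul_distrib]
    refine Finset.prod_congr rfl fun i _ => ?_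
    rw [← mul_inv, mul_sub, mul_one, mul_div_cancel₀ _ (h0 i)]
  simp only [e1, e2]
  exact this

/-- Taylor expansion and Cauchy estimates on a polydisc. -/
theorem exists_taylor {p : ℕ} {s t : ℝ} (hs : 0 < s) (hst : s < t) {f : (Fin p → ℂ) → ℂ}
    (hf : DifferentiableOn ℂ f (polydisc 0 t)) :
    ∃ c : (Fin p →₀ ℕ) → ℂ,
      (∀ β, ‖c β‖ₑ * ENNReal.ofReal s ^ β.degree ≤ supNorm (polydisc 0 t) f) ∧
      ∀ v ∈ polydisc (0 : Fin p → ℂ) s, HasSum (fun β => c β * wmon v β) (f v) := by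
  set ζ : (Fin p → ℝ) → Fin p → ℂ := torusMap 0 fun _ => s with hζ
  have hζn : ∀ θ i, ‖ζ θ i‖ = s := torusMap_norm hs.le
  have hζ0 : ∀ θ i, ζ θ i ≠ 0 := fun θ i => by rw [← norm_pos_iff, hζn]; exact hs
  set A : ℂ := (2 * Real.pi * Complex.I) ^ p with hA
  have hA0 : A ≠ 0 := pow_ne_zero _ (by simp [Real.pi_ne_zero])
  -- The Taylor coefficients are Cauchy integrals over the torus of radius `s < t`. The estimate is
  -- immediate from this, and the expansion follows by integrating the geometric series of the
  -- Cauchy kernel term by term.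
  set c : (Fin p →₀ ℕ) → ℂ := fun β =>
    A⁻¹ * torusIntegral (fun z => (∏ i, (z i)⁻¹ ^ (β i + 1)) * f z) 0 fun _ => s with hc
  have hmem : ∀ θ, ζ θ ∈ polydisc (0 : Fin p → ℂ) t := fun θ i => by simpa [hζn] using hst
  have hnormprod : ∀ (β : Fin p →₀ ℕ) θ,
      ‖∏ i, (ζ θ i)⁻¹ ^ (β i + 1)‖ = (s ^ β.degree)⁻¹ * (s ^ p)⁻¹ := fun β θ => by
    rw [norm_prod, Finsupp.degree_eq_sum, ← Finset.prod_pow_eq_pow_sum]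
    simp [hζn, pow_succ, Finset.prod_mul_distrib, mul_comm]
  have hfc : Continuous fun θ => f (ζ θ) := continuous_comp_torusMap hs.le hst hf
  refine ⟨c, fun β => ?_, fun v hv => ?_⟩
  · by_cases htop : supNorm (polydisc 0 t) f = ⊤
    · rw [htop]; exact le_top
    set M := (supNorm (polydisc 0 t) f).toReal with hM
    have h1 := norm_torusIntegral_le_of_norm_le_const (c := (0 : Fin p → ℂ)) (R := fun _ => s)
      (f := fun z => (∏ i, (z i)⁻¹ ^ (β i + 1)) * f z) (C := (s ^ β.degree)⁻¹ * (s ^ p)⁻¹ * M)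
      fun θ => by
        change ‖(∏ i, (ζ θ i)⁻¹ ^ (β i + 1)) * f (ζ θ)‖ ≤ _
        rw [norm_mul, hnormprod]
        exact mul_le_mul_of_nonneg_left (norm_le_toReal_supNorm htop (hmem θ)) (by positivity)
    have h2 : ‖c β‖ * s ^ β.degree ≤ M := by
      rw [hc]
      simp only [norm_mul, norm_inv]
      have hAn : ‖A‖ = (2 * Real.pi) ^ p := by
        rw [hA, norm_pow]; simp [abs_of_pos Real.pi_pos]
      rw [hAn]
      have hpi : (0 : ℝ) < (2 * Real.pi) ^ p := by positivity
      calc ((2 * Real.pi) ^ p)⁻¹ * _ * s ^ β.degree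
          ≤ ((2 * Real.pi) ^ p)⁻¹ * (((2 * Real.pi) ^ p * ∏ _i : Fin p, |s|) *
            ((s ^ β.degree)⁻¹ * (s ^ p)⁻¹ * M)) * s ^ β.degree := by gcongr
        _ = M := by
          rw [Finset.prod_const, Finset.card_univ, Fintype.card_fin, abs_of_pos hs]
          field_simp
    rw [← ENNReal.ofReal_toReal htop, ← ofReal_norm, ← ENNReal.ofReal_pow hs.le,
      ← ENNReal.ofReal_mul (norm_nonneg _)]
    exact ENNReal.ofReal_le_ofReal h2
  · have hv' : ∀ i, ‖v i‖ < s := fun i => by simpa using hv i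
    have hq : ∀ i, ‖((‖v i‖ / s : ℝ) : ℂ)‖ < 1 := fun i => by
      rw [Complex.norm_real, Real.norm_of_nonneg (by positivity), div_lt_one hs]; exact hv' i
    obtain ⟨C, hC⟩ := isCompact_Icc.exists_bound_of_continuousOn
      (s := Set.Icc (0 : Fin p → ℝ) fun _ => 2 * Real.pi) hfc.continuousOn
    set J : (Fin p → ℝ) → ℂ := fun θ => ∏ i, (s * Complex.exp (θ i * Complex.I) * Complex.I : ℂ)
      with hJ
    have hJn : ∀ θ, ‖J θ‖ = s ^ p := fun θ => by
      rw [hJ, norm_prod]; simp [abs_of_pos hs, Complex.norm_exp_ofReal_mul_I]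
    have hJc : Continuous J := by rw [hJ]; fun_prop
    set F : (Fin p →₀ ℕ) → (Fin p → ℝ) → ℂ := fun β θ =>
      J θ * (wmon v β * ((∏ i, (ζ θ i)⁻¹ ^ (β i + 1)) * f (ζ θ))) with hF
    have hFc : ∀ β, Continuous (F β) := fun β => by
      refine hJc.mul (continuous_const.mul (Continuous.mul (continuous_finsetProd _ fun i _ => ?_) hfc))
      exact (((continuous_apply i).comp (continuous_torusMap s)).inv₀ fun θ => hζ0 θ i).pow _
    have hFn : ∀ β, ∀ θ ∈ Set.Icc (0 : Fin p → ℝ) fun _ => 2 * Real.pi,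
        ‖F β θ‖ ≤ C * ‖wmon (fun i => ((‖v i‖ / s : ℝ) : ℂ)) β‖ := fun β θ hθ => by
      have e : ‖wmon (fun i => ((‖v i‖ / s : ℝ) : ℂ)) β‖ = ‖wmon v β‖ * (s ^ β.degree)⁻¹ := by
        rw [wmon, wmon, norm_prod, norm_prod, Finsupp.degree_eq_sum, ← Finset.prod_pow_eq_pow_sum,
          ← Finset.prod_inv_distrib, ← Finset.prod_mul_distrib]
        refine Finset.prod_congr rfl fun i _ => ?_
        rw [norm_pow, norm_pow, Complex.norm_real, Real.norm_of_nonneg (by positivity),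
          div_eq_mul_inv, mul_pow, inv_pow]
      rw [e]
      simp only [hF, norm_mul, hJn, hnormprod]
      calc s ^ p * (‖wmon v β‖ * ((s ^ β.degree)⁻¹ * (s ^ p)⁻¹ * ‖f (ζ θ)‖))
          = ‖f (ζ θ)‖ * (‖wmon v β‖ * (s ^ β.degree)⁻¹) := by field_simp
        _ ≤ _ := mul_le_mul_of_nonneg_right (hC θ hθ) (by positivity)
    have hvol : MeasureTheory.volume (Set.Icc (0 : Fin p → ℝ) fun _ => 2 * Real.pi) < ⊤ :=
      isCompact_Icc.measure_lt_top
    -- The terms are dominated by `C ∏ (‖v_i‖ / s)^{β_i}`, a convergent geometric series, so sum and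
    -- integral may be exchanged.
    have hsum := MeasureTheory.hasSum_integral_of_summable_integral_norm
      (μ := MeasureTheory.volume.restrict (Set.Icc (0 : Fin p → ℝ) fun _ => 2 * Real.pi)) (F := F)
      (fun β => (hFc β).continuousOn.integrableOn_compact isCompact_Icc) (by
        refine Summable.of_nonneg_of_le (fun β => MeasureTheory.integral_nonneg fun _ => norm_nonneg _)
          (fun β => ?_) (((hasSum_wmon hq).1.mul_left C).mul_right
            (MeasureTheory.volume.real (Set.Icc (0 : Fin p → ℝ) fun _ => 2 * Real.pi)))
        have := MeasureTheory.norm_setIntegral_le_of_norm_le_const (f := fun θ => ‖F β θ‖) hvol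
          (C := C * ‖wmon (fun i => ((‖v i‖ / s : ℝ) : ℂ)) β‖) fun θ hθ => by
            rw [norm_norm]; exact hFn β θ hθ
        exact (Real.le_norm_self _).trans this)
    have htotal : ∫ θ in Set.Icc (0 : Fin p → ℝ) fun _ => 2 * Real.pi, ∑' β, F β θ =
        A * f v := by
      rw [← torusIntegral_cauchy hs hst hf hv', torusIntegral]
      refine MeasureTheory.setIntegral_congr_fun measurableSet_Icc fun θ _ => ?_
      have h1 := ((hasSum_cauchyKernel (v := v) (ζ := ζ θ) fun i => by
        rw [hζn]; exact hv' i).mul_right (f (ζ θ))).mul_left (J θ)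
      simp only [hF]
      rw [smul_eq_mul]
      refine Eq.trans ?_ h1.tsum_eq
      simp only [mul_assoc]
    rw [htotal] at hsum
    have h3 := hsum.mul_left A⁻¹
    rw [inv_mul_cancel_left₀ hA0] at h3
    have e3 : ∀ β, c β * wmon v β =
        A⁻¹ * ∫ θ in Set.Icc (0 : Fin p → ℝ) fun _ => 2 * Real.pi, F β θ := fun β => by
      rw [hc]
      simp only
      rw [mul_assoc, mul_comm (torusIntegral _ _ _), ← torusIntegral_const_mul]
      rfl
    simp only [e3]
    exact h3

end Taylor

/-! ### Series with holomorphic coefficients as power series in `x` and `v = u - b` -/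

section Conversion

variable {n p : ℕ}

/-- The exponent of `x^Q v^β`. -/
def pair (Q : Fin n →₀ ℕ) (β : Fin p →₀ ℕ) : Fin n ⊕ Fin p →₀ ℕ :=
  Finsupp.sumFinsuppEquivProdFinsupp.symm (Q, β)

@[simp] theorem pair_inl (Q : Fin n →₀ ℕ) (β : Fin p →₀ ℕ) (i : Fin n) :
    pair Q β (Sum.inl i) = Q i := by simp [pair]

@[simp] theorem pair_inr (Q : Fin n →₀ ℕ) (β : Fin p →₀ ℕ) (k : Fin p) :
    pair Q β (Sum.inr k) = β k := by simp [pair]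

theorem exists_eq_pair (γ : Fin n ⊕ Fin p →₀ ℕ) : ∃ Q β, γ = pair Q β :=
  ⟨(Finsupp.sumFinsuppEquivProdFinsupp γ).1, (Finsupp.sumFinsuppEquivProdFinsupp γ).2,
    (Finsupp.sumFinsuppEquivProdFinsupp.symm_apply_apply γ).symm⟩

theorem wmon_pair {M : Type*} [CommMonoid M] (w : Fin n ⊕ Fin p → M) (Q : Fin n →₀ ℕ)
    (β : Fin p →₀ ℕ) :
    wmon w (pair Q β) = wmon (fun i => w (Sum.inl i)) Q * wmon (fun k => w (Sum.inr k)) β := by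
  simp [wmon, Fintype.prod_sum_type]

theorem wdeg_xw_pair (Q : Fin n →₀ ℕ) (β : Fin p →₀ ℕ) : wdeg xw (pair Q β) = Q.degree := by
  simp [wdeg, xw, Fintype.sum_sum_type, Finsupp.degree_eq_sum]

/-- The polyradius `(ρ, …, ρ, t, …, t)`. -/
def rad (ρ t : ℝ) : Fin n ⊕ Fin p → ℝ≥0∞ :=
  Sum.elim (fun _ => ENNReal.ofReal ρ) fun _ => ENNReal.ofReal t

theorem wmon_rad (ρ t : ℝ) (Q : Fin n →₀ ℕ) (β : Fin p →₀ ℕ) :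
    wmon (rad ρ t) (pair Q β) = ENNReal.ofReal ρ ^ Q.degree * ENNReal.ofReal t ^ β.degree := by
  rw [wmon_pair]
  simp only [rad, Sum.elim_inl, Sum.elim_inr, wmon_const]

theorem rad_mono {ρ t ρ' t' : ℝ} (hρ : ρ ≤ ρ') (ht : t ≤ t') (s : Fin n ⊕ Fin p) :
    rad ρ t s ≤ rad ρ' t' s := by
  cases s
  · exact ENNReal.ofReal_le_ofReal hρ
  · exact ENNReal.ofReal_le_ofReal ht

theorem tsum_pair (g : (Fin n ⊕ Fin p →₀ ℕ) → ℝ≥0∞) :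
    ∑' γ, g γ = ∑' (Q : Fin n →₀ ℕ) (β : Fin p →₀ ℕ), g (pair Q β) := by
  rw [← Finsupp.sumFinsuppEquivProdFinsupp.symm.tsum_eq, ENNReal.tsum_prod']
  rfl

theorem wnorm_rad (ρ t : ℝ) (F : FS n p) : wnorm (rad ρ t) F =
    ∑' (Q : Fin n →₀ ℕ) (β : Fin p →₀ ℕ), ‖MvPowerSeries.coeff (pair Q β) F‖ₑ *
      (ENNReal.ofReal ρ ^ Q.degree * ENNReal.ofReal t ^ β.degree) := by
  rw [wnorm, gnorm, tsum_pair]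
  simp only [wmon_rad]

theorem serNorm_eq (U : Set (Fin p → ℂ)) (r : ℝ) (f : Ser n p) :
    serNorm U r f = gnorm (supNorm U) (fun _ => ENNReal.ofReal r) f := by
  rw [serNorm, gnorm]
  simp only [wmon_const]
  rfl

/-- The point `(x, u - b)`. -/
def pt (b : Fin p → ℂ) (z : (Fin n → ℂ) × (Fin p → ℂ)) : Fin n ⊕ Fin p → ℂ :=
  Sum.elim z.1 (z.2 - b)

theorem enorm_lt_ofReal {z : ℂ} {r : ℝ} : ‖z‖ₑ < ENNReal.ofReal r ↔ ‖z‖ < r := by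
  rw [← ofReal_norm, ENNReal.ofReal_lt_ofReal_iff_of_nonneg (norm_nonneg _)]

theorem pt_mem_openPoly {b : Fin p → ℂ} {z : (Fin n → ℂ) × (Fin p → ℂ)} {ρ t : ℝ} :
    pt b z ∈ openPoly (rad ρ t) ↔ z ∈ polydisc 0 ρ ×ˢ polydisc b t := by
  simp only [openPoly, Set.mem_ofPred_eq, Sum.forall, pt, rad, Sum.elim_inl, Sum.elim_inr,
    enorm_lt_ofReal, Set.mem_prod, polydisc, Pi.sub_apply, Pi.zero_apply, sub_zero]

theorem wmon_pt (b : Fin p → ℂ) (z : (Fin n → ℂ) × (Fin p → ℂ)) (Q : Fin n →₀ ℕ)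
    (β : Fin p →₀ ℕ) : wmon (pt b z) (pair Q β) = wmon z.1 Q * wmon (z.2 - b) β := by
  rw [wmon_pair]
  rfl

/-- `F` is the power series at `b` of the series `f`, whose coefficients are holomorphic on
`D(b, t)`. -/
structure IsRep (b : Fin p → ℂ) (s t : ℝ) (f : Ser n p) (F : FS n p) : Prop where
  bound : ∀ Q β, ‖MvPowerSeries.coeff (pair Q β) F‖ₑ * ENNReal.ofReal s ^ β.degree ≤
    supNorm (polydisc b t) (MvPowerSeries.coeff Q f)
  hasSum : ∀ Q, ∀ u ∈ polydisc b s, HasSum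
    (fun β => MvPowerSeries.coeff (pair Q β) F * wmon (u - b) β) (MvPowerSeries.coeff Q f u)

theorem exists_isRep {b : Fin p → ℂ} {s t : ℝ} (hs : 0 < s) (hst : s < t) {f : Ser n p}
    (hf : ∀ Q, DifferentiableOn ℂ (MvPowerSeries.coeff Q f) (polydisc b t)) :
    ∃ F : FS n p, IsRep b s t f F := by
  have h : ∀ Q : Fin n →₀ ℕ, ∃ c : (Fin p →₀ ℕ) → ℂ,
      (∀ β, ‖c β‖ₑ * ENNReal.ofReal s ^ β.degree ≤
        supNorm (polydisc b t) (MvPowerSeries.coeff Q f)) ∧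
      ∀ u ∈ polydisc b s, HasSum (fun β => c β * wmon (u - b) β) (MvPowerSeries.coeff Q f u) := by
    intro Q
    obtain ⟨c, h1, h2⟩ := exists_taylor hs hst (f := fun v => MvPowerSeries.coeff Q f (b + v))
      ((hf Q).comp (by fun_prop) fun v hv i => by simpa using hv i)
    refine ⟨c, fun β => (h1 β).trans (iSup₂_le fun v hv => le_supNorm (fun i => ?_) _),
      fun u hu => ?_⟩
    · simpa using hv i
    · simpa using h2 (u - b) fun i => by simpa using hu i
  choose c h1 h2 using h
  refine ⟨fun γ => c (Finsupp.sumFinsuppEquivProdFinsupp γ).1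
    (Finsupp.sumFinsuppEquivProdFinsupp γ).2, ?_, ?_⟩
  · intro Q β
    have : MvPowerSeries.coeff (pair Q β) (fun γ => c (Finsupp.sumFinsuppEquivProdFinsupp γ).1
        (Finsupp.sumFinsuppEquivProdFinsupp γ).2 : FS n p) = c Q β := by
      change c _ _ = _
      simp only [pair, Equiv.apply_symm_apply]
    rw [this]
    exact h1 Q β
  · intro Q u hu
    have : ∀ β, MvPowerSeries.coeff (pair Q β) (fun γ => c (Finsupp.sumFinsuppEquivProdFinsupp γ).1
        (Finsupp.sumFinsuppEquivProdFinsupp γ).2 : FS n p) = c Q β := fun β => by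
      change c _ _ = _
      simp only [pair, Equiv.apply_symm_apply]
    simp only [this]
    exact h2 Q u hu

/-- The sum of the geometric series in `p` variables with ratio `18/19`. -/
def geomConst (p : ℕ) : ℝ≥0∞ := ∑' β : Fin p →₀ ℕ, ENNReal.ofReal (18 / 19) ^ β.degree

theorem geomConst_ne_top (p : ℕ) : geomConst p ≠ ⊤ := by
  have h := (hasSum_wmon (p := p) (q := fun _ => ((18 / 19 : ℝ) : ℂ)) fun _ => by
    rw [Complex.norm_real]; norm_num).1
  have e : geomConst p = ∑' β : Fin p →₀ ℕ, ENNReal.ofReal ‖wmon (fun _ => ((18 / 19 : ℝ) : ℂ)) β‖ := by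
    refine tsum_congr fun β => ?_
    rw [wmon_const, norm_pow, Complex.norm_real, ENNReal.ofReal_pow (norm_nonneg _)]
    congr 2
    norm_num
  rw [e, ← ENNReal.ofReal_tsum_of_nonneg (fun _ => norm_nonneg _) h]
  exact ENNReal.ofReal_ne_top

variable {b : Fin p → ℂ} {s t t' : ℝ} {f : Ser n p} {F : FS n p}

/-- Cauchy estimates at radius `s` followed by a geometric series: the price of replacing sup norms
in `u` by `ℓ¹` norms. The ratio of the radii is fixed, so the price does not depend on `m`. -/
theorem IsRep.wnorm_le (h : IsRep b s t f F) (ht' : t' ≤ 18 / 19 * s) (ρ : ℝ) :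
    wnorm (rad ρ t') F ≤ geomConst p * serNorm (polydisc b t) ρ f := by
  rw [wnorm_rad, serNorm_eq, gnorm, ← ENNReal.tsum_mul_left]
  refine ENNReal.tsum_le_tsum fun Q => ?_
  rw [geomConst, ← ENNReal.tsum_mul_right]
  refine ENNReal.tsum_le_tsum fun β => ?_
  rw [wmon_const]
  calc ‖MvPowerSeries.coeff (pair Q β) F‖ₑ *
        (ENNReal.ofReal ρ ^ Q.degree * ENNReal.ofReal t' ^ β.degree)
      ≤ ‖MvPowerSeries.coeff (pair Q β) F‖ₑ * (ENNReal.ofReal ρ ^ Q.degree *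
        (ENNReal.ofReal (18 / 19) * ENNReal.ofReal s) ^ β.degree) := by
        gcongr
        rw [← ENNReal.ofReal_mul (by norm_num)]
        exact ENNReal.ofReal_le_ofReal ht'
    _ = ENNReal.ofReal (18 / 19) ^ β.degree * ((‖MvPowerSeries.coeff (pair Q β) F‖ₑ *
        ENNReal.ofReal s ^ β.degree) * ENNReal.ofReal ρ ^ Q.degree) := by
        rw [mul_pow]; ring
    _ ≤ _ := by
        gcongr
        exact h.bound Q β

/-- If a coefficient function vanishes on `D(b, t)`, the Cauchy bound with supremum `0` forces all
its Taylor coefficients at `b` to vanish. -/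
theorem IsRep.mem_ordIdeal (h : IsRep b s t f F) (hs : 0 < s) {N : ℕ}
    (hf : ∀ Q : Fin n →₀ ℕ, Q.degree < N → ∀ u ∈ polydisc b t, MvPowerSeries.coeff Q f u = 0) :
    F ∈ ordIdeal xw N := by
  intro γ hγ
  obtain ⟨Q, β, rfl⟩ := exists_eq_pair γ
  rw [wdeg_xw_pair] at hγ
  have h0 : supNorm (polydisc b t) (MvPowerSeries.coeff Q f) = 0 := by
    refine le_antisymm (iSup₂_le fun u hu => ?_) zero_le
    rw [hf Q hγ u hu, enorm_zero]
  have := h.bound Q β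
  rw [h0, nonpos_iff_eq_zero, mul_eq_zero] at this
  exact enorm_eq_zero.1 (this.resolve_right (pow_ne_zero _ (by simpa using hs)))

theorem hasSum_pair {z : (Fin n → ℂ) × (Fin p → ℂ)}
    (hF : wnorm (fun i => ‖pt b z i‖ₑ) F ≠ ⊤) :
    HasSum (fun q : (Fin n →₀ ℕ) × (Fin p →₀ ℕ) => MvPowerSeries.coeff (pair q.1 q.2) F *
      wmon (z.2 - b) q.2 * wmon z.1 q.1) (ev F (pt b z)) := by
  have h := hasSum_ev hF
  rw [← Finsupp.sumFinsuppEquivProdFinsupp.symm.hasSum_iff] at h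
  refine h.congr_fun fun q => ?_
  change _ = MvPowerSeries.coeff (pair q.1 q.2) F * wmon (pt b z) (pair q.1 q.2)
  rw [wmon_pt]
  ring

theorem ev_pt_eq_tsum {z : (Fin n → ℂ) × (Fin p → ℂ)} {c : (Fin n →₀ ℕ) → ℂ}
    (hF : wnorm (fun i => ‖pt b z i‖ₑ) F ≠ ⊤)
    (h : ∀ Q, HasSum (fun β => MvPowerSeries.coeff (pair Q β) F * wmon (z.2 - b) β) (c Q)) :
    ev F (pt b z) = ∑' Q, c Q * wmon z.1 Q := by
  have h1 : ∀ Q, HasSum (fun β => MvPowerSeries.coeff (pair Q β) F * wmon (z.2 - b) β *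
    wmon z.1 Q) (c Q * wmon z.1 Q) := fun Q => (h Q).mul_right _
  exact ((hasSum_pair hF).prod_fiberwise h1).tsum_eq.symm

theorem serEval_eq (f : Ser n p) (z : (Fin n → ℂ) × (Fin p → ℂ)) :
    serEval f z = ∑' Q : Fin n →₀ ℕ, MvPowerSeries.coeff Q f z.2 * wmon z.1 Q := rfl

theorem IsRep.ev_eq (h : IsRep b s t f F) {z : (Fin n → ℂ) × (Fin p → ℂ)}
    (hz : z.2 ∈ polydisc b s) (hF : wnorm (fun i => ‖pt b z i‖ₑ) F ≠ ⊤) :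
    ev F (pt b z) = serEval f z := by
  rw [serEval_eq]
  exact ev_pt_eq_tsum hF fun Q => h.hasSum Q z.2 hz

/-! ### Return from power series in `(x, v)` to series in `x` with holomorphic coefficients -/

/-- The series in `x` of a power series in `x` and `v = u - b`. -/
def ofFS (b : Fin p → ℂ) (F : FS n p) : Ser n p :=
  fun Q u => ∑' β : Fin p →₀ ℕ, MvPowerSeries.coeff (pair Q β) F * wmon (u - b) β

theorem coeff_ofFS (Q : Fin n →₀ ℕ) (u : Fin p → ℂ) : MvPowerSeries.coeff Q (ofFS b F) u =
    ∑' β : Fin p →₀ ℕ, MvPowerSeries.coeff (pair Q β) F * wmon (u - b) β := rfl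

theorem supNorm_term_le (Q : Fin n →₀ ℕ) (β : Fin p →₀ ℕ) :
    supNorm (polydisc b t) (fun u => MvPowerSeries.coeff (pair Q β) F * wmon (u - b) β) ≤
      ‖MvPowerSeries.coeff (pair Q β) F‖ₑ * ENNReal.ofReal t ^ β.degree :=
  iSup₂_le fun u hu => by
    rw [enorm_mul, enorm_wmon, ← wmon_const]
    exact mul_le_mul_right (wmon_mono (fun k => (enorm_lt_ofReal.2 (hu k)).le) β) _

/-- The way back to sup norms is free, since on the polydisc the modulus of a series in `v` is at
most the sum of the moduli of its terms. -/
theorem serNorm_ofFS_le (ρ : ℝ) :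
    serNorm (polydisc b t) ρ (ofFS b F) ≤ wnorm (rad ρ t) F := by
  rw [wnorm_rad, serNorm_eq, gnorm]
  refine ENNReal.tsum_le_tsum fun Q => ?_
  have : supNorm (polydisc b t) (MvPowerSeries.coeff Q (ofFS b F)) ≤
      ∑' β, ‖MvPowerSeries.coeff (pair Q β) F‖ₑ * ENNReal.ofReal t ^ β.degree := by
    refine iSup₂_le fun u hu => ?_
    rw [coeff_ofFS]
    exact (enorm_tsum_le _).trans (ENNReal.tsum_le_tsum fun β =>
      (le_supNorm hu fun u => MvPowerSeries.coeff (pair Q β) F * wmon (u - b) β).trans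
        (supNorm_term_le Q β))
  refine (mul_le_mul_left this _).trans ?_
  rw [← ENNReal.tsum_mul_right, wmon_const]
  exact (tsum_congr fun β => by ring).le

theorem tsum_coeff_ne_top {ρ : ℝ} (hρ : 0 < ρ) (hF : wnorm (rad ρ t) F ≠ ⊤) (Q : Fin n →₀ ℕ) :
    ∑' β : Fin p →₀ ℕ, ‖MvPowerSeries.coeff (pair Q β) F‖ₑ * ENNReal.ofReal t ^ β.degree ≠ ⊤ := by
  rw [wnorm_rad] at hF
  have := ENNReal.ne_top_of_tsum_ne_top hF Q
  intro htop
  apply this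
  calc _ = (∑' β : Fin p →₀ ℕ, ‖MvPowerSeries.coeff (pair Q β) F‖ₑ *
        ENNReal.ofReal t ^ β.degree) * ENNReal.ofReal ρ ^ Q.degree := by
        rw [← ENNReal.tsum_mul_right]
        exact tsum_congr fun β => by ring
    _ = ⊤ := by
        rw [htop, ENNReal.top_mul]
        exact pow_ne_zero _ (by simpa using hρ)

theorem differentiableOn_coeff_ofFS {ρ : ℝ} (hρ : 0 < ρ) (hF : wnorm (rad ρ t) F ≠ ⊤)
    (Q : Fin n →₀ ℕ) :
    DifferentiableOn ℂ (MvPowerSeries.coeff Q (ofFS b F)) (polydisc b t) := by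
  refine differentiableOn_tsum_of_supNorm (isOpen_polydisc b t)
    (g := fun (β : Fin p →₀ ℕ) u => MvPowerSeries.coeff (pair Q β) F * wmon (u - b) β)
    (fun β => Differentiable.differentiableOn ?_)
    (ne_top_of_le_ne_top (tsum_coeff_ne_top hρ hF Q)
      (ENNReal.tsum_le_tsum fun β => supNorm_term_le Q β))
  unfold wmon
  simp only [Pi.sub_apply]
  fun_prop

theorem coeff_ofFS_eq_zero {N : ℕ} (hF : F ∈ ordIdeal xw N) {Q : Fin n →₀ ℕ} (hQ : Q.degree < N)
    (u : Fin p → ℂ) : MvPowerSeries.coeff Q (ofFS b F) u = 0 := by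
  rw [coeff_ofFS]
  have : ∀ β : Fin p →₀ ℕ, MvPowerSeries.coeff (pair Q β) F = 0 := fun β =>
    hF _ (by rwa [wdeg_xw_pair])
  simp [this]

theorem summable_coeff {ρ : ℝ} (hρ : 0 < ρ) {u : Fin p → ℂ} (hu : u ∈ polydisc b t)
    (hF : wnorm (rad ρ t) F ≠ ⊤) (Q : Fin n →₀ ℕ) :
    Summable fun β : Fin p →₀ ℕ => MvPowerSeries.coeff (pair Q β) F * wmon (u - b) β := by
  refine summable_of_tsum_enorm_ne_top (ne_top_of_le_ne_top (tsum_coeff_ne_top hρ hF Q)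
    (ENNReal.tsum_le_tsum fun β => ?_))
  exact (le_supNorm hu fun u => MvPowerSeries.coeff (pair Q β) F * wmon (u - b) β).trans
    (supNorm_term_le Q β)

theorem serEval_ofFS {z : (Fin n → ℂ) × (Fin p → ℂ)} {ρ : ℝ} (hρ : 0 < ρ)
    (hz : z ∈ polydisc 0 ρ ×ˢ polydisc b t) (hF : wnorm (rad ρ t) F ≠ ⊤) :
    serEval (ofFS b F) z = ev F (pt b z) := by
  have hF' := wnorm_ne_top_of_mem hF (pt_mem_openPoly.2 hz)
  rw [serEval_eq, ev_pt_eq_tsum hF' (c := fun Q => MvPowerSeries.coeff Q (ofFS b F) z.2)]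
  intro Q
  rw [coeff_ofFS]
  exact (summable_coeff hρ hz.2 hF Q).hasSum

/-- The series in `x` at a fixed parameter `u`. -/
def serAt (u : Fin p → ℂ) : Ser n p →+* MvPowerSeries (Fin n) ℂ :=
  MvPowerSeries.map (Pi.evalRingHom (fun _ => ℂ) u)

@[simp] theorem coeff_serAt (u : Fin p → ℂ) (f : Ser n p) (Q : Fin n →₀ ℕ) :
    MvPowerSeries.coeff Q (serAt u f) = MvPowerSeries.coeff Q f u := rfl

theorem serEval_eq_ev (f : Ser n p) (z : (Fin n → ℂ) × (Fin p → ℂ)) :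
    serEval f z = ev (serAt z.2 f) z.1 := rfl

theorem wnorm_serAt_le {U : Set (Fin p → ℂ)} {u : Fin p → ℂ} (hu : u ∈ U) (r : ℝ) (f : Ser n p) :
    wnorm (fun _ => ENNReal.ofReal r) (serAt u f) ≤ serNorm U r f := by
  rw [serNorm_eq]
  exact ENNReal.tsum_le_tsum fun Q => mul_le_mul_left (le_supNorm hu _) _

theorem differentiableOn_serEval {r : ℝ}
    (hf : ∀ Q, DifferentiableOn ℂ (MvPowerSeries.coeff Q f) (polydisc b t))
    (hr : serNorm (polydisc b t) r f ≠ ⊤) :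
    DifferentiableOn ℂ (serEval f) (polydisc 0 r ×ˢ polydisc b t) := by
  refine differentiableOn_tsum_of_supNorm ((isOpen_polydisc 0 r).prod (isOpen_polydisc b t))
    (g := fun (Q : Fin n →₀ ℕ) z => MvPowerSeries.coeff Q f z.2 * ∏ i, z.1 i ^ Q i)
    (fun Q => ?_) (ne_top_of_le_ne_top hr ?_)
  · refine DifferentiableOn.mul ((hf Q).comp differentiableOn_snd fun z hz => hz.2) ?_
    exact Differentiable.differentiableOn (by fun_prop)
  · rw [serNorm_eq]
    refine ENNReal.tsum_le_tsum fun Q => iSup₂_le fun z hz => ?_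
    change ‖MvPowerSeries.coeff Q f z.2 * wmon z.1 Q‖ₑ ≤ _
    rw [enorm_mul, enorm_wmon]
    exact mul_le_mul' (le_supNorm hz.2 _) (wmon_mono (fun i =>
      (enorm_lt_ofReal.2 (by simpa using hz.1 i)).le) Q)

end Conversion

/-! ### Weights, resonances and the cohomological equation -/

section Cohomological

variable {n p l : ℕ}

theorem coeff_X_mul_pderiv {A : Type*} [CommRing A] (s : Fin n) (f : MvPowerSeries (Fin n) A)
    (Q : Fin n →₀ ℕ) : MvPowerSeries.coeff Q (MvPowerSeries.X s * MvPowerSeries.pderiv A s f) =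
      Q s * MvPowerSeries.coeff Q f := by
  classical
  by_cases hQ : Q s = 0
  · rw [hQ, Nat.cast_zero, zero_mul, MvPowerSeries.X, MvPowerSeries.coeff_monomial_mul, if_neg]
    intro h
    have := h s
    simp [hQ] at this
  · have hle : Finsupp.single s 1 ≤ Q := by
      rw [Finsupp.single_le_iff]; omega
    obtain ⟨Q', rfl⟩ := exists_add_of_le hle
    rw [MvPowerSeries.X, MvPowerSeries.coeff_monomial_mul, if_pos hle, add_tsub_cancel_left,
      MvPowerSeries.coeff_pderiv, add_comm Q']
    simp [mul_comm, add_comm]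

theorem coeff_lieDeriv (c : Fin n → ℂ) (f : MvPowerSeries (Fin n) ℂ) (Q : Fin n →₀ ℕ) :
    MvPowerSeries.coeff Q (lieDeriv c f) = (∑ s, c s * Q s) * MvPowerSeries.coeff Q f := by
  rw [lieDeriv, map_sum, Finset.sum_mul]
  refine Finset.sum_congr rfl fun s _ => ?_
  rw [MvPowerSeries.coeff_smul, coeff_X_mul_pderiv]
  ring

variable {lam : Fin l → Fin n → ℂ} {R : Fin p → Fin n →₀ ℕ}

/-- If `R k` were `0`, the monomial would be `1` and `X_k - 1` would be an algebraic relation.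
Without this, substituting the monomials into power series would not make sense. -/
theorem IsResonantSystem.exponent_ne_zero (hS : IsResonantSystem lam R) (k : Fin p) : R k ≠ 0 := by
  intro h
  have h1 := hS.algebraicIndependent
  rw [algebraicIndependent_iff] at h1
  have h2 := h1 (MvPolynomial.X k - 1) (by
    simp only [map_sub, MvPolynomial.aeval_X, map_one, h]
    exact sub_self _)
  have h3 := congrArg (MvPolynomial.eval fun _ => (0 : ℂ)) h2
  simp at h3

/-- The monomial `x^{R_k}` is the image of the variable `X_k`, hence itself a first integral. Its
Lie derivative along `S_j` is this sum times the monomial. -/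
theorem IsResonantSystem.sum_eq_zero (hS : IsResonantSystem lam R) (j : Fin l) (k : Fin p) :
    ∑ s, lam j s * R k s = 0 := by
  classical
  have hsub : MvPowerSeries.HasSubst
      (fun k => (MvPowerSeries.monomial (R k) (1 : ℂ) : MvPowerSeries (Fin n) ℂ)) := by
    refine MvPowerSeries.hasSubst_of_constantCoeff_zero fun k => ?_
    rw [← MvPowerSeries.coeff_zero_eq_constantCoeff_apply, MvPowerSeries.coeff_monomial,
      if_neg (hS.exponent_ne_zero k).symm]
  have h1 : (MvPowerSeries.monomial (R k) (1 : ℂ) : MvPowerSeries (Fin n) ℂ) ∈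
      {f : MvPowerSeries (Fin n) ℂ | ∀ j, lieDeriv (lam j) f = 0} := by
    rw [hS.firstIntegrals]
    exact ⟨MvPowerSeries.X k, MvPowerSeries.subst_X hsub k⟩
  have h2 := congrArg (MvPowerSeries.coeff (R k)) (h1 j)
  rw [coeff_lieDeriv, MvPowerSeries.coeff_monomial_same, mul_one] at h2
  simpa using h2

theorem IsResonantSystem.pos (hS : IsResonantSystem lam R) (hl : 0 < l) :
    0 < bigLambda lam ∧ ∀ j i, ‖lam j i‖ ≤ bigLambda lam := by
  have hle : ∀ j i, ‖lam j i‖ ≤ bigLambda lam := fun j i =>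
    (le_ciSup (f := fun i => ‖lam j i‖) (Set.finite_range _).bddAbove i).trans
      (le_ciSup (f := fun j => ⨆ i, ‖lam j i‖) (Set.finite_range _).bddAbove j)
  refine ⟨?_, hle⟩
  have h0 := hS.linearIndependent.ne_zero ⟨0, hl⟩
  obtain ⟨i, hi⟩ := Function.ne_iff.1 h0
  exact (norm_pos_iff.2 hi).trans_le (hle _ _)

/-- The value of the exponent `Q` on the vector fields `S_1, …, S_l`. -/
def expo (lam : Fin l → Fin n → ℂ) (Q : Fin n →₀ ℕ) : Fin l → ℂ :=
  fun j => ∑ s, (Q s : ℂ) * lam j s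

theorem expo_add (Q Q' : Fin n →₀ ℕ) : expo lam (Q + Q') = expo lam Q + expo lam Q' := by
  ext j
  simp [expo, add_mul, Finset.sum_add_distrib]

theorem expo_single (s : Fin n) (j : Fin l) : expo lam (Finsupp.single s 1) j = lam j s := by
  simp only [expo, Finsupp.single_apply]
  simp

/-- All monomials of `f` have the value `μ` on `S_1, …, S_l`. -/
def HasExpo (lam : Fin l → Fin n → ℂ) (μ : Fin l → ℂ) (f : MvPowerSeries (Fin n) ℂ) : Prop :=
  ∀ Q, MvPowerSeries.coeff Q f ≠ 0 → expo lam Q = μ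

theorem HasExpo.mul {μ ν : Fin l → ℂ} {f g : MvPowerSeries (Fin n) ℂ} (hf : HasExpo lam μ f)
    (hg : HasExpo lam ν g) : HasExpo lam (μ + ν) (f * g) := by
  classical
  intro Q hQ
  rw [MvPowerSeries.coeff_mul] at hQ
  obtain ⟨q, hq, h⟩ := Finset.exists_ne_zero_of_sum_ne_zero hQ
  rw [← hf q.1 (left_ne_zero_of_mul h), ← hg q.2 (right_ne_zero_of_mul h), ← expo_add,
    Finset.HasAntidiagonal.mem_antidiagonal.1 hq]

theorem HasExpo.smul {μ : Fin l → ℂ} {f : MvPowerSeries (Fin n) ℂ} (c : ℂ)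
    (hf : HasExpo lam μ f) : HasExpo lam μ (c • f) := fun Q hQ =>
  hf Q fun h => hQ (by rw [MvPowerSeries.coeff_smul, h, mul_zero])

theorem HasExpo.sum {ι : Type*} {t : Finset ι} {μ : Fin l → ℂ} {f : ι → MvPowerSeries (Fin n) ℂ}
    (hf : ∀ i ∈ t, HasExpo lam μ (f i)) : HasExpo lam μ (∑ i ∈ t, f i) := by
  intro Q hQ
  rw [map_sum] at hQ
  obtain ⟨i, hi, h⟩ := Finset.exists_ne_zero_of_sum_ne_zero hQ
  exact hf i hi Q h

/-- The monomial `x^{R_k}`. -/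
def rmon (R : Fin p → Fin n →₀ ℕ) (k : Fin p) : MvPowerSeries (Fin n) ℂ :=
  MvPowerSeries.monomial (R k) 1

theorem X_mul_pderiv_rmon (s : Fin n) (k : Fin p) :
    MvPowerSeries.X s * MvPowerSeries.pderiv ℂ s (rmon R k) = (R k s : ℂ) • rmon R k := by
  classical
  ext Q
  rw [coeff_X_mul_pderiv, MvPowerSeries.coeff_smul, rmon, MvPowerSeries.coeff_monomial]
  split_ifs with h
  · rw [h]
  · simp

theorem hasExpo_pderiv_rmon (hS : IsResonantSystem lam R) (s : Fin n) (k : Fin p) :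
    HasExpo lam (fun j => -lam j s) (MvPowerSeries.pderiv ℂ s (rmon R k)) := by
  classical
  intro Q hQ
  rw [MvPowerSeries.coeff_pderiv, rmon, MvPowerSeries.coeff_monomial] at hQ
  have h : Q + Finsupp.single s 1 = R k := by
    by_contra h
    simp [h] at hQ
  ext j
  have h1 : expo lam (R k) j = 0 := by
    rw [expo, ← hS.sum_eq_zero j k]
    exact Finset.sum_congr rfl fun _ _ => mul_comm _ _
  rw [← h, expo_add, Pi.add_apply, expo_single] at h1
  exact eq_neg_of_add_eq_zero_left h1

/-- The coefficients of `V` belong to the weight `α`. -/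
def HasWeight (lam : Fin l → Fin n → ℂ) (α : Fin l → ℂ) (V : Fin n → MvPowerSeries (Fin n) ℂ) :
    Prop :=
  ∀ i, HasExpo lam (fun j => α j + lam j i) (V i)

/-- The operator `V ↦ D_u NF · Dπ · V`, where `d i k` is the derivative in `u_k` of the
`i`-th eigenvalue of `NF`. -/
def duOp (R : Fin p → Fin n →₀ ℕ) (d : Fin n → Fin p → ℂ) (V : Fin n → MvPowerSeries (Fin n) ℂ)
    (i : Fin n) : MvPowerSeries (Fin n) ℂ :=
  ∑ k, d i k • ((∑ s, MvPowerSeries.pderiv ℂ s (rmon R k) * V s) * MvPowerSeries.X i)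

/-- The monomials `x^{R_k}` have value `0` on the `S_j`, so `∂_s x^{R_k}` has value `-λ_s`.
Multiplication by the component `V_s`, of value `α + λ_s`, leaves `α`, and the factor `x_i` restores
weight `α` in the component `i`. -/
theorem HasWeight.duOp (hS : IsResonantSystem lam R) (d : Fin n → Fin p → ℂ) {α : Fin l → ℂ}
    {V : Fin n → MvPowerSeries (Fin n) ℂ} (hV : HasWeight lam α V) :
    HasWeight lam α (duOp R d V) := by
  classical
  intro i
  refine HasExpo.sum fun k _ => HasExpo.smul _ ?_
  have hX : HasExpo lam (fun j => lam j i) (MvPowerSeries.X i : MvPowerSeries (Fin n) ℂ) := by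
    intro Q hQ
    rw [MvPowerSeries.coeff_X] at hQ
    have : Q = Finsupp.single i 1 := by
      by_contra h
      simp [h] at hQ
    ext j
    rw [this, expo_single]
  refine HasExpo.mul (μ := α) (HasExpo.sum fun s _ => ?_) hX
  have h := (hasExpo_pderiv_rmon hS s k).mul (hV s)
  have e : ((fun j => -lam j s) + fun j => α j + lam j s) = α := by
    ext j
    simp
  rwa [e] at h

/-- The operator `U ↦ D_x NF · U - D_x U · NF` for the linear diagonal field `NF` with eigenvalues
`c`. -/
def adOp (c : Fin n → ℂ) (U : Fin n → MvPowerSeries (Fin n) ℂ) (i : Fin n) :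
    MvPowerSeries (Fin n) ℂ :=
  c i • U i - ∑ s, c s • (MvPowerSeries.X s * MvPowerSeries.pderiv ℂ s (U i))

theorem adOp_of_hasWeight {a : Fin l → ℂ} {α : Fin l → ℂ} {V : Fin n → MvPowerSeries (Fin n) ℂ}
    (hV : HasWeight lam α V) (i : Fin n) :
    adOp (fun i => ∑ j, a j * lam j i) V i = -(∑ j, a j * α j) • V i := by
  ext Q
  simp only [adOp, map_sub, map_sum, MvPowerSeries.coeff_smul, coeff_X_mul_pderiv]
  by_cases hQ : MvPowerSeries.coeff Q (V i) = 0
  · simp [hQ]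
  have h := hV i Q hQ
  have h1 : ∑ s, (∑ j, a j * lam j s) * (Q s : ℂ) = ∑ j, a j * (α j + lam j i) := by
    simp only [Finset.sum_mul]
    rw [Finset.sum_comm]
    refine Finset.sum_congr rfl fun j _ => ?_
    rw [← congrFun h j, expo, Finset.mul_sum]
    exact Finset.sum_congr rfl fun s _ => by ring
  have h2 : ∑ s, (∑ j, a j * lam j s) * ((Q s : ℂ) * MvPowerSeries.coeff Q (V i)) =
      (∑ j, a j * (α j + lam j i)) * MvPowerSeries.coeff Q (V i) := by
    rw [← h1, Finset.sum_mul]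
    exact Finset.sum_congr rfl fun s _ => by ring
  rw [h2]
  simp only [mul_add, Finset.sum_add_distrib]
  ring

/-- `Dπ · S_j = 0`, because the components of `π` are first integrals. Both `D_m ∘ D_m = 0` and `Dπ
· NF = 0` come from this. -/
theorem sum_pderiv_rmon_mul_X (hS : IsResonantSystem lam R) (a : Fin l → ℂ) (k : Fin p) :
    ∑ s, MvPowerSeries.pderiv ℂ s (rmon R k) *
      ((∑ j, a j * lam j s) • (MvPowerSeries.X s : MvPowerSeries (Fin n) ℂ)) = 0 := by
  have h : ∀ s, MvPowerSeries.pderiv ℂ s (rmon R k) *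
      ((∑ j, a j * lam j s) • (MvPowerSeries.X s : MvPowerSeries (Fin n) ℂ)) =
      ((∑ j, a j * lam j s) * (R k s : ℂ)) • rmon R k := fun s => by
    rw [mul_smul_comm, mul_comm, X_mul_pderiv_rmon, smul_smul]
  simp only [h]
  rw [← Finset.sum_smul]
  have h2 : ∑ s, (∑ j, a j * lam j s) * (R k s : ℂ) = 0 := by
    simp only [Finset.sum_mul]
    rw [Finset.sum_comm]
    refine Finset.sum_eq_zero fun j _ => ?_
    have := hS.sum_eq_zero j k
    simp only [mul_assoc, ← Finset.mul_sum, this, mul_zero]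
  rw [h2, zero_smul]

/-- The image of the operator consists of combinations of the `S_j` with coefficients depending on
`x`, and these are annihilated by `Dπ`. -/
theorem duOp_duOp (hS : IsResonantSystem lam R) (δ : Fin l → Fin p → ℂ)
    (V : Fin n → MvPowerSeries (Fin n) ℂ) (i : Fin n) :
    duOp R (fun i k => ∑ j, δ j k * lam j i) (duOp R (fun i k => ∑ j, δ j k * lam j i) V) i =
      0 := by
  have h : ∀ k, ∑ s, MvPowerSeries.pderiv ℂ s (rmon R k) *
      duOp R (fun i k => ∑ j, δ j k * lam j i) V s = 0 := fun k => by
    simp only [duOp, Finset.mul_sum]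
    rw [Finset.sum_comm]
    refine Finset.sum_eq_zero fun k' _ => ?_
    calc _ = ∑ s, (∑ t, MvPowerSeries.pderiv ℂ t (rmon R k') * V t) *
          (MvPowerSeries.pderiv ℂ s (rmon R k) *
          ((∑ j, δ j k' * lam j s) • (MvPowerSeries.X s : MvPowerSeries (Fin n) ℂ))) := by
          refine Finset.sum_congr rfl fun s _ => ?_
          rw [mul_smul_comm, mul_smul_comm, mul_smul_comm]
          congr 1
          ring
      _ = 0 := by
          rw [← Finset.mul_sum, sum_pderiv_rmon_mul_X hS fun j => δ j k', mul_zero]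
  rw [duOp]
  simp only [h, zero_mul, smul_zero, Finset.sum_const_zero]

theorem duOp_linear (d : Fin n → Fin p → ℂ) (x y : ℂ) (V W : Fin n → MvPowerSeries (Fin n) ℂ)
    (i : Fin n) : duOp R d (x • V + y • W) i = x • duOp R d V i + y • duOp R d W i := by
  simp only [duOp, Pi.add_apply, Pi.smul_apply, mul_add, mul_smul_comm, Finset.sum_add_distrib,
    ← Finset.smul_sum, add_mul, smul_mul_assoc, smul_add]
  rw [Finset.smul_sum, Finset.smul_sum]
  congr 1 <;> exact Finset.sum_congr rfl fun k _ => smul_comm _ _ _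

theorem duOp_sum {ι : Type*} (t : Finset ι) (d : Fin n → Fin p → ℂ)
    (V : ι → Fin n → MvPowerSeries (Fin n) ℂ) (i : Fin n) :
    duOp R d (∑ α ∈ t, V α) i = ∑ α ∈ t, duOp R d (V α) i := by
  classical
  induction t using Finset.induction_on with
  | empty => simp [duOp]
  | insert α t hα ih =>
    rw [Finset.sum_insert hα, Finset.sum_insert hα, ← ih]
    simpa using duOp_linear (R := R) d 1 1 (V α) (∑ α ∈ t, V α) i

theorem adOp_sum {ι : Type*} (t : Finset ι) (c : Fin n → ℂ)
    (V : ι → Fin n → MvPowerSeries (Fin n) ℂ) (i : Fin n) :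
    adOp c (∑ α ∈ t, V α) i = ∑ α ∈ t, adOp c (V α) i := by
  simp only [adOp, Finset.sum_apply, map_sum, Finset.mul_sum, Finset.smul_sum,
    Finset.sum_sub_distrib]
  rw [Finset.sum_comm]

/-- The solution of the cohomological equation in one weight space. -/
theorem cohomological_weight (hS : IsResonantSystem lam R) (a : Fin l → ℂ) (δ : Fin l → Fin p → ℂ)
    {α : Fin l → ℂ} (hα : ∑ j, a j * α j ≠ 0) {V U : Fin n → MvPowerSeries (Fin n) ℂ}
    (hV : HasWeight lam α V)
    (hU : ∀ i, U i = -((∑ j, a j * α j)⁻¹ • V i + ((∑ j, a j * α j)⁻¹ ^ 2) •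
      duOp R (fun i k => ∑ j, δ j k * lam j i) V i)) (i : Fin n) :
    adOp (fun i => ∑ j, a j * lam j i) U i +
      duOp R (fun i k => ∑ j, δ j k * lam j i) U i = V i := by
  set A := ∑ j, a j * α j with hA
  set O := duOp R (fun i k => ∑ j, δ j k * lam j i) with hO
  -- On the weight space the equation reads `(-A + O) U = V` with `O² = 0`, so the inverse is the
  -- finite Neumann series `-A⁻¹ - A⁻² O`. That `U` stays in the weight space is needed for `adOp`
  -- to act on it as `-A`.
  have hU' : U = (-A⁻¹) • V + (-(A⁻¹ ^ 2)) • O V := by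
    ext1 i
    rw [hU i, Pi.add_apply, Pi.smul_apply, Pi.smul_apply, neg_add, neg_smul, neg_smul]
  have hw : HasWeight lam α U := by
    intro i Q hQ
    rw [hU'] at hQ
    simp only [Pi.add_apply, Pi.smul_apply, map_add, MvPowerSeries.coeff_smul] at hQ
    by_cases h : MvPowerSeries.coeff Q (V i) = 0
    · refine HasWeight.duOp hS (fun i k => ∑ j, δ j k * lam j i) hV i Q fun h' => hQ ?_
      rw [← hO] at h'
      rw [h, h']
      simp
    · exact hV i Q h
  have h1 : O (O V) i = 0 := duOp_duOp hS δ V i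
  have h2 : O U i = (-A⁻¹) • O V i := by
    rw [hU', hO, duOp_linear, ← hO, h1, smul_zero, add_zero]
  rw [adOp_of_hasWeight hw, ← hA, h2, hU i, smul_neg, smul_add, smul_smul, smul_smul, neg_mul,
    mul_inv_cancel₀ hα, neg_mul, pow_two, mul_inv_cancel_left₀ hα]
  simp

end Cohomological

/-! ### The solution of the cohomological equation as a series with holomorphic coefficients -/

section Solution

variable {n p l : ℕ} {lam : Fin l → Fin n → ℂ} {R : Fin p → Fin n →₀ ℕ}
  {a : Fin l → (Fin p → ℂ) → ℂ} {B : VF n p} {u : Fin p → ℂ} {m : ℕ}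

theorem serAt_smul (g : (Fin p → ℂ) → ℂ) (f : Ser n p) : serAt u (g • f) = g u • serAt u f := by
  ext Q
  simp

theorem serAt_pderiv (s : Fin n) (f : Ser n p) :
    serAt u (MvPowerSeries.pderiv ((Fin p → ℂ) → ℂ) s f) =
      MvPowerSeries.pderiv ℂ s (serAt u f) := by
  ext Q
  rw [coeff_serAt, MvPowerSeries.coeff_pderiv, MvPowerSeries.coeff_pderiv, coeff_serAt]
  simp

theorem serAt_monomial (Q : Fin n →₀ ℕ) (g : (Fin p → ℂ) → ℂ) :
    serAt u (MvPowerSeries.monomial Q g) = MvPowerSeries.monomial Q (g u) := by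
  classical
  ext Q'
  rw [coeff_serAt, MvPowerSeries.coeff_monomial, MvPowerSeries.coeff_monomial]
  split_ifs <;> rfl

theorem serAt_opD (V : VF n p) (i : Fin n) : serAt u (opD lam R a V i) =
    duOp R (fun i k => ∑ j, fderiv ℂ (a j) u (Pi.single k 1) * lam j i)
      (fun i => serAt u (V i)) i := by
  simp only [opD, duOp, map_sum, serAt_smul, map_mul, serAt_pderiv, serAt_monomial, rmon,
    Finset.sum_smul, MvPowerSeries.X, Pi.one_apply]
  exact Finset.sum_comm

theorem serAt_cohomSol (α : Fin l → ℂ) (i : Fin n) : serAt u (cohomSol lam R a B α i) =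
    -((∑ j, a j u * α j)⁻¹ • serAt u (weightProj lam α B i) + ((∑ j, a j u * α j)⁻¹ ^ 2) •
      duOp R (fun i k => ∑ j, fderiv ℂ (a j) u (Pi.single k 1) * lam j i)
        (fun i => serAt u (weightProj lam α B i)) i) := by
  rw [cohomSol, map_neg, map_add, serAt_smul, serAt_smul, serAt_opD]
  rfl

open Classical in
theorem coeff_weightProj (α : Fin l → ℂ) (i : Fin n) (Q : Fin n →₀ ℕ) :
    MvPowerSeries.coeff Q (weightProj lam α B i) =
      if weight lam Q i = α then MvPowerSeries.coeff Q (B i) else 0 := rfl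

theorem weight_eq_iff (Q : Fin n →₀ ℕ) (i : Fin n) (α : Fin l → ℂ) :
    weight lam Q i = α ↔ expo lam Q = fun j => α j + lam j i := by
  simp only [funext_iff, weight, expo, sub_eq_iff_eq_add]

theorem hasWeight_weightProj (α : Fin l → ℂ) :
    HasWeight lam α fun i => serAt u (weightProj lam α B i) := by
  classical
  intro i Q hQ
  rw [coeff_serAt, coeff_weightProj] at hQ
  by_contra h
  rw [← weight_eq_iff] at h
  rw [if_neg h] at hQ
  exact hQ rfl

/-- The cohomological equation at a fixed parameter. -/
theorem cohomological_eq (hS : IsResonantSystem lam R)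
    (hA : ∀ α ∈ nonzeroWeights lam (m + 1) (2 * m), smallDivisor a α u ≠ 0) (i : Fin n) :
    adOp (fun i => ∑ j, a j u * lam j i) (fun i => serAt u (normalizingU lam R a m B i)) i +
      duOp R (fun i k => ∑ j, fderiv ℂ (a j) u (Pi.single k 1) * lam j i)
        (fun i => serAt u (normalizingU lam R a m B i)) i =
      ∑ α ∈ nonzeroWeights lam (m + 1) (2 * m), serAt u (weightProj lam α B i) := by
  have h : (fun i => serAt u (normalizingU lam R a m B i)) =
      ∑ α ∈ nonzeroWeights lam (m + 1) (2 * m), fun i => serAt u (cohomSol lam R a B α i) := by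
    ext1 i
    simp only [normalizingU, Finset.sum_apply, map_sum]
  rw [h, adOp_sum, duOp_sum, ← Finset.sum_add_distrib]
  refine Finset.sum_congr rfl fun α hα => ?_
  exact cohomological_weight hS (fun j => a j u) (fun j k => fderiv ℂ (a j) u (Pi.single k 1))
    (hA α hα) (hasWeight_weightProj α) (fun i => serAt_cohomSol α i) i

theorem mem_nonzeroWeights {lo hi : ℕ} {α : Fin l → ℂ} : α ∈ nonzeroWeights lam lo hi ↔
    α ≠ 0 ∧ ∃ Q : Fin n →₀ ℕ, ∃ i, lo ≤ Q.degree ∧ Q.degree ≤ hi ∧ weight lam Q i = α := by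
  classical
  simp only [nonzeroWeights, Finset.mem_erase, Finset.mem_biUnion, Finset.mem_Icc,
    Finset.mem_image, Finset.mem_product, Finset.mem_finsuppAntidiag, Finset.mem_univ, and_true,
    Prod.exists]
  refine and_congr_right fun _ => ⟨?_, ?_⟩
  · rintro ⟨d, hd, Q, i, ⟨hQ, -⟩, h⟩
    have : Q.degree = d := by rw [Finsupp.degree_eq_sum, hQ]
    exact ⟨Q, i, this ▸ hd.1, this ▸ hd.2, h⟩
  · rintro ⟨Q, i, h1, h2, h⟩
    exact ⟨Q.degree, ⟨h1, h2⟩, Q, i, ⟨(Finsupp.degree_eq_sum Q).symm, by simp⟩, h⟩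

/-- The part of `B` that is neither resonant nor removed. -/
def restPart (lam : Fin l → Fin n → ℂ) (m : ℕ) (B : VF n p) (i : Fin n) : Ser n p :=
  B i - weightProj lam 0 B i - ∑ α ∈ nonzeroWeights lam (m + 1) (2 * m), weightProj lam α B i

/-- For degrees between `m + 1` and `2m` the weight is either `0` or in the finite list, so exactly
one of the subtracted projections contains the monomial. The projections may also take away
monomials of degree above `2m`, which does no harm. -/
theorem coeff_restPart_eq_zero (i : Fin n) {Q : Fin n →₀ ℕ}
    (hB : Q.degree < m + 1 → MvPowerSeries.coeff Q (B i) u = 0) (hQ : Q.degree < 2 * m + 1) :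
    MvPowerSeries.coeff Q (restPart lam m B i) u = 0 := by
  classical
  simp only [restPart, map_sub, map_sum, coeff_weightProj, Finset.sum_ite_eq]
  by_cases h : Q.degree < m + 1
  · have h0 := hB h
    split_ifs <;> simp [h0]
  · by_cases h0 : weight lam Q i = 0
    · have : weight lam Q i ∉ nonzeroWeights lam (m + 1) (2 * m) := fun h' =>
        (mem_nonzeroWeights.1 h').1 h0
      rw [if_pos h0, if_neg this]
      simp
    · have : weight lam Q i ∈ nonzeroWeights lam (m + 1) (2 * m) :=
        mem_nonzeroWeights.2 ⟨h0, Q, i, by omega, by omega, rfl⟩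
      rw [if_neg h0, if_pos this]
      simp

/-! ### Holomorphic coefficients -/

/-- The coefficients of `f` are holomorphic on `U`. -/
def HolSer (U : Set (Fin p → ℂ)) (f : Ser n p) : Prop :=
  ∀ Q, DifferentiableOn ℂ (MvPowerSeries.coeff Q f) U

variable {U : Set (Fin p → ℂ)} {f g : Ser n p}

theorem HolSer.mono {U' : Set (Fin p → ℂ)} (h : U' ⊆ U) (hf : HolSer U f) : HolSer U' f :=
  fun Q => (hf Q).mono h

theorem HolSer.add (hf : HolSer U f) (hg : HolSer U g) : HolSer U (f + g) := fun Q => by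
  rw [map_add]
  exact (hf Q).add (hg Q)

theorem HolSer.neg (hf : HolSer U f) : HolSer U (-f) := fun Q => by
  rw [map_neg]
  exact (hf Q).neg

theorem HolSer.sub (hf : HolSer U f) (hg : HolSer U g) : HolSer U (f - g) := fun Q => by
  rw [map_sub]
  exact (hf Q).sub (hg Q)

theorem HolSer.sum {ι : Type*} {t : Finset ι} {F : ι → Ser n p} (h : ∀ i ∈ t, HolSer U (F i)) :
    HolSer U (∑ i ∈ t, F i) := fun Q => by
  rw [map_sum]
  exact DifferentiableOn.sum fun i hi => h i hi Q

theorem HolSer.smul {c : (Fin p → ℂ) → ℂ} (hc : DifferentiableOn ℂ c U) (hf : HolSer U f) :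
    HolSer U (c • f) := fun Q => by
  rw [MvPowerSeries.coeff_smul]
  exact hc.mul (hf Q)

theorem HolSer.mul (hf : HolSer U f) (hg : HolSer U g) : HolSer U (f * g) := fun Q => by
  classical
  rw [MvPowerSeries.coeff_mul]
  exact DifferentiableOn.sum fun i _ => (hf i.1).mul (hg i.2)

theorem holSer_monomial {c : (Fin p → ℂ) → ℂ} (hc : DifferentiableOn ℂ c U) (Q : Fin n →₀ ℕ) :
    HolSer U (MvPowerSeries.monomial Q c : Ser n p) := fun Q' => by
  classical
  rw [MvPowerSeries.coeff_monomial]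
  split_ifs
  · exact hc
  · exact differentiableOn_const 0

theorem HolSer.pderiv (hf : HolSer U f) (s : Fin n) :
    HolSer U (MvPowerSeries.pderiv ((Fin p → ℂ) → ℂ) s f) := fun Q => by
  rw [MvPowerSeries.coeff_pderiv]
  exact (hf _).mul (differentiableOn_const ((Q s : ℂ) + 1))

theorem holSer_weightProj {i : Fin n} (hB : HolSer U (B i)) (α : Fin l → ℂ) :
    HolSer U (weightProj lam α B i) := fun Q => by
  classical
  rw [coeff_weightProj]
  split_ifs
  · exact hB Q
  · exact differentiableOn_const 0

theorem holSer_normalizingU (ha : ∀ j, DifferentiableOn ℂ (a j) U)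
    (hda : ∀ j k, DifferentiableOn ℂ (fun u => fderiv ℂ (a j) u (Pi.single k 1)) U)
    (hA : ∀ α ∈ nonzeroWeights lam (m + 1) (2 * m), ∀ u ∈ U, smallDivisor a α u ≠ 0)
    (hB : ∀ i, HolSer U (B i)) (i : Fin n) : HolSer U (normalizingU lam R a m B i) := by
  rw [normalizingU, Finset.sum_apply]
  refine HolSer.sum fun α hα => HolSer.neg ?_
  have hsd : DifferentiableOn ℂ (smallDivisor a α)⁻¹ U := by
    refine DifferentiableOn.inv ?_ (hA α hα)
    exact DifferentiableOn.fun_sum fun j _ => (ha j).mul_const _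
  refine (HolSer.smul hsd (holSer_weightProj (hB i) α)).add (HolSer.smul (hsd.pow 2) ?_)
  refine HolSer.sum fun j _ => HolSer.sum fun k _ => HolSer.smul ((hda j k).mul_const _) ?_
  refine (HolSer.sum fun s _ => HolSer.mul ?_ (holSer_weightProj (hB s) α)).mul
    (holSer_monomial (differentiableOn_const 1) _)
  exact (holSer_monomial (differentiableOn_const 1) _).pderiv s

theorem coeff_pderiv_rmon_mul_eq_zero {V : Fin n → MvPowerSeries (Fin n) ℂ} {N : ℕ}
    (hV : ∀ i Q, Q.degree < N → MvPowerSeries.coeff Q (V i) = 0) (d : Fin n → Fin p → ℂ)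
    (i : Fin n) : ∀ Q : Fin n →₀ ℕ, Q.degree < N → MvPowerSeries.coeff Q (duOp R d V i) = 0 := by
  have key : ∀ f : MvPowerSeries (Fin n) ℂ, (∀ Q, Q.degree < N → MvPowerSeries.coeff Q f = 0) ↔
      f ∈ ordIdeal (fun _ => 1) N := fun f => by
    rw [mem_ordIdeal]
    simp [wdeg, Finsupp.degree_eq_sum]
  rw [key]
  refine Ideal.sum_mem _ fun k _ => smul_mem_ordIdeal _ (Ideal.mul_mem_right _ _
    (Ideal.sum_mem _ fun s _ => Ideal.mul_mem_left _ _ ((key _).1 (hV s))))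

theorem coeff_normalizingU_eq_zero {N : ℕ}
    (hB : ∀ i, ∀ Q : Fin n →₀ ℕ, Q.degree < N → MvPowerSeries.coeff Q (B i) u = 0) (i : Fin n)
    (Q : Fin n →₀ ℕ) (hQ : Q.degree < N) :
    MvPowerSeries.coeff Q (normalizingU lam R a m B i) u = 0 := by
  classical
  have hW : ∀ (α : Fin l → ℂ) (i : Fin n) (Q : Fin n →₀ ℕ), Q.degree < N →
      MvPowerSeries.coeff Q (serAt u (weightProj lam α B i)) = 0 := fun α i Q hQ => by
    rw [coeff_serAt, coeff_weightProj]
    split_ifs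
    · exact hB i Q hQ
    · rfl
  rw [← coeff_serAt, normalizingU, Finset.sum_apply, map_sum, map_sum]
  refine Finset.sum_eq_zero fun α _ => ?_
  rw [serAt_cohomSol, map_neg, map_add, MvPowerSeries.coeff_smul, MvPowerSeries.coeff_smul,
    hW α i Q hQ, coeff_pderiv_rmon_mul_eq_zero (hW α) _ i Q hQ]
  simp

/-! ### Derivatives of holomorphic functions of several variables -/

/-- Inside a smaller polydisc the function is its Taylor series at `b`, and a derivative of a power
series is a power series. This is applied to the `a_j`, which are holomorphic on the larger polydisc
of radius `t_{m/2}`. -/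
theorem differentiableOn_fderiv_apply {b : Fin p → ℂ} {s t : ℝ} (hs : 0 < s) (hst : s < t)
    {h : (Fin p → ℂ) → ℂ} (hh : DifferentiableOn ℂ h (polydisc b t)) (k : Fin p) :
    DifferentiableOn ℂ (fun u => fderiv ℂ h u (Pi.single k 1)) (polydisc b s) := by
  obtain ⟨c, -, hc⟩ := exists_taylor hs hst (f := fun v => h (b + v))
    (hh.comp (by fun_prop) fun v hv i => by simpa using hv i)
  set F : MvPowerSeries (Fin p) ℂ := c with hF
  have hev : ∀ u ∈ polydisc b s, h u = ev F (u - b) := fun u hu => by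
    have := (hc (u - b) fun i => by simpa using hu i).tsum_eq
    rw [add_sub_cancel] at this
    exact this.symm
  intro u hu
  have hlt : ‖u - b‖ < s := by
    rw [pi_norm_lt_iff hs]
    exact hu
  -- Two intermediate radii: the `ℓ¹` norm of the series is finite at `s₂ < s`, and that of its
  -- derivative at `s₁ < s₂`.
  obtain ⟨s₂, h2, h2s⟩ := exists_between hlt
  obtain ⟨s₁, h1, h12⟩ := exists_between h2
  have hs₁ : 0 < s₁ := (norm_nonneg _).trans_lt h1
  have hs₂ : 0 < s₂ := hs₁.trans h12
  have hfin : wnorm (fun _ => ENNReal.ofReal s₂) F ≠ ⊤ := by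
    have hsum := (hc (fun _ => (s₂ : ℂ)) fun i => by
      simpa [abs_of_pos hs₂] using h2s).summable.norm
    have e : wnorm (fun _ => ENNReal.ofReal s₂) F =
        ∑' β, ENNReal.ofReal ‖c β * wmon (fun _ => (s₂ : ℂ)) β‖ := by
      refine tsum_congr fun β => ?_
      rw [norm_mul, ENNReal.ofReal_mul (norm_nonneg _), wmon_const, wmon_const, norm_pow,
        Complex.norm_real, Real.norm_of_nonneg hs₂.le, ENNReal.ofReal_pow hs₂.le, ofReal_norm]
      rfl
    rw [e, ← ENNReal.ofReal_tsum_of_nonneg (fun _ => norm_nonneg _) hsum]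
    exact ENNReal.ofReal_ne_top
  have hlt12 : ENNReal.ofReal s₁ < ENNReal.ofReal s₂ := (ENNReal.ofReal_lt_ofReal_iff hs₂).2 h12
  have hfin' : wnorm (fun _ => ENNReal.ofReal s₁) (MvPowerSeries.pderiv ℂ k F) ≠ ⊤ :=
    wnorm_pderiv_ne_top (fun _ => hlt12.le) hlt12 hfin
  have hmem : ∀ v : Fin p → ℂ, v - b ∈ openPoly (fun _ => ENNReal.ofReal s₁) ↔
      v ∈ polydisc b s₁ := fun v => by
    simp only [openPoly, Set.mem_ofPred_eq, enorm_lt_ofReal, polydisc, Pi.sub_apply]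
  have hu₁ : u ∈ polydisc b s₁ := (pi_norm_lt_iff hs₁).1 h1
  have hsub : polydisc b s₁ ⊆ polydisc b s := fun v hv i => (hv i).trans (h12.trans h2s)
  have hd : ∀ v ∈ polydisc b s₁, fderiv ℂ h v (Pi.single k 1) =
      ev (MvPowerSeries.pderiv ℂ k F) (v - b) := by
    intro v hv
    obtain ⟨L, hL, hLv⟩ := hasFDerivAt_ev (wnorm_ne_top_mono (fun _ => hlt12.le) hfin)
      ((hmem v).2 hv)
    have h3 : HasFDerivAt (fun v => ev F (v - b)) L v :=
      HasFDerivAt.comp (f := fun v => v - b) v hL ((hasFDerivAt_id v).sub_const b)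
    have h4 : HasFDerivAt h L v := h3.congr_of_eventuallyEq <| by
      filter_upwards [(isOpen_polydisc b s₁).mem_nhds hv] with w hw using hev w (hsub hw)
    rw [h4.fderiv, hLv]
    simp [Pi.single_apply]
  have h5 : DifferentiableAt ℂ (fun v => ev (MvPowerSeries.pderiv ℂ k F) (v - b)) u :=
    DifferentiableAt.comp (g := ev _) (f := fun v => v - b) u
      ((differentiableOn_ev hfin').differentiableAt ((isOpen_openPoly _).mem_nhds
        ((hmem u).2 hu₁))) (by fun_prop)
  exact (h5.congr_of_eventuallyEq (by
    filter_upwards [(isOpen_polydisc b s₁).mem_nhds hu₁] with w hw using hd w hw)).differentiableWithinAt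

end Solution

/-! ### Estimates for the normal form and for the solution of the cohomological equation -/

section Estimates

variable {n p l : ℕ} {lam : Fin l → Fin n → ℂ} {R : Fin p → Fin n →₀ ℕ}
  {a : Fin l → (Fin p → ℂ) → ℂ} {B : VF n p} {u : Fin p → ℂ} {m : ℕ} {U : Set (Fin p → ℂ)}
  {e : Fin l → Fin n} {r : ℝ}

theorem norm_le_normLinv (lam : Fin l → Fin n → ℂ) (e : Fin l → Fin n) (i j : Fin l) :
    ‖(minorL lam e)⁻¹ i j‖ ≤ normLinv lam e :=
  (le_ciSup (f := fun j => ‖(minorL lam e)⁻¹ i j‖) (Set.finite_range _).bddAbove j).trans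
    (le_ciSup (f := fun i => ⨆ j, ‖(minorL lam e)⁻¹ i j‖) (Set.finite_range _).bddAbove i)

theorem normLinv_pos (hl : 0 < l) (hL : IsUnit (minorL lam e).det) : 0 < normLinv lam e := by
  have h : (minorL lam e)⁻¹ ≠ 0 := fun h0 => by
    have h1 := Matrix.mul_nonsing_inv _ hL
    rw [h0, mul_zero] at h1
    have := congrFun (congrFun h1 ⟨0, hl⟩) ⟨0, hl⟩
    simp at this
  obtain ⟨i, hi⟩ := Function.ne_iff.1 h
  obtain ⟨j, hj⟩ := Function.ne_iff.1 hi
  exact (norm_pos_iff.2 hj).trans_le (norm_le_normLinv lam e i j)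

theorem coeff_linField (i : Fin n) : MvPowerSeries.coeff (Finsupp.single i 1)
    (linField lam a i : Ser n p) = fun u => ∑ j, a j u * lam j i :=
  MvPowerSeries.coeff_monomial_same _ _

/-- The `l` selected eigenvalues of the normal form are the image of `(a_j)` under the matrix `L`.
Regularity and bounds of the `a_j` can therefore be read off from the vector field. -/
theorem eq_sum_minor_inv (hL : IsUnit (minorL lam e).det) (j : Fin l) :
    a j = fun u => ∑ i, (∑ j', a j' u * lam j' (e i)) * (minorL lam e)⁻¹ i j := by
  ext u
  have h := Matrix.mul_nonsing_inv _ hL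
  have h1 : ∑ i, (∑ j', a j' u * lam j' (e i)) * (minorL lam e)⁻¹ i j =
      Matrix.vecMul (Matrix.vecMul (fun j => a j u) (minorL lam e)) (minorL lam e)⁻¹ j := by
    simp only [Matrix.vecMul, dotProduct, minorL, Matrix.of_apply]
  rw [h1, Matrix.vecMul_vecMul, h, Matrix.vecMul_one]

theorem differentiableOn_coeff_of_linField (hL : IsUnit (minorL lam e).det)
    (h : ∀ i Q, DifferentiableOn ℂ (MvPowerSeries.coeff Q (linField lam a i : Ser n p)) U)
    (j : Fin l) : DifferentiableOn ℂ (a j) U := by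
  rw [eq_sum_minor_inv (a := a) hL j]
  refine DifferentiableOn.fun_sum fun i _ => DifferentiableOn.mul_const ?_ _
  have := h (e i) (Finsupp.single (e i) 1)
  rwa [coeff_linField] at this

/-- The derivatives of the coefficients `a_j` of a normal form in the class are at most `1`. -/
theorem sum_supNorm_fderiv_le (hl : 0 < l) (hL : IsUnit (minorL lam e).det) (hU : IsOpen U)
    (ha : ∀ j, DifferentiableOn ℂ (a j) U) (hr : 1 / 2 < r)
    (h : vfDuNorm U r (linField lam a : VF n p) ≤ ENNReal.ofReal (1 / (2 * l * normLinv lam e)))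
    (j : Fin l) :
    ∑ k, supNorm U (fun u => fderiv ℂ (a j) u (Pi.single k 1)) ≤ 1 := by
  have hN := normLinv_pos hl hL
  set d : Fin n → Fin p → (Fin p → ℂ) → ℂ := fun i k u =>
    fderiv ℂ (fun u => ∑ j, a j u * lam j i) u (Pi.single k 1) with hd
  -- The norm of the field carries the weight `r` of the monomial `x_i`. Dividing by `r > 1/2` costs
  -- the factor `2` that the definition of the class provides; the remaining `1 / (l |L⁻¹|)`
  -- compensates the `l` entries of `L⁻¹`.
  have h1 : ∀ i, ∑ k, supNorm U (d i k) ≤ ENNReal.ofReal (1 / (l * normLinv lam e)) := by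
    intro i
    have h2 : (∑ k, supNorm U (d i k)) * ENNReal.ofReal r ≤
        ENNReal.ofReal (1 / (2 * l * normLinv lam e)) := by
      rw [Finset.sum_mul]
      refine le_trans (Finset.sum_le_sum fun k _ => ?_)
        ((le_iSup (fun i => ∑ k, serNorm U r (serDu k (linField lam a i : Ser n p))) i).trans h)
      have h3 := coeff_le_gnorm (ν := supNorm U) (w := fun _ => ENNReal.ofReal r)
        (Finsupp.single i 1) (serDu k (linField lam a i : Ser n p))
      rw [serNorm_eq]
      refine le_trans (le_of_eq ?_) h3
      rw [wmon_single, pow_one]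
      congr 2
      change _ = fun u => fderiv ℂ (MvPowerSeries.coeff (Finsupp.single i 1)
        (linField lam a i : Ser n p)) u (Pi.single k 1)
      rw [coeff_linField]
    calc ∑ k, supNorm U (d i k)
        = (∑ k, supNorm U (d i k)) * ENNReal.ofReal (1 / 2) * 2 := by
          rw [mul_assoc, show (2 : ℝ≥0∞) = ENNReal.ofReal 2 by simp,
            ← ENNReal.ofReal_mul (by norm_num)]
          norm_num
      _ ≤ ENNReal.ofReal (1 / (2 * l * normLinv lam e)) * 2 := by
          gcongr
          refine le_trans ?_ h2
          gcongr
      _ = ENNReal.ofReal (1 / (l * normLinv lam e)) := by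
          rw [show (2 : ℝ≥0∞) = ENNReal.ofReal 2 by simp, ← ENNReal.ofReal_mul (by positivity)]
          congr 1
          field_simp
  have h4 : ∀ k, ∀ u ∈ U, fderiv ℂ (a j) u (Pi.single k 1) =
      ∑ i, (minorL lam e)⁻¹ i j * d (e i) k u := by
    intro k u hu
    have hda : ∀ j, DifferentiableAt ℂ (a j) u := fun j => (ha j).differentiableAt (hU.mem_nhds hu)
    have hdc : ∀ i, DifferentiableAt ℂ (fun u => ∑ j', a j' u * lam j' (e i)) u := fun i =>
      DifferentiableAt.fun_sum fun j _ => (hda j).mul_const _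
    conv_lhs => rw [eq_sum_minor_inv (a := a) hL j]
    rw [fderiv_fun_sum fun i _ => (hdc i).mul_const _, sum_apply]
    refine Finset.sum_congr rfl fun i _ => ?_
    rw [fderiv_mul_const (hdc i)]
    rfl
  calc ∑ k, supNorm U (fun u => fderiv ℂ (a j) u (Pi.single k 1))
      ≤ ∑ k, ∑ i, ENNReal.ofReal (normLinv lam e) * supNorm U (d (e i) k) := by
        refine Finset.sum_le_sum fun k _ => iSup₂_le fun u hu => ?_
        beta_reduce
        rw [h4 k u hu]
        refine (enorm_sum_le _ _).trans (Finset.sum_le_sum fun i _ => ?_)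
        rw [enorm_mul]
        gcongr
        · rw [← ofReal_norm]
          exact ENNReal.ofReal_le_ofReal (norm_le_normLinv lam e i j)
        · exact le_supNorm hu _
    _ = ∑ i, ENNReal.ofReal (normLinv lam e) * ∑ k, supNorm U (d (e i) k) := by
        rw [Finset.sum_comm]
        simp only [Finset.mul_sum]
    _ ≤ ∑ i : Fin l, ENNReal.ofReal (normLinv lam e) *
          ENNReal.ofReal (1 / (l * normLinv lam e)) := by
        gcongr with i _
        exact h1 _
    _ = 1 := by
        rw [Finset.sum_const, Finset.card_univ, Fintype.card_fin, nsmul_eq_mul,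
          ← ENNReal.ofReal_mul hN.le, ← ENNReal.ofReal_natCast, ← ENNReal.ofReal_mul (by positivity),
          ← ENNReal.ofReal_one]
        congr 1
        field_simp

theorem norm_apply_le_sum (L : (Fin p → ℂ) →L[ℂ] ℂ) (v : Fin p → ℂ) :
    ‖L v‖ ≤ ‖v‖ * ∑ k, ‖L (Pi.single k 1)‖ := by
  have h : v = ∑ k, v k • (Pi.single k 1 : Fin p → ℂ) := by
    ext i
    simp [Pi.single_apply]
  conv_lhs => rw [h]
  rw [map_sum, Finset.mul_sum]
  refine (norm_sum_le _ _).trans (Finset.sum_le_sum fun k _ => ?_)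
  rw [map_smul, norm_smul]
  gcongr
  exact norm_le_pi_norm v k

theorem polydisc_eq_ball {b : Fin p → ℂ} {t : ℝ} (ht : 0 < t) :
    polydisc b t = Metric.ball b t := by
  ext u
  rw [Metric.mem_ball, dist_eq_norm, pi_norm_lt_iff ht]
  rfl

/-- The mean value inequality on the polydisc, which is a ball of the sup norm. The operator norm of
the derivative for this norm is controlled by the sum of the partial derivatives, hence by `1`. -/
theorem norm_sub_lt_of_fderiv {b : Fin p → ℂ} {t : ℝ} (ht : 0 < t) {h : (Fin p → ℂ) → ℂ}
    (hh : DifferentiableOn ℂ h (polydisc b t))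
    (hd : ∑ k, supNorm (polydisc b t) (fun u => fderiv ℂ h u (Pi.single k 1)) ≤ 1)
    (hu : u ∈ polydisc b t) : ‖h u - h b‖ ≤ t := by
  rw [polydisc_eq_ball ht] at *
  have h1 : ∀ v ∈ Metric.ball b t, ‖fderiv ℂ h v‖ ≤ 1 := by
    intro v hv
    refine ContinuousLinearMap.opNorm_le_bound _ zero_le_one fun x => ?_
    refine (norm_apply_le_sum _ x).trans ?_
    rw [one_mul]
    refine mul_le_of_le_one_right (norm_nonneg _) ?_
    have h2 : ∑ k, ‖fderiv ℂ h v (Pi.single k 1)‖ₑ ≤ 1 :=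
      (Finset.sum_le_sum fun k _ => le_supNorm hv
        fun u => fderiv ℂ h u (Pi.single k 1)).trans hd
    rw [← ENNReal.ofReal_one] at h2
    simp only [← ofReal_norm] at h2
    rw [← ENNReal.ofReal_sum_of_nonneg fun _ _ => norm_nonneg _] at h2
    exact (ENNReal.ofReal_le_ofReal_iff zero_le_one).1 h2
  have h3 := (convex_ball b t).norm_image_sub_le_of_norm_fderiv_le
    (fun x hx => hh.differentiableAt (Metric.isOpen_ball.mem_nhds hx)) h1
    (Metric.mem_ball_self ht) hu
  rw [one_mul] at h3
  exact h3.trans (by rw [← dist_eq_norm]; exact (Metric.mem_ball.1 hu).le)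

theorem norm_weight_le {Λ : ℝ} (hΛ : ∀ j i, ‖lam j i‖ ≤ Λ) {lo : ℕ} {α : Fin l → ℂ}
    (hα : α ∈ nonzeroWeights lam lo (2 * m)) (j : Fin l) : ‖α j‖ ≤ Λ * (2 * m + 1) := by
  obtain ⟨-, Q, i, -, hQ, rfl⟩ := mem_nonzeroWeights.1 hα
  have hΛ0 : 0 ≤ Λ := (norm_nonneg _).trans (hΛ j i)
  rw [weight]
  calc _ ≤ ‖∑ s, (Q s : ℂ) * lam j s‖ + ‖lam j i‖ := norm_sub_le _ _
    _ ≤ ∑ s, (Q s : ℝ) * Λ + Λ := by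
        refine add_le_add ((norm_sum_le _ _).trans (Finset.sum_le_sum fun s _ => ?_)) (hΛ j i)
        rw [norm_mul, Complex.norm_natCast]
        exact mul_le_mul_of_nonneg_left (hΛ j s) (Nat.cast_nonneg _)
    _ = Λ * (Q.degree + 1) := by
        rw [← Finset.sum_mul, Finsupp.degree_eq_sum]
        push_cast
        ring
    _ ≤ _ := by
        gcongr
        exact_mod_cast hQ

/-- The small divisors on the polydisc around a point where they are large. -/
theorem le_norm_smallDivisor {Λ γ' t : ℝ} (hΛ : ∀ j i, ‖lam j i‖ ≤ Λ) (ht : 0 < t)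
    {b : Fin p → ℂ} (ha : ∀ j, DifferentiableOn ℂ (a j) (polydisc b t))
    (hd : ∀ j, ∑ k, supNorm (polydisc b t) (fun u => fderiv ℂ (a j) u (Pi.single k 1)) ≤ 1)
    {lo : ℕ} {α : Fin l → ℂ} (hα : α ∈ nonzeroWeights lam lo (2 * m))
    (hb : γ' ≤ ‖smallDivisor a α b‖) (hu : u ∈ polydisc b t) :
    γ' - l * (t * (Λ * (2 * m + 1))) ≤ ‖smallDivisor a α u‖ := by
  have h1 : ‖smallDivisor a α u - smallDivisor a α b‖ ≤ l * (t * (Λ * (2 * m + 1))) := by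
    simp only [smallDivisor, ← Finset.sum_sub_distrib, ← sub_mul]
    refine (norm_sum_le _ _).trans ?_
    have : ∀ j ∈ Finset.univ, ‖(a j u - a j b) * α j‖ ≤ t * (Λ * (2 * m + 1)) := fun j _ => by
      rw [norm_mul]
      exact mul_le_mul (norm_sub_lt_of_fderiv ht (ha j) (hd j) hu) (norm_weight_le hΛ hα j)
        (norm_nonneg _) ht.le
    refine (Finset.sum_le_sum this).trans ?_
    rw [Finset.sum_const, Finset.card_univ, Fintype.card_fin, nsmul_eq_mul]
  have h2 := norm_sub_norm_le (smallDivisor a α b) (smallDivisor a α u)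
  rw [norm_sub_rev] at h2
  linarith

/-! ### The norm of the solution -/

/-- Each monomial of each component has one weight only, so the projections have disjoint supports
and their `ℓ¹` norms add up to at most the norm of the field. -/
theorem sum_serNorm_weightProj_le (t : Finset (Fin l → ℂ)) (i : Fin n) :
    ∑ α ∈ t, serNorm U r (weightProj lam α B i) ≤ serNorm U r (B i) := by
  classical
  simp only [serNorm_eq, gnorm]
  rw [← Summable.tsum_finsetSum fun _ _ => ENNReal.summable]
  refine ENNReal.tsum_le_tsum fun Q => ?_
  rw [← Finset.sum_mul]
  gcongr
  have h : ∀ α, supNorm U (MvPowerSeries.coeff Q (weightProj lam α B i)) =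
      if weight lam Q i = α then supNorm U (MvPowerSeries.coeff Q (B i)) else 0 := fun α => by
    rw [coeff_weightProj]
    split_ifs
    · rfl
    · exact (isSubmul_supNorm U).zero
  simp only [h, Finset.sum_ite_eq]
  split_ifs
  · exact le_rfl
  · exact zero_le

theorem serNorm_weightProj_le (α : Fin l → ℂ) (i : Fin n) :
    serNorm U r (weightProj lam α B i) ≤ serNorm U r (B i) := by
  simpa using sum_serNorm_weightProj_le (lam := lam) (B := B) (U := U) (r := r) {α} i

theorem supNorm_const_le (c : ℂ) : supNorm U (fun _ : Fin p → ℂ => c) ≤ ‖c‖ₑ :=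
  iSup₂_le fun _ _ => le_rfl

theorem serNorm_pderiv_monomial_le (hr : r ≤ 1) (Q : Fin n →₀ ℕ) (s : Fin n) :
    serNorm U r (MvPowerSeries.pderiv ((Fin p → ℂ) → ℂ) s
      (MvPowerSeries.monomial Q 1 : Ser n p)) ≤ Q s := by
  classical
  by_cases hQ : Q s = 0
  · have : MvPowerSeries.pderiv ((Fin p → ℂ) → ℂ) s (MvPowerSeries.monomial Q 1 : Ser n p) = 0 := by
      ext1 Q'
      rw [MvPowerSeries.coeff_pderiv, MvPowerSeries.coeff_monomial, if_neg, zero_mul, map_zero]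
      rintro rfl
      simp at hQ
    rw [this, serNorm_eq, gnorm_zero (isSubmul_supNorm U)]
    exact zero_le
  · have hle : Finsupp.single s 1 ≤ Q := by
      rw [Finsupp.single_le_iff]; omega
    obtain ⟨Q', rfl⟩ := exists_add_of_le hle
    have : MvPowerSeries.pderiv ((Fin p → ℂ) → ℂ) s
        (MvPowerSeries.monomial (Finsupp.single s 1 + Q') 1 : Ser n p) =
        MvPowerSeries.monomial Q' (fun _ => ((Q' s + 1 : ℕ) : ℂ)) := by
      ext1 Q''
      rw [MvPowerSeries.coeff_pderiv, MvPowerSeries.coeff_monomial, MvPowerSeries.coeff_monomial,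
        add_comm (Finsupp.single s 1) Q']
      by_cases h : Q'' = Q'
      · subst h
        rw [if_pos rfl, if_pos rfl]
        ext u
        simp
      · rw [if_neg h, if_neg (fun h' => h (add_right_cancel h')), zero_mul]
    rw [this, serNorm_eq, gnorm_monomial (isSubmul_supNorm U)]
    calc _ ≤ ‖((Q' s + 1 : ℕ) : ℂ)‖ₑ * 1 := by
          refine mul_le_mul' (supNorm_const_le _) ?_
          rw [wmon_const]
          exact pow_le_one₀ zero_le (ENNReal.ofReal_le_one.2 hr)
      _ = _ := by
          rw [mul_one, ← ofReal_norm, Complex.norm_natCast, ENNReal.ofReal_natCast,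
            Finsupp.add_apply, Finsupp.single_eq_same, add_comm]

theorem serNorm_opD_le {Λ : ℝ} (hΛ0 : 0 ≤ Λ) (hΛ : ∀ j i, ‖lam j i‖ ≤ Λ) (hr : r ≤ 1)
    (hd : ∀ j, ∑ k, supNorm U (fun u => fderiv ℂ (a j) u (Pi.single k 1)) ≤ 1)
    (V : VF n p) (i : Fin n) : serNorm U r (opD lam R a V i) ≤
      ENNReal.ofReal (l * Λ * ∑ k, (R k).degree) * ∑ s, serNorm U r (V s) := by
  have hν := isSubmul_supNorm U
  set C : ℝ≥0∞ := ((∑ k, (R k).degree : ℕ) : ℝ≥0∞) with hC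
  have hCs : ∀ k s, (R k s : ℝ≥0∞) ≤ C := fun k s => by
    rw [hC]
    refine Nat.cast_le.2 (le_trans ?_ (Finset.single_le_sum (f := fun k => (R k).degree)
      (fun _ _ => Nat.zero_le _) (Finset.mem_univ k)))
    rw [Finsupp.degree_eq_sum]
    exact Finset.single_le_sum (f := fun s => R k s) (fun _ _ => Nat.zero_le _) (Finset.mem_univ s)
  have h1 : ∀ k, serNorm U r ((∑ s, MvPowerSeries.pderiv ((Fin p → ℂ) → ℂ) s
      (MvPowerSeries.monomial (R k) 1) * V s) * MvPowerSeries.X i) ≤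
      C * ∑ s, serNorm U r (V s) := fun k => by
    rw [serNorm_eq]
    refine (gnorm_mul_le hν _ _).trans ?_
    have hX : gnorm (supNorm U) (fun _ => ENNReal.ofReal r)
        (MvPowerSeries.X i : Ser n p) ≤ 1 := by
      rw [MvPowerSeries.X, gnorm_monomial hν, wmon_single, pow_one]
      exact mul_le_one' ((supNorm_const_le 1).trans (by simp)) (ENNReal.ofReal_le_one.2 hr)
    refine (mul_le_mul' (gnorm_sum_le hν _ _) hX).trans ?_
    rw [mul_one, Finset.mul_sum]
    refine Finset.sum_le_sum fun s _ => (gnorm_mul_le hν _ _).trans ?_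
    simp only [← serNorm_eq]
    gcongr
    exact (serNorm_pderiv_monomial_le hr _ _).trans (hCs k s)
  rw [serNorm_eq, opD]
  refine (gnorm_sum_le hν _ _).trans ?_
  have h2 : ∀ j, gnorm (supNorm U) (fun _ => ENNReal.ofReal r)
      (∑ k, (fun u => fderiv ℂ (a j) u (Pi.single k 1) * lam j i) •
      ((∑ s, MvPowerSeries.pderiv ((Fin p → ℂ) → ℂ) s (MvPowerSeries.monomial (R k) 1) * V s) *
      MvPowerSeries.X i) : Ser n p) ≤ ENNReal.ofReal Λ * (C * ∑ s, serNorm U r (V s)) := fun j => by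
    refine (gnorm_sum_le hν _ _).trans ?_
    calc _ ≤ ∑ k, (supNorm U (fun u => fderiv ℂ (a j) u (Pi.single k 1)) * ENNReal.ofReal Λ) *
          (C * ∑ s, serNorm U r (V s)) := by
          refine Finset.sum_le_sum fun k _ => (gnorm_smul_le hν _ _).trans ?_
          refine mul_le_mul' (iSup₂_le fun u hu => ?_) ((serNorm_eq U r _).symm.le.trans (h1 k))
          rw [enorm_mul]
          gcongr
          · exact le_supNorm hu fun u => fderiv ℂ (a j) u (Pi.single k 1)
          · rw [← ofReal_norm]
            exact ENNReal.ofReal_le_ofReal (hΛ j i)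
      _ = (∑ k, supNorm U (fun u => fderiv ℂ (a j) u (Pi.single k 1))) *
          (ENNReal.ofReal Λ * (C * ∑ s, serNorm U r (V s))) := by
          rw [Finset.sum_mul]
          exact Finset.sum_congr rfl fun k _ => by ring
      _ ≤ 1 * (ENNReal.ofReal Λ * (C * ∑ s, serNorm U r (V s))) := by
          gcongr
          exact hd j
      _ = _ := one_mul _
  refine (Finset.sum_le_sum fun j _ => h2 j).trans (le_of_eq ?_)
  rw [Finset.sum_const, Finset.card_univ, Fintype.card_fin, nsmul_eq_mul, hC,
    ENNReal.ofReal_mul (by positivity), ENNReal.ofReal_mul (by positivity), ENNReal.ofReal_natCast,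
    ENNReal.ofReal_natCast]
  ring

theorem serNorm_cohomSol_le {Λ A₀ : ℝ} (hΛ0 : 0 ≤ Λ) (hΛ : ∀ j i, ‖lam j i‖ ≤ Λ) (hr : r ≤ 1)
    (hd : ∀ j, ∑ k, supNorm U (fun u => fderiv ℂ (a j) u (Pi.single k 1)) ≤ 1) (hA₀ : 0 < A₀)
    {α : Fin l → ℂ} (hA : ∀ u ∈ U, A₀ ≤ ‖smallDivisor a α u‖) (i : Fin n) :
    serNorm U r (cohomSol lam R a B α i) ≤
      ENNReal.ofReal A₀⁻¹ * serNorm U r (weightProj lam α B i) + ENNReal.ofReal A₀⁻¹ ^ 2 *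
      (ENNReal.ofReal (l * Λ * ∑ k, (R k).degree) *
        ∑ s, serNorm U r (weightProj lam α B s)) := by
  have hν := isSubmul_supNorm U
  have hinv : supNorm U (smallDivisor a α)⁻¹ ≤ ENNReal.ofReal A₀⁻¹ := iSup₂_le fun u hu => by
    rw [Pi.inv_apply, ← ofReal_norm, norm_inv]
    exact ENNReal.ofReal_le_ofReal (inv_anti₀ hA₀ (hA u hu))
  rw [cohomSol, serNorm_eq, gnorm_neg hν]
  refine (gnorm_add_le hν _ _).trans (add_le_add ((gnorm_smul_le hν _ _).trans ?_)
    ((gnorm_smul_le hν _ _).trans ?_))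
  · rw [← serNorm_eq]
    gcongr
  · rw [← serNorm_eq]
    refine mul_le_mul' ?_ (serNorm_opD_le hΛ0 hΛ hr hd _ i)
    rw [pow_two, pow_two]
    exact (hν.mul_le _ _).trans (mul_le_mul' hinv hinv)

/-- The sum over the weights is taken before the norm of `B` is inserted, so the number of weights
does not enter. The factor `n` comes from the components of `V` in `Dπ · V`. The square of the
inverse divisor comes from the nilpotent part `D_m`. -/
theorem serNorm_normalizingU_le {Λ A₀ : ℝ} (hΛ0 : 0 ≤ Λ) (hΛ : ∀ j i, ‖lam j i‖ ≤ Λ) (hr : r ≤ 1)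
    (hd : ∀ j, ∑ k, supNorm U (fun u => fderiv ℂ (a j) u (Pi.single k 1)) ≤ 1) (hA₀ : 0 < A₀)
    (hA : ∀ α ∈ nonzeroWeights lam (m + 1) (2 * m), ∀ u ∈ U, A₀ ≤ ‖smallDivisor a α u‖)
    (i : Fin n) : serNorm U r (normalizingU lam R a m B i) ≤
      ENNReal.ofReal (A₀⁻¹ + A₀⁻¹ ^ 2 * (l * Λ * (∑ k, (R k).degree) * n)) * vfNorm U r B := by
  have hν := isSubmul_supNorm U
  have hM : ∀ i, serNorm U r (B i) ≤ vfNorm U r B := le_iSup fun i => serNorm U r (B i)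
  rw [normalizingU, Finset.sum_apply, serNorm_eq]
  refine (gnorm_sum_le hν _ _).trans ?_
  simp only [← serNorm_eq]
  refine (Finset.sum_le_sum fun α hα =>
    serNorm_cohomSol_le hΛ0 hΛ hr hd hA₀ (hA α hα) i).trans ?_
  rw [Finset.sum_add_distrib, ← Finset.mul_sum, ← Finset.mul_sum, ← Finset.mul_sum,
    Finset.sum_comm]
  have h1 : ∑ s, ∑ α ∈ nonzeroWeights lam (m + 1) (2 * m), serNorm U r (weightProj lam α B s) ≤
      n * vfNorm U r B := by
    refine (Finset.sum_le_sum fun s _ => (sum_serNorm_weightProj_le _ s).trans (hM s)).trans ?_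
    rw [Finset.sum_const, Finset.card_univ, Fintype.card_fin, nsmul_eq_mul]
  refine (add_le_add (mul_le_mul_right ((sum_serNorm_weightProj_le _ i).trans (hM i)) _)
    (mul_le_mul_right (mul_le_mul_right h1 _) _)).trans (le_of_eq ?_)
  have hp : (0 : ℝ) ≤ l * Λ * ((∑ k, (R k).degree : ℕ) : ℝ) := by positivity
  generalize (l * Λ * ((∑ k, (R k).degree : ℕ) : ℝ)) = C at hp ⊢
  rw [ENNReal.ofReal_add (by positivity) (by positivity), add_mul,
    ENNReal.ofReal_mul (by positivity), ENNReal.ofReal_mul hp, ENNReal.ofReal_natCast,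
    ENNReal.ofReal_pow (by positivity)]
  ring

/-- Gain for series of order at least `N` in `x`. -/
theorem serNorm_mul_le {θ : ℝ} (hθ0 : 0 ≤ θ) (hθ : θ ≤ 1) {f : Ser n p} {N : ℕ}
    (hf : ∀ Q : Fin n →₀ ℕ, Q.degree < N → ∀ u ∈ U, MvPowerSeries.coeff Q f u = 0) :
    serNorm U (θ * r) f ≤ ENNReal.ofReal θ ^ N * serNorm U r f := by
  rw [serNorm, serNorm, ← ENNReal.tsum_mul_left]
  refine ENNReal.tsum_le_tsum fun Q => ?_
  rcases lt_or_ge Q.degree N with h | h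
  · have : (⨆ u ∈ U, ‖MvPowerSeries.coeff Q f u‖ₑ) = 0 := by
      refine le_antisymm (iSup₂_le fun u hu => ?_) zero_le
      rw [hf Q h u hu, enorm_zero]
    rw [this, zero_mul, zero_mul, mul_zero]
  · rw [ENNReal.ofReal_mul hθ0, mul_pow, mul_left_comm]
    gcongr ?_ * _
    exact pow_le_pow_of_le_one zero_le (ENNReal.ofReal_le_one.2 hθ) h

end Estimates

/-! ### Restriction to `Σ` -/

section Restriction

variable {n p : ℕ} {R : Fin p → Fin n →₀ ℕ} {τ : (Fin n →₀ ℕ) → Fin p → ℕ} {f : Ser n p}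
  {U : Set (Fin p → ℂ)} {ρ : ℝ}

/-- The exponent of `(x^R)^s x^{Q'}`. -/
def joinExp (R : Fin p → Fin n →₀ ℕ) (q : (Fin n →₀ ℕ) × (Fin p → ℕ)) : Fin n →₀ ℕ :=
  q.1 + ∑ k, q.2 k • R k

open Classical in
/-- The terms of the coefficients of the restriction to `Σ`. -/
def restrictTerm (R : Fin p → Fin n →₀ ℕ) (τ : (Fin n →₀ ℕ) → Fin p → ℕ) (f : Ser n p)
    (q : (Fin n →₀ ℕ) × (Fin p → ℕ)) (u : Fin p → ℂ) : ℂ :=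
  if τ (joinExp R q) = q.2 then
    MvPowerSeries.coeff (joinExp R q) f u * ∏ k, u k ^ q.2 k
  else 0

theorem coeff_restrictSigma (Q' : Fin n →₀ ℕ) :
    MvPowerSeries.coeff Q' (restrictSigma R τ f) = fun u => ∑' s, restrictTerm R τ f (Q', s) u :=
  rfl

theorem degree_joinExp (q : (Fin n →₀ ℕ) × (Fin p → ℕ)) :
    (joinExp R q).degree = q.1.degree + ∑ k, (R k).degree * q.2 k := by
  simp [joinExp, mul_comm]

/-- Among the pairs compatible with the chosen factorization, the product monomial determines `s`
through `τ`, and then `Q'`. So no monomial of `f` is counted twice. -/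
theorem injOn_joinExp : Set.InjOn (joinExp R) {q | τ (joinExp R q) = q.2} := by
  intro q hq q' hq' h
  have h2 : q.2 = q'.2 := by
    rw [← hq.out, ← hq'.out, h]
  have h1 : q.1 = q'.1 := by
    simp only [joinExp, h2] at h
    exact add_right_cancel h
  exact Prod.ext h1 h2

theorem supNorm_restrictTerm_le (hU : ∀ u ∈ U, ∀ k, ‖u k‖ ≤ ρ ^ (R k).degree) (hρ : 0 ≤ ρ)
    (q : (Fin n →₀ ℕ) × (Fin p → ℕ)) :
    supNorm U (restrictTerm R τ f q) * ENNReal.ofReal ρ ^ q.1.degree ≤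
      Set.indicator {q | τ (joinExp R q) = q.2} (fun q =>
        supNorm U (MvPowerSeries.coeff (joinExp R q) f) *
          ENNReal.ofReal ρ ^ (joinExp R q).degree) q := by
  classical
  by_cases h : τ (joinExp R q) = q.2
  · rw [Set.indicator_of_mem (by exact h), degree_joinExp, pow_add,
      mul_comm (ENNReal.ofReal ρ ^ q.1.degree), ← mul_assoc]
    gcongr
    refine iSup₂_le fun u hu => ?_
    rw [restrictTerm, if_pos h, enorm_mul]
    gcongr
    · exact le_supNorm hu _
    · rw [← ofReal_norm, ← ENNReal.ofReal_pow hρ, norm_prod]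
      refine ENNReal.ofReal_le_ofReal ?_
      rw [← Finset.prod_pow_eq_pow_sum]
      refine Finset.prod_le_prod (fun _ _ => norm_nonneg _) fun k _ => ?_
      rw [norm_pow, pow_mul]
      exact pow_le_pow_left₀ (norm_nonneg _) (hU u hu k) _
  · rw [Set.indicator_of_notMem (by exact h)]
    have : supNorm U (restrictTerm R τ f q) = 0 := by
      refine le_antisymm (iSup₂_le fun u _ => ?_) zero_le
      rw [restrictTerm, if_neg h, enorm_zero]
    rw [this, zero_mul]

/-- The terms of the restriction are a rearrangement of terms of `f`. Under `‖u_k‖ ≤ ρ^{|R_k|}` the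
factor `u^s` is bounded by the weight of the monomial `(x^R)^s` that it replaces. -/
theorem tsum_restrictTerm_le (hU : ∀ u ∈ U, ∀ k, ‖u k‖ ≤ ρ ^ (R k).degree) (hρ : 0 ≤ ρ) :
    ∑' (Q' : Fin n →₀ ℕ) (s : Fin p → ℕ), supNorm U (restrictTerm R τ f (Q', s)) *
      ENNReal.ofReal ρ ^ Q'.degree ≤ serNorm U ρ f := by
  rw [← ENNReal.tsum_prod' (f := fun q : (Fin n →₀ ℕ) × (Fin p → ℕ) =>
    supNorm U (restrictTerm R τ f q) * ENNReal.ofReal ρ ^ q.1.degree)]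
  refine (ENNReal.tsum_le_tsum (supNorm_restrictTerm_le hU hρ)).trans ?_
  rw [← tsum_subtype]
  exact ENNReal.tsum_comp_le_tsum_of_injective
    (f := fun q : {q : (Fin n →₀ ℕ) × (Fin p → ℕ) | τ (joinExp R q) = q.2} => joinExp R q)
    (injOn_joinExp.injective) (fun Q => supNorm U (MvPowerSeries.coeff Q f) *
      ENNReal.ofReal ρ ^ Q.degree)

theorem serNorm_restrictSigma_le (hU : ∀ u ∈ U, ∀ k, ‖u k‖ ≤ ρ ^ (R k).degree) (hρ : 0 ≤ ρ) :
    serNorm U ρ (restrictSigma R τ f) ≤ serNorm U ρ f := by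
  refine le_trans ?_ (tsum_restrictTerm_le (τ := τ) hU hρ)
  refine ENNReal.tsum_le_tsum fun Q' => ?_
  rw [ENNReal.tsum_mul_right]
  gcongr
  refine iSup₂_le fun u hu => ?_
  rw [coeff_restrictSigma]
  exact (enorm_tsum_le _).trans (ENNReal.tsum_le_tsum fun s => le_supNorm hu _)

theorem tsum_supNorm_restrictTerm_ne_top (hU : ∀ u ∈ U, ∀ k, ‖u k‖ ≤ ρ ^ (R k).degree)
    (hρ : 0 < ρ) (hf : serNorm U ρ f ≠ ⊤) (Q' : Fin n →₀ ℕ) :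
    ∑' s : Fin p → ℕ, supNorm U (restrictTerm R τ f (Q', s)) ≠ ⊤ := by
  have h := ENNReal.ne_top_of_tsum_ne_top
    (ne_top_of_le_ne_top hf (tsum_restrictTerm_le (τ := τ) hU hρ.le)) Q'
  rw [ENNReal.tsum_mul_right] at h
  intro htop
  apply h
  rw [htop, ENNReal.top_mul]
  exact pow_ne_zero _ (by simpa using hρ)

theorem holSer_restrictSigma (hUo : IsOpen U) (hU : ∀ u ∈ U, ∀ k, ‖u k‖ ≤ ρ ^ (R k).degree)
    (hρ : 0 < ρ) (hf : serNorm U ρ f ≠ ⊤) (hh : HolSer U f) :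
    HolSer U (restrictSigma R τ f) := fun Q' => by
  classical
  rw [coeff_restrictSigma]
  refine differentiableOn_tsum_of_supNorm hUo (fun s => ?_)
    (tsum_supNorm_restrictTerm_ne_top hU hρ hf Q')
  unfold restrictTerm
  by_cases h : τ (joinExp R (Q', s)) = s
  · simp only [h, if_true]
    exact (hh _).mul (Differentiable.differentiableOn (by fun_prop))
  · simp only [h, if_false]
    exact differentiableOn_const 0

/-- On `Σ`, a series and its restriction have the same values. -/
theorem serEval_restrictSigma (hτ : IsReduction R τ)
    (hU : ∀ u ∈ U, ∀ k, ‖u k‖ ≤ ρ ^ (R k).degree) (hρ : 0 < ρ) (hf : serNorm U ρ f ≠ ⊤)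
    {z : (Fin n → ℂ) × (Fin p → ℂ)} (hz1 : z.1 ∈ polydisc 0 ρ) (hz2 : z.2 ∈ U)
    (hz : z ∈ graphSigma R) : serEval (restrictSigma R τ f) z = serEval f z := by
  classical
  have hz1' : ∀ i, ‖z.1 i‖ₑ ≤ ENNReal.ofReal ρ := fun i =>
    (enorm_lt_ofReal.2 (by simpa using hz1 i)).le
  have hfz : wnorm (fun i => ‖z.1 i‖ₑ) (serAt z.2 f) ≠ ⊤ :=
    ne_top_of_le_ne_top hf ((gnorm_mono hz1' _).trans (wnorm_serAt_le hz2 ρ f))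
  have h1 : HasSum (fun Q => MvPowerSeries.coeff Q f z.2 * wmon z.1 Q) (serEval f z) :=
    hasSum_ev hfz
  -- `j` records the chosen factorization of each monomial. It is injective, and the terms off its
  -- range are zero, so on `Σ` the sum over pairs `(Q', s)` is the sum over `Q`.
  set j : (Fin n →₀ ℕ) → (Fin n →₀ ℕ) × (Fin p → ℕ) := fun Q => ((hτ Q).choose, τ Q) with hj
  have hjoin : ∀ Q, joinExp R (j Q) = Q := fun Q => (hτ Q).choose_spec.1.symm
  have hinj : Function.Injective j := fun Q Q' h => by rw [← hjoin Q, h, hjoin]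
  have hmon : ∀ q : (Fin n →₀ ℕ) × (Fin p → ℕ),
      wmon z.1 (joinExp R q) = (∏ k, z.2 k ^ q.2 k) * wmon z.1 q.1 := by
    intro q
    rw [joinExp, wmon_add, mul_comm]
    congr 1
    have hu : ∀ k, z.2 k = wmon z.1 (R k) := fun k => congrFun (hz : z.2 = piMap R z.1) k
    simp only [hu, wmon, Finsupp.coe_finsetSum, Finset.sum_apply, Finsupp.smul_apply,
      smul_eq_mul, ← Finset.prod_pow, ← pow_mul]
    rw [Finset.prod_comm]
    refine Finset.prod_congr rfl fun i _ => ?_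
    rw [Finset.prod_pow_eq_pow_sum]
    simp only [mul_comm]
  have h2 : HasSum (fun q => restrictTerm R τ f q z.2 * wmon z.1 q.1) (serEval f z) := by
    rw [← hinj.hasSum_iff]
    · refine h1.congr_fun fun Q => ?_
      simp only [Function.comp_apply, restrictTerm, hjoin]
      rw [if_pos rfl]
      conv_rhs => rw [← hjoin Q, hmon]
      rw [hjoin]
      ring
    · intro q hq
      have : τ (joinExp R q) ≠ q.2 := fun h => hq ⟨joinExp R q, by
        refine injOn_joinExp (R := R) (τ := τ) ?_ h (hjoin _)
        change τ (joinExp R (j (joinExp R q))) = (j (joinExp R q)).2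
        rw [hjoin]⟩
      rw [restrictTerm, if_neg this, zero_mul]
  have h3 : ∀ Q', HasSum (fun s => restrictTerm R τ f (Q', s) z.2 * wmon z.1 Q')
      (MvPowerSeries.coeff Q' (restrictSigma R τ f) z.2 * wmon z.1 Q') := by
    intro Q'
    rw [coeff_restrictSigma]
    refine (Summable.hasSum ?_).mul_right _
    exact summable_of_tsum_enorm_ne_top (ne_top_of_le_ne_top
      (tsum_supNorm_restrictTerm_ne_top hU hρ hf Q')
      (ENNReal.tsum_le_tsum fun s => le_supNorm hz2 _))
  rw [serEval_eq]
  exact (h2.prod_fiberwise h3).tsum_eq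

end Restriction

/-! ### Slices of power series at a fixed parameter -/

section Slices

variable {n p l : ℕ} {R : Fin p → Fin n →₀ ℕ} {b u : Fin p → ℂ} {F G : FS n p}
  {f g : MvPowerSeries (Fin n) ℂ} {z : (Fin n → ℂ) × (Fin p → ℂ)} {w w' : Fin n ⊕ Fin p → ℝ≥0∞}

/-- `g` is the series in `x` obtained from `F` at the parameter `u`. -/
def IsSlice (b : Fin p → ℂ) (F : FS n p) (u : Fin p → ℂ) (g : MvPowerSeries (Fin n) ℂ) : Prop :=
  ∀ Q, HasSum (fun β => MvPowerSeries.coeff (pair Q β) F * wmon (u - b) β)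
    (MvPowerSeries.coeff Q g)

theorem IsRep.isSlice {s t : ℝ} {h : Ser n p} (hF : IsRep b s t h F) (hu : u ∈ polydisc b s) :
    IsSlice b F u (serAt u h) := fun Q => hF.hasSum Q u hu

theorem IsSlice.pderiv (h : IsSlice b F u g) (i : Fin n) :
    IsSlice b (MvPowerSeries.pderiv ℂ (Sum.inl i) F) u (MvPowerSeries.pderiv ℂ i g) := by
  intro Q
  rw [MvPowerSeries.coeff_pderiv]
  refine ((h (Q + Finsupp.single i 1)).mul_right _).congr_fun fun β => ?_
  have e : pair Q β + Finsupp.single (Sum.inl i) 1 = pair (Q + Finsupp.single i 1) β := by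
    ext s
    cases s with
    | inl j => simp [Finsupp.single_apply]
    | inr k => simp
  rw [MvPowerSeries.coeff_pderiv, e, pair_inl]
  ring

theorem IsSlice.ev_eq (h : IsSlice b F z.2 g) (hF : wnorm (fun i => ‖pt b z i‖ₑ) F ≠ ⊤) :
    ev F (pt b z) = ev g z.1 :=
  ev_pt_eq_tsum hF h

theorem IsSlice.wnorm_le (h : IsSlice b F z.2 g) :
    wnorm (fun i => ‖z.1 i‖ₑ) g ≤ wnorm (fun i => ‖pt b z i‖ₑ) F := by
  rw [wnorm, wnorm, gnorm, gnorm, tsum_pair]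
  refine ENNReal.tsum_le_tsum fun Q => ?_
  rw [← (h Q).tsum_eq]
  refine (mul_le_mul_left (enorm_tsum_le _) _).trans ?_
  rw [← ENNReal.tsum_mul_right]
  refine ENNReal.tsum_le_tsum fun β => ?_
  rw [wmon_pair, enorm_mul, enorm_wmon]
  change _ ≤ _ * (wmon (fun i => ‖z.1 i‖ₑ) Q * wmon (fun k => ‖(z.2 - b) k‖ₑ) β)
  rw [mul_assoc, mul_comm (wmon _ β)]

theorem resMon_xvar_eq (k : Fin p) :
    (resMon R k xvar : FS n p) = MvPowerSeries.monomial (pair (R k) 0) 1 := by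
  have h : ∀ γ : Fin n ⊕ Fin p →₀ ℕ, (MvPowerSeries.monomial γ (1 : ℂ) : FS n p) =
      wmon MvPowerSeries.X γ := by
    intro γ
    rw [MvPowerSeries.monomial_one_eq, finsuppProd_eq_wmon]
  rw [h, wmon_pair, wmon_zero, mul_one]
  rfl

theorem isSlice_resMon (k : Fin p) : IsSlice b (resMon R k xvar) u (rmon R k) := by
  classical
  intro Q
  rw [resMon_xvar_eq, rmon, MvPowerSeries.coeff_monomial]
  have hp : ∀ β : Fin p →₀ ℕ, pair Q β = pair (R k) 0 ↔ Q = R k ∧ β = 0 := fun β => by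
    rw [pair, pair, Equiv.apply_eq_iff_eq, Prod.mk.injEq]
  have e : ∀ β : Fin p →₀ ℕ, MvPowerSeries.coeff (pair Q β)
      (MvPowerSeries.monomial (pair (R k) 0) (1 : ℂ) : FS n p) * wmon (u - b) β =
      if β = 0 then (if Q = R k then 1 else 0) else 0 := fun β => by
    rw [MvPowerSeries.coeff_monomial]
    simp only [hp]
    by_cases hQ : Q = R k <;> by_cases hβ : β = 0 <;> simp [hQ, hβ]
  simp only [e]
  exact hasSum_ite_eq 0 _

theorem wnorm_resMon_ne_top (hw : ∀ s, w s ≠ ⊤) (k : Fin p) :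
    wnorm w (resMon R k xvar : FS n p) ≠ ⊤ := by
  rw [resMon_xvar_eq, wnorm, gnorm_monomial isSubmul_enorm]
  refine ENNReal.mul_ne_top (by simp) ?_
  exact ENNReal.prod_ne_top fun s _ => ENNReal.pow_ne_top (hw s)

theorem wnorm_pderiv_resMon_ne_top (hw : ∀ s, w s ≠ ⊤) (s : Fin n) (k : Fin p) :
    wnorm w (MvPowerSeries.pderiv ℂ (Sum.inl s) (resMon R k xvar : FS n p)) ≠ ⊤ :=
  wnorm_pderiv_ne_top (w' := fun i => w i + 1) (fun _ => le_self_add)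
    (ENNReal.lt_add_right (hw _) one_ne_zero)
    (wnorm_resMon_ne_top (fun i => ENNReal.add_ne_top.2 ⟨hw i, ENNReal.one_ne_top⟩) k)

theorem wnorm_smul_ne_top {σ : Type*} [Fintype σ] {w : σ → ℝ≥0∞} {h : MvPowerSeries σ ℂ} (c : ℂ)
    (hh : wnorm w h ≠ ⊤) : wnorm w (c • h) ≠ ⊤ :=
  ne_top_of_le_ne_top (ENNReal.mul_ne_top (by simp) hh) (gnorm_smul_le isSubmul_enorm c h)

theorem wnorm_X_ne_top (x : Fin n → ℂ) (i : Fin n) :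
    wnorm (fun i => ‖x i‖ₑ) (MvPowerSeries.X i : MvPowerSeries (Fin n) ℂ) ≠ ⊤ := by
  rw [wnorm_X]
  simp

theorem ev_adOp {x : Fin n → ℂ} {U : Fin n → MvPowerSeries (Fin n) ℂ} {i : Fin n}
    (hU : ∀ s, wnorm (fun i => ‖x i‖ₑ) (U s) ≠ ⊤)
    (hdU : ∀ s, wnorm (fun i => ‖x i‖ₑ) (MvPowerSeries.pderiv ℂ s (U i)) ≠ ⊤) (c : Fin n → ℂ) :
    ev (adOp c U i) x = c i * ev (U i) x -
      ∑ s, c s * (x s * ev (MvPowerSeries.pderiv ℂ s (U i)) x) := by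
  have hm : ∀ s, wnorm (fun i => ‖x i‖ₑ)
      (MvPowerSeries.X s * MvPowerSeries.pderiv ℂ s (U i)) ≠ ⊤ := fun s =>
    wnorm_mul_ne_top (wnorm_X_ne_top x s) (hdU s)
  rw [adOp, ev_sub (wnorm_smul_ne_top _ (hU i)) (wnorm_sum_ne_top fun s _ =>
    wnorm_smul_ne_top _ (hm s)), ev_smul, ev_sum fun s _ => wnorm_smul_ne_top _ (hm s)]
  simp only [ev_smul]
  congr 1
  refine Finset.sum_congr rfl fun s _ => ?_
  rw [ev_mul (wnorm_X_ne_top x s) (hdU s), ev_X]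

theorem ev_duOp {x : Fin n → ℂ} {U : Fin n → MvPowerSeries (Fin n) ℂ} {i : Fin n}
    (hU : ∀ s, wnorm (fun i => ‖x i‖ₑ) (U s) ≠ ⊤)
    (hπ : ∀ s k, wnorm (fun i => ‖x i‖ₑ) (MvPowerSeries.pderiv ℂ s (rmon R k)) ≠ ⊤)
    (d : Fin n → Fin p → ℂ) :
    ev (duOp R d U i) x =
      ∑ k, d i k * ((∑ s, ev (MvPowerSeries.pderiv ℂ s (rmon R k)) x * ev (U s) x) * x i) := by
  have hm : ∀ k, wnorm (fun i => ‖x i‖ₑ)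
      (∑ s, MvPowerSeries.pderiv ℂ s (rmon R k) * U s) ≠ ⊤ := fun k =>
    wnorm_sum_ne_top fun s _ => wnorm_mul_ne_top (hπ s k) (hU s)
  rw [duOp, ev_sum fun k _ => wnorm_smul_ne_top _ (wnorm_mul_ne_top (hm k) (wnorm_X_ne_top x i))]
  refine Finset.sum_congr rfl fun k _ => ?_
  rw [ev_smul, ev_mul (hm k) (wnorm_X_ne_top x i), ev_X,
    ev_sum fun s _ => wnorm_mul_ne_top (hπ s k) (hU s)]
  congr 2
  exact Finset.sum_congr rfl fun s _ => ev_mul (hπ s k) (hU s)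

/-! ### Derivatives -/

/-- The derivative of `(x, u) ↦ (x, u - b)`. -/
def ptL : ((Fin n → ℂ) × (Fin p → ℂ)) →L[ℂ] (Fin n ⊕ Fin p → ℂ) :=
  ContinuousLinearMap.pi (Sum.elim
    (fun i => (ContinuousLinearMap.proj i).comp (ContinuousLinearMap.fst ℂ _ _))
    fun k => (ContinuousLinearMap.proj k).comp (ContinuousLinearMap.snd ℂ _ _))

theorem hasFDerivAt_pt : HasFDerivAt (pt b) ptL z := by
  rw [hasFDerivAt_pi']
  intro s
  cases s with
  | inl i => exact (ContinuousLinearMap.hasFDerivAt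
      ((ContinuousLinearMap.proj i).comp (ContinuousLinearMap.fst ℂ (Fin n → ℂ) (Fin p → ℂ))))
  | inr k => exact (ContinuousLinearMap.hasFDerivAt
      ((ContinuousLinearMap.proj k).comp
        (ContinuousLinearMap.snd ℂ (Fin n → ℂ) (Fin p → ℂ)))).sub_const (b k)

theorem hasFDerivAt_ev_pt (hF : wnorm w F ≠ ⊤) (hz : pt b z ∈ openPoly w) :
    ∃ L : ((Fin n → ℂ) × (Fin p → ℂ)) →L[ℂ] ℂ,
      HasFDerivAt (fun z => ev F (pt b z)) L z ∧ ∀ v, L v =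
        ∑ i, v.1 i * ev (MvPowerSeries.pderiv ℂ (Sum.inl i) F) (pt b z) +
        ∑ k, v.2 k * ev (MvPowerSeries.pderiv ℂ (Sum.inr k) F) (pt b z) := by
  obtain ⟨L, hL, hLv⟩ := hasFDerivAt_ev hF hz
  refine ⟨L.comp ptL, HasFDerivAt.comp (f := pt b) z hL hasFDerivAt_pt, fun v => ?_⟩
  rw [ContinuousLinearMap.comp_apply, hLv, Fintype.sum_sum_type]
  rfl

theorem fderiv_piMap_apply (x v : Fin n → ℂ) (k : Fin p) : fderiv ℂ (piMap R) x v k =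
    ∑ s, ev (MvPowerSeries.pderiv ℂ s (rmon R k)) x * v s := by
  have h : ∀ k, ∃ L : (Fin n → ℂ) →L[ℂ] ℂ, HasFDerivAt (fun x => piMap R x k) L x ∧
      ∀ v, L v = ∑ s, v s * ev (MvPowerSeries.pderiv ℂ s (rmon R k)) x := fun k => by
    have hx : x ∈ openPoly (fun i => ‖x i‖ₑ + 1) := fun i =>
      ENNReal.lt_add_right (by simp) one_ne_zero
    have hfin : wnorm (fun i => ‖x i‖ₑ + 1) (rmon R k) ≠ ⊤ := by
      rw [rmon, wnorm, gnorm_monomial isSubmul_enorm]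
      exact ENNReal.mul_ne_top (by simp) (ENNReal.prod_ne_top fun s _ =>
        ENNReal.pow_ne_top (by simp))
    obtain ⟨L, hL, hLv⟩ := hasFDerivAt_ev hfin hx
    refine ⟨L, hL.congr_of_eventuallyEq (Eventually.of_forall fun y => ?_), hLv⟩
    rw [rmon, ev_monomial, one_mul]
    rfl
  choose L hL hLv using h
  have h2 : HasFDerivAt (piMap R) (ContinuousLinearMap.pi L) x := hasFDerivAt_pi.2 hL
  rw [h2.fderiv]
  change L k v = _
  rw [hLv]
  exact Finset.sum_congr rfl fun s _ => mul_comm _ _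

theorem differentiable_piMap : Differentiable ℂ (piMap R : (Fin n → ℂ) → Fin p → ℂ) := by
  unfold piMap
  fun_prop

theorem enorm_pt_ne_top (s : Fin n ⊕ Fin p) : ‖pt b z s‖ₑ ≠ ⊤ := by simp

theorem ev_dpi {Y : Fin n → FS n p} (hY : ∀ s, wnorm (fun i => ‖pt b z i‖ₑ) (Y s) ≠ ⊤)
    (k : Fin p) :
    ev (dpi R Y k) (pt b z) = fderiv ℂ (piMap R) z.1 (fun s => ev (Y s) (pt b z)) k := by
  have hπ := fun s => wnorm_pderiv_resMon_ne_top (R := R) (enorm_pt_ne_top (b := b) (z := z)) s k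
  rw [dpi, ev_sum fun s _ => wnorm_mul_ne_top (hπ s) (hY s), fderiv_piMap_apply]
  refine Finset.sum_congr rfl fun s _ => ?_
  rw [ev_mul (hπ s) (hY s), ((isSlice_resMon k).pderiv s).ev_eq (hπ s)]

theorem wnorm_dpi_ne_top {Y : Fin n → FS n p} (hw : ∀ s, w s ≠ ⊤)
    (hY : ∀ s, wnorm w (Y s) ≠ ⊤) (k : Fin p) : wnorm w (dpi R Y k) ≠ ⊤ :=
  wnorm_sum_ne_top fun s _ => wnorm_mul_ne_top (wnorm_pderiv_resMon_ne_top hw s k) (hY s)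

theorem ev_pushSeries {U X : Fin n → FS n p}
    (hdU : ∀ i s, wnorm (fun i => ‖pt b z i‖ₑ) (MvPowerSeries.pderiv ℂ s (U i)) ≠ ⊤)
    (hX : ∀ s, wnorm (fun i => ‖pt b z i‖ₑ) (X s) ≠ ⊤) (i : Fin n) :
    ev (pushSeries R U X i) (pt b z) = ev (X i) (pt b z) +
      (∑ s, ev (X s) (pt b z) * ev (MvPowerSeries.pderiv ℂ (Sum.inl s) (U i)) (pt b z) +
      ∑ k, fderiv ℂ (piMap R) z.1 (fun s => ev (X s) (pt b z)) k *
        ev (MvPowerSeries.pderiv ℂ (Sum.inr k) (U i)) (pt b z)) := by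
  have hd := fun k => wnorm_dpi_ne_top (R := R) (enorm_pt_ne_top (b := b) (z := z)) hX k
  have h1 : ∀ s, wnorm (fun i => ‖pt b z i‖ₑ)
      (MvPowerSeries.pderiv ℂ (Sum.inl s) (U i) * X s) ≠ ⊤ := fun s =>
    wnorm_mul_ne_top (hdU i _) (hX s)
  have h2 : ∀ k, wnorm (fun i => ‖pt b z i‖ₑ)
      (MvPowerSeries.pderiv ℂ (Sum.inr k) (U i) * dpi R X k) ≠ ⊤ := fun k =>
    wnorm_mul_ne_top (hdU i _) (hd k)
  rw [pushSeries, ev_add (wnorm_add_ne_top (hX i) (wnorm_sum_ne_top fun s _ => h1 s))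
    (wnorm_sum_ne_top fun k _ => h2 k), ev_add (hX i) (wnorm_sum_ne_top fun s _ => h1 s),
    ev_sum fun s _ => h1 s, ev_sum fun k _ => h2 k, add_assoc]
  congr 2
  · exact Finset.sum_congr rfl fun s _ => by rw [ev_mul (hdU i _) (hX s), mul_comm]
  · exact Finset.sum_congr rfl fun k _ => by rw [ev_mul (hdU i _) (hd k), ev_dpi hX, mul_comm]

end Slices

/-! ### The cohomological equation for power series in `x` and `u - b` -/

section FormalEquation

variable {n p l : ℕ} {lam : Fin l → Fin n → ℂ} {R : Fin p → Fin n →₀ ℕ}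
  {a : Fin l → (Fin p → ℂ) → ℂ} {B : VF n p} {m : ℕ} {b : Fin p → ℂ} {s t ρ t₁ : ℝ}
  {z : (Fin n → ℂ) × (Fin p → ℂ)} {NF U Rem B0 Brest : Fin n → FS n p}

theorem eq_zero_of_ev_pt_eq_zero (hρ : 0 < ρ) (ht : 0 < t₁) {F : FS n p}
    (hF : wnorm (rad ρ t₁) F ≠ ⊤) (h : ∀ z, pt b z ∈ openPoly (rad ρ t₁) → ev F (pt b z) = 0) :
    F = 0 := by
  refine eq_zero_of_ev_eq_zero (w := rad ρ t₁) (fun s => ?_) (fun s => ?_) hF fun y hy => ?_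
  · cases s <;> simpa [rad]
  · cases s <;> simp [rad]
  · have e : pt b (fun i => y (Sum.inl i), fun k => b k + y (Sum.inr k)) = y := by
      ext s
      cases s <;> simp [pt]
    rw [← e] at hy ⊢
    exact h _ hy

theorem serAt_linField (u : Fin p → ℂ) (i : Fin n) :
    serAt u (linField lam a i : Ser n p) = (∑ j, a j u * lam j i) • MvPowerSeries.X i := by
  rw [linField, serAt_monomial, MvPowerSeries.X]
  ext1 Q
  classical
  rw [MvPowerSeries.coeff_smul, MvPowerSeries.coeff_monomial, MvPowerSeries.coeff_monomial]
  split_ifs <;> simp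

theorem ev_pderiv_linField (u : Fin p → ℂ) (x : Fin n → ℂ) (i j : Fin n) :
    ev (MvPowerSeries.pderiv ℂ j (serAt u (linField lam a i : Ser n p))) x =
      if j = i then ∑ j, a j u * lam j i else 0 := by
  classical
  rw [serAt_linField, Derivation.map_smul, ev_smul]
  split_ifs with h
  · rw [h, MvPowerSeries.pderiv_X_self, ev_one, mul_one]
  · rw [MvPowerSeries.pderiv_X_of_ne (Ne.symm h), ev_zero, mul_zero]

/-- The derivative in `u` of the series of a normal form. -/
theorem ev_pderiv_inr_linField (hts : t₁ ≤ s)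
    (ha : ∀ j, DifferentiableOn ℂ (a j) (polydisc b t₁)) {i : Fin n}
    (hNF : IsRep b s t (linField lam a i) (NF i)) (hfin : wnorm (rad ρ t₁) (NF i) ≠ ⊤)
    (hz : pt b z ∈ openPoly (rad ρ t₁)) (k : Fin p) :
    ev (MvPowerSeries.pderiv ℂ (Sum.inr k) (NF i)) (pt b z) =
      z.1 i * ∑ j, fderiv ℂ (a j) z.2 (Pi.single k 1) * lam j i := by
  obtain ⟨L, hL, hLv⟩ := hasFDerivAt_ev_pt hfin hz
  have hz' := pt_mem_openPoly.1 hz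
  have hev : ∀ ζ, pt b ζ ∈ openPoly (rad ρ t₁) →
      ev (NF i) (pt b ζ) = ζ.1 i * ∑ j, a j ζ.2 * lam j i := by
    intro ζ hζ
    have hu : ζ.2 ∈ polydisc b s := fun k => ((pt_mem_openPoly.1 hζ).2 k).trans_le hts
    rw [(hNF.isSlice hu).ev_eq (wnorm_ne_top_of_mem hfin hζ), serAt_linField, ev_smul, ev_X,
      mul_comm]
  have hda : ∀ j, HasFDerivAt (a j) (fderiv ℂ (a j) z.2) z.2 := fun j =>
    ((ha j).differentiableAt ((isOpen_polydisc b t₁).mem_nhds hz'.2)).hasFDerivAt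
  have hc : HasFDerivAt (fun u => ∑ j, a j u * lam j i)
      (∑ j, lam j i • fderiv ℂ (a j) z.2) z.2 :=
    HasFDerivAt.fun_sum fun j _ => (hda j).mul_const _
  have h1 : HasFDerivAt (fun u => z.1 i * ∑ j, a j u * lam j i)
      (z.1 i • ∑ j, lam j i • fderiv ℂ (a j) z.2) z.2 := hc.const_mul _
  have h2 : HasFDerivAt (fun u => ev (NF i) (pt b (z.1, u)))
      (L.comp (ContinuousLinearMap.inr ℂ (Fin n → ℂ) (Fin p → ℂ))) z.2 :=
    HasFDerivAt.comp (f := fun u => (z.1, u)) (g := fun z => ev (NF i) (pt b z)) z.2 hL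
      (hasFDerivAt_prodMk_right z.1 z.2)
  have h3 : (fun u => ev (NF i) (pt b (z.1, u))) =ᶠ[𝓝 z.2]
      fun u => z.1 i * ∑ j, a j u * lam j i := by
    filter_upwards [(isOpen_polydisc b t₁).mem_nhds hz'.2] with u hu
    exact hev (z.1, u) (pt_mem_openPoly.2 ⟨hz'.1, hu⟩)
  have h4 := h2.unique (h1.congr_of_eventuallyEq h3)
  have h5 := congrArg (fun T => T (Pi.single k 1)) h4
  simp only [ContinuousLinearMap.comp_apply, ContinuousLinearMap.inr_apply, hLv,
    smul_apply, sum_apply, smul_eq_mul, Pi.zero_apply,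
    zero_mul, Finset.sum_const_zero, zero_add, Pi.single_apply, ite_mul, one_mul,
    Finset.sum_ite_eq', Finset.mem_univ, if_true] at h5
  rw [h5]
  congr 1
  exact Finset.sum_congr rfl fun j _ => mul_comm _ _

theorem half_lt_rad (hρ : 0 < ρ) (ht : 0 < t₁) (s : Fin n ⊕ Fin p) :
    rad (ρ / 2) (t₁ / 2) s < rad ρ t₁ s := by
  cases s
  · exact (ENNReal.ofReal_lt_ofReal_iff hρ).2 (half_lt_self hρ)
  · exact (ENNReal.ofReal_lt_ofReal_iff ht).2 (half_lt_self ht)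

theorem rad_ne_top (s : Fin n ⊕ Fin p) : rad ρ t₁ s ≠ ⊤ := by
  cases s <;> simp [rad]

theorem openPoly_mono {σ : Type*} {w w' : σ → ℝ≥0∞} (h : ∀ s, w s ≤ w' s) :
    openPoly w ⊆ openPoly w' := fun _ hy s => (hy s).trans_le (h s)

/-- The relation holds at each parameter `u` by `sum_pderiv_rmon_mul_X`; a convergent series whose
values all vanish is zero. -/
theorem dpi_linField_eq_zero (hS : IsResonantSystem lam R) (hρ : 0 < ρ) (ht : 0 < t₁)
    (hts : t₁ ≤ s) (hNF : ∀ i, IsRep b s t (linField lam a i) (NF i))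
    (hfin : ∀ i, wnorm (rad ρ t₁) (NF i) ≠ ⊤) (k : Fin p) : dpi R NF k = 0 := by
  refine eq_zero_of_ev_pt_eq_zero (b := b) hρ ht (wnorm_dpi_ne_top rad_ne_top hfin k)
    fun z hz => ?_
  have hu : z.2 ∈ polydisc b s := fun k => ((pt_mem_openPoly.1 hz).2 k).trans_le hts
  have hfz := fun i => wnorm_ne_top_of_mem (hfin i) hz
  have hx : ∀ i, wnorm (fun i => ‖z.1 i‖ₑ) (MvPowerSeries.X i : MvPowerSeries (Fin n) ℂ) ≠ ⊤ :=
    wnorm_X_ne_top z.1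
  have hπ : ∀ i, wnorm (fun i => ‖z.1 i‖ₑ) (MvPowerSeries.pderiv ℂ i (rmon R k)) ≠ ⊤ := fun i =>
    ne_top_of_le_ne_top (wnorm_pderiv_resMon_ne_top (enorm_pt_ne_top (b := b)) i k)
      ((isSlice_resMon k).pderiv i).wnorm_le
  have h := congrArg (fun f => ev f z.1) (sum_pderiv_rmon_mul_X hS (fun j => a j z.2) k)
  rw [ev_zero, ev_sum fun i _ => wnorm_mul_ne_top (hπ i) (wnorm_smul_ne_top _ (hx i))] at h
  rw [ev_dpi hfz, fderiv_piMap_apply, ← h]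
  refine Finset.sum_congr rfl fun i _ => ?_
  rw [ev_mul (hπ i) (wnorm_smul_ne_top _ (hx i)), ((hNF i).isSlice hu).ev_eq (hfz i),
    serAt_linField]

/-- Freeze `u`: the slices in `x` satisfy the equation weight by weight. Evaluating both sides at
all points near `(0, b)` gives equal values, and the identity theorem lifts this to power series in
`(x, v)`, the form needed by `pushSeries_sub_mem`. -/
theorem formal_cohomological_eq (hS : IsResonantSystem lam R) (hρ : 0 < ρ) (ht : 0 < t₁)
    (hts : t₁ ≤ s) (ha : ∀ j, DifferentiableOn ℂ (a j) (polydisc b t₁))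
    (hA : ∀ α ∈ nonzeroWeights lam (m + 1) (2 * m), ∀ u ∈ polydisc b t₁,
      smallDivisor a α u ≠ 0)
    (hNF : ∀ i, IsRep b s t (linField lam a i) (NF i))
    (hU : ∀ i, IsRep b s t (normalizingU lam R a m B i) (U i))
    (hRem : ∀ i, IsRep b s t (B i) (Rem i))
    (hB0 : ∀ i, IsRep b s t (weightProj lam 0 B i) (B0 i))
    (hBr : ∀ i, IsRep b s t (restPart lam m B i) (Brest i))
    (fNF : ∀ i, wnorm (rad ρ t₁) (NF i) ≠ ⊤) (fU : ∀ i, wnorm (rad ρ t₁) (U i) ≠ ⊤)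
    (fRem : ∀ i, wnorm (rad ρ t₁) (Rem i) ≠ ⊤) (fB0 : ∀ i, wnorm (rad ρ t₁) (B0 i) ≠ ⊤)
    (fBr : ∀ i, wnorm (rad ρ t₁) (Brest i) ≠ ⊤) (i : Fin n) :
    ∑ s, U s * MvPowerSeries.pderiv ℂ (Sum.inl s) (NF i) -
      ∑ s, MvPowerSeries.pderiv ℂ (Sum.inl s) (U i) * NF s +
      ∑ k, dpi R U k * MvPowerSeries.pderiv ℂ (Sum.inr k) (NF i) = Rem i - B0 i - Brest i := by
  have hlt := half_lt_rad (n := n) (p := p) hρ ht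
  have hle := fun s => (hlt s).le
  have hd : ∀ {F : FS n p} (s), wnorm (rad ρ t₁) F ≠ ⊤ →
      wnorm (rad (ρ / 2) (t₁ / 2)) (MvPowerSeries.pderiv ℂ s F) ≠ ⊤ := fun s hF =>
    wnorm_pderiv_ne_top hle (hlt s) hF
  have hm : ∀ {F : FS n p}, wnorm (rad ρ t₁) F ≠ ⊤ → wnorm (rad (ρ / 2) (t₁ / 2)) F ≠ ⊤ :=
    wnorm_ne_top_mono hle
  have g1 : ∀ {w : Fin n ⊕ Fin p → ℝ≥0∞}, (∀ s, wnorm w (U s) ≠ ⊤) →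
      (∀ s, wnorm w (MvPowerSeries.pderiv ℂ (Sum.inl s) (NF i)) ≠ ⊤) →
      wnorm w (∑ s, U s * MvPowerSeries.pderiv ℂ (Sum.inl s) (NF i)) ≠ ⊤ := fun h h' =>
    wnorm_sum_ne_top fun s _ => wnorm_mul_ne_top (h s) (h' s)
  have g2 : ∀ {w : Fin n ⊕ Fin p → ℝ≥0∞}, (∀ s, wnorm w (NF s) ≠ ⊤) →
      (∀ s, wnorm w (MvPowerSeries.pderiv ℂ (Sum.inl s) (U i)) ≠ ⊤) →
      wnorm w (∑ s, MvPowerSeries.pderiv ℂ (Sum.inl s) (U i) * NF s) ≠ ⊤ := fun h h' =>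
    wnorm_sum_ne_top fun s _ => wnorm_mul_ne_top (h' s) (h s)
  have g3 : ∀ {w : Fin n ⊕ Fin p → ℝ≥0∞}, (∀ s, w s ≠ ⊤) → (∀ s, wnorm w (U s) ≠ ⊤) →
      (∀ k, wnorm w (MvPowerSeries.pderiv ℂ (Sum.inr k) (NF i)) ≠ ⊤) →
      wnorm w (∑ k, dpi R U k * MvPowerSeries.pderiv ℂ (Sum.inr k) (NF i)) ≠ ⊤ :=
    fun hw h h' => wnorm_sum_ne_top fun k _ => wnorm_mul_ne_top (wnorm_dpi_ne_top hw h k) (h' k)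
  -- On half the radii the norms of the derivatives are finite too, so each sum and product may be
  -- evaluated factor by factor.
  have hρ2 := half_pos hρ
  have ht2 := half_pos ht
  rw [← sub_eq_zero]
  refine eq_zero_of_ev_pt_eq_zero (b := b) hρ2 ht2 ?_ fun z hz => ?_
  · exact wnorm_sub_ne_top (wnorm_add_ne_top (wnorm_sub_ne_top
      (g1 (fun s => hm (fU s)) fun s => hd _ (fNF i)) (g2 (fun s => hm (fNF s)) fun s => hd _ (fU i)))
      (g3 rad_ne_top (fun s => hm (fU s)) fun k => hd _ (fNF i)))
      (wnorm_sub_ne_top (wnorm_sub_ne_top (hm (fRem i)) (hm (fB0 i))) (hm (fBr i)))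
  have hz1 := openPoly_mono hle hz
  have hu1 : z.2 ∈ polydisc b t₁ := (pt_mem_openPoly.1 hz1).2
  have hu : z.2 ∈ polydisc b s := fun k => (hu1 k).trans_le hts
  have zU := fun s => wnorm_ne_top_of_mem (fU s) hz1
  have zNF := fun s => wnorm_ne_top_of_mem (fNF s) hz1
  have zdU : ∀ s, wnorm (fun i => ‖pt b z i‖ₑ) (MvPowerSeries.pderiv ℂ s (U i)) ≠ ⊤ := fun s =>
    wnorm_ne_top_of_mem (hd s (fU i)) hz
  have zdNF : ∀ s, wnorm (fun i => ‖pt b z i‖ₑ) (MvPowerSeries.pderiv ℂ s (NF i)) ≠ ⊤ := fun s =>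
    wnorm_ne_top_of_mem (hd s (fNF i)) hz
  have zRem := wnorm_ne_top_of_mem (fRem i) hz1
  have zB0 := wnorm_ne_top_of_mem (fB0 i) hz1
  have zBr := wnorm_ne_top_of_mem (fBr i) hz1
  have zdpi := fun k => wnorm_dpi_ne_top (R := R) (enorm_pt_ne_top (b := b) (z := z)) zU k
  rw [ev_sub (wnorm_add_ne_top (wnorm_sub_ne_top (g1 zU fun s => zdNF _) (g2 zNF fun s => zdU _))
      (g3 enorm_pt_ne_top zU fun k => zdNF _))
    (wnorm_sub_ne_top (wnorm_sub_ne_top zRem zB0) zBr),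
    ev_add (wnorm_sub_ne_top (g1 zU fun s => zdNF _) (g2 zNF fun s => zdU _))
      (g3 enorm_pt_ne_top zU fun k => zdNF _),
    ev_sub (g1 zU fun s => zdNF _) (g2 zNF fun s => zdU _),
    ev_sum fun s _ => wnorm_mul_ne_top (zU s) (zdNF _),
    ev_sum fun s _ => wnorm_mul_ne_top (zdU _) (zNF s),
    ev_sum fun k _ => wnorm_mul_ne_top (zdpi k) (zdNF _),
    ev_sub (wnorm_sub_ne_top zRem zB0) zBr, ev_sub zRem zB0]
  set u := z.2 with hu_def
  set x := z.1 with hx_def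
  have sU := fun s => (hU s).isSlice hu
  -- `NF` is diagonal: only the derivative of its component `i` in the variable `x_i` survives.
  have e1 : ∑ s, ev (U s * MvPowerSeries.pderiv ℂ (Sum.inl s) (NF i)) (pt b z) =
      (∑ j, a j u * lam j i) * ev (serAt u (normalizingU lam R a m B i)) x := by
    rw [Finset.sum_eq_single i]
    · rw [ev_mul (zU i) (zdNF _), (((hNF i).isSlice hu).pderiv i).ev_eq (zdNF _),
        ev_pderiv_linField, if_pos rfl, (sU i).ev_eq (zU i), mul_comm]
    · intro s _ hs
      rw [ev_mul (zU s) (zdNF _), (((hNF i).isSlice hu).pderiv s).ev_eq (zdNF _),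
        ev_pderiv_linField, if_neg hs, mul_zero]
    · simp
  have e2 : ∑ s, ev (MvPowerSeries.pderiv ℂ (Sum.inl s) (U i) * NF s) (pt b z) =
      ∑ s, (∑ j, a j u * lam j s) * (x s * ev (MvPowerSeries.pderiv ℂ s
        (serAt u (normalizingU lam R a m B i))) x) := by
    refine Finset.sum_congr rfl fun s _ => ?_
    rw [ev_mul (zdU _) (zNF s), ((sU i).pderiv s).ev_eq (zdU _),
      ((hNF s).isSlice hu).ev_eq (zNF s), serAt_linField, ev_smul, ev_X]
    ring
  have e3 : ∑ k, ev (dpi R U k * MvPowerSeries.pderiv ℂ (Sum.inr k) (NF i)) (pt b z) =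
      ∑ k, (∑ j, fderiv ℂ (a j) u (Pi.single k 1) * lam j i) *
        ((∑ s, ev (MvPowerSeries.pderiv ℂ s (rmon R k)) x *
          ev (serAt u (normalizingU lam R a m B s)) x) * x i) := by
    refine Finset.sum_congr rfl fun k _ => ?_
    rw [ev_mul (zdpi k) (zdNF _), ev_dpi zU, fderiv_piMap_apply,
      ev_pderiv_inr_linField hts ha (hNF i) (fNF i) hz1 k,
      Finset.sum_congr rfl fun s _ => by rw [(sU s).ev_eq (zU s)]]
    ring
  have yU := fun s => ne_top_of_le_ne_top (zU s) (sU s).wnorm_le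
  have ydU := fun s => ne_top_of_le_ne_top (zdU (Sum.inl s)) ((sU i).pderiv s).wnorm_le
  have yπ : ∀ s k, wnorm (fun i => ‖x i‖ₑ) (MvPowerSeries.pderiv ℂ s (rmon R k)) ≠ ⊤ := fun s k =>
    ne_top_of_le_ne_top (wnorm_pderiv_resMon_ne_top (enorm_pt_ne_top (b := b)) s k)
      ((isSlice_resMon k).pderiv s).wnorm_le
  have yad : wnorm (fun i => ‖x i‖ₑ) (adOp (fun i => ∑ j, a j u * lam j i)
      (fun i => serAt u (normalizingU lam R a m B i)) i) ≠ ⊤ :=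
    wnorm_sub_ne_top (wnorm_smul_ne_top _ (yU i)) (wnorm_sum_ne_top fun s _ =>
      wnorm_smul_ne_top _ (wnorm_mul_ne_top (wnorm_X_ne_top x s) (ydU s)))
  have ydu : wnorm (fun i => ‖x i‖ₑ) (duOp R
      (fun i k => ∑ j, fderiv ℂ (a j) u (Pi.single k 1) * lam j i)
      (fun i => serAt u (normalizingU lam R a m B i)) i) ≠ ⊤ :=
    wnorm_sum_ne_top fun k _ => wnorm_smul_ne_top _ (wnorm_mul_ne_top
      (wnorm_sum_ne_top fun s _ => wnorm_mul_ne_top (yπ s k) (yU s)) (wnorm_X_ne_top x i))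
  have sRem := (hRem i).isSlice hu
  have sB0 := (hB0 i).isSlice hu
  have sBr := (hBr i).isSlice hu
  have yRem := ne_top_of_le_ne_top zRem sRem.wnorm_le
  have yB0 := ne_top_of_le_ne_top zB0 sB0.wnorm_le
  have yBr := ne_top_of_le_ne_top zBr sBr.wnorm_le
  have hco := cohomological_eq (B := B) hS (fun α hα => hA α hα u hu1) i
  have hrest : serAt u (B i) - serAt u (weightProj lam 0 B i) - serAt u (restPart lam m B i) =
      ∑ α ∈ nonzeroWeights lam (m + 1) (2 * m), serAt u (weightProj lam α B i) := by
    simp only [restPart, map_sub, map_sum]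
    ring
  rw [← hrest] at hco
  have hco' := congrArg (fun f => ev f x) hco
  rw [ev_add yad ydu, ev_adOp yU ydU, ev_duOp yU yπ, ev_sub (wnorm_sub_ne_top yRem yB0) yBr,
    ev_sub yRem yB0] at hco'
  rw [e1, e2, e3, sRem.ev_eq zRem, sB0.ev_eq zB0, sBr.ev_eq zBr, ← hco', sub_self]

end FormalEquation

/-! ### The inverse of a fibered map and the push-forward -/

section Inverse

variable {n p : ℕ} {R : Fin p → Fin n →₀ ℕ} {b : Fin p → ℂ} {U V : Fin n → FS n p}
  {Us : VF n p} {w W : Fin n ⊕ Fin p → ℝ≥0∞} {z : (Fin n → ℂ) × (Fin p → ℂ)}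

/-- The map with the series `fib R V`. -/
def psi (R : Fin p → Fin n →₀ ℕ) (b : Fin p → ℂ) (V : Fin n → FS n p)
    (z : (Fin n → ℂ) × (Fin p → ℂ)) : (Fin n → ℂ) × (Fin p → ℂ) :=
  (fun i => ev (fib R V (Sum.inl i)) (pt b z), fun k => b k + ev (fib R V (Sum.inr k)) (pt b z))

theorem pt_psi : pt b (psi R b V z) = fun s => ev (fib R V s) (pt b z) := by
  ext s
  cases s <;> simp [pt, psi]

theorem differentiableOn_ev_pt {F : FS n p} (hF : wnorm w F ≠ ⊤) :
    DifferentiableOn ℂ (fun z => ev F (pt b z)) {z | pt b z ∈ openPoly w} := fun z hz => by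
  obtain ⟨L, hL, -⟩ := hasFDerivAt_ev_pt hF hz
  exact hL.differentiableAt.differentiableWithinAt

theorem differentiableOn_psi (h : ∀ s, wnorm w (fib R V s) ≠ ⊤) :
    DifferentiableOn ℂ (psi R b V) {z | pt b z ∈ openPoly w} := by
  refine DifferentiableOn.prodMk ?_ ?_ <;> rw [differentiableOn_pi]
  · exact fun i => differentiableOn_ev_pt (h _)
  · exact fun k => (differentiableOn_ev_pt (h _)).const_add _

theorem psi_center (hV : ∀ i, V i ∈ ordIdeal xw 1) : psi R b V (0, b) = (0, b) := by
  have h0 : pt b ((0, b) : (Fin n → ℂ) × (Fin p → ℂ)) = 0 := by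
    ext s
    cases s <;> simp [pt]
  ext s
  · simp [psi, h0, ev_at_zero, constantCoeff_fib hV]
  · simp [psi, h0, ev_at_zero, constantCoeff_fib hV]

theorem enorm_pt_psi_le (hw : ∀ s, wnorm w (fib R V s) ≤ W s) (hz : pt b z ∈ openPoly w)
    (s : Fin n ⊕ Fin p) : ‖pt b (psi R b V z) s‖ₑ ≤ W s := by
  rw [pt_psi]
  exact enorm_ev_le.trans ((gnorm_mono (fun s => (hz s).le) _).trans (hw s))

theorem ev_subst_fib (hV : ∀ i, V i ∈ ordIdeal xw 1) (hw : ∀ s, wnorm w (fib R V s) ≤ W s)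
    (hW : ∀ s, W s ≠ ⊤) (hz : pt b z ∈ openPoly w) {F : FS n p} (hF : wnorm W F ≠ ⊤) :
    ev (MvPowerSeries.subst (fib R V) F) (pt b z) = ev F (pt b (psi R b V z)) := by
  have h1 : ∀ s, wnorm (fun i => ‖pt b z i‖ₑ) (fib R V s) ≤ W s := fun s =>
    (gnorm_mono (fun s => (hz s).le) _).trans (hw s)
  rw [ev_subst (hasSubst_fib hV) (fun s => ne_top_of_le_ne_top (hW s) (h1 s))
    (wnorm_ne_top_mono h1 hF), pt_psi]

theorem psi_fst (hV : ∀ i, wnorm w (V i) ≠ ⊤) (hz : pt b z ∈ openPoly w) (i : Fin n) :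
    (psi R b V z).1 i = z.1 i + ev (V i) (pt b z) := by
  change ev (xvar i + V i) (pt b z) = _
  have hX : wnorm (fun i => ‖pt b z i‖ₑ) (xvar i : FS n p) ≠ ⊤ := by
    rw [xvar, wnorm_X]
    simp
  rw [ev_add hX (wnorm_ne_top_of_mem (hV i) hz), xvar, ev_X]
  rfl

theorem ev_resMon {y : Fin n → FS n p} (hy : ∀ i, wnorm (fun i => ‖pt b z i‖ₑ) (y i) ≠ ⊤)
    (k : Fin p) : ev (resMon R k y) (pt b z) = piMap R (fun i => ev (y i) (pt b z)) k := by
  rw [resMon, ev_prod fun i _ => wnorm_pow_ne_top (hy i) _]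
  exact Finset.prod_congr rfl fun i _ => ev_pow (hy i) _

/-- The map conserves `u - π(x)`. This is what makes it an inverse of the fibered map and lets it
preserve `Σ`. -/
theorem psi_snd (hV : ∀ i, wnorm w (V i) ≠ ⊤) (hz : pt b z ∈ openPoly w) :
    (psi R b V z).2 = z.2 + piMap R (psi R b V z).1 - piMap R z.1 := by
  ext k
  have hX : ∀ s, wnorm (fun i => ‖pt b z i‖ₑ) (MvPowerSeries.X s : FS n p) ≠ ⊤ := fun s => by
    rw [wnorm_X]
    simp
  have hy : ∀ i, wnorm (fun i => ‖pt b z i‖ₑ) ((xvar + V : Fin n → FS n p) i) ≠ ⊤ := fun i =>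
    wnorm_add_ne_top (hX _) (wnorm_ne_top_of_mem (hV i) hz)
  have h1 : wnorm (fun i => ‖pt b z i‖ₑ) (resMon R k (xvar + V)) ≠ ⊤ :=
    wnorm_prod_ne_top fun i _ => wnorm_pow_ne_top (hy i) _
  have h2 : wnorm (fun i => ‖pt b z i‖ₑ) (resMon R k xvar : FS n p) ≠ ⊤ :=
    wnorm_prod_ne_top fun i _ => wnorm_pow_ne_top (hX _) _
  have e1 : (psi R b V z).2 k = b k + ev (fib R V (Sum.inr k)) (pt b z) := rfl
  have e2 : (fun i => ev ((xvar + V : Fin n → FS n p) i) (pt b z)) = (psi R b V z).1 := rfl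
  have e3 : pt b z (Sum.inr k) = z.2 k - b k := rfl
  have e4 : (fun i => ev (xvar i : FS n p) (pt b z)) = z.1 := by
    ext i
    rw [xvar, ev_X]
    rfl
  rw [e1, fib_inr, ev_add (hX _) (wnorm_sub_ne_top h1 h2), ev_sub h1 h2, ev_resMon hy,
    ev_resMon (y := xvar) fun i => hX (Sum.inl i), ev_X, e2, e3, e4]
  generalize psi R b V z = y
  rw [Pi.sub_apply, Pi.add_apply]
  ring

/-- `psi R b V` is a right inverse of the fibered map of `x + U` if `V = -U ∘ (x + V)`. -/
theorem fiberedMap_psi (hV : ∀ i, V i ∈ ordIdeal xw 1) (hVw : ∀ i, wnorm w (V i) ≠ ⊤)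
    (hVU : ∀ i, V i = -MvPowerSeries.subst (fib R V) (U i))
    (hw : ∀ s, wnorm w (fib R V s) ≤ W s) (hW : ∀ s, W s ≠ ⊤) (hUW : ∀ i, wnorm W (U i) ≠ ⊤)
    (hz : pt b z ∈ openPoly w)
    (hUs : ∀ i, serEval (Us i) (psi R b V z) = ev (U i) (pt b (psi R b V z))) :
    fiberedMap R Us (psi R b V z) = z := by
  have h1 : (psi R b V z).1 + vfEval Us (psi R b V z) = z.1 := by
    ext i
    have := congrArg (fun F => ev F (pt b z)) (hVU i)
    rw [ev_neg, ev_subst_fib hV hw hW hz (hUW i)] at this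
    rw [Pi.add_apply, psi_fst hVw hz, vfEval, hUs i, this]
    ring
  rw [fiberedMap, h1, psi_snd hVw hz]
  ext s
  · rfl
  · simp

/-- `psi R b V` preserves `Σ`. -/
theorem psi_mem_graphSigma (hVw : ∀ i, wnorm w (V i) ≠ ⊤) (hz : pt b z ∈ openPoly w)
    (h : z ∈ graphSigma R) : psi R b V z ∈ graphSigma R := by
  change (psi R b V z).2 = _
  rw [psi_snd hVw hz, (h : z.2 = piMap R z.1)]
  simp

/-- The first component of the push-forward of a fibered field. -/
theorem fderiv_fiberedMap_fst (hU : ∀ i, wnorm w (U i) ≠ ⊤) (hz : pt b z ∈ openPoly w)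
    (hUs : ∀ i, ∀ ζ, pt b ζ ∈ openPoly w → serEval (Us i) ζ = ev (U i) (pt b ζ))
    (hd : DifferentiableAt ℂ (fiberedMap R Us) z) (X : Fin n → ℂ) (i : Fin n) :
    (fderiv ℂ (fiberedMap R Us) z (X, fderiv ℂ (piMap R) z.1 X)).1 i = X i +
      (∑ s, X s * ev (MvPowerSeries.pderiv ℂ (Sum.inl s) (U i)) (pt b z) +
      ∑ k, fderiv ℂ (piMap R) z.1 X k *
        ev (MvPowerSeries.pderiv ℂ (Sum.inr k) (U i)) (pt b z)) := by
  obtain ⟨L, hL, hLv⟩ := hasFDerivAt_ev_pt (hU i) hz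
  have hnhds : {ζ | pt b ζ ∈ openPoly w} ∈ 𝓝 z :=
    hasFDerivAt_pt.continuousAt.preimage_mem_nhds ((isOpen_openPoly w).mem_nhds hz)
  have h1 : HasFDerivAt (fun ζ => serEval (Us i) ζ) L z :=
    hL.congr_of_eventuallyEq (by filter_upwards [hnhds] with ζ hζ using hUs i ζ hζ)
  have h2 : HasFDerivAt (fun ζ : (Fin n → ℂ) × (Fin p → ℂ) => ζ.1 i)
      ((ContinuousLinearMap.proj i).comp (ContinuousLinearMap.fst ℂ (Fin n → ℂ) (Fin p → ℂ))) z :=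
    ((ContinuousLinearMap.proj i).comp
      (ContinuousLinearMap.fst ℂ (Fin n → ℂ) (Fin p → ℂ))).hasFDerivAt
  have h3 : HasFDerivAt (fun ζ => (fiberedMap R Us ζ).1 i) ((ContinuousLinearMap.proj i).comp
      ((ContinuousLinearMap.fst ℂ (Fin n → ℂ) (Fin p → ℂ)).comp
        (fderiv ℂ (fiberedMap R Us) z))) z :=
    hasFDerivAt_pi'.1 hd.hasFDerivAt.fst i
  have h4 := h3.unique (h2.add h1)
  have h5 := congrArg (fun T => T (X, fderiv ℂ (piMap R) z.1 X)) h4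
  simp only [add_apply, hLv] at h5
  exact h5

/-- The push-forward of a holomorphic fibered field is holomorphic. -/
theorem differentiableOn_fderiv_fiberedMap_fst (hU : ∀ i, wnorm w (U i) ≠ ⊤)
    (hdU : ∀ i s, wnorm w (MvPowerSeries.pderiv ℂ s (U i)) ≠ ⊤) (hw : ∀ s, w s ≠ ⊤)
    (hUs : ∀ i, ∀ ζ, pt b ζ ∈ openPoly w → serEval (Us i) ζ = ev (U i) (pt b ζ))
    (hd : ∀ z, pt b z ∈ openPoly w → DifferentiableAt ℂ (fiberedMap R Us) z)
    {X : (Fin n → ℂ) × (Fin p → ℂ) → Fin n → ℂ}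
    (hX : DifferentiableOn ℂ X {z | pt b z ∈ openPoly w}) :
    DifferentiableOn ℂ (fun z => (fderiv ℂ (fiberedMap R Us) z (fiberedField R X z)).1)
      {z | pt b z ∈ openPoly w} := by
  rw [differentiableOn_pi]
  intro i
  have hXi := fun s => differentiableOn_pi.1 hX s
  have hπ : ∀ k, DifferentiableOn ℂ (fun z => fderiv ℂ (piMap R) z.1 (X z) k)
      {z | pt b z ∈ openPoly w} := fun k => by
    have : DifferentiableOn ℂ (fun z => ∑ s, ev (MvPowerSeries.pderiv ℂ (Sum.inl s)
        (resMon R k xvar : FS n p)) (pt b z) * X z s) {z | pt b z ∈ openPoly w} :=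
      DifferentiableOn.fun_sum fun s _ =>
        (differentiableOn_ev_pt (wnorm_pderiv_resMon_ne_top hw s k)).mul (hXi s)
    refine this.congr fun z _ => ?_
    rw [fderiv_piMap_apply]
    exact Finset.sum_congr rfl fun s _ => by
      rw [((isSlice_resMon k).pderiv s).ev_eq (wnorm_pderiv_resMon_ne_top enorm_pt_ne_top s k)]
  refine DifferentiableOn.congr (f := fun z => X z i +
      (∑ s, X z s * ev (MvPowerSeries.pderiv ℂ (Sum.inl s) (U i)) (pt b z) +
      ∑ k, fderiv ℂ (piMap R) z.1 (X z) k *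
        ev (MvPowerSeries.pderiv ℂ (Sum.inr k) (U i)) (pt b z))) ?_
    fun z hz => fderiv_fiberedMap_fst hU hz hUs (hd z hz) (X z) i
  exact (hXi i).add ((DifferentiableOn.fun_sum fun s _ =>
    (hXi s).mul (differentiableOn_ev_pt (hdU i _))).add (DifferentiableOn.fun_sum fun k _ =>
    (hπ k).mul (differentiableOn_ev_pt (hdU i _))))

end Inverse

/-! ### The parameters of the scheme -/

section Parameters

variable {ω : ℕ → ℝ} {γ c₁ : ℝ} {k : ℕ}

theorem thetaK_eq_exp (hγ : 0 < γ) (hc₁ : 0 < c₁) (hω : 0 < ω (k + 1)) :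
    thetaK ω γ c₁ k =
      Real.exp (-(Real.log (c₁ / γ ^ 2 * ((2 : ℝ) ^ k) ^ 2 / ω (k + 1) ^ 2) / 2 ^ k)) := by
  have h1 : 0 < c₁ / (γ ^ 2 * ω (k + 1) ^ 2) := by positivity
  have h2 : (0 : ℝ) < 2 ^ k := by positivity
  rw [thetaK, gammaK, Real.rpow_def_of_pos h1, Real.rpow_def_of_pos h2, ← Real.exp_add]
  congr 1
  have h3 : c₁ / γ ^ 2 * ((2 : ℝ) ^ k) ^ 2 / ω (k + 1) ^ 2 =
      c₁ / (γ ^ 2 * ω (k + 1) ^ 2) * ((2 : ℝ) ^ k) ^ 2 := by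
    field_simp
  rw [h3, Real.log_mul h1.ne' (by positivity), Real.log_pow ((2 : ℝ) ^ k)]
  push_cast
  ring

/-- All numerical estimates use `θ_k` through this power: shrinking a radius by `θ_k` at order `m`
gains `ω_{k+1}² / m²` up to a constant. -/
theorem thetaK_pow (hγ : 0 < γ) (hc₁ : 0 < c₁) (hω : 0 < ω (k + 1)) :
    thetaK ω γ c₁ k ^ 2 ^ k = γ ^ 2 / c₁ * ω (k + 1) ^ 2 / ((2 : ℝ) ^ k) ^ 2 := by
  rw [thetaK_eq_exp hγ hc₁ hω, ← Real.exp_nat_mul]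
  push_cast
  rw [mul_neg, mul_div_cancel₀ _ (by positivity), Real.exp_neg, Real.exp_log (by positivity)]
  field_simp

/-- Asymptotics of `θ_k`: it tends to `1`, but `1 - θ_k` is large compared with `1/m`. -/
theorem exists_threshold (hω : IsDiophantineSeq ω) (hγ : 0 < γ) (hc₁ : 0 < c₁) (C : ℝ) :
    ∃ k₀ : ℕ, 1 ≤ k₀ ∧ ∀ k ≥ k₀, 1 / 2 ≤ thetaK ω γ c₁ k ∧ thetaK ω γ c₁ k < 1 ∧
      C ≤ 2 ^ k ∧ C ≤ 2 ^ k * (1 - thetaK ω γ c₁ k) := by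
  -- With `m = 2^k` one has `θ_k = exp(-q_k / m)`. As `ω ≤ 1`, `q_k` grows at least linearly in `k`;
  -- as the Diophantine series converges, `q_k / m` tends to `0`.
  set q : ℕ → ℝ := fun k => Real.log (c₁ / γ ^ 2 * ((2 : ℝ) ^ k) ^ 2 / ω (k + 1) ^ 2) with hq
  have hpos : ∀ k, 0 < ω (k + 1) := fun k => hω.pos _ (by omega)
  have hqe : ∀ k, q k = Real.log (c₁ / γ ^ 2) + 2 * Real.log 2 * k +
      -2 * Real.log (ω (k + 1)) := fun k => by
    have hp := hpos k
    simp only [hq]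
    rw [Real.log_div (by positivity) (by positivity), Real.log_mul (by positivity) (by positivity),
      Real.log_pow, Real.log_pow, Real.log_pow]
    push_cast
    ring
  have hql : ∀ k, Real.log (c₁ / γ ^ 2) + 2 * Real.log 2 * k ≤ q k := fun k => by
    rw [hqe]
    have := Real.log_nonpos (hpos k).le (hω.le_one _ (by omega))
    linarith
  have hqt : Tendsto q atTop atTop := by
    refine tendsto_atTop_mono hql (tendsto_atTop_add_const_left _ _ ?_)
    exact tendsto_natCast_atTop_atTop.const_mul_atTop (mul_pos two_pos (Real.log_pos (by norm_num)))
  have h2 : Tendsto (fun k : ℕ => (2 : ℝ) ^ k) atTop atTop :=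
    tendsto_pow_atTop_atTop_of_one_lt (by norm_num)
  have hqm : Tendsto (fun k => q k / 2 ^ k) atTop (𝓝 0) := by
    -- The term `-2 log ω_{k+1} / 2^k` is four times the general term of the summable series, whose
    -- denominator is `2^(k+1)`.
    have e : (fun k => q k / 2 ^ k) = fun k : ℕ => Real.log (c₁ / γ ^ 2) / 2 ^ k +
        2 * Real.log 2 * ((k : ℝ) ^ 1 / 2 ^ k) + 4 * (-Real.log (ω (k + 1)) / 2 ^ (k + 1)) := by
      ext k
      rw [hqe, pow_succ]
      field_simp
      ring
    rw [e]
    have t1 : Tendsto (fun k : ℕ => Real.log (c₁ / γ ^ 2) / (2 : ℝ) ^ k) atTop (𝓝 0) :=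
      h2.const_div_atTop _
    have t2 : Tendsto (fun k : ℕ => (k : ℝ) ^ 1 / (2 : ℝ) ^ k) atTop (𝓝 0) :=
      tendsto_pow_const_div_const_pow_of_one_lt 1 (by norm_num)
    have t3 := hω.summable.tendsto_atTop_zero
    simpa using (t1.add (t2.const_mul (2 * Real.log 2))).add (t3.const_mul 4)
  have hθ : ∀ k, thetaK ω γ c₁ k = Real.exp (-(q k / 2 ^ k)) := fun k =>
    thetaK_eq_exp hγ hc₁ (hpos k)
  have hθt : Tendsto (fun k => thetaK ω γ c₁ k) atTop (𝓝 1) := by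
    have := (Real.continuous_exp.tendsto 0).comp (by simpa using hqm.neg)
    simp only [Real.exp_zero] at this
    exact this.congr fun k => (hθ k).symm
  obtain ⟨k₀, hk₀⟩ := eventually_atTop.1 ((hθt.eventually (eventually_ge_nhds
    (by norm_num : (1 / 2 : ℝ) < 1))).and ((hqt.eventually_ge_atTop (max (2 * C) 1)).and
    (h2.eventually_ge_atTop C)))
  refine ⟨max k₀ 1, le_max_right _ _, fun k hk => ?_⟩
  obtain ⟨h3, h4, h5⟩ := hk₀ k ((le_max_left _ _).trans hk)
  have hq0 : 0 < q k := one_pos.trans_le ((le_max_right _ _).trans h4)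
  have hm : (0 : ℝ) < 2 ^ k := by positivity
  refine ⟨h3, ?_, h5, ?_⟩
  · rw [hθ, Real.exp_lt_one_iff]
    simpa using div_pos hq0 hm
  · have h6 : q k / 2 ^ k * thetaK ω γ c₁ k ≤ 1 - thetaK ω γ c₁ k := by
      have := Real.add_one_le_exp (q k / 2 ^ k)
      have h7 : thetaK ω γ c₁ k * Real.exp (q k / 2 ^ k) = 1 := by
        rw [hθ, ← Real.exp_add]
        simp
      have hθ0 : 0 < thetaK ω γ c₁ k := by linarith
      nlinarith
    have h8 : q k / 2 ≤ 2 ^ k * (q k / 2 ^ k * thetaK ω γ c₁ k) := by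
      rw [← mul_assoc, mul_div_cancel₀ _ hm.ne']
      nlinarith
    have h9 := mul_le_mul_of_nonneg_left h6 hm.le
    have := (le_max_left (2 * C) 1).trans h4
    linarith

end Parameters

/-! ### One step of the Newton scheme -/

section Step

variable {n p l : ℕ} {lam : Fin l → Fin n → ℂ} {R : Fin p → Fin n →₀ ℕ}
  {a : Fin l → (Fin p → ℂ) → ℂ} {B : VF n p} {m : ℕ} {b : Fin p → ℂ}

theorem le_ofReal_div {x : ℝ≥0∞} {δ N : ℝ} (hδ : 0 < δ) (h : ENNReal.ofReal δ * x ≤ ENNReal.ofReal N) :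
    x ≤ ENNReal.ofReal (N / δ) := by
  rw [ENNReal.ofReal_div_of_pos hδ, ENNReal.le_div_iff_mul_le (Or.inl (by simpa using hδ))
    (Or.inl ENNReal.ofReal_ne_top), mul_comm]
  exact h

theorem wnorm_pderiv_resMon_le {ρ t : ℝ} (hρ : ρ ≤ 1) (s : Fin n) (k : Fin p) :
    wnorm (rad ρ t) (MvPowerSeries.pderiv ℂ (Sum.inl s) (resMon R k xvar : FS n p)) ≤ R k s := by
  have h : MvPowerSeries.pderiv ℂ (Sum.inl s) (resMon R k xvar : FS n p) =
      MvPowerSeries.monomial (pair (R k) 0 - Finsupp.single (Sum.inl s) 1) (R k s : ℂ) := by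
    rw [resMon_xvar_eq, ← MvPolynomial.coe_monomial, MvPowerSeries.pderiv_coe,
      MvPolynomial.pderiv_monomial, MvPolynomial.coe_monomial, pair_inl, one_mul]
  have h2 : pair (R k) (0 : Fin p →₀ ℕ) - Finsupp.single (Sum.inl s) 1 =
      pair (R k - Finsupp.single s 1) 0 := by
    ext i
    cases i <;> simp [Finsupp.single_apply]
  rw [h, h2, wnorm, gnorm_monomial isSubmul_enorm, wmon_rad]
  calc _ ≤ ‖(R k s : ℂ)‖ₑ * (1 * 1) := by
        gcongr
        · exact pow_le_one₀ zero_le (ENNReal.ofReal_le_one.2 hρ)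
        · simp
    _ = _ := by
        rw [mul_one, mul_one, ← ofReal_norm, Complex.norm_natCast, ENNReal.ofReal_natCast]

theorem wnorm_dpi_le {ρ t : ℝ} (hρ : ρ ≤ 1) {X : Fin n → FS n p} {N : ℝ≥0∞}
    (hX : ∀ s, wnorm (rad ρ t) (X s) ≤ N) (k : Fin p) :
    wnorm (rad ρ t) (dpi R X k) ≤ (R k).degree * N := by
  refine (gnorm_sum_le isSubmul_enorm _ _).trans ?_
  rw [Finsupp.degree_eq_sum, Nat.cast_sum, Finset.sum_mul]
  exact Finset.sum_le_sum fun s _ => (gnorm_mul_le isSubmul_enorm _ _).trans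
    (mul_le_mul' (wnorm_pderiv_resMon_le hρ s k) (hX s))

theorem wnorm_pderiv_inl_le {ρ₁ ρ₂ t₁ t₂ N : ℝ} (hρ₂ : 0 ≤ ρ₂) (hρ : ρ₂ < ρ₁) (ht : t₂ ≤ t₁)
    {F : FS n p} (hF : wnorm (rad ρ₁ t₁) F ≤ ENNReal.ofReal N) (s : Fin n) :
    wnorm (rad ρ₂ t₂) (MvPowerSeries.pderiv ℂ (Sum.inl s) F) ≤
      ENNReal.ofReal (N / (ρ₁ - ρ₂)) := by
  refine le_ofReal_div (sub_pos.2 hρ) ((wnorm_pderiv_le (rad_mono hρ.le ht) ?_ F).trans hF)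
  rw [rad, rad, Sum.elim_inl, Sum.elim_inl, ← ENNReal.ofReal_add hρ₂ (sub_pos.2 hρ).le,
    add_sub_cancel]

theorem wnorm_pderiv_inr_le {ρ₁ ρ₂ t₁ t₂ N : ℝ} (ht₂ : 0 ≤ t₂) (hρ : ρ₂ ≤ ρ₁) (ht : t₂ < t₁)
    {F : FS n p} (hF : wnorm (rad ρ₁ t₁) F ≤ ENNReal.ofReal N) (k : Fin p) :
    wnorm (rad ρ₂ t₂) (MvPowerSeries.pderiv ℂ (Sum.inr k) F) ≤
      ENNReal.ofReal (N / (t₁ - t₂)) := by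
  refine le_ofReal_div (sub_pos.2 ht) ((wnorm_pderiv_le (rad_mono hρ ht.le) ?_ F).trans hF)
  rw [rad, rad, Sum.elim_inr, Sum.elim_inr, ← ENNReal.ofReal_add ht₂ (sub_pos.2 ht).le,
    add_sub_cancel]

theorem wnorm_pushSeries_le {ρ₁ ρ₂ t₁ t₂ NU NX : ℝ} (hρ₂ : 0 ≤ ρ₂) (hρ₁ : ρ₂ ≤ 1) (hρ : ρ₂ < ρ₁)
    (ht₂ : 0 ≤ t₂) (ht : t₂ < t₁) (hNU : 0 ≤ NU) (hNX : 0 ≤ NX) {U X : Fin n → FS n p}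
    (hU : ∀ i, wnorm (rad ρ₁ t₁) (U i) ≤ ENNReal.ofReal NU)
    (hX : ∀ i, wnorm (rad ρ₂ t₂) (X i) ≤ ENNReal.ofReal NX) (i : Fin n) :
    wnorm (rad ρ₂ t₂) (pushSeries R U X i) ≤ ENNReal.ofReal (NX * (1 + n * (NU / (ρ₁ - ρ₂)) +
      ((∑ k, (R k).degree : ℕ) : ℝ) * (NU / (t₁ - t₂)))) := by
  have hδ := sub_pos.2 hρ
  have hδ' := sub_pos.2 ht
  refine (gnorm_add_le isSubmul_enorm _ _).trans ((add_le_add (gnorm_add_le isSubmul_enorm _ _)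
    le_rfl).trans ?_)
  have h1 : wnorm (rad ρ₂ t₂) (∑ s, MvPowerSeries.pderiv ℂ (Sum.inl s) (U i) * X s) ≤
      ENNReal.ofReal (n * (NU / (ρ₁ - ρ₂) * NX)) := by
    refine (gnorm_sum_le isSubmul_enorm _ _).trans ((Finset.sum_le_sum fun s _ =>
      (gnorm_mul_le isSubmul_enorm _ _).trans
        (mul_le_mul' (wnorm_pderiv_inl_le hρ₂ hρ ht.le (hU i) s) (hX s))).trans ?_)
    rw [Finset.sum_const, Finset.card_univ, Fintype.card_fin, nsmul_eq_mul,
      ← ENNReal.ofReal_mul (by positivity), ENNReal.ofReal_mul (Nat.cast_nonneg n),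
      ENNReal.ofReal_natCast]
  have h2 : wnorm (rad ρ₂ t₂) (∑ k, MvPowerSeries.pderiv ℂ (Sum.inr k) (U i) * dpi R X k) ≤
      ENNReal.ofReal (((∑ k, (R k).degree : ℕ) : ℝ) * (NU / (t₁ - t₂) * NX)) := by
    refine (gnorm_sum_le isSubmul_enorm _ _).trans ((Finset.sum_le_sum fun k _ =>
      (gnorm_mul_le isSubmul_enorm _ _).trans
        (mul_le_mul' (wnorm_pderiv_inr_le ht₂ hρ.le ht (hU i) k)
          (wnorm_dpi_le (R := R) hρ₁ hX k))).trans ?_)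
    rw [ENNReal.ofReal_mul (Nat.cast_nonneg _), ENNReal.ofReal_natCast, Nat.cast_sum,
      Finset.sum_mul, ENNReal.ofReal_mul (by positivity)]
    exact Finset.sum_le_sum fun k _ => (by ring : _ = _).le
  refine (add_le_add (add_le_add (hX i) h1) h2).trans (le_of_eq ?_)
  rw [← ENNReal.ofReal_add hNX (by positivity), ← ENNReal.ofReal_add (by positivity) (by positivity)]
  congr 1
  ring

theorem holSer_restPart {U : Set (Fin p → ℂ)} (hB : ∀ i, HolSer U (B i)) (i : Fin n) :
    HolSer U (restPart lam m B i) :=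
  ((hB i).sub (holSer_weightProj (hB i) 0)).sub
    (HolSer.sum fun α _ => holSer_weightProj (hB i) α)

theorem serNorm_restPart_ne_top {U : Set (Fin p → ℂ)} {r : ℝ} {i : Fin n}
    (hB : serNorm U r (B i) ≠ ⊤) : serNorm U r (restPart lam m B i) ≠ ⊤ := by
  have hν := isSubmul_supNorm U
  have h : ∀ t, serNorm U r (∑ α ∈ t, weightProj lam α B i) ≤ serNorm U r (B i) := fun t => by
    refine le_trans ?_ (sum_serNorm_weightProj_le (lam := lam) t i)
    simp only [serNorm_eq]
    exact gnorm_sum_le hν _ _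
  have h0 := serNorm_weightProj_le (lam := lam) (B := B) (U := U) (r := r) 0 i
  have h1 := h (nonzeroWeights lam (m + 1) (2 * m))
  rw [restPart]
  simp only [serNorm_eq] at *
  exact ne_top_of_le_ne_top (ENNReal.add_ne_top.2 ⟨ENNReal.add_ne_top.2 ⟨hB,
    ne_top_of_le_ne_top hB h0⟩, ne_top_of_le_ne_top hB h1⟩)
    ((gnorm_sub_le hν _ _).trans (add_le_add (gnorm_sub_le hν _ _) le_rfl))

theorem differentiableOn_fiberedMap {Us : VF n p} {r t : ℝ}
    (hUs : ∀ i, HolSer (polydisc b t) (Us i)) (hfin : ∀ i, serNorm (polydisc b t) r (Us i) ≠ ⊤) :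
    DifferentiableOn ℂ (fiberedMap R Us) (polydisc 0 r ×ˢ polydisc b t) := by
  have h1 : DifferentiableOn ℂ (fun z : (Fin n → ℂ) × (Fin p → ℂ) => z.1 + vfEval Us z)
      (polydisc 0 r ×ˢ polydisc b t) :=
    differentiableOn_fst.add (differentiableOn_pi.2 fun i =>
      differentiableOn_serEval (hUs i) (hfin i))
  exact h1.prodMk ((differentiableOn_snd.add (differentiable_piMap.comp_differentiableOn h1)).sub
    (differentiable_piMap.comp_differentiableOn differentiableOn_fst))

/-- The analytic map inverse to the normalizing map, and the new remainder. -/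
theorem newton_step (hS : IsResonantSystem lam R) (hm : 1 ≤ m) {tm T r θ G KU MB ε : ℝ}
    (htm : 0 < tm) (hT : 0 < T) (hr0 : 0 < r) (hr : r ≤ 1) (hθ0 : 0 < θ) (hθ : θ < 1)
    (hG : geomConst p ≤ ENNReal.ofReal G) (hG0 : 0 ≤ G) (hKU : 0 ≤ KU) (hMB : 0 ≤ MB)
    (ha : ∀ j, DifferentiableOn ℂ (a j) (polydisc b tm))
    (hda : ∀ j k, DifferentiableOn ℂ (fun u => fderiv ℂ (a j) u (Pi.single k 1)) (polydisc b tm))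
    (hA : ∀ α ∈ nonzeroWeights lam (m + 1) (2 * m), ∀ u ∈ polydisc b tm,
      smallDivisor a α u ≠ 0)
    (hB : ∀ i, HolSer (polydisc b tm) (B i))
    (hB0 : ∀ i, ∀ Q : Fin n →₀ ℕ, Q.degree < m + 1 → ∀ u ∈ polydisc b tm,
      MvPowerSeries.coeff Q (B i) u = 0)
    (nNF : ∀ i, serNorm (polydisc b tm) r (linField lam a i : Ser n p) ≤ 1)
    (nB : ∀ i, serNorm (polydisc b tm) r (B i) ≤ ENNReal.ofReal MB)
    (nU : ∀ i, serNorm (polydisc b tm) r (normalizingU lam R a m B i) ≤ ENNReal.ofReal KU)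
    (hε : θ ^ (2 * (m + 1)) * (G * KU) ≤ ε) (hε1 : θ ^ 3 * r + ε ≤ θ ^ 2 * r)
    (hε2 : ∀ k, T + (R k).degree * ε ≤ 0.8 * tm) :
    DifferentiableOn ℂ (fiberedMap R (normalizingU lam R a m B)) (polydisc 0 r ×ˢ polydisc b tm) ∧
    ∃ Ψ : (Fin n → ℂ) × (Fin p → ℂ) → (Fin n → ℂ) × (Fin p → ℂ),
      DifferentiableOn ℂ Ψ (polydisc 0 (θ ^ 3 * r) ×ˢ polydisc b T) ∧
      (∀ z ∈ polydisc 0 (θ ^ 3 * r) ×ˢ polydisc b T,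
        Ψ z ∈ polydisc 0 (θ * r) ×ˢ polydisc b (0.85 * tm) ∧
        fiberedMap R (normalizingU lam R a m B) (Ψ z) = z ∧
        (z ∈ graphSigma R → Ψ z ∈ graphSigma R)) ∧
      Ψ (0, b) = (0, b) ∧
      (∀ X : (Fin n → ℂ) × (Fin p → ℂ) → Fin n → ℂ,
        DifferentiableOn ℂ X (polydisc 0 (θ * r) ×ˢ polydisc b (0.85 * tm)) →
        DifferentiableOn ℂ (fun z => (fderiv ℂ (fiberedMap R (normalizingU lam R a m B)) z
          (fiberedField R X z)).1) (polydisc 0 (θ * r) ×ˢ polydisc b (0.85 * tm))) ∧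
      ∃ Rem' : VF n p, (∀ i, HolSer (polydisc b T) (Rem' i)) ∧
        (∀ i, ∀ Q : Fin n →₀ ℕ, Q.degree < 2 * m + 1 → ∀ u ∈ polydisc b T,
          MvPowerSeries.coeff Q (Rem' i) u = 0) ∧
        (∀ i, serNorm (polydisc b T) (θ ^ 5 * r) (Rem' i) ≤ ENNReal.ofReal
          ((θ ^ 2) ^ (2 * m + 1) * (G * (1 + MB) * (1 + n * (G * KU / (θ * r - θ ^ 2 * r)) +
            ((∑ k, (R k).degree : ℕ) : ℝ) * (G * KU / (0.9 * tm - 0.8 * tm))) +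
            G * (1 + MB)))) ∧
        ∀ z ∈ polydisc 0 (θ ^ 5 * r) ×ˢ polydisc b T,
          (fderiv ℂ (fiberedMap R (normalizingU lam R a m B)) (Ψ z)
            (fiberedField R (fun w => vfEval (linField lam a) w + vfEval B w) (Ψ z))).1 =
          vfEval (linField lam a) z + vfEval (weightProj lam 0 B) z + vfEval Rem' z := by
  set Us := normalizingU lam R a m B with hUs_def
  set D := polydisc b tm with hD
  -- The `u`-radii decrease through fixed fractions of `tm`: Taylor expansion at `0.95`, `ℓ¹` norms
  -- at `0.9` (the ratio is the `18/19` of `geomConst`), derivatives of `U` at `0.85`, the image of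
  -- the inverse within `0.8`, its domain at `T`. Except for the Taylor step, the `x`-radii decrease
  -- in parallel: `r`, `θr`, `θ²r`, `θ³r`.
  have hs0 : 0 < 0.95 * tm := by positivity
  have hst : 0.95 * tm < tm := by linarith
  have ht9 : 0 < 0.9 * tm := by positivity
  have ht95 : 0.9 * tm ≤ 0.95 * tm := by linarith
  have ht1 : 0.9 * tm ≤ 18 / 19 * (0.95 * tm) := by linarith
  have hsub9 : polydisc b (0.9 * tm) ⊆ D := fun u hu i => (hu i).trans (by linarith)
  have hθr : θ * r < r := by nlinarith
  have hθ2r : θ ^ 2 * r < θ * r := by nlinarith [mul_pos hθ0 hr0]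
  have hθ3r : θ ^ 3 * r ≤ θ ^ 2 * r := by nlinarith [mul_pos (pow_pos hθ0 2) hr0]
  have hr2 : 0 < θ ^ 2 * r := by positivity
  have hr3 : 0 < θ ^ 3 * r := by positivity
  have hr5 : 0 < θ ^ 5 * r := by positivity
  have hε0 : 0 ≤ ε := le_trans (by positivity) hε
  -- power series representations
  have hUhol : ∀ i, HolSer D (Us i) := holSer_normalizingU ha hda hA hB
  have hNFhol : ∀ i, HolSer D (linField lam a i : Ser n p) := fun i => holSer_monomial
    (DifferentiableOn.fun_sum fun j _ => (ha j).mul_const _) _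
  have hex : ∀ {f : Fin n → Ser n p}, (∀ i, HolSer D (f i)) →
      ∃ F : Fin n → FS n p, ∀ i, IsRep b (0.95 * tm) tm (f i) (F i) := fun hf =>
    ⟨_, fun i => (exists_isRep hs0 hst (hf i)).choose_spec⟩
  obtain ⟨NF, hNF⟩ := hex hNFhol
  obtain ⟨U, hU⟩ := hex hUhol
  obtain ⟨Rem, hRem⟩ := hex hB
  obtain ⟨B0, hB0r⟩ := hex fun i => holSer_weightProj (lam := lam) (hB i) 0
  obtain ⟨Brest, hBr⟩ := hex (holSer_restPart (lam := lam) (m := m) hB)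
  -- their norms
  have key : ∀ {f : Ser n p} {F : FS n p} {N : ℝ}, IsRep b (0.95 * tm) tm f F →
      serNorm D r f ≤ ENNReal.ofReal N → wnorm (rad r (0.9 * tm)) F ≤ ENNReal.ofReal (G * N) :=
    fun hF hN => (hF.wnorm_le ht1 r).trans
      ((mul_le_mul' hG hN).trans (ENNReal.ofReal_mul hG0).ge)
  have fNF := fun i => key (hNF i) (N := 1) ((nNF i).trans (by simp))
  have fU := fun i => key (hU i) (nU i)
  have fRem := fun i => key (hRem i) (nB i)
  have fB0 := fun i => key (hB0r i) ((serNorm_weightProj_le 0 i).trans (nB i))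
  -- Only finiteness matters for the part that is not removed: it enters through its order, not its
  -- size.
  have fBr : ∀ i, wnorm (rad r (0.9 * tm)) (Brest i) ≠ ⊤ := fun i =>
    ne_top_of_le_ne_top (ENNReal.mul_ne_top (geomConst_ne_top p) (serNorm_restPart_ne_top
      (ne_top_of_le_ne_top ENNReal.ofReal_ne_top (nB i)))) ((hBr i).wnorm_le ht1 r)
  have tNF := fun i => ne_top_of_le_ne_top ENNReal.ofReal_ne_top (fNF i)
  have tU := fun i => ne_top_of_le_ne_top ENNReal.ofReal_ne_top (fU i)
  have tRem := fun i => ne_top_of_le_ne_top ENNReal.ofReal_ne_top (fRem i)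
  have tB0 := fun i => ne_top_of_le_ne_top ENNReal.ofReal_ne_top (fB0 i)
  -- their orders
  have oU : ∀ i, U i ∈ ordIdeal xw (m + 1) := fun i => (hU i).mem_ordIdeal hs0
    fun Q hQ u hu => coeff_normalizingU_eq_zero (fun i Q hQ => hB0 i Q hQ u hu) i Q hQ
  have oRem : ∀ i, Rem i ∈ ordIdeal xw (m + 1) := fun i => (hRem i).mem_ordIdeal hs0 (hB0 i)
  have oB0 : ∀ i, B0 i ∈ ordIdeal xw (m + 1) := fun i => (hB0r i).mem_ordIdeal hs0
    fun Q hQ u hu => by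
      classical
      rw [coeff_weightProj]
      split_ifs
      · exact hB0 i Q hQ u hu
      · rfl
  have oBr : ∀ i, Brest i ∈ ordIdeal xw (2 * m + 1) := fun i => (hBr i).mem_ordIdeal hs0
    fun Q hQ u hu => coeff_restPart_eq_zero i (fun h => hB0 i Q h u hu) hQ
  have hπ := dpi_linField_eq_zero hS hr0 ht9 ht95 hNF tNF
  have hcoh := formal_cohomological_eq hS hr0 ht9 ht95 (fun j => (ha j).mono hsub9)
    (fun α hα u hu => hA α hα u (hsub9 hu)) hNF hU hRem hB0r hBr tNF tU tRem tB0 fBr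
  -- the inverse
  have hUε : ∀ i, wnorm (rad (θ ^ 2 * r) (0.8 * tm)) (U i) ≤ ENNReal.ofReal ε := fun i => by
    refine (wnorm_le_of_mem_ordIdeal (w' := rad r (0.9 * tm)) (θ := ENNReal.ofReal (θ ^ 2))
      (fun i => (ENNReal.ofReal_mul (by positivity)).le)
      (fun k => ENNReal.ofReal_le_ofReal (by linarith))
      (ENNReal.ofReal_le_one.2 (pow_le_one₀ hθ0.le hθ.le)) (oU i)).trans ?_
    refine (mul_le_mul_right (fU i) _).trans ?_
    rw [← ENNReal.ofReal_pow (by positivity), ← ENNReal.ofReal_mul (by positivity), ← pow_mul]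
    exact ENNReal.ofReal_le_ofReal hε
  have hx : ∀ i : Fin n, rad (p := p) (θ ^ 3 * r) T (Sum.inl i) + ENNReal.ofReal ε ≤
      rad (p := p) (θ ^ 2 * r) (0.8 * tm) (Sum.inl i) := fun i => by
    rw [rad, rad, Sum.elim_inl, Sum.elim_inl, ← ENNReal.ofReal_add hr3.le hε0]
    exact ENNReal.ofReal_le_ofReal hε1
  have hu : ∀ k : Fin p, rad (n := n) (θ ^ 3 * r) T (Sum.inr k) +
      (R k).degree * ENNReal.ofReal ε ≤ rad (n := n) (θ ^ 2 * r) (0.8 * tm) (Sum.inr k) :=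
    fun k => by
    rw [rad, rad, Sum.elim_inr, Sum.elim_inr, ← ENNReal.ofReal_natCast,
      ← ENNReal.ofReal_mul (Nat.cast_nonneg _), ← ENNReal.ofReal_add hT.le (by positivity)]
    exact ENNReal.ofReal_le_ofReal (hε2 k)
  have hW1 : ∀ i : Fin n, rad (p := p) (θ ^ 2 * r) (0.8 * tm) (Sum.inl i) ≤ 1 := fun i =>
    ENNReal.ofReal_le_one.2 (by linarith)
  obtain ⟨V, hV, hVε, hVU⟩ := exists_fib_inverse (R := R)
    (fun i => ordIdeal_anti (by omega) (oU i)) hUε hx hW1 hu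
  have hfib := wnorm_fib_le (R := R) hVε hx hW1 hu
  have tV := fun i => ne_top_of_le_ne_top ENNReal.ofReal_ne_top (hVε i)
  have tfib := fun s => ne_top_of_le_ne_top (rad_ne_top s) (hfib s)
  have hset : ∀ ρ t : ℝ, {z | pt b z ∈ openPoly (rad ρ t)} =
      (polydisc 0 ρ ×ˢ polydisc b t : Set ((Fin n → ℂ) × (Fin p → ℂ))) := fun ρ t =>
    Set.ext fun z => pt_mem_openPoly
  have hltmid : ∀ s : Fin n ⊕ Fin p,
      rad (θ ^ 2 * r) (0.8 * tm) s < rad (θ * r) (0.85 * tm) s := fun s => by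
    cases s
    · exact (ENNReal.ofReal_lt_ofReal_iff (by positivity)).2 hθ2r
    · exact (ENNReal.ofReal_lt_ofReal_iff (by positivity)).2 (by linarith)
  have hltout : ∀ s : Fin n ⊕ Fin p, rad (θ * r) (0.85 * tm) s < rad r (0.9 * tm) s := fun s => by
    cases s
    · exact (ENNReal.ofReal_lt_ofReal_iff (by positivity)).2 hθr
    · exact (ENNReal.ofReal_lt_ofReal_iff (by positivity)).2 (by linarith)
  -- The norm bounds put the image in a closed polydisc, which lies in the slightly larger open one
  -- where `U` is differentiated.
  have hΨmem : ∀ z, pt b z ∈ openPoly (rad (θ ^ 3 * r) T) →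
      pt b (psi R b V z) ∈ openPoly (rad (θ * r) (0.85 * tm)) := fun z hz s =>
    (enorm_pt_psi_le hfib hz s).trans_lt (hltmid s)
  have hUs : ∀ i ζ, pt b ζ ∈ openPoly (rad r (0.9 * tm)) →
      serEval (Us i) ζ = ev (U i) (pt b ζ) := fun i ζ hζ =>
    ((hU i).ev_eq (fun k => ((pt_mem_openPoly.1 hζ).2 k).trans_le ht95)
      (wnorm_ne_top_of_mem (tU i) hζ)).symm
  have hmidout := openPoly_mono (fun s => (hltout s).le) (σ := Fin n ⊕ Fin p)
  have hΦ : DifferentiableOn ℂ (fiberedMap R Us) (polydisc 0 r ×ˢ D) :=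
    differentiableOn_fiberedMap hUhol fun i => ne_top_of_le_ne_top ENNReal.ofReal_ne_top (nU i)
  have hΦat : ∀ z, pt b z ∈ openPoly (rad (θ * r) (0.85 * tm)) →
      DifferentiableAt ℂ (fiberedMap R Us) z := fun z hz => by
    refine hΦ.differentiableAt (((isOpen_polydisc 0 r).prod (isOpen_polydisc b tm)).mem_nhds ?_)
    have := pt_mem_openPoly.1 (hmidout hz)
    exact ⟨this.1, hsub9 this.2⟩
  have tU' := fun i => wnorm_ne_top_mono (fun s => (hltout s).le) (tU i)
  have tdU : ∀ i s, wnorm (rad (θ * r) (0.85 * tm)) (MvPowerSeries.pderiv ℂ s (U i)) ≠ ⊤ :=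
    fun i s => wnorm_pderiv_ne_top (fun s => (hltout s).le) (hltout s) (tU i)
  have hUs' : ∀ i ζ, pt b ζ ∈ openPoly (rad (θ * r) (0.85 * tm)) →
      serEval (Us i) ζ = ev (U i) (pt b ζ) := fun i ζ hζ => hUs i ζ (hmidout hζ)
  refine ⟨hΦ, psi R b V, ?_, ?_, psi_center hV, ?_, ?_⟩
  · rw [← hset]
    exact differentiableOn_psi tfib
  · intro z hz
    rw [← pt_mem_openPoly] at hz
    refine ⟨pt_mem_openPoly.1 (hΨmem z hz), ?_, psi_mem_graphSigma tV hz⟩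
    exact fiberedMap_psi hV tV hVU hfib rad_ne_top
      (fun i => ne_top_of_le_ne_top ENNReal.ofReal_ne_top (hUε i)) hz
      fun i => hUs' i _ (hΨmem z hz)
  · intro X hX
    rw [← hset] at hX ⊢
    exact differentiableOn_fderiv_fiberedMap_fst tU' tdU rad_ne_top hUs' hΦat hX
  -- the remainder
  set P : Fin n → FS n p := fun i =>
    MvPowerSeries.subst (fib R V) (pushSeries R U (NF + Rem) i) with hP
  have oP : ∀ i, P i - (NF i + B0 i) ∈ ordIdeal xw (2 * m + 1) :=
    subst_pushSeries_sub_mem hm oU oRem oB0 oBr hπ hcoh hV hVU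
  have hGM : 0 ≤ G * (1 + MB) := by positivity
  have nsum : ∀ {w : Fin n ⊕ Fin p → ℝ≥0∞} {F F' : FS n p}, (∀ s, w s ≤ rad r (0.9 * tm) s) →
      wnorm (rad r (0.9 * tm)) F ≤ ENNReal.ofReal (G * 1) →
      wnorm (rad r (0.9 * tm)) F' ≤ ENNReal.ofReal (G * MB) →
      wnorm w (F + F') ≤ ENNReal.ofReal (G * (1 + MB)) := fun hw h h' => by
    refine (gnorm_mono hw _).trans ((gnorm_add_le isSubmul_enorm _ _).trans
      ((add_le_add h h').trans ?_))
    rw [← ENNReal.ofReal_add (by positivity) (by positivity), mul_add]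
  have hle8 : ∀ s : Fin n ⊕ Fin p, rad (θ ^ 2 * r) (0.8 * tm) s ≤ rad r (0.9 * tm) s := fun s =>
    ((hltmid s).trans (hltout s)).le
  have hT8 : ∀ s : Fin n ⊕ Fin p, rad (θ ^ 3 * r) T s ≤ rad (θ ^ 2 * r) (0.8 * tm) s := fun s => by
    cases s with
    | inl i => exact le_self_add.trans (hx i)
    | inr k => exact le_self_add.trans (hu k)
  have nPush := fun i => wnorm_pushSeries_le (R := R) hr2.le (by linarith) hθ2r
    (by positivity : 0 ≤ 0.8 * tm) (by linarith : 0.8 * tm < 0.9 * tm) (by positivity) hGM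
    (fun i => (gnorm_mono (rad_mono hθr.le le_rfl) _).trans (fU i))
    (fun i => nsum (F := NF i) (F' := Rem i) hle8 (fNF i) (fRem i)) i
  -- A crude bound of the whole push-forward minus its main part. No cancellation is used in the
  -- norm; it is already encoded in the order `oP`.
  have nP : ∀ i, wnorm (rad (θ ^ 3 * r) T) (P i - (NF i + B0 i)) ≤ ENNReal.ofReal
      (G * (1 + MB) * (1 + n * (G * KU / (θ * r - θ ^ 2 * r)) +
        ((∑ k, (R k).degree : ℕ) : ℝ) * (G * KU / (0.9 * tm - 0.8 * tm))) + G * (1 + MB)) :=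
    fun i => by
    have h1 : 0 < θ * r - θ ^ 2 * r := sub_pos.2 hθ2r
    have h2 : 0 < 0.9 * tm - 0.8 * tm := by linarith
    rw [ENNReal.ofReal_add (by positivity) hGM]
    refine (gnorm_sub_le isSubmul_enorm _ _).trans (add_le_add ?_ ?_)
    · exact (wnorm_subst_le (hasSubst_fib hV) _ _).trans ((gnorm_mono hfib _).trans (nPush i))
    · exact nsum (fun s => (hT8 s).trans (hle8 s)) (fNF i) (fB0 i)
  -- From `θ³r` to `θ⁵r`, the order `2m + 1` gains `(θ²)^(2m+1)`.
  have n5 : ∀ i, wnorm (rad (θ ^ 5 * r) T) (P i - (NF i + B0 i)) ≤ ENNReal.ofReal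
      ((θ ^ 2) ^ (2 * m + 1) * (G * (1 + MB) * (1 + n * (G * KU / (θ * r - θ ^ 2 * r)) +
        ((∑ k, (R k).degree : ℕ) : ℝ) * (G * KU / (0.9 * tm - 0.8 * tm))) + G * (1 + MB))) :=
    fun i => by
    refine (wnorm_le_of_mem_ordIdeal (w' := rad (θ ^ 3 * r) T) (θ := ENNReal.ofReal (θ ^ 2))
      (fun i => ?_) (fun k => le_refl (ENNReal.ofReal T))
      (ENNReal.ofReal_le_one.2 (pow_le_one₀ hθ0.le hθ.le)) (oP i)).trans ?_
    · rw [rad, rad, Sum.elim_inl, Sum.elim_inl, ← ENNReal.ofReal_mul (by positivity)]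
      exact ENNReal.ofReal_le_ofReal (by ring_nf; rfl)
    · refine (mul_le_mul_right (nP i) _).trans ?_
      rw [← ENNReal.ofReal_pow (by positivity), ← ENNReal.ofReal_mul (by positivity)]
  have t5 := fun i => ne_top_of_le_ne_top ENNReal.ofReal_ne_top (n5 i)
  refine ⟨fun i => ofFS b (P i - (NF i + B0 i)), fun i => differentiableOn_coeff_ofFS hr5 (t5 i),
    fun i Q hQ u _ => coeff_ofFS_eq_zero (oP i) hQ u,
    fun i => (serNorm_ofFS_le _).trans (n5 i), fun z hz => ?_⟩
  have hz3 : pt b z ∈ openPoly (rad (θ ^ 3 * r) T) := by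
    refine pt_mem_openPoly.2 ⟨fun i => (hz.1 i).trans_le ?_, hz.2⟩
    have : θ ^ 5 ≤ θ ^ 3 := pow_le_pow_of_le_one hθ0.le hθ.le (by norm_num)
    exact mul_le_mul_of_nonneg_right this hr0.le
  have hzout : pt b z ∈ openPoly (rad r (0.9 * tm)) :=
    openPoly_mono (fun s => (hT8 s).trans (hle8 s)) hz3
  have hyout := hmidout (hΨmem z hz3)
  have evr : ∀ {f : Ser n p} {F : FS n p} {ζ}, IsRep b (0.95 * tm) tm f F →
      wnorm (rad r (0.9 * tm)) F ≠ ⊤ → pt b ζ ∈ openPoly (rad r (0.9 * tm)) →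
      ev F (pt b ζ) = serEval f ζ := fun hF hfin hζ =>
    hF.ev_eq (fun k => ((pt_mem_openPoly.1 hζ).2 k).trans_le ht95) (wnorm_ne_top_of_mem hfin hζ)
  have tX : ∀ s, wnorm (rad (θ ^ 2 * r) (0.8 * tm)) ((NF + Rem) s) ≠ ⊤ := fun s =>
    ne_top_of_le_ne_top ENNReal.ofReal_ne_top
      (nsum (F := NF s) (F' := Rem s) hle8 (fNF s) (fRem s))
  have tP : ∀ i, wnorm (rad (θ ^ 2 * r) (0.8 * tm)) (pushSeries R U (NF + Rem) i) ≠ ⊤ := fun i =>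
    ne_top_of_le_ne_top ENNReal.ofReal_ne_top (nPush i)
  have hX : ∀ s, ev ((NF + Rem) s) (pt b (psi R b V z)) =
      vfEval (linField lam a) (psi R b V z) s + vfEval B (psi R b V z) s := fun s => by
    rw [Pi.add_apply, ev_add (wnorm_ne_top_of_mem (tNF s) hyout)
      (wnorm_ne_top_of_mem (tRem s) hyout), evr (hNF s) (tNF s) hyout,
      evr (hRem s) (tRem s) hyout]
    rfl
  ext i
  have e1 : vfEval (fun i => ofFS b (P i - (NF i + B0 i))) z i =
      ev (P i) (pt b z) - (serEval (linField lam a i) z + serEval (weightProj lam 0 B i) z) := by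
    have tP3 : wnorm (rad (θ ^ 3 * r) T) (P i) ≠ ⊤ :=
      ne_top_of_le_ne_top (tP i) ((wnorm_subst_le (hasSubst_fib hV) _ _).trans
        (gnorm_mono hfib _))
    rw [vfEval, serEval_ofFS hr5 hz (t5 i), ev_sub (wnorm_ne_top_of_mem tP3 hz3)
      (wnorm_add_ne_top (wnorm_ne_top_of_mem (tNF i) hzout) (wnorm_ne_top_of_mem (tB0 i) hzout)),
      ev_add (wnorm_ne_top_of_mem (tNF i) hzout) (wnorm_ne_top_of_mem (tB0 i) hzout),
      evr (hNF i) (tNF i) hzout, evr (hB0r i) (tB0 i) hzout]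
  have hyle := fun s => enorm_pt_psi_le hfib hz3 s
  -- The formal composition has the value of the outer series at `Ψ z`, and there the formal
  -- push-forward is the derivative of the fibered map applied to the fibered field.
  have e2 : ev (P i) (pt b z) = (fderiv ℂ (fiberedMap R Us) (psi R b V z)
      (fiberedField R (fun w => vfEval (linField lam a) w + vfEval B w) (psi R b V z))).1 i := by
    rw [hP, ev_subst_fib hV hfib rad_ne_top hz3 (tP i), ev_pushSeries
      (fun i s => wnorm_ne_top_of_mem (tdU i s) (hΨmem z hz3))
      (fun s => wnorm_ne_top_mono hyle (tX s)), fiberedField,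
      fderiv_fiberedMap_fst tU' (hΨmem z hz3) hUs' (hΦat _ (hΨmem z hz3))]
    simp only [hX]
    rfl
  rw [← e2, Pi.add_apply, Pi.add_apply, e1]
  change _ = serEval _ z + serEval _ z + _
  ring

end Step

/-! ### Numerical estimates -/

section Estimates

variable {m W θ r q γ M S N G K t T : ℝ}

theorem radius_bounds (hm : 1 ≤ m) (hW : 0 < W) (hγ : 0 < γ) (hM : 0 < M)
    (ht : t = γ * W / (2 * M * (2 * m + 1))) :
    0 < t ∧ γ * W / (6 * M * m) ≤ t ∧ t ≤ γ * W / (4 * M * m) := by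
  have hm0 : 0 < m := by linarith
  subst ht
  refine ⟨by positivity, ?_, ?_⟩
  · apply div_le_div_of_nonneg_left (by positivity) (by positivity)
    nlinarith
  · apply div_le_div_of_nonneg_left (by positivity) (by positivity)
    nlinarith

theorem inv_add_inv_sq_le {C : ℝ} (hW : 0 < W) (hW1 : W ≤ 1) (hγ : 0 < γ) :
    (γ * W / 2)⁻¹ + (γ * W / 2)⁻¹ ^ 2 * C ≤ (2 / γ + 4 * C / γ ^ 2) / W ^ 2 := by
  have h1 : (γ * W / 2)⁻¹ + (γ * W / 2)⁻¹ ^ 2 * C = (2 / γ * W + 4 * C / γ ^ 2) / W ^ 2 := by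
    field_simp
    ring
  rw [h1]
  have : 0 < 2 / γ := by positivity
  gcongr
  nlinarith

theorem pow_two_mul_succ_le {m : ℕ} (hθ0 : 0 ≤ θ) (hθ1 : θ ≤ 1) :
    θ ^ (2 * (m + 1)) ≤ (θ ^ m) ^ 2 := by
  rw [← pow_mul]
  exact pow_le_pow_of_le_one hθ0 hθ1 (by omega)

/-- The displacement is `O(1/m)`, while the gap `θ²r(1 - θ)` is at least `(1 - θ)/8` because `θ, r ≥
1/2`; and `1 - θ` is large compared with `1/m`. -/
theorem shift_le (hm : 1 ≤ m) (hW : 0 < W) (hW1 : W ≤ 1) (hG : 0 ≤ G) (hK : 0 ≤ K)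
    (hr : 1 / 2 < r) (hθ : 1 / 2 ≤ θ) (hC : 8 * (q ^ 2 * G * K) ≤ m * (1 - θ)) :
    θ ^ 3 * r + (q * W ^ 2 / m ^ 2) ^ 2 * (G * (K / (W ^ 2 * m ^ 4))) ≤ θ ^ 2 * r := by
  have hm0 : 0 < m := by linarith
  have h1 : (q * W ^ 2 / m ^ 2) ^ 2 * (G * (K / (W ^ 2 * m ^ 4))) =
      q ^ 2 * G * K * (W ^ 2 / m ^ 8) := by field_simp
  have h2 : W ^ 2 / m ^ 8 ≤ 1 / m := by
    apply div_le_div₀ (by norm_num) (by nlinarith) hm0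
    exact le_self_pow₀ hm (by norm_num)
  have h3 : q ^ 2 * G * K * (W ^ 2 / m ^ 8) ≤ q ^ 2 * G * K * (1 / m) := by gcongr
  have h4 : q ^ 2 * G * K * (1 / m) ≤ (1 - θ) / 8 := by
    rw [mul_one_div, div_le_iff₀ hm0]
    linarith
  have h0 : 0 ≤ 1 - θ := by
    have : 0 ≤ m * (1 - θ) := le_trans (by positivity) hC
    by_contra h
    nlinarith
  have h5 : 1 / 4 ≤ θ ^ 2 := by nlinarith
  have h6 : 1 / 8 ≤ θ ^ 2 * r := by nlinarith
  have h7 : (1 - θ) / 8 ≤ θ ^ 2 * r * (1 - θ) := by nlinarith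
  nlinarith

theorem shift_base_le (hm : 1 ≤ m) (hW : 0 < W) (hW1 : W ≤ 1) (hγ : 0 < γ) (hM : 0 < M)
    (hG : 0 ≤ G) (hK : 0 ≤ K) (hS : 0 ≤ S) (ht : γ * W / (6 * M * m) ≤ t) (hT : T ≤ 0.6 * t)
    (hC : 30 * M * S * (q ^ 2 * G * K) / γ ≤ m) :
    T + S * ((q * W ^ 2 / m ^ 2) ^ 2 * (G * (K / (W ^ 2 * m ^ 4)))) ≤ 0.8 * t := by
  have hm0 : 0 < m := by linarith
  have h1 : S * ((q * W ^ 2 / m ^ 2) ^ 2 * (G * (K / (W ^ 2 * m ^ 4)))) =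
      S * (q ^ 2 * G * K) * (W ^ 2 / m ^ 8) := by field_simp
  have h2 : W ^ 2 / m ^ 8 ≤ W / m ^ 2 := by
    apply div_le_div₀ hW.le (by nlinarith) (by positivity)
    exact pow_le_pow_right₀ hm (by norm_num)
  have h3 : S * (q ^ 2 * G * K) * (W ^ 2 / m ^ 8) ≤ S * (q ^ 2 * G * K) * (W / m ^ 2) := by
    gcongr
  have h4 : S * (q ^ 2 * G * K) * (W / m ^ 2) ≤ 0.2 * (γ * W / (6 * M * m)) := by
    rw [div_le_iff₀ hγ] at hC
    have : S * (q ^ 2 * G * K) ≤ m * γ / (30 * M) := by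
      rw [le_div_iff₀ (by positivity)]
      linarith
    calc S * (q ^ 2 * G * K) * (W / m ^ 2) ≤ m * γ / (30 * M) * (W / m ^ 2) := by gcongr
      _ = 0.2 * (γ * W / (6 * M * m)) := by field_simp; norm_num
  rw [h1]
  linarith

/-- The worst loss is `x / W³`: two powers of `W` come from the small divisors in `U`, the third
power and `x` from the radius `t ~ W/x` in the Cauchy estimate in `u`. -/
theorem remainder_bracket_le {x Q₁ Q₂ MB : ℝ} (hx : 1 ≤ x) (hW : 0 < W) (hW1 : W ≤ 1)
    (hγ : 0 < γ) (hM : 0 < M) (hG : 0 ≤ G) (hK : 0 ≤ K) (hS : 0 ≤ S) (hN : 0 ≤ N)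
    (hQ₁ : 1 / (4 * x) ≤ Q₁) (hQ₂ : γ * W / (60 * M * x) ≤ Q₂)
    (hMB : MB ≤ 32 * N) :
    G * (1 + MB) * (1 + N * (G * (K / (W ^ 2 * x ^ 4)) / Q₁) +
      S * (G * (K / (W ^ 2 * x ^ 4)) / Q₂)) + G * (1 + MB) ≤
    x / W ^ 3 * (G * (1 + 32 * N) * (1 + N * (4 * (G * K)) + S * (60 * M * (G * K) / γ)) +
      G * (1 + 32 * N)) := by
  have hx0 : 0 < x := by linarith
  have hKU : G * (K / (W ^ 2 * x ^ 4)) ≤ G * K / W ^ 2 := by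
    rw [mul_div_assoc]
    gcongr
    exact le_mul_of_one_le_right (by positivity) (one_le_pow₀ hx)
  have hKU0 : 0 ≤ G * (K / (W ^ 2 * x ^ 4)) := by positivity
  generalize G * (K / (W ^ 2 * x ^ 4)) = V at hKU hKU0 ⊢
  have hW3 : W ^ 3 ≤ W ^ 2 := pow_le_pow_of_le_one hW.le hW1 (by norm_num)
  have hy : 1 ≤ x / W ^ 3 := by
    rw [le_div_iff₀ (by positivity)]
    have : W ^ 3 ≤ 1 := pow_le_one₀ hW.le hW1
    linarith
  have hq₁ : 0 < 1 / (4 * x) := by positivity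
  have hq₂ : 0 < γ * W / (60 * M * x) := by positivity
  have h3 : V / Q₁ ≤ 4 * (G * K) * (x / W ^ 3) := by
    calc V / Q₁ ≤ G * K / W ^ 2 / (1 / (4 * x)) := by gcongr
      _ = 4 * (G * K) * (x / W ^ 2) := by field_simp
      _ ≤ 4 * (G * K) * (x / W ^ 3) := by gcongr
  have h4 : V / Q₂ ≤ 60 * M * (G * K) / γ * (x / W ^ 3) := by
    calc V / Q₂ ≤ G * K / W ^ 2 / (γ * W / (60 * M * x)) := by gcongr
      _ = 60 * M * (G * K) / γ * (x / W ^ 3) := by field_simp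
  have h3' : 0 ≤ V / Q₁ := div_nonneg hKU0 (hq₁.le.trans hQ₁)
  have h4' : 0 ≤ V / Q₂ := div_nonneg hKU0 (hq₂.le.trans hQ₂)
  generalize x / W ^ 3 = y at hy h3 h4 ⊢
  generalize V / Q₁ = v₁ at h3 h3' ⊢
  generalize V / Q₂ = v₂ at h4 h4' ⊢
  have hy0 : 0 ≤ y := by linarith
  calc _ ≤ G * (1 + 32 * N) * (y + N * (4 * (G * K) * y) + S * (60 * M * (G * K) / γ * y)) +
        G * (1 + 32 * N) * y := by
        apply add_le_add
        · gcongr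
        · calc G * (1 + MB) ≤ G * (1 + 32 * N) * 1 := by rw [mul_one]; gcongr
            _ ≤ _ := by gcongr
    _ = _ := by ring

/-- Since `(θ²)^(2m+1) ≤ (θ^m)^4 = q⁴ W⁸ / m⁸`, multiplication by the loss `m / W³` leaves a
constant times `W⁵ / m⁷`. The threshold absorbs the constant, and `1/m⁶` is far below the admissible
`2N / m⁴`. -/
theorem remainder_lt {m : ℕ} (hm : 1 ≤ m) (hW : 0 < W) (hW1 : W ≤ 1) (hγ : 0 < γ) (hM : 0 < M)
    (hG : 0 ≤ G) (hK : 0 ≤ K) (hS : 0 ≤ S) (hN : 1 ≤ N) (hr : 1 / 2 < r)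
    (hθ : 1 / 2 ≤ θ) (hθ1 : θ < 1) (hθm : θ ^ m = q * W ^ 2 / (m : ℝ) ^ 2)
    (ht : γ * W / (6 * M * m) ≤ t) (hmθ : 1 ≤ m * (1 - θ))
    (hC : q ^ 4 * (G * (1 + 32 * N) * (1 + N * (4 * (G * K)) + S * (60 * M * (G * K) / γ)) +
      G * (1 + 32 * N)) ≤ m) :
    (θ ^ 2) ^ (2 * m + 1) * (G * (1 + 2 ^ 5 * N / (m : ℝ) ^ 4) *
      (1 + N * (G * (K / (W ^ 2 * (m : ℝ) ^ 4)) / (θ * r - θ ^ 2 * r)) +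
        S * (G * (K / (W ^ 2 * (m : ℝ) ^ 4)) / (0.9 * t - 0.8 * t))) +
      G * (1 + 2 ^ 5 * N / (m : ℝ) ^ 4)) < 2 ^ 5 * N / (2 * (m : ℝ)) ^ 4 := by
  have hm1 : (1 : ℝ) ≤ m := by exact_mod_cast hm
  have hm0 : (0 : ℝ) < m := by linarith
  have hθ0 : 0 < θ := by linarith
  have h1 : (θ ^ 2) ^ (2 * m + 1) ≤ (q * W ^ 2 / (m : ℝ) ^ 2) ^ 4 := by
    rw [← hθm, ← pow_mul, ← pow_mul]
    exact pow_le_pow_of_le_one hθ0.le hθ1.le (by omega)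
  generalize (m : ℝ) = x at *
  have h2 : 2 ^ 5 * N / x ^ 4 ≤ 32 * N := by
    have : (2 : ℝ) ^ 5 * N = 32 * N := by norm_num
    rw [this]
    exact div_le_self (by positivity) (one_le_pow₀ hm1)
  have hd₁ : 1 / (4 * x) ≤ θ * r - θ ^ 2 * r := by
    rw [div_le_iff₀ (by positivity)]
    have h : 1 / 4 ≤ θ * r := by nlinarith
    have h' := mul_le_mul h hmθ (by norm_num) (by linarith)
    linarith
  have hd₂ : γ * W / (60 * M * x) ≤ 0.9 * t - 0.8 * t := by
    have e : γ * W / (60 * M * x) = 0.1 * (γ * W / (6 * M * x)) := by field_simp; norm_num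
    rw [e]
    linarith
  have hA := remainder_bracket_le hm1 hW hW1 hγ hM hG hK hS (by linarith) hd₁ hd₂
    h2
  have hZ0 : 0 ≤ G * (1 + 32 * N) * (1 + N * (4 * (G * K)) + S * (60 * M * (G * K) / γ)) +
      G * (1 + 32 * N) := by positivity
  generalize G * (1 + 32 * N) * (1 + N * (4 * (G * K)) + S * (60 * M * (G * K) / γ)) +
      G * (1 + 32 * N) = Z at hA hC hZ0
  refine (mul_le_mul_of_nonneg_left hA (by positivity)).trans_lt ?_
  calc _ ≤ (q * W ^ 2 / x ^ 2) ^ 4 * (x / W ^ 3 * Z) :=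
        mul_le_mul_of_nonneg_right h1 (by positivity)
    _ = q ^ 4 * Z * (W ^ 5 / x ^ 7) := by field_simp
    _ ≤ x * (1 / x ^ 7) := by
        have : W ^ 5 ≤ 1 := pow_le_one₀ hW.le hW1
        gcongr
    _ = 1 / x ^ 6 := by field_simp
    _ ≤ 1 / x ^ 4 := by
        apply one_div_le_one_div_of_le (by positivity)
        exact pow_le_pow_right₀ hm1 (by norm_num)
    _ < 2 ^ 5 * N / (2 * x) ^ 4 := by
        rw [mul_pow, div_lt_div_iff₀ (by positivity) (by positivity)]
        have : 0 < x ^ 4 := by positivity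
        nlinarith

/-- The hypothesis controls only `D(b, t_{2m})` at radius `θ³r`. Enlarging the radius to `θr` frees
at least `4^(-d) (1 - θ)`, which exceeds `t_m = O(1/m)`; here `d ≠ 0` is needed. The restriction to
`Σ` can thus be estimated on all of `D(b, t_m)`, leaving room for a Cauchy estimate down to
`t_{2m}`. -/
theorem base_radius_le {d : ℕ} (hd : d ≠ 0) (hm : 1 ≤ m) (hW1 : W ≤ 1) (hγ : 0 < γ)
    (hM : 0 < M) (hr : 1 / 2 < r) (hθ : 1 / 2 ≤ θ) (hθ1 : θ < 1) (hT : 0 < T)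
    (ht : t ≤ γ * W / (4 * M * m)) {β : ℝ} (hb : β + T ≤ (θ ^ 3 * r) ^ d) (hdS : (d : ℝ) ≤ S)
    (hC : 4 ^ S * γ / (4 * M) ≤ m * (1 - θ)) : β + t ≤ (θ * r) ^ d := by
  have hm0 : 0 < m := by linarith
  have hθ0 : 0 < θ := by linarith
  have h1 : (θ ^ 3 * r) ^ d = (θ * r) ^ d * (θ ^ 2) ^ d := by rw [← mul_pow]; ring
  have h2 : (θ ^ 2) ^ d ≤ θ := by
    rw [← pow_mul]
    exact pow_le_of_le_one hθ0.le hθ1.le (by omega)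
  have h3 : (1 / 4 : ℝ) ^ d ≤ (θ * r) ^ d := by
    gcongr
    nlinarith
  have h4 : t ≤ (1 / 4 : ℝ) ^ d * (1 - θ) := by
    have h5 : t ≤ γ / (4 * M * m) := by
      refine ht.trans ?_
      gcongr
      nlinarith
    have h6 : (4 : ℝ) ^ d ≤ 4 ^ S := by
      rw [← Real.rpow_natCast]
      exact Real.rpow_le_rpow_of_exponent_le (by norm_num) hdS
    have h7 : 4 ^ d * (γ / (4 * M * m)) ≤ 1 - θ := by
      have : 4 ^ d * γ / (4 * M) ≤ m * (1 - θ) := le_trans (by gcongr) hC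
      rw [mul_comm m, ← div_le_iff₀ hm0] at this
      refine le_of_eq_of_le ?_ this
      field_simp
    rw [one_div_pow, one_div_mul_eq_div, le_div_iff₀ (by positivity), mul_comm]
    exact le_trans (by gcongr) h7
  have h8 : (1 / 4 : ℝ) ^ d * (1 - θ) ≤ (θ * r) ^ d * (1 - (θ ^ 2) ^ d) := by
    have := mul_le_mul h3 (sub_le_sub_left h2 1) (by linarith) (by positivity)
    exact this
  rw [h1] at hb
  linarith

/-- The room is `7/8 · m⁻³`; the factor `θ^m` brings the increment below half of `m⁻³`. -/
theorem normalForm_increment_le {m : ℕ} (hm : 1 ≤ m) (hW : 0 < W) (hW1 : W ≤ 1) (hq : 0 ≤ q)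
    (hN : 0 ≤ N) (hθ0 : 0 ≤ θ) (hθ1 : θ < 1) (hθm : θ ^ m = q * W ^ 2 / (m : ℝ) ^ 2)
    (hC : 64 * (N * q) ≤ m) :
    1 - 1 / (m : ℝ) ^ 3 + θ ^ (m + 1) * (2 ^ 5 * N / (m : ℝ) ^ 4) ≤
      1 - 1 / (2 * (m : ℝ)) ^ 3 := by
  have hm1 : (1 : ℝ) ≤ m := by exact_mod_cast hm
  have hm0 : (0 : ℝ) < m := by linarith
  set x : ℝ := (m : ℝ)
  have h1 : θ ^ (m + 1) ≤ q / x ^ 2 := by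
    calc θ ^ (m + 1) ≤ θ ^ m := pow_le_pow_of_le_one hθ0 hθ1.le (by omega)
      _ ≤ q / x ^ 2 := by
        rw [hθm]
        gcongr
        exact mul_le_of_le_one_right hq (pow_le_one₀ hW.le hW1)
  have h2 : θ ^ (m + 1) * (2 ^ 5 * N / x ^ 4) ≤ 1 / 2 * (1 / x ^ 3) := by
    calc _ ≤ q / x ^ 2 * (2 ^ 5 * N / x ^ 4) := by gcongr
      _ = 1 / 2 * (64 * (N * q)) / x ^ 6 := by ring
      _ ≤ 1 / 2 * x / x ^ 6 := by gcongr
      _ = 1 / 2 * (1 / x ^ 5) := by field_simp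
      _ ≤ 1 / 2 * (1 / x ^ 3) := by
        have : x ^ 3 ≤ x ^ 5 := pow_le_pow_right₀ hm1 (by norm_num)
        gcongr
  have h3 : 1 / (2 * x) ^ 3 = 1 / 8 * (1 / x ^ 3) := by field_simp; norm_num
  have h4 : 0 < 1 / x ^ 3 := by positivity
  rw [h3]
  linarith

/-- Cauchy's estimate in `u` loses `1 / (t - T)`, of size `m / W`. The factor `W²` in `θ^m` cancels
the small denominator, and the room is `3/4 · m⁻²`. -/
theorem normalForm_deriv_increment_le {m : ℕ} {P c : ℝ} (hm : 1 ≤ m) (hW : 0 < W) (hW1 : W ≤ 1)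
    (hq : 0 ≤ q) (hγ : 0 < γ) (hM : 0 < M) (hP : 0 ≤ P)
    (hN : 0 ≤ N) (hθ0 : 0 ≤ θ) (hθ1 : θ < 1) (hθm : θ ^ m = q * W ^ 2 / (m : ℝ) ^ 2)
    (ht : γ * W / (6 * M * m) ≤ t) (hT : T ≤ 0.6 * t)
    (hC : 1920 * (P * M * N * q) / γ ≤ m) :
    c - 1 / (m : ℝ) ^ 2 + P * (2 / (t - T) * (θ ^ (m + 1) * (2 ^ 5 * N / (m : ℝ) ^ 4))) ≤
      c - 1 / (2 * (m : ℝ)) ^ 2 := by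
  have hm1 : (1 : ℝ) ≤ m := by exact_mod_cast hm
  have hm0 : (0 : ℝ) < m := by linarith
  set x : ℝ := (m : ℝ)
  have ht0 : 0 < t := lt_of_lt_of_le (by positivity) ht
  have h1 : θ ^ (m + 1) ≤ q * W / x ^ 2 := by
    calc θ ^ (m + 1) ≤ θ ^ m := pow_le_pow_of_le_one hθ0 hθ1.le (by omega)
      _ ≤ q * W / x ^ 2 := by
        rw [hθm]
        gcongr
        nlinarith
  have h5 : 2 / (t - T) ≤ 30 * M * x / (γ * W) := by
    have : γ * W / (15 * M * x) ≤ t - T := by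
      have e : γ * W / (15 * M * x) = 0.4 * (γ * W / (6 * M * x)) := by field_simp; norm_num
      rw [e]
      linarith
    calc 2 / (t - T) ≤ 2 / (γ * W / (15 * M * x)) := by gcongr
      _ = _ := by field_simp; norm_num
  have h2 : P * (2 / (t - T) * (θ ^ (m + 1) * (2 ^ 5 * N / x ^ 4))) ≤ 1 / 2 * (1 / x ^ 2) := by
    calc _ ≤ P * (30 * M * x / (γ * W) * (q * W / x ^ 2 * (2 ^ 5 * N / x ^ 4))) := by gcongr
      _ = 1 / 2 * (1920 * (P * M * N * q) / γ) / x ^ 5 := by field_simp; ring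
      _ ≤ 1 / 2 * x / x ^ 5 := by gcongr
      _ = 1 / 2 * (1 / x ^ 4) := by field_simp
      _ ≤ 1 / 2 * (1 / x ^ 2) := by
        have : x ^ 2 ≤ x ^ 4 := pow_le_pow_right₀ hm1 (by norm_num)
        gcongr
  have h3 : 1 / (2 * x) ^ 2 = 1 / 4 * (1 / x ^ 2) := by field_simp; norm_num
  have h4 : 0 < 1 / x ^ 2 := by positivity
  rw [h3]
  linarith

end Estimates

/-- The factor `0.6` is the value of `(2m+1)/(4m+1)` at `m = 1`, where this ratio is largest for `m
≥ 1`; the `ω_k` do not increase. -/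
theorem tRad_succ_le {n l : ℕ} {lam : Fin l → Fin n → ℂ} {ω : ℕ → ℝ} {γ : ℝ} (hl : 0 < l)
    (hΛ : 0 < bigLambda lam) (hω : IsDiophantineSeq ω) (hγ : 0 < γ) (k : ℕ) :
    0 < tRad lam ω γ k ∧ tRad lam ω γ (k + 1) ≤ 0.6 * tRad lam ω γ k := by
  have hl' : (0 : ℝ) < l := by exact_mod_cast hl
  have h1 := hω.pos (k + 1) (by omega)
  have h2 := hω.anti (k + 1) (by omega)
  refine ⟨by unfold tRad; positivity, ?_⟩
  have h2k : (1 : ℝ) ≤ 2 ^ k := one_le_pow₀ (by norm_num)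
  unfold tRad
  calc γ * ω (k + 1 + 1) / (2 * l * bigLambda lam * (2 * 2 ^ (k + 1) + 1)) ≤
      γ * ω (k + 1) / (2 * l * bigLambda lam * ((2 * 2 ^ k + 1) / 0.6)) := by
        gcongr
        rw [pow_succ, div_le_iff₀ (by norm_num)]
        linarith
    _ = _ := by field_simp

/-! ### Norms of the new normal form -/

section NormalForm

variable {n p l : ℕ} {lam : Fin l → Fin n → ℂ} {b : Fin p → ℂ} {t T r r' : ℝ} {f g : Ser n p}
  {U U' : Set (Fin p → ℂ)}

theorem polydisc_mono {d : ℕ} {c : Fin d → ℂ} {s s' : ℝ} (h : s ≤ s') :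
    polydisc c s ⊆ polydisc c s' := fun _ hz i => (hz i).trans_le h

theorem serNorm_mono (hU : U ⊆ U') (hr : r ≤ r') (f : Ser n p) :
    serNorm U r f ≤ serNorm U' r' f := by
  refine ENNReal.tsum_le_tsum fun Q => ?_
  exact mul_le_mul' (supNorm_mono hU _) (pow_le_pow_left' (ENNReal.ofReal_le_ofReal hr) _)

theorem serNorm_add_le (f g : Ser n p) : serNorm U r (f + g) ≤ serNorm U r f + serNorm U r g := by
  simp only [serNorm_eq]
  exact gnorm_add_le (isSubmul_supNorm U) f g

theorem supNorm_fderiv_apply_le (hTt : T < t) {h : (Fin p → ℂ) → ℂ}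
    (hh : DifferentiableOn ℂ h (polydisc b t)) (k : Fin p) :
    supNorm (polydisc b T) (fun u => fderiv ℂ h u (Pi.single k 1)) ≤
      ENNReal.ofReal (2 / (t - T)) * supNorm (polydisc b t) h := by
  have hδ : 0 < t - T := sub_pos.2 hTt
  by_cases htop : supNorm (polydisc b t) h = ⊤
  · rw [htop, ENNReal.mul_top (ENNReal.ofReal_pos.2 (by positivity)).ne']
    exact le_top
  refine iSup₂_le fun u hu => ?_
  have hsub : Metric.ball u (t - T) ⊆ polydisc b t := fun v hv i => by
    have h1 : ‖v i - u i‖ < t - T := (norm_le_pi_norm (v - u) i).trans_lt (mem_ball_iff_norm.1 hv)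
    have h2 := hu i
    calc ‖v i - b i‖ = ‖(v i - u i) + (u i - b i)‖ := by ring_nf
      _ ≤ _ := norm_add_le _ _
      _ < t := by linarith
  have h1 := norm_fderiv_le_of_bound hδ (hh.mono hsub)
    fun x hx => norm_le_toReal_supNorm htop (hsub hx)
  have h2 : ‖fderiv ℂ h u (Pi.single k 1)‖ ≤ 2 / (t - T) * (supNorm (polydisc b t) h).toReal := by
    refine ((fderiv ℂ h u).le_opNorm _).trans ?_
    rw [Pi.norm_single, norm_one, mul_one]
    exact h1.trans_eq (by ring)
  rw [← ofReal_norm, ← ENNReal.ofReal_toReal htop, ← ENNReal.ofReal_mul (by positivity)]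
  exact ENNReal.ofReal_le_ofReal h2

theorem serNorm_serDu_le (hTt : T < t) (hf : HolSer (polydisc b t) f) (k : Fin p) :
    serNorm (polydisc b T) r (serDu k f) ≤
      ENNReal.ofReal (2 / (t - T)) * serNorm (polydisc b t) r f := by
  rw [serNorm, serNorm, ← ENNReal.tsum_mul_left]
  refine ENNReal.tsum_le_tsum fun Q => ?_
  rw [← mul_assoc]
  exact mul_le_mul' (supNorm_fderiv_apply_le hTt (hf Q) k) le_rfl

theorem serNorm_serDu_add_le (hU : IsOpen U) (hf : HolSer U f) (hg : HolSer U g) (k : Fin p) :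
    serNorm U r (serDu k (f + g)) ≤ serNorm U r (serDu k f) + serNorm U r (serDu k g) := by
  rw [serNorm, serNorm, serNorm, ← ENNReal.tsum_add]
  refine ENNReal.tsum_le_tsum fun Q => ?_
  rw [← add_mul]
  gcongr
  refine iSup₂_le fun u hu => ?_
  have e : MvPowerSeries.coeff Q (serDu k (f + g)) u =
      MvPowerSeries.coeff Q (serDu k f) u + MvPowerSeries.coeff Q (serDu k g) u := by
    change fderiv ℂ (MvPowerSeries.coeff Q (f + g)) u _ =
      fderiv ℂ (MvPowerSeries.coeff Q f) u _ + fderiv ℂ (MvPowerSeries.coeff Q g) u _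
    rw [map_add, fderiv_add ((hf Q).differentiableAt (hU.mem_nhds hu))
      ((hg Q).differentiableAt (hU.mem_nhds hu)), add_apply]
  rw [e]
  exact (enorm_add_le _ _).trans (add_le_add
    (le_supNorm hu (MvPowerSeries.coeff Q (serDu k f)))
    (le_supNorm hu (MvPowerSeries.coeff Q (serDu k g))))

theorem add_lt_ofReal_add {x y : ℝ≥0∞} {A B C : ℝ} (hx : x < ENNReal.ofReal A)
    (hy : y ≤ ENNReal.ofReal B) (hB : 0 ≤ B) (h : A + B ≤ C) : x + y < ENNReal.ofReal C := by
  have hA : 0 < A := ENNReal.ofReal_pos.1 (bot_le.trans_lt hx)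
  calc x + y < ENNReal.ofReal A + ENNReal.ofReal B :=
        ENNReal.add_lt_add_of_lt_of_le (hy.trans_lt ENNReal.ofReal_lt_top).ne hx hy
    _ = ENNReal.ofReal (A + B) := (ENNReal.ofReal_add hA.le hB).symm
    _ ≤ _ := ENNReal.ofReal_le_ofReal h

/-- Moving to index `k + 1` weakens the required bounds, and the added field must fit into that
difference. Its `u`-derivatives are bounded by Cauchy between `t_m` and `t_{2m}`, once for each of
the `p` variables. Holomorphy is asked on `D(b, t_m)`, so `Y` has to be controlled there. -/
theorem add_mem_classNF {e : Fin l → Fin n} {ω : ℕ → ℝ} {γ : ℝ} {k : ℕ} {X Y : VF n p} {δ : ℝ}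
    (hT : tRad lam ω γ (k + 1) < tRad lam ω γ k)
    (ht' : tRad lam ω γ k ≤ tRad lam ω γ (k - 1)) (hr : r' ≤ r) (hδ : 0 ≤ δ)
    (hX : X ∈ classNF lam e ω γ k b r) (hY : ∀ i, HolSer (polydisc b (tRad lam ω γ k)) (Y i))
    (hlin : ∀ i Q, Q.degree ≠ 1 → ∀ u ∈ polydisc b (tRad lam ω γ k),
      MvPowerSeries.coeff Q ((X + Y) i) u = 0)
    (hYδ : ∀ i, serNorm (polydisc b (tRad lam ω γ k)) r' (Y i) ≤ ENNReal.ofReal δ)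
    (h1 : 1 - 1 / ((2 : ℝ) ^ k) ^ 3 + δ ≤ 1 - 1 / ((2 : ℝ) ^ (k + 1)) ^ 3)
    (h2 : 1 / (2 * l * normLinv lam e) - 1 / ((2 : ℝ) ^ k) ^ 2 +
      p * (2 / (tRad lam ω γ k - tRad lam ω γ (k + 1)) * δ) ≤
      1 / (2 * l * normLinv lam e) - 1 / ((2 : ℝ) ^ (k + 1)) ^ 2) :
    X + Y ∈ classNF lam e ω γ (k + 1) b r' := by
  obtain ⟨hXh, -, hX1, hX2⟩ := hX
  have hsub := polydisc_mono (c := b) hT.le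
  have hXh' : ∀ i, HolSer (polydisc b (tRad lam ω γ k)) (X i) := fun i Q =>
    (hXh i Q).mono (polydisc_mono ht')
  refine ⟨fun i Q => ?_, ?_, ?_, ?_⟩
  · rw [Nat.add_sub_cancel]
    exact (hXh' i).add (hY i) Q
  · rw [Nat.add_sub_cancel]
    exact hlin
  · refine lt_of_le_of_lt ?_ (add_lt_ofReal_add hX1 le_rfl hδ h1)
    refine iSup_le fun i => ?_
    refine (serNorm_add_le (X i) (Y i)).trans (add_le_add ?_ ?_)
    · exact (serNorm_mono hsub hr _).trans
        (le_iSup (fun i => serNorm (polydisc b (tRad lam ω γ k)) r (X i)) i)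
    · exact (serNorm_mono hsub le_rfl _).trans (hYδ i)
  · have hd : 0 < tRad lam ω γ k - tRad lam ω γ (k + 1) := sub_pos.2 hT
    refine lt_of_le_of_lt ?_ (add_lt_ofReal_add hX2 le_rfl (by positivity) h2)
    refine iSup_le fun i => ?_
    have hadd : ∀ k', serNorm (polydisc b (tRad lam ω γ (k + 1))) r' (serDu k' ((X + Y) i)) ≤
        serNorm (polydisc b (tRad lam ω γ k)) r (serDu k' (X i)) +
          ENNReal.ofReal (2 / (tRad lam ω γ k - tRad lam ω γ (k + 1)) * δ) := fun k' => by
      refine (serNorm_serDu_add_le (isOpen_polydisc _ _) ((hXh' i).mono hsub)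
        ((hY i).mono hsub) k').trans (add_le_add (serNorm_mono hsub hr _) ?_)
      refine (serNorm_serDu_le hT (hY i) k').trans ?_
      rw [ENNReal.ofReal_mul (by positivity)]
      exact mul_le_mul' le_rfl (hYδ i)
    refine (Finset.sum_le_sum fun k' _ => hadd k').trans ?_
    rw [Finset.sum_add_distrib, Finset.sum_const, Finset.card_univ, Fintype.card_fin,
      nsmul_eq_mul, ENNReal.ofReal_mul (p := (p : ℝ)) (Nat.cast_nonneg p), ENNReal.ofReal_natCast]
    exact add_le_add (le_iSup (fun i => ∑ k', serNorm (polydisc b (tRad lam ω γ k)) r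
      (serDu k' (X i))) i) le_rfl

theorem vfEval_add {X Y : VF n p} {z : (Fin n → ℂ) × (Fin p → ℂ)} (hz1 : z.1 ∈ polydisc 0 r)
    (hz2 : z.2 ∈ U) (hX : ∀ i, serNorm U r (X i) ≠ ⊤) (hY : ∀ i, serNorm U r (Y i) ≠ ⊤) :
    vfEval (X + Y) z = vfEval X z + vfEval Y z := by
  have key : ∀ f : Ser n p, serNorm U r f ≠ ⊤ → wnorm (fun s => ‖z.1 s‖ₑ) (serAt z.2 f) ≠ ⊤ :=
    fun f hf => by
      refine wnorm_ne_top_of_mem (w := fun _ => ENNReal.ofReal r)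
        (ne_top_of_le_ne_top hf (wnorm_serAt_le hz2 r f)) fun i => ?_
      have := hz1 i
      rw [Pi.zero_apply, sub_zero] at this
      exact enorm_lt_ofReal.2 this
  funext i
  change serEval (X i + Y i) z = serEval (X i) z + serEval (Y i) z
  rw [serEval_eq_ev, serEval_eq_ev, serEval_eq_ev, map_add, ev_add (key _ (hX i)) (key _ (hY i))]

theorem differentiableOn_vfEval {X : VF n p} (hX : ∀ i, HolSer (polydisc b t) (X i))
    (hfin : ∀ i, serNorm (polydisc b t) r (X i) ≠ ⊤) :
    DifferentiableOn ℂ (vfEval X) (polydisc 0 r ×ˢ polydisc b t) :=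
  differentiableOn_pi.2 fun i => differentiableOn_serEval (hX i) (hfin i)

theorem fiberedField_add (R : Fin p → Fin n →₀ ℕ)
    (X Y : (Fin n → ℂ) × (Fin p → ℂ) → Fin n → ℂ) (z : (Fin n → ℂ) × (Fin p → ℂ)) :
    fiberedField R (fun w => X w + Y w) z = fiberedField R X z + fiberedField R Y z := by
  simp [fiberedField]

theorem coeff_linField_of_degree_ne_one {a : Fin l → (Fin p → ℂ) → ℂ} (i : Fin n)
    {Q : Fin n →₀ ℕ} (hQ : Q.degree ≠ 1) :
    MvPowerSeries.coeff Q (linField lam a i : Ser n p) = 0 := by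
  classical
  rw [linField, MvPowerSeries.coeff_monomial, if_neg]
  rintro rfl
  simp at hQ

end NormalForm

/-! ### The threshold -/

section Threshold

variable {n p l : ℕ} {lam : Fin l → Fin n → ℂ} {R : Fin p → Fin n →₀ ℕ} {ω : ℕ → ℝ} {γ c₁ : ℝ}

/-- All numerical conditions hold once `m` and `m(1 - θ)` exceed finitely many nonnegative
constants. Their sum serves as a single threshold, uniform in `r`, `b` and the fields. -/
theorem exists_step_constants (hω : IsDiophantineSeq ω) (hγ : 0 < γ) (hc₁ : 0 < c₁) (hl : 0 < l)
    (hΛ : 0 < bigLambda lam) {G K S N P : ℝ} (hG : 0 ≤ G) (hK : 0 ≤ K) (hS : 0 ≤ S) (hN : 1 ≤ N)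
    (hP : 0 ≤ P) :
    ∃ k₀ : ℕ, 1 ≤ k₀ ∧ ∀ k ≥ k₀, 1 / 2 ≤ thetaK ω γ c₁ k ∧ thetaK ω γ c₁ k < 1 ∧ ∃ ε : ℝ,
      thetaK ω γ c₁ k ^ (2 * (2 ^ k + 1)) *
        (G * (K / (ω (k + 1) ^ 2 * ((2 : ℝ) ^ k) ^ 4))) ≤ ε ∧
      tRad lam ω γ (k + 1) + S * ε ≤ 0.8 * tRad lam ω γ k ∧
      (∀ c : ℝ, c - 1 / ((2 : ℝ) ^ k) ^ 2 +
        P * (2 / (tRad lam ω γ k - tRad lam ω γ (k + 1)) *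
          (thetaK ω γ c₁ k ^ (2 ^ k + 1) * (2 ^ 5 * N / ((2 : ℝ) ^ k) ^ 4))) ≤
        c - 1 / ((2 : ℝ) ^ (k + 1)) ^ 2) ∧
      1 - 1 / ((2 : ℝ) ^ k) ^ 3 +
        thetaK ω γ c₁ k ^ (2 ^ k + 1) * (2 ^ 5 * N / ((2 : ℝ) ^ k) ^ 4) ≤
        1 - 1 / ((2 : ℝ) ^ (k + 1)) ^ 3 ∧
      ∀ r : ℝ, 1 / 2 < r →
        thetaK ω γ c₁ k ^ 3 * r + ε ≤ thetaK ω γ c₁ k ^ 2 * r ∧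
        (∀ (d : ℕ) (β : ℝ), d ≠ 0 → (d : ℝ) ≤ S →
          β + tRad lam ω γ (k + 1) ≤ (thetaK ω γ c₁ k ^ 3 * r) ^ d →
          β + tRad lam ω γ k ≤ (thetaK ω γ c₁ k * r) ^ d) ∧
        (thetaK ω γ c₁ k ^ 2) ^ (2 * 2 ^ k + 1) * (G * (1 + 2 ^ 5 * N / ((2 : ℝ) ^ k) ^ 4) *
          (1 + N * (G * (K / (ω (k + 1) ^ 2 * ((2 : ℝ) ^ k) ^ 4)) /
              (thetaK ω γ c₁ k * r - thetaK ω γ c₁ k ^ 2 * r)) +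
            S * (G * (K / (ω (k + 1) ^ 2 * ((2 : ℝ) ^ k) ^ 4)) /
              (0.9 * tRad lam ω γ k - 0.8 * tRad lam ω γ k))) +
          G * (1 + 2 ^ 5 * N / ((2 : ℝ) ^ k) ^ 4)) < 2 ^ 5 * N / ((2 : ℝ) ^ (k + 1)) ^ 4 := by
  have hM : 0 < l * bigLambda lam := by positivity
  set M : ℝ := l * bigLambda lam with hMdef
  set q : ℝ := γ ^ 2 / c₁ with hq
  have hq0 : 0 ≤ q := by positivity
  have hN0 : 0 ≤ N := by linarith
  have z1 : 0 ≤ 8 * (q ^ 2 * G * K) := by positivity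
  have z2 : 0 ≤ 30 * M * S * (q ^ 2 * G * K) / γ := by positivity
  have z3 : 0 ≤ q ^ 4 * (G * (1 + 32 * N) * (1 + N * (4 * (G * K)) +
    S * (60 * M * (G * K) / γ)) + G * (1 + 32 * N)) := by positivity
  have z4 : 0 ≤ (4 : ℝ) ^ S * γ / (4 * M) := by positivity
  have z5 : 0 ≤ 64 * (N * q) := by positivity
  have z6 : 0 ≤ 1920 * (P * M * N * q) / γ := by positivity
  obtain ⟨k₀, hk₀, h⟩ := exists_threshold hω hγ hc₁ (1 + 8 * (q ^ 2 * G * K) +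
    30 * M * S * (q ^ 2 * G * K) / γ + q ^ 4 * (G * (1 + 32 * N) * (1 + N * (4 * (G * K)) +
    S * (60 * M * (G * K) / γ)) + G * (1 + 32 * N)) + (4 : ℝ) ^ S * γ / (4 * M) +
    64 * (N * q) + 1920 * (P * M * N * q) / γ)
  refine ⟨k₀, hk₀, fun k hk => ?_⟩
  obtain ⟨hθ, hθ1, hm, hmθ⟩ := h k hk
  have hW := hω.pos (k + 1) (by omega)
  have hW1 := hω.le_one (k + 1) (by omega)
  have hm1 : (1 : ℝ) ≤ 2 ^ k := one_le_pow₀ (by norm_num)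
  have hnat : 1 ≤ 2 ^ k := Nat.one_le_two_pow
  have hcast : ((2 ^ k : ℕ) : ℝ) = 2 ^ k := by push_cast; rfl
  have hpow := thetaK_pow (k := k) hγ hc₁ hW
  obtain ⟨ht0, ht1, ht2⟩ := radius_bounds (t := tRad lam ω γ k) hm1 hW hγ hM (by
    rw [tRad, hMdef]; ring_nf)
  have hT := (tRad_succ_le hl hΛ hω hγ k).2
  have hT0 := (tRad_succ_le hl hΛ hω hγ (k + 1)).1
  have h2 : (2 : ℝ) ^ (k + 1) = 2 * 2 ^ k := by rw [pow_succ, mul_comm]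
  have hθ0 : 0 ≤ thetaK ω γ c₁ k := by linarith
  rw [h2]
  generalize thetaK ω γ c₁ k = θ at *
  generalize tRad lam ω γ (k + 1) = T at *
  generalize tRad lam ω γ k = t at *
  -- The witness `ε` is the bound for `U` with `θ^(2(m+1))` replaced by the larger `(θ^m)²`, whose
  -- value is known exactly.
  refine ⟨hθ, hθ1, (q * ω (k + 1) ^ 2 / ((2 : ℝ) ^ k) ^ 2) ^ 2 *
    (G * (K / (ω (k + 1) ^ 2 * ((2 : ℝ) ^ k) ^ 4))), ?_, ?_, fun c => ?_, ?_, fun r hr =>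
    ⟨?_, fun d β hd hdS hβ => ?_, ?_⟩⟩
  · rw [← hpow]
    exact mul_le_mul_of_nonneg_right (pow_two_mul_succ_le hθ0 hθ1.le) (by positivity)
  · exact shift_base_le hm1 hW hW1 hγ hM hG hK hS ht1 hT (by linarith)
  · have := normalForm_deriv_increment_le (c := c) (q := q) hnat hW hW1 hq0 hγ hM hP hN0 hθ0 hθ1
      (by rw [hcast]; exact hpow) (by rw [hcast]; exact ht1) hT (by rw [hcast]; linarith)
    rwa [hcast] at this
  · have := normalForm_increment_le (q := q) hnat hW hW1 hq0 hN0 hθ0 hθ1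
      (by rw [hcast]; exact hpow) (by rw [hcast]; linarith)
    rwa [hcast] at this
  · exact shift_le hm1 hW hW1 hG hK hr hθ (by linarith)
  · exact base_radius_le hd hm1 hW1 hγ hM hr hθ hθ1 hT0 ht2 hβ hdS (by linarith)
  · have := remainder_lt (q := q) (t := t) hnat hW hW1 hγ hM hG hK hS hN hr hθ hθ1
      (by rw [hcast]; exact hpow) (by rw [hcast]; exact ht1) (by rw [hcast]; linarith)
      (by rw [hcast]; linarith)
    rwa [hcast] at this

/-- `𝒦_0` carries no condition on divisors, so `k ≥ 1` is needed to read the condition off the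
definition. -/
theorem smallDivisor_of_mem_compactK {a : ℕ → Fin l → (Fin p → ℂ) → ℂ} {K : Set (Fin p → ℂ)}
    {b : Fin p → ℂ} {k : ℕ} (hk : 1 ≤ k) (hb : b ∈ compactK lam ω γ a K k) {α : Fin l → ℂ}
    (hα : α ∈ nonzeroWeights lam (2 ^ k + 1) (2 * 2 ^ k)) :
    γ * ω (k + 1) ≤ ‖smallDivisor (a k) α b‖ := by
  obtain ⟨k, rfl⟩ := Nat.exists_eq_add_of_le' hk
  refine hb.2 α ?_
  rwa [show 2 ^ (k + 2) = 2 * 2 ^ (k + 1) by ring]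

end Threshold

end LPNewton

end

/-! ### Assembly of the Newton step -/

theorem mainTheorem4 {n p l : ℕ} (hp : 0 < p) (hl : 0 < l)
    (lam : Fin l → Fin n → ℂ) (R : Fin p → Fin n →₀ ℕ) (hS : LPNewton.IsResonantSystem lam R)
    (e : Fin l → Fin n) (hL : IsUnit (LPNewton.minorL lam e).det)
    (ω : ℕ → ℝ) (hω : LPNewton.IsDiophantineSeq ω)
    (γ : ℝ) (hγ : 0 < γ) (c₁ : ℝ) (hc₁ : 0 < c₁) :
    ∃ k₀ : ℕ, ∀ k ≥ k₀, ∀ r : ℝ, 1 / 2 < r → r ≤ 1 →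
      -- the point `b` of `𝒦_k` and the coefficients `a κ j = a_j^{2^κ}` of the normal forms
      ∀ ρ : ℝ, 0 < ρ → ρ < 1 / 2 → ∀ K : Set (Fin p → ℂ), IsCompact K →
      K ⊆ LPNewton.piMap R '' LPNewton.polydisc (0 : Fin n → ℂ) ρ →
      ∀ a : ℕ → Fin l → (Fin p → ℂ) → ℂ,
      ∀ b ∈ LPNewton.compactK lam ω γ a K k,
      (∀ i, ‖b‖ + LPNewton.tRad lam ω γ (k + 1) ≤
        (LPNewton.thetaK ω γ c₁ k ^ 3 * r) ^ (R i).degree) →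
      -- the vector field `X̃_m`, normalized up to order `m = 2^k`
      LPNewton.linField lam (a k) ∈ LPNewton.classNF (p := p) lam e ω γ k b r →
      ∀ Rem ∈ LPNewton.classB (n := n) lam ω γ k b r,
      ∀ rS : (Fin n → ℂ) × (Fin p → ℂ) → Fin n → ℂ,
      DifferentiableOn ℂ rS
        (LPNewton.polydisc (0 : Fin n → ℂ) r ×ˢ LPNewton.polydisc b (LPNewton.tRad lam ω γ k)) →
      (∀ z ∈ LPNewton.polydisc (0 : Fin n → ℂ) r ×ˢ
          LPNewton.polydisc b (LPNewton.tRad lam ω γ k),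
        z ∈ LPNewton.graphSigma R → rS z = 0) →
      -- `B0` is the resonant part of the remainder, `B0S` its restriction to `Σ`
      ∀ τ : Fin n → (Fin n →₀ ℕ) → Fin p → ℕ, (∀ i, LPNewton.IsReduction R (τ i)) →
      let B0 : LPNewton.VF n p := LPNewton.weightProj lam 0 Rem
      let B0S : LPNewton.VF n p := fun i => LPNewton.restrictSigma R (τ i) (B0 i)
      let NF2m : LPNewton.VF n p := LPNewton.linField lam (a k) + B0S
      -- good perturbation: `NF^{2m}` is of the form `∑_j a_j^{2m}(u) S_j`
      (∀ u ∈ LPNewton.polydisc b (LPNewton.tRad lam ω γ k), ∀ i Q,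
        MvPowerSeries.coeff Q (NF2m i) u =
          MvPowerSeries.coeff Q (LPNewton.linField lam (a (k + 1)) i) u) →
      let Φ : (Fin n → ℂ) × (Fin p → ℂ) → (Fin n → ℂ) × (Fin p → ℂ) :=
        LPNewton.fiberedMap R (LPNewton.normalizingU lam R (a k) (2 ^ k) Rem)
      let D : Set ((Fin n → ℂ) × (Fin p → ℂ)) :=
        LPNewton.polydisc 0 r ×ˢ LPNewton.polydisc b (LPNewton.tRad lam ω γ k)
      let D4 : Set ((Fin n → ℂ) × (Fin p → ℂ)) :=
        LPNewton.polydisc 0 (LPNewton.thetaK ω γ c₁ k ^ 4 * r) ×ˢ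
          LPNewton.polydisc b (LPNewton.tRad lam ω γ (k + 1))
      let r5 : ℝ := LPNewton.thetaK ω γ c₁ k ^ 5 * r
      let D5 : Set ((Fin n → ℂ) × (Fin p → ℂ)) :=
        LPNewton.polydisc 0 r5 ×ˢ LPNewton.polydisc b (LPNewton.tRad lam ω γ (k + 1))
      DifferentiableOn ℂ Φ D ∧ D4 ⊆ Φ '' D ∧
      -- `Ψ` is the inverse of `Φ` on `D4`
      ∃ Ψ : (Fin n → ℂ) × (Fin p → ℂ) → (Fin n → ℂ) × (Fin p → ℂ),
        DifferentiableOn ℂ Ψ D4 ∧ Set.MapsTo Ψ D4 D ∧ (∀ z ∈ D4, Φ (Ψ z) = z) ∧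
        Ψ (0, b) = (0, b) ∧
        -- `pr₁ (Φ_* X̃_m) = NF^{2m} + R'_{2m+1} + r'_Σ`
        ∃ Rem' : LPNewton.VF n p, ∃ rS' : (Fin n → ℂ) × (Fin p → ℂ) → Fin n → ℂ,
          (∀ z ∈ D5, (LPNewton.pushforward Φ Ψ (LPNewton.fiberedField R fun w =>
              LPNewton.vfEval (LPNewton.linField lam (a k)) w + LPNewton.vfEval Rem w + rS w)
                z).1 = LPNewton.vfEval NF2m z + LPNewton.vfEval Rem' z + rS' z) ∧
          (∀ z ∈ D5, rS' z = (LPNewton.pushforward Φ Ψ (LPNewton.fiberedField R rS) z).1 +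
            LPNewton.vfEval B0 z - LPNewton.vfEval B0S z) ∧
          DifferentiableOn ℂ rS' D5 ∧ (∀ z ∈ D5, z ∈ LPNewton.graphSigma R → rS' z = 0) ∧
          NF2m ∈ LPNewton.classNF lam e ω γ (k + 1) b r5 ∧
          Rem' ∈ LPNewton.classB lam ω γ (k + 1) b r5 := by
  open LPNewton in
  -- The `l ≥ 1` chosen coordinates force `n ≥ 1`, without which the strict bound `2⁵n/m⁴` could not
  -- hold.
  have hn : 0 < n := (Nat.zero_le _).trans_lt (e ⟨0, hl⟩).2
  obtain ⟨hΛ, hΛle⟩ := hS.pos hl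
  have hl' : (0 : ℝ) < l := by exact_mod_cast hl
  set M : ℝ := l * bigLambda lam with hM
  have hM0 : 0 < M := by positivity
  set S : ℝ := ((∑ k, (R k).degree : ℕ) : ℝ) with hSdef
  have hS0 : 0 ≤ S := Nat.cast_nonneg _
  have hdS : ∀ i, ((R i).degree : ℝ) ≤ S := fun i => by
    rw [hSdef]
    exact_mod_cast Finset.single_le_sum (f := fun i => (R i).degree) (fun _ _ => Nat.zero_le _)
      (Finset.mem_univ i)
  -- The constant in `|U| ≤ K₁ / (ω² m⁴)`: the bound of the solution operator times the numerator
  -- `2⁵n` of the class of remainders.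
  set K₁ : ℝ := (2 / γ + 4 * (M * S * n) / γ ^ 2) * (2 ^ 5 * n) with hK₁
  have hK₁0 : 0 ≤ K₁ := by positivity
  obtain ⟨k₀, hk₀, hnum⟩ := exists_step_constants (n := n) (P := p) hω hγ hc₁ hl hΛ
    (G := (geomConst p).toReal) ENNReal.toReal_nonneg hK₁0 hS0 (N := n) (by exact_mod_cast hn)
    (Nat.cast_nonneg p)
  refine ⟨k₀, ?_⟩
  intro k hk r hr hr1 ρ _ _ K _ _ a b hb hbR hNF Rem hRem rS hrS hrS0 τ hτ B0 B0S NF2m hgood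
    Φ D D4 r5 D5
  have hk1 : 1 ≤ k := hk₀.trans hk
  obtain ⟨hθ, hθ1, ε, hε, hε2, hdu, hnf, hnumr⟩ := hnum k hk
  obtain ⟨hε1, hrad, hrem⟩ := hnumr r hr
  have hW := hω.pos (k + 1) (by omega)
  have hW1 := hω.le_one (k + 1) (by omega)
  have ht := (tRad_succ_le hl hΛ hω hγ k).1
  have hT := (tRad_succ_le hl hΛ hω hγ (k + 1)).1
  have hTt : tRad lam ω γ (k + 1) < tRad lam ω γ k := by
    have := (tRad_succ_le hl hΛ hω hγ k).2
    linarith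
  have htt : tRad lam ω γ k < tRad lam ω γ (k - 1) := by
    have h1 := (tRad_succ_le hl hΛ hω hγ (k - 1)).2
    rw [Nat.sub_add_cancel hk1] at h1
    linarith
  have hm1 : (1 : ℝ) ≤ 2 ^ k := one_le_pow₀ (by norm_num)
  have hr0 : 0 < r := by linarith
  have hθ0 : 0 < thetaK ω γ c₁ k := by linarith
  have hpowr : ∀ j, thetaK ω γ c₁ k ^ (j + 1) * r ≤ thetaK ω γ c₁ k * r := fun j =>
    mul_le_mul_of_nonneg_right (pow_le_of_le_one hθ0.le hθ1.le (by omega)) hr0.le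
  have hθr : thetaK ω γ c₁ k * r ≤ r := mul_le_of_le_one_left hr0.le hθ1.le
  have ha : ∀ j, DifferentiableOn ℂ (a k j) (polydisc b (tRad lam ω γ (k - 1))) :=
    differentiableOn_coeff_of_linField hL hNF.1
  have ha' : ∀ j, DifferentiableOn ℂ (a k j) (polydisc b (tRad lam ω γ k)) := fun j =>
    (ha j).mono (polydisc_mono htt.le)
  have hdsum := sum_supNorm_fderiv_le hl hL (isOpen_polydisc b (tRad lam ω γ k)) ha' hr
    (hNF.2.2.2.le.trans (ENNReal.ofReal_le_ofReal (sub_le_self _ (by positivity))))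
  have hA : ∀ α ∈ nonzeroWeights lam (2 ^ k + 1) (2 * 2 ^ k),
      ∀ u ∈ polydisc b (tRad lam ω γ k), γ * ω (k + 1) / 2 ≤ ‖smallDivisor (a k) α u‖ := by
    intro α hα u hu
    -- The definition of `t_m` gives `l · t_m · Λ(2m+1) = γω_{k+1}/2`: the divisor loses at most
    -- half of its value at `b`.
    refine le_trans (le_of_eq ?_)
      (le_norm_smallDivisor hΛle ht ha' hdsum hα (smallDivisor_of_mem_compactK hk1 hb hα) hu)
    rw [tRad]
    push_cast
    field_simp
    ring
  have hA₀ : 0 < γ * ω (k + 1) / 2 := by positivity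
  obtain ⟨hRemH, hRem0, hRemN⟩ := hRem
  have nB : ∀ i, serNorm (polydisc b (tRad lam ω γ k)) r (Rem i) ≤
      ENNReal.ofReal (2 ^ 5 * n / ((2 : ℝ) ^ k) ^ 4) := fun i =>
    (le_iSup (fun i => serNorm (polydisc b (tRad lam ω γ k)) r (Rem i)) i).trans hRemN.le
  have nU : ∀ i, serNorm (polydisc b (tRad lam ω γ k)) r
      (normalizingU lam R (a k) (2 ^ k) Rem i) ≤
      ENNReal.ofReal (K₁ / (ω (k + 1) ^ 2 * ((2 : ℝ) ^ k) ^ 4)) := fun i => by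
    refine (serNorm_normalizingU_le hΛ.le hΛle hr1 hdsum hA₀ hA i).trans ?_
    refine (mul_le_mul' le_rfl hRemN.le).trans ?_
    rw [← ENNReal.ofReal_mul (by positivity)]
    apply ENNReal.ofReal_le_ofReal
    have h1 := inv_add_inv_sq_le (C := M * S * n) hW hW1 hγ
    calc _ = ((γ * ω (k + 1) / 2)⁻¹ + (γ * ω (k + 1) / 2)⁻¹ ^ 2 * (M * S * n)) *
          (2 ^ 5 * n / ((2 : ℝ) ^ k) ^ 4) := by
          rw [hM, hSdef]
      _ ≤ _ := mul_le_mul_of_nonneg_right h1 (by positivity)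
      _ = _ := by
          rw [hK₁]
          field_simp
  have hε0 : 0 ≤ ε := le_trans (by positivity) hε
  obtain ⟨hΦ, Ψ, hΨd, hΨ, hΨ0, hpush, Rem', hRem'H, hRem'0, hRem'N, hRem'⟩ :=
    newton_step (R := R) (a := a k) (B := Rem) (m := 2 ^ k) (b := b) (tm := tRad lam ω γ k)
      (T := tRad lam ω γ (k + 1)) (r := r) (θ := thetaK ω γ c₁ k)
      (G := (geomConst p).toReal) (ε := ε)
      (KU := K₁ / (ω (k + 1) ^ 2 * ((2 : ℝ) ^ k) ^ 4)) (MB := 2 ^ 5 * n / ((2 : ℝ) ^ k) ^ 4)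
      hS Nat.one_le_two_pow ht hT hr0 hr1 hθ0 hθ1 (ENNReal.ofReal_toReal (geomConst_ne_top p)).ge
      ENNReal.toReal_nonneg (by positivity) (by positivity) ha'
      (fun j k' => differentiableOn_fderiv_apply ht htt (ha j) k')
      (fun α hα u hu => norm_pos_iff.1 (hA₀.trans_le (hA α hα u hu)))
      hRemH hRem0
      (fun i => by
        refine (le_iSup (fun i => serNorm (polydisc b (tRad lam ω γ k)) r
          (linField lam (a k) i : Ser n p)) i).trans (hNF.2.2.1.le.trans ?_)
        rw [← ENNReal.ofReal_one]
        exact ENNReal.ofReal_le_ofReal (sub_le_self _ (by positivity)))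
      nB nU hε hε1
      (fun i => le_trans (add_le_add le_rfl (mul_le_mul_of_nonneg_right (hdS i) hε0)) hε2)
  have hsubT := polydisc_mono (c := b) hTt.le
  -- On all of `D(b, t_m)` the parameters are small enough for the restriction to `Σ` at radius
  -- `θr`, by the margin between `θ³r` and `θr`.
  have hbase : ∀ u ∈ polydisc b (tRad lam ω γ k), ∀ i,
      ‖u i‖ ≤ (thetaK ω γ c₁ k * r) ^ (R i).degree := fun u hu i => by
    have h1 := hrad (R i).degree ‖b‖ (by
      rw [Ne, Finsupp.degree_eq_zero_iff]
      exact hS.exponent_ne_zero i) (hdS i) (hbR i)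
    have h2 := hu i
    have h3 := norm_le_pi_norm b i
    calc ‖u i‖ = ‖(u i - b i) + b i‖ := by ring_nf
      _ ≤ _ := norm_add_le _ _
      _ ≤ _ := by linarith
  have hB0H : ∀ i, HolSer (polydisc b (tRad lam ω γ k)) (B0 i) := fun i =>
    holSer_weightProj (hRemH i) 0
  set δ : ℝ := thetaK ω γ c₁ k ^ (2 ^ k + 1) * (2 ^ 5 * n / ((2 : ℝ) ^ k) ^ 4) with hδ
  have hδ0 : 0 ≤ δ := by positivity
  -- The resonant part has order `m + 1` and is measured at `θr`; this single shrinking of the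
  -- radius supplies the whole gain `θ^(m+1)`.
  have hB0N : ∀ i, serNorm (polydisc b (tRad lam ω γ k)) (thetaK ω γ c₁ k * r) (B0 i) ≤
      ENNReal.ofReal δ := fun i => by
    refine (serNorm_weightProj_le 0 i).trans ((serNorm_mul_le hθ0.le hθ1.le (hRem0 i)).trans ?_)
    rw [hδ, ENNReal.ofReal_mul (by positivity), ENNReal.ofReal_pow hθ0.le]
    exact mul_le_mul' le_rfl (nB i)
  have hθr0 : 0 < thetaK ω γ c₁ k * r := by positivity
  have hB0fin : ∀ i, serNorm (polydisc b (tRad lam ω γ k)) (thetaK ω γ c₁ k * r) (B0 i) ≠ ⊤ :=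
    fun i => ((hB0N i).trans_lt ENNReal.ofReal_lt_top).ne
  have hB0SN : ∀ i, serNorm (polydisc b (tRad lam ω γ k)) (thetaK ω γ c₁ k * r) (B0S i) ≤
      ENNReal.ofReal δ := fun i => (serNorm_restrictSigma_le hbase hθr0.le).trans (hB0N i)
  have hB0Sfin : ∀ i, serNorm (polydisc b (tRad lam ω γ k)) (thetaK ω γ c₁ k * r) (B0S i) ≠ ⊤ :=
    fun i => ((hB0SN i).trans_lt ENNReal.ofReal_lt_top).ne
  have hB0SH : ∀ i, HolSer (polydisc b (tRad lam ω γ k)) (B0S i) := fun i =>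
    holSer_restrictSigma (isOpen_polydisc _ _) hbase hθr0 (hB0fin i) (hB0H i)
  -- The inverse was constructed on the larger polydisc of radius `r₃ = θ³r`.
  have hD4 : D4 ⊆ polydisc 0 (thetaK ω γ c₁ k ^ 3 * r) ×ˢ polydisc b (tRad lam ω γ (k + 1)) :=
    Set.prod_mono (polydisc_mono (mul_le_mul_of_nonneg_right
      (pow_le_pow_of_le_one hθ0.le hθ1.le (by norm_num)) hr0.le)) subset_rfl
  have hD5 : D5 ⊆ polydisc 0 (thetaK ω γ c₁ k ^ 3 * r) ×ˢ polydisc b (tRad lam ω γ (k + 1)) :=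
    Set.prod_mono (polydisc_mono (mul_le_mul_of_nonneg_right
      (pow_le_pow_of_le_one hθ0.le hθ1.le (by norm_num)) hr0.le)) subset_rfl
  have hD5' : D5 ⊆ polydisc 0 (thetaK ω γ c₁ k * r) ×ˢ polydisc b (tRad lam ω γ k) :=
    Set.prod_mono (polydisc_mono (hpowr 4)) hsubT
  have hmid : polydisc (0 : Fin n → ℂ) (thetaK ω γ c₁ k * r) ×ˢ
      polydisc b (0.85 * tRad lam ω γ k) ⊆ D :=
    Set.prod_mono (polydisc_mono hθr) (polydisc_mono (by linarith))
  have hmaps : Set.MapsTo Ψ D4 D := fun z hz => hmid (hΨ z (hD4 hz)).1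
  refine ⟨hΦ, fun z hz => ⟨Ψ z, hmaps hz, (hΨ z (hD4 hz)).2.1⟩, Ψ, hΨd.mono hD4, hmaps,
    fun z hz => (hΨ z (hD4 hz)).2.1, hΨ0, Rem', fun z =>
      (pushforward Φ Ψ (fiberedField R rS) z).1 + vfEval B0 z - vfEval B0S z,
    fun z hz => ?_, fun z _ => rfl, ?_, fun z hz hzS => ?_, ?_, ?_⟩
  · have h1 := hRem' z hz
    have h2 : vfEval NF2m z = vfEval (linField lam (a k)) z + vfEval B0S z := by
      refine vfEval_add (hD5' hz).1 (hD5' hz).2 (fun i => ?_) hB0Sfin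
      refine ((serNorm_mono subset_rfl hθr _).trans_lt ?_).ne
      exact (le_iSup (fun i => serNorm (polydisc b (tRad lam ω γ k)) r
        (linField lam (a k) i : Ser n p)) i).trans_lt (hNF.2.2.1.trans ENNReal.ofReal_lt_top)
    have h3 : (pushforward Φ Ψ (fiberedField R fun w =>
        vfEval (linField lam (a k)) w + vfEval Rem w + rS w) z).1 =
        (fderiv ℂ Φ (Ψ z) (fiberedField R (fun w => vfEval (linField lam (a k)) w + vfEval Rem w)
          (Ψ z))).1 + (pushforward Φ Ψ (fiberedField R rS) z).1 := by
      rw [pushforward, pushforward, fiberedField_add R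
        (fun w => vfEval (linField lam (a k)) w + vfEval Rem w) rS, map_add, Prod.fst_add]
    -- The step itself produces `NF + B₀`. Replacing `B₀` by its restriction moves `B₀ - B₀|Σ` into
    -- the part that vanishes on `Σ`.
    have h4 : ∀ v₁ v₂ v₃ v₄ v₅ : Fin n → ℂ,
        v₁ + v₂ + v₃ + v₄ = v₁ + v₅ + v₃ + (v₄ + v₂ - v₅) := fun _ _ _ _ _ => by abel
    rw [h3, h1, h2]
    exact h4 _ _ _ _ _
  · have hd1 : DifferentiableOn ℂ (fun z => (pushforward Φ Ψ (fiberedField R rS) z).1) D5 :=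
      (hpush rS (hrS.mono hmid)).comp (hΨd.mono hD5) fun z hz => (hΨ z (hD5 hz)).1
    exact (hd1.add ((differentiableOn_vfEval hB0H hB0fin).mono hD5')).sub
      ((differentiableOn_vfEval hB0SH hB0Sfin).mono hD5')
  -- `Ψ` maps `Σ` to `Σ`, so the transported field vanishes there, and on `Σ` the series `B₀` and
  -- its restriction have the same values.
  · obtain ⟨hz1, -, hz2⟩ := hΨ z (hD5 hz)
    have h1 : fiberedField R rS (Ψ z) = 0 := by
      rw [fiberedField, hrS0 _ (hmid hz1) (hz2 hzS), map_zero]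
      rfl
    have h2 : vfEval B0S z = vfEval B0 z := funext fun i =>
      serEval_restrictSigma (hτ i) hbase hθr0 (hB0fin i) (hD5' hz).1 (hD5' hz).2 hzS
    change (fderiv ℂ Φ (Ψ z) (fiberedField R rS (Ψ z))).1 + vfEval B0 z - vfEval B0S z = 0
    rw [h1, h2, map_zero, Prod.fst_zero, zero_add, sub_self]
  · refine add_mem_classNF hTt htt.le ((hpowr 4).trans hθr) hδ0 hNF hB0SH
      (fun i Q hQ u hu => ?_) (fun i => (serNorm_mono subset_rfl (hpowr 4) _).trans (hB0SN i))
      hnf (hdu _)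
    refine (hgood u hu i Q).trans ?_
    rw [coeff_linField_of_degree_ne_one i hQ]
    rfl
  · refine ⟨hRem'H, fun i Q hQ => hRem'0 i Q ?_, ?_⟩
    · rwa [pow_succ, mul_comm] at hQ
    · have hlt := (ENNReal.ofReal_lt_ofReal_iff (by positivity)).2 hrem
      refine lt_of_le_of_lt (iSup_le fun i => ?_) hlt
      exact hRem'N i
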